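/- **Setting.** Let $M>0$, $l>0$, $m>0$, and fix harmonics $s\in\mathbb N+\tfrac12$, $n\in\{-s,\dots,s\}$ ($n$ does not enter the operator below). Let $F(r)=1-\frac{2M}{r}+\frac{r^2}{l^2}$, let $r_+=p_++p_-$ with $p_\pm=\bigl(Ml^2\pm(M^2l^4+\tfrac{l^6}{27})^{1/2}\bigr)^{1/3}$ be its real root and $\kappa=\tfrac12F'(r_+)$ the surface gravity. Let $x\in\,]-\infty,0[$ be the coordinate $x(r)=-\int_r^\infty\frac{d\rho}{F(\rho)}$, $r>r_+$, with inverse $r(x)$, and put $B(x)=F(r(x))^{1/2}$, $A(x)=B(x)/r(x)$. Let $$\gamma^0=i\begin{pmatrix}0&\sigma^0\\-\sigma^0&0\end{pmatrix},\quad \gamma^k=i\begin{pmatrix}0&\sigma^k\\\sigma^k&0\end{pmatrix},\quad \sigma^0=\begin{pmatrix}1&0\\0&1\end{pmatrix},\ \sigma^1=\begin{pmatrix}1&0\\0&-1\end{pmatrix},\ \sigma^2=\begin{pmatrix}0&1\\1&0\end{pmatrix},$$ and $\Gamma^1=-\gamma^0\gamma^1=\mathrm{diag}(1,-1,-1,1)$.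 On $\mathcal H=[L^2(]-\infty,0[)]^4$ consider $$H=H_m^{s,n}=i\gamma^0\gamma^1\partial_x+(s+\tfrac12)A(x)\gamma^0\gamma^2-m\,B(x)\gamma^0,$$ with domain $\{u\in\mathcal H : Hu\in\mathcal H\}$ if $2ml\ge1$, and $\{u\in\mathcal H : Hu\in\mathcal H,\ \|(\gamma^1+i)u(x)\|=o(\sqrt{-x})\text{ as }x\to0^-\}$ if $2ml<1$. For $\lambda\in\mathbb C$ a *Jost solution* is a solution $\psi$ of $H\psi=\lambda\psi$ on $]-\infty,0[$ with $\psi(x)=(0,e^{-i\lambda x},0,0)^t+o(e^{\mathrm{Im}(\lambda)x})$ as $x\to-\infty$. A *boundary solution* is a solution $\varphi$ of $H\varphi=\lambda\varphi$ on $]-\infty,0[$ such that, as $x\to0^-$, $\|(\gamma^1+i)\varphi(x)\|=o(\sqrt{-x})$ if $2ml<1$, and $\varphi(x)\to0$ if $2ml\ge1$. For a spinor $v$ put $\tilde v=-i\gamma^0\gamma^1\gamma^2v$; a boundary solution $\varphi$ is *nondegenerate* if $\varphi$ and $\tilde\varphi$ are linearly independent. **Theorem.** (i) Let $\mathrm{Im}\,\lambda>0$.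 A Jost solution and a nondegenerate boundary solution exist. Let $\psi$ be any Jost solution and $\varphi$ any nondegenerate boundary solution. Then $\alpha=\varphi_1\psi_2-\psi_1\varphi_2+\varphi_3\psi_4-\psi_3\varphi_4$ and $\beta=\varphi_1\psi_3-\psi_1\varphi_3+\varphi_2\psi_4-\psi_2\varphi_4$ do not depend on $x$, the matrix $$M_{\alpha,\beta}=\begin{pmatrix}0&\alpha&\beta&0\\-\alpha&0&0&\beta\\-\beta&0&0&\alpha\\0&-\beta&-\alpha&0\end{pmatrix}$$ is invertible, $H-\lambda$ maps the domain of $H$ bijectively onto $\mathcal H$ with bounded inverse, and for every $f\in\mathcal H$ and almost every $x<0$ $$\bigl((H-\lambda)^{-1}f\bigr)(x)=\int_{-\infty}^0R(x,y,\lambda)f(y)\,dy,$$ where the integral converges absolutely for every $x<0$ and $$R(x,y,\lambda)=\bigl(\varphi(x)\psi^t(y)+\tilde\varphi(x)\tilde\psi^t(y)\bigr)M_{\alpha,\beta}^{-1}\,i\Gamma^1\,\mathbf 1_{]-\infty,x[}(y)+\bigl(\psi(x)\varphi^t(y)+\tilde\psi(x)\tilde\varphi^t(y)\bigr)M_{\alpha,\beta}^{-1}\,i\Gamma^1\,\mathbf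 1_{]x,0[}(y).$$ (ii) Let $0<\varepsilon<\kappa/2$. The function $\lambda\mapsto e^{\varepsilon x}(H-\lambda)^{-1}e^{\varepsilon x}$, defined for $\mathrm{Im}\,\lambda>0$ with values in the bounded operators on $\mathcal H$, extends to a meromorphic function on $\{\lambda\in\mathbb C:\mathrm{Im}\,\lambda>-\varepsilon\}$, analytic away from its poles. (These poles are called resonances.) -/

import Mathlib

open MeasureTheory Set Filter Topology Asymptotics

namespace SAdS

noncomputable section

/-! ### The geometry -/

/-- `F(r) = 1 - 2M/r + r²/l²`. -/
def lapse (M l r : ℝ) : ℝ := 1 - 2 * M / r + r ^ 2 / l ^ 2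

/-- The horizon radius `p₊ + p₋`, `p± = (M l² ± (M² l⁴ + l⁶/27)^{1/2})^{1/3}` (real cube roots; the
radicand of `p₋` is negative, so `p₋` is written as minus the cube root of a positive number). -/
def horizon (M l : ℝ) : ℝ :=
  (M * l ^ 2 + √(M ^ 2 * l ^ 4 + l ^ 6 / 27)) ^ (1 / 3 : ℝ)
    - (√(M ^ 2 * l ^ 4 + l ^ 6 / 27) - M * l ^ 2) ^ (1 / 3 : ℝ)

/-- The surface gravity `κ = F'(r₊) / 2`. -/
def surfaceGravity (M l : ℝ) : ℝ := deriv (lapse M l) (horizon M l) / 2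

/-- The Regge-Wheeler coordinate: `dx/dr = 1/F(r)` and `x → 0` as `r → ∞`. -/
def tortoise (M l r : ℝ) : ℝ := -∫ ρ in Ioi r, (lapse M l ρ)⁻¹

/-- `r` as a function of `x < 0`: the inverse of `tortoise` on `]r₊, ∞[`. -/
def radius (M l : ℝ) : ℝ → ℝ := Function.invFunOn (tortoise M l) (Ioi (horizon M l))

/-- `A(x) = F(r(x))^{1/2} / r(x)`. -/
def potA (M l x : ℝ) : ℝ := √(lapse M l (radius M l x)) / radius M l x

/-- `B(x) = F(r(x))^{1/2}`. -/
def potB (M l x : ℝ) : ℝ := √(lapse M l (radius M l x))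

/-! ### Dirac matrices -/

abbrev Mat4 := Matrix (Fin 4) (Fin 4) ℂ

/-- `ℂ⁴` with its Hermitian norm. -/
abbrev Spinor := EuclideanSpace ℂ (Fin 4)

def γ0 : Mat4 := Complex.I • !![0, 0, 1, 0; 0, 0, 0, 1; -1, 0, 0, 0; 0, -1, 0, 0]

def γ1 : Mat4 := Complex.I • !![0, 0, 1, 0; 0, 0, 0, -1; 1, 0, 0, 0; 0, -1, 0, 0]

def γ2 : Mat4 := Complex.I • !![0, 0, 0, 1; 0, 0, 1, 0; 0, 1, 0, 0; 1, 0, 0, 0]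

/-- `Γ¹ = -γ⁰γ¹ = diag(1, -1, -1, 1)`. -/
def Γ1 : Mat4 := -(γ0 * γ1)

/-- The action of a matrix on a spinor. -/
def act (T : Mat4) (v : Spinor) : Spinor := Matrix.toEuclideanCLM (n := Fin 4) (𝕜 := ℂ) T v

/-- `ṽ = -i γ⁰γ¹γ² v`. -/
def tilde (v : Spinor) : Spinor := act ((-Complex.I) • (γ0 * γ1 * γ2)) v

/-! ### The separated Dirac operator -/

/-- The potential `(s + 1/2) A(x) γ⁰γ² - m B(x) γ⁰`. -/
def potV (M l m s x : ℝ) : Mat4 :=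
  (((s + 1 / 2) * potA M l x : ℝ) : ℂ) • (γ0 * γ2) - ((m * potB M l x : ℝ) : ℂ) • γ0

/-- The differential expression `i γ⁰γ¹ ∂ₓ w + V w` at the point `x`, where `w` has value `v` and
derivative `v'` at `x`. -/
def diracExpr (M l m s x : ℝ) (v v' : Spinor) : Spinor :=
  act (Complex.I • (γ0 * γ1)) v' + act (potV M l m s x) v

/-- The condition `‖(γ¹ + i) w(x)‖ = o(√(-x))` as `x → 0⁻`. -/
def BoundaryCond (w : ℝ → Spinor) : Prop :=
  (fun x => act (γ1 + Complex.I • (1 : Mat4)) (w x)) =o[𝓝[<] 0] fun x => √(-x)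

/-- `w` is locally absolutely continuous on `]-∞, 0[`, with almost everywhere derivative `w'`. -/
def IsLocAC (w w' : ℝ → Spinor) : Prop :=
  ∀ a < 0, ∀ b < 0, IntervalIntegrable w' volume a b ∧ w b - w a = ∫ t in a..b, w' t

/-- The Hilbert space `[L²(]-∞, 0[)]⁴`. -/
abbrev Hil := Lp Spinor 2 (volume.restrict (Iio (0 : ℝ)))

/-- The graph of `H`: pairs `(u, v)` of square integrable functions such that `u` has a locally
absolutely continuous representative `w` with `i γ⁰γ¹ w' + V w = v` almost everywhere and, when
`2 m l < 1`, with the boundary condition at `0`. -/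
def diracGraph (M l m s : ℝ) : Submodule ℂ (Hil × Hil) where
  carrier := {p | ∃ w w' : ℝ → Spinor, IsLocAC w w' ∧
    (∀ᵐ x ∂(volume.restrict (Iio (0 : ℝ))), p.1 x = w x) ∧
    (∀ᵐ x ∂(volume.restrict (Iio (0 : ℝ))), p.2 x = diracExpr M l m s x (w x) (w' x)) ∧
    (2 * m * l < 1 → BoundaryCond w)}
  add_mem' := by
    rintro ⟨u₁, v₁⟩ ⟨u₂, v₂⟩ ⟨w₁, d₁, h₁, hu₁, hv₁, hb₁⟩ ⟨w₂, d₂, h₂, hu₂, hv₂, hb₂⟩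
    refine ⟨fun x => w₁ x + w₂ x, fun x => d₁ x + d₂ x, ?_, ?_, ?_, ?_⟩
    · intro a ha b hb
      obtain ⟨i₁, e₁⟩ := h₁ a ha b hb
      obtain ⟨i₂, e₂⟩ := h₂ a ha b hb
      refine ⟨i₁.add i₂, ?_⟩
      rw [intervalIntegral.integral_add i₁ i₂, ← e₁, ← e₂]
      exact add_sub_add_comm _ _ _ _
    · filter_upwards [hu₁, hu₂, Lp.coeFn_add u₁ u₂] with x a₁ a₂ a₃
      simp only [Prod.mk_add_mk] at *
      rw [a₃, Pi.add_apply, a₁, a₂]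
    · filter_upwards [hv₁, hv₂, Lp.coeFn_add v₁ v₂] with x a₁ a₂ a₃
      simp only [Prod.mk_add_mk] at *
      rw [a₃, Pi.add_apply, a₁, a₂]
      simp only [diracExpr, act, map_add]
      abel
    · intro hm
      have := (hb₁ hm).add (hb₂ hm)
      simpa only [BoundaryCond, act, map_add] using this
  zero_mem' := by
    refine ⟨fun _ => 0, fun _ => 0, ?_, ?_, ?_, ?_⟩
    · intro a _ b _
      simp
    · filter_upwards [Lp.coeFn_zero Spinor 2 (volume.restrict (Iio (0 : ℝ)))] with x hx
      simpa using hx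
    · filter_upwards [Lp.coeFn_zero Spinor 2 (volume.restrict (Iio (0 : ℝ)))] with x hx
      simpa [diracExpr, act] using hx
    · intro _
      simp only [BoundaryCond, act, map_zero]
      exact isLittleO_zero _ _
  smul_mem' := by
    rintro c ⟨u, v⟩ ⟨w, d, h, hu, hv, hb⟩
    refine ⟨fun x => c • w x, fun x => c • d x, ?_, ?_, ?_, ?_⟩
    · intro a ha b hb
      obtain ⟨i, e⟩ := h a ha b hb
      refine ⟨i.smul c, ?_⟩
      rw [intervalIntegral.integral_smul, ← e, smul_sub]
    · filter_upwards [hu, Lp.coeFn_smul c u] with x a₁ a₂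
      simp only [Prod.smul_mk] at *
      rw [a₂, Pi.smul_apply, a₁]
    · filter_upwards [hv, Lp.coeFn_smul c v] with x a₁ a₂
      simp only [Prod.smul_mk] at *
      rw [a₂, Pi.smul_apply, a₁]
      simp only [diracExpr, act, map_smul, smul_add]
    · intro hm
      have := (hb hm).const_smul_left c
      simp only [BoundaryCond, act, map_smul]
      exact this

/-- The separated massive Dirac operator `H`, as an unbounded operator on its domain. -/
def diracOp (M l m s : ℝ) : Hil →ₗ.[ℂ] Hil := (diracGraph M l m s).toLinearPMap

theorem diracGraph_single (M l m s : ℝ) (p : Hil × Hil) (hp : p ∈ diracGraph M l m s)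
    (h0 : p.1 = 0) : p.2 = 0 := by
  obtain ⟨w, d, h, hu, hv, -⟩ := hp
  have hcont : ContinuousOn w (Iio 0) := by
    intro x hx
    have hx' : x < 0 := hx
    have hev : w =ᶠ[𝓝 x] fun b => w (x - 1) + ∫ t in (x - 1)..b, d t := by
      filter_upwards [Iio_mem_nhds hx'] with b hb
      rw [← (h (x - 1) (by linarith) b hb).2]
      abel
    have hc : ContinuousOn (fun b => ∫ t in (x - 1)..b, d t) (uIcc (x - 1) (x / 2)) :=
      intervalIntegral.continuousOn_primitive_interval'
        (h (x - 1) (by linarith) (x / 2) (by linarith)).1 left_mem_uIcc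
    have hmem : uIcc (x - 1) (x / 2) ∈ 𝓝 x := by
      rw [uIcc_of_le (by linarith)]
      exact Icc_mem_nhds (by linarith) (by linarith)
    have : ContinuousAt w x :=
      (continuousAt_const.add (hc.continuousAt hmem)).congr hev.symm
    exact this.continuousWithinAt
  have hw0 : ∀ x < 0, w x = 0 := by
    have hae : w =ᵐ[volume.restrict (Iio (0 : ℝ))] fun _ => (0 : Spinor) := by
      filter_upwards [hu, Lp.coeFn_zero Spinor 2 (volume.restrict (Iio (0 : ℝ)))] with x a b
      rw [h0] at a
      rw [← a, b]
      rfl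
    have := Measure.eqOn_open_of_ae_eq hae isOpen_Iio hcont continuousOn_const
    exact fun x hx => this hx
  have hint : ∀ a < 0, ∀ b < 0, ∫ t in a..b, d t = 0 := by
    intro a ha b hb
    rw [← (h a ha b hb).2, hw0 a ha, hw0 b hb, sub_zero]
  have hd : ∀ᵐ x ∂(volume.restrict (Iio (0 : ℝ))), d x = 0 := by
    rw [ae_restrict_iff' measurableSet_Iio]
    have key : ∀ n : ℕ, ∀ᵐ x : ℝ, x ∈ uIcc (-(n + 2 : ℝ)) (-(n + 2 : ℝ)⁻¹) →
        ∀ c ∈ uIcc (-(n + 2 : ℝ)) (-(n + 2 : ℝ)⁻¹),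
          HasDerivAt (fun y => ∫ t in c..y, d t) (d x) x := fun n =>
      (h (-(n + 2 : ℝ)) (neg_lt_zero.2 (by positivity)) (-(n + 2 : ℝ)⁻¹)
        (neg_lt_zero.2 (by positivity))).1.ae_hasDerivAt_integral
    filter_upwards [ae_all_iff.2 key] with x hx hx0
    have hx' : x < 0 := hx0
    obtain ⟨n, hn⟩ := exists_nat_ge (max (-x) (-x)⁻¹)
    have h1 : -x ≤ n := le_trans (le_max_left _ _) hn
    have h2 : (-x)⁻¹ ≤ n := le_trans (le_max_right _ _) hn
    have h3 : (n + 2 : ℝ)⁻¹ ≤ -x := by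
      apply inv_le_of_inv_le₀ (by linarith)
      linarith
    have hmem : x ∈ uIcc (-(n + 2 : ℝ)) (-(n + 2 : ℝ)⁻¹) := by
      rw [mem_uIcc]
      left
      constructor <;> linarith
    have hD := hx n hmem x hmem
    have hev : (fun y => ∫ t in x..y, d t) =ᶠ[𝓝 x] fun _ => (0 : Spinor) := by
      filter_upwards [Iio_mem_nhds hx'] with y hy
      exact hint x hx' y hy
    exact hD.unique ((hasDerivAt_const x (0 : Spinor)).congr_of_eventuallyEq hev)
  apply Lp.ext
  filter_upwards [hv, hd, ae_restrict_mem measurableSet_Iio,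
    Lp.coeFn_zero Spinor 2 (volume.restrict (Iio (0 : ℝ)))] with x a b c e
  rw [a, b, hw0 x c, e]
  simp [diracExpr, act]

theorem diracOp_graph (M l m s : ℝ) : (diracOp M l m s).graph = diracGraph M l m s :=
  Submodule.toLinearPMap_graph_eq _ (fun p hp h0 => diracGraph_single M l m s p hp h0)

/-- `R = (T - z)⁻¹`: the bounded operator `R` maps into the domain of `T` and is a two-sided inverse
of `T - z` (with `T` defined on its domain). -/
def IsResolventAt {E : Type*} [NormedAddCommGroup E] [NormedSpace ℂ E] (T : E →ₗ.[ℂ] E) (z : ℂ)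
    (R : E →L[ℂ] E) : Prop :=
  (∀ f : E, ∃ u : T.domain, (u : E) = R f ∧ T u - z • (u : E) = f) ∧
    ∀ u : T.domain, R (T u - z • (u : E)) = u

/-! ### Jost solution, boundary solution, kernel -/

/-- `w` solves the ordinary differential equation `H w = z w` on `]-∞, 0[`. -/
def IsSol (M l m s : ℝ) (z : ℂ) (w : ℝ → Spinor) : Prop :=
  ∀ x < 0, DifferentiableAt ℝ w x ∧ diracExpr M l m s x (w x) (deriv w x) = z • w x

/-- A Jost solution: `ψ(x) = (0, e^{-izx}, 0, 0) + o(e^{Im(z) x})` as `x → -∞`. -/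
def IsJost (M l m s : ℝ) (z : ℂ) (ψ : ℝ → Spinor) : Prop :=
  IsSol M l m s z ψ ∧
    (fun x => ψ x - EuclideanSpace.single 1 (Complex.exp (-Complex.I * z * x))) =o[atBot]
      fun x => Real.exp (z.im * x)

/-- A solution satisfying the boundary condition at `0`: `‖(γ¹ + i) φ‖ = o(√(-x))` if `2 m l < 1`,
and `φ(x) → 0` if `2 m l ≥ 1`. -/
def IsBoundarySol (M l m s : ℝ) (z : ℂ) (φ : ℝ → Spinor) : Prop :=
  IsSol M l m s z φ ∧ (2 * m * l < 1 → BoundaryCond φ) ∧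
    (1 ≤ 2 * m * l → Tendsto φ (𝓝[<] 0) (𝓝 0))

/-- `φ` and `φ̃ = -i γ⁰γ¹γ² φ` are linearly independent as functions on `]-∞, 0[`. -/
def IsNondegenerate (φ : ℝ → Spinor) : Prop :=
  LinearIndependent ℂ ![fun x : Iio (0 : ℝ) => φ x, fun x : Iio (0 : ℝ) => tilde (φ x)]

/-- `φ₁ψ₂ - ψ₁φ₂ + φ₃ψ₄ - ψ₃φ₄`. -/
def alphaW (φ ψ : Spinor) : ℂ := φ 0 * ψ 1 - ψ 0 * φ 1 + φ 2 * ψ 3 - ψ 2 * φ 3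

/-- `φ₁ψ₃ - ψ₁φ₃ + φ₂ψ₄ - ψ₂φ₄`. -/
def betaW (φ ψ : Spinor) : ℂ := φ 0 * ψ 2 - ψ 0 * φ 2 + φ 1 * ψ 3 - ψ 1 * φ 3

def matM (α β : ℂ) : Mat4 := !![0, α, β, 0; -α, 0, 0, β; -β, 0, 0, α; 0, -β, -α, 0]

/-- The product `v wᵗ` (no complex conjugation). -/
def outer (v w : Spinor) : Mat4 := Matrix.vecMulVec (fun i => v i) (fun j => w j)

/-- The kernel
`(φ(x)ψᵗ(y) + φ̃(x)ψ̃ᵗ(y)) M⁻¹ iΓ¹ 1_{y < x} + (ψ(x)φᵗ(y) + ψ̃(x)φ̃ᵗ(y)) M⁻¹ iΓ¹ 1_{x < y < 0}`. -/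
def kernelR (φ ψ : ℝ → Spinor) (α β : ℂ) (x y : ℝ) : Mat4 :=
  (Iio x).indicator (fun y => (outer (φ x) (ψ y) + outer (tilde (φ x)) (tilde (ψ y))) *
      (matM α β)⁻¹ * (Complex.I • Γ1)) y +
  (Ioo x 0).indicator (fun y => (outer (ψ x) (φ y) + outer (tilde (ψ x)) (tilde (φ y))) *
      (matM α β)⁻¹ * (Complex.I • Γ1)) y

/-! ### The weight and resonances -/

theorem memLp_weight (ε : ℝ) (hε : 0 ≤ ε) :
    MemLp (fun x : ℝ => (Real.exp (ε * x) : ℂ)) ⊤ (volume.restrict (Iio (0 : ℝ))) := by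
  refine memLp_top_of_bound (by fun_prop) 1 ?_
  filter_upwards [ae_restrict_mem measurableSet_Iio] with x hx
  have hx' : x < 0 := hx
  rw [Complex.norm_real, Real.norm_eq_abs, Real.abs_exp, Real.exp_le_one_iff]
  nlinarith

/-- The bounded operator of multiplication by `e^{εx}`, for `ε ≥ 0`. -/
def weight (ε : ℝ) (hε : 0 ≤ ε) : Hil →L[ℂ] Hil :=
  (ContinuousLinearMap.lsmul ℂ ℂ : ℂ →L[ℂ] Spinor →L[ℂ] Spinor).holderL
    (volume.restrict (Iio (0 : ℝ))) ⊤ 2 2 ((memLp_weight ε hε).toLp _)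

/-- The half plane `Im z > -ε`. -/
def halfPlane (ε : ℝ) : Set ℂ := {z | -ε < z.im}

/-- The poles of an operator-valued function in the half plane `Im z > -ε`; for the extension of the
weighted resolvent these are the resonances. -/
def poles (ε : ℝ) (𝓡 : ℂ → Hil →L[ℂ] Hil) : Set ℂ :=
  {z ∈ halfPlane ε | meromorphicOrderAt 𝓡 z < 0}

end

end SAdS

open MeasureTheory Set Filter Topology Asymptotics

namespace SAdS

noncomputable section

/-! ### Volterra equations on a half line -/

/-! The matrix of `tilde` is an involution commuting with the equation `w' = N w` equivalent to `H w
= z w`. On its eigenspace with eigenvalue `σ = ±1` the four equations collapse to two, with `A`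
replaced by `σ A`. So everything about solutions reduces to one 2×2 system with a bounded potential
`a` and a potential `b` that behaves like `ν / (-x)` at `0`, where `ν = m l`; both decay like
`e^{kx}` at `-∞` for every `k < κ`. These properties come from the geometry: `F` has a simple zero
with slope `2κ` at the horizon, and `-x = l² / r + O(r⁻³)` at infinity.

Solutions are built as Picard series of Volterra equations starting at `-∞`, with bounds that are
locally uniform in `z`, hence holomorphic in `z`. For the Jost solution the variable is `x`
(`exists_jost_family`); the coupling between `e^{izx}` and `e^{-izx}` can be integrated down to `Im
z > -ε` as long as `2ε < κ`. For the boundary solution the variable is `ξ = log (-x)`, which moves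
the singular endpoint to `-∞` (`exists_bdry_family`); this family is entire in `z`.

The energy identity for the flux `|w₁|² - |w₂|² - |w₃|² + |w₄|²` gives `Im z ‖u‖ ≤ ‖(H - z) u‖` for
`Im z > 0` (`IsForcedSol.energy_le`). The boundary terms vanish along sequences: at `-∞` by
integrability, at `0` by the boundary condition if `2ν < 1` and automatically if `2ν ≥ 1`. In
particular no nonzero square integrable solution satisfies the boundary condition. Since `α ± β`
are, up to sign, the Wronskians of the two reduced systems, a zero of one of them would produce such
a solution; hence `α² - β² ≠ 0` and `M_{α,β}` is invertible (`sq_sub_sq_wronskian_ne_zero`).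

The jump of the kernel on the diagonal is `M_{α,β}`, so the Green integral solves `(H - z) u = f`.
For truncated `f` it is a multiple of the right solutions at both ends, so the energy estimate
applies; Fatou's lemma then shows that the Green integral of any `f` is square integrable
(`GreenPair.memLp_greenSol`). With the energy bound this gives the resolvent and its formula.

For the continuation, `M_{α,β}⁻¹ = (α² - β²)⁻¹ M_{-α,β}`. Apart from the scalar `(α² - β²)⁻¹`, the
weighted kernel is built from families holomorphic in `Im z > -ε`. A monotone weight `w` splits it
into two square integrable factors and a ratio `w(x) / w(y)` bounded by `1`, so it is a holomorphic
family of bounded operators (`exists_weightedGreenOp`). The poles can only come from the zeros of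
`α² - β²`. -/

/-- A nonnegative continuous function on the open lower set `S`, integrable at `-∞`. -/
structure VolterraWeight (S : Set ℝ) (ρ : ℝ → ℝ) : Prop where
  isOpen : IsOpen S
  lower : IsLowerSet S
  cont : ContinuousOn ρ S
  nonneg : ∀ t ∈ S, 0 ≤ ρ t
  int : ∀ t ∈ S, IntegrableOn ρ (Iic t)

/-- The exponential weight `exp (2 ∫_{-∞}^t ρ)`. -/
def bielecki (ρ : ℝ → ℝ) (t : ℝ) : ℝ := Real.exp (2 * ∫ s in Iic t, ρ s)

theorem bielecki_pos (ρ : ℝ → ℝ) (t : ℝ) : 0 < bielecki ρ t := Real.exp_pos _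

namespace VolterraWeight

variable {S : Set ℝ} {ρ : ℝ → ℝ}

theorem Iic_subset (h : VolterraWeight S ρ) {t : ℝ} (ht : t ∈ S) : Iic t ⊆ S := fun _ hs => h.lower hs ht

theorem exists_gt (h : VolterraWeight S ρ) {t : ℝ} (ht : t ∈ S) : ∃ u ∈ S, t < u := by
  have := (mem_nhdsGT_iff_exists_Ioo_subset (a := t) (s := S)).1
    (mem_nhdsWithin_of_mem_nhds (h.isOpen.mem_nhds ht))
  obtain ⟨u, hu, hsub⟩ := this
  exact ⟨(t + u) / 2, hsub ⟨by simp at hu; linarith, by simp at hu; linarith⟩,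
    by simp at hu; linarith⟩

end VolterraWeight

/-- The derivative of `t ↦ ∫_{-∞}^t f` at a point of an open lower set of continuity. -/
theorem hasDerivAt_integral_Iic {E : Type*} [NormedAddCommGroup E] [NormedSpace ℝ E]
    [CompleteSpace E] {S : Set ℝ} (hS : IsOpen S) {f : ℝ → E}
    (hf : ContinuousOn f S) (h_int : ∀ t ∈ S, IntegrableOn f (Iic t)) {t : ℝ} (ht : t ∈ S) :
    HasDerivAt (fun t => ∫ s in Iic t, f s) (f t) t := by
  have hct : ContinuousAt f t := hf.continuousAt (hS.mem_nhds ht)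
  have hev : (fun u => ∫ s in Iic u, f s) =ᶠ[𝓝 t]
      fun u => (∫ s in Iic t, f s) + ∫ s in t..u, f s := by
    filter_upwards [hS.mem_nhds ht] with u hu
    rw [← intervalIntegral.integral_Iic_sub_Iic (h_int t ht) (h_int u hu)]
    abel
  have hd : HasDerivAt (fun u => ∫ s in t..u, f s) (f t) t := by
    refine intervalIntegral.integral_hasDerivAt_right (by simp) ?_ hct
    exact hf.stronglyMeasurableAtFilter hS t ht
  exact (hd.const_add _).congr_of_eventuallyEq hev

theorem tendsto_integral_Iic_atBot {E : Type*} [NormedAddCommGroup E] [NormedSpace ℝ E]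
    {f : ℝ → E} {t : ℝ} (h_int : IntegrableOn f (Iic t)) :
    Tendsto (fun t => ∫ s in Iic t, f s) atBot (𝓝 0) := by
  have h1 : Tendsto (fun u => ∫ s in u..t, f s) atBot (𝓝 (∫ s in Iic t, f s)) :=
    intervalIntegral_tendsto_integral_Iic t h_int tendsto_id
  have h2 := (tendsto_const_nhds (x := ∫ s in Iic t, f s)).sub h1
  rw [sub_self] at h2
  refine h2.congr' ?_
  filter_upwards [eventually_le_atBot t] with u hu
  rw [← intervalIntegral.integral_Iic_sub_Iic (h_int.mono_set (Iic_subset_Iic.2 hu)) h_int]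
  abel

namespace VolterraWeight

variable {S : Set ℝ} {ρ : ℝ → ℝ}

theorem hasDerivAt_bielecki (h : VolterraWeight S ρ) {t : ℝ} (ht : t ∈ S) :
    HasDerivAt (bielecki ρ) (2 * (ρ t * bielecki ρ t)) t := by
  have := ((hasDerivAt_integral_Iic h.isOpen h.cont h.int ht).const_mul 2).exp
  refine this.congr_deriv ?_
  rw [bielecki]
  ring

theorem continuousOn_bielecki (h : VolterraWeight S ρ) : ContinuousOn (bielecki ρ) S := fun _ ht =>
  (h.hasDerivAt_bielecki ht).continuousAt.continuousWithinAt

theorem bielecki_mono (h : VolterraWeight S ρ) {s t : ℝ} (ht : t ∈ S) (hst : s ≤ t) : bielecki ρ s ≤ bielecki ρ t := by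
  refine Real.exp_le_exp.2 (mul_le_mul_of_nonneg_left ?_ zero_le_two)
  refine setIntegral_mono_set (h.int t ht) ?_ (Iic_subset_Iic.2 hst).eventuallyLE
  filter_upwards [ae_restrict_mem measurableSet_Iic] with u hu
  exact h.nonneg u (h.Iic_subset ht hu)

theorem one_le_bielecki (h : VolterraWeight S ρ) {t : ℝ} (ht : t ∈ S) : 1 ≤ bielecki ρ t := by
  refine Real.one_le_exp (mul_nonneg zero_le_two ?_)
  exact setIntegral_nonneg measurableSet_Iic fun u hu => h.nonneg u (h.Iic_subset ht hu)

theorem tendsto_bielecki (h : VolterraWeight S ρ) {t : ℝ} (ht : t ∈ S) : Tendsto (bielecki ρ) atBot (𝓝 1) := by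
  have := ((tendsto_integral_Iic_atBot (h.int t ht)).const_mul 2).rexp
  rw [mul_zero, Real.exp_zero] at this
  exact this

theorem integrableOn_mul_bielecki (h : VolterraWeight S ρ) {t : ℝ} (ht : t ∈ S) :
    IntegrableOn (fun s => ρ s * bielecki ρ s) (Iic t) := by
  refine Integrable.mono' ((h.int t ht).mul_const (bielecki ρ t)) ?_ ?_
  · exact ((h.cont.mul h.continuousOn_bielecki).mono
      (h.Iic_subset ht)).aestronglyMeasurable measurableSet_Iic
  · filter_upwards [ae_restrict_mem measurableSet_Iic] with s hs
    have hρ := h.nonneg s (h.Iic_subset ht hs)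
    rw [Real.norm_of_nonneg (mul_nonneg hρ (bielecki_pos _ _).le)]
    exact mul_le_mul_of_nonneg_left (h.bielecki_mono ht hs) hρ

/-- This is what the factor `2` in the exponent buys: `ρ E` is half the derivative of the weight
`E`, and `E → 1` at `-∞`. In the norm `sup ‖w‖ / E` the Volterra operator therefore has norm at most
`1/2`, with no smallness required of `ρ`. -/
theorem integral_mul_bielecki (h : VolterraWeight S ρ) {t : ℝ} (ht : t ∈ S) :
    ∫ s in Iic t, ρ s * bielecki ρ s = (bielecki ρ t - 1) / 2 := by
  have := integral_Iic_of_hasDerivAt_of_tendsto' (a := t) (f := bielecki ρ)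
    (f' := fun s => 2 * (ρ s * bielecki ρ s)) (m := 1)
    (fun s hs => h.hasDerivAt_bielecki (h.Iic_subset ht hs))
    ((h.integrableOn_mul_bielecki ht).const_mul 2) (h.tendsto_bielecki ht)
  rw [integral_const_mul] at this
  linarith

end VolterraWeight

/-! ### The Picard series: convergence, continuity, asymptotics and dependence on parameters. -/

section Volterra

variable {X : Type*} [NormedAddCommGroup X] [NormedSpace ℂ X]

/-- A kernel `k t s`, `s ≤ t`, dominated by the weight `ρ s`. -/
structure VolterraKernel (S : Set ℝ) (ρ : ℝ → ℝ) (k : ℝ → ℝ → X →L[ℂ] X) : Prop where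
  cont : ContinuousOn (fun p : ℝ × ℝ => k p.1 p.2) (S ×ˢ S)
  bound : ∀ t ∈ S, ∀ s ≤ t, ‖k t s‖ ≤ ρ s

/-- The iterated integrals of the Picard series. -/
def volterraTerm (k : ℝ → ℝ → X →L[ℂ] X) (w₀ : X) : ℕ → ℝ → X
  | 0 => fun _ => w₀
  | n + 1 => fun t => ∫ s in Iic t, k t s (volterraTerm k w₀ n s)

/-- The solution of `w(t) = w₀ + ∫_{-∞}^t k(t,s) w(s) ds`. -/
def volterraSol (k : ℝ → ℝ → X →L[ℂ] X) (w₀ : X) (t : ℝ) : X := ∑' n, volterraTerm k w₀ n t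

variable {S : Set ℝ} {ρ : ℝ → ℝ} {k : ℝ → ℝ → X →L[ℂ] X}

theorem VolterraKernel.norm_apply_le (hρ : VolterraWeight S ρ) (hk : VolterraKernel S ρ k)
    {w : ℝ → X} {C : ℝ} (hw : ∀ s ∈ S, ‖w s‖ ≤ C * bielecki ρ s) {t s : ℝ} (ht : t ∈ S)
    (hs : s ≤ t) : ‖k t s (w s)‖ ≤ C * (ρ s * bielecki ρ s) := by
  have hsS := hρ.lower hs ht
  calc ‖k t s (w s)‖ ≤ ‖k t s‖ * ‖w s‖ := ContinuousLinearMap.le_opNorm _ _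
    _ ≤ ρ s * (C * bielecki ρ s) := mul_le_mul (hk.bound t ht s hs) (hw s hsS) (norm_nonneg _)
        (hρ.nonneg s hsS)
    _ = _ := by ring

theorem VolterraKernel.continuousOn_apply (hk : VolterraKernel S ρ k) {w : ℝ → X}
    (hw : ContinuousOn w S) {t : ℝ} (ht : t ∈ S) : ContinuousOn (fun s => k t s (w s)) S := by
  refine ContinuousOn.clm_apply ?_ hw
  exact hk.cont.comp (f := fun s => (t, s)) (by fun_prop) fun s hs => ⟨ht, hs⟩

theorem VolterraKernel.integrableOn_apply (hρ : VolterraWeight S ρ) (hk : VolterraKernel S ρ k)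
    {w : ℝ → X} (hwc : ContinuousOn w S) {C : ℝ} (hw : ∀ s ∈ S, ‖w s‖ ≤ C * bielecki ρ s) {t : ℝ}
    (ht : t ∈ S) : IntegrableOn (fun s => k t s (w s)) (Iic t) := by
  refine Integrable.mono' ((hρ.integrableOn_mul_bielecki ht).const_mul C) ?_ ?_
  · exact ((hk.continuousOn_apply hwc ht).mono (hρ.Iic_subset ht)).aestronglyMeasurable
      measurableSet_Iic
  · filter_upwards [ae_restrict_mem measurableSet_Iic] with s hs
    exact hk.norm_apply_le hρ hw ht hs

theorem VolterraKernel.norm_integral_le (hρ : VolterraWeight S ρ) (hk : VolterraKernel S ρ k)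
    {w : ℝ → X} {C : ℝ} (hw : ∀ s ∈ S, ‖w s‖ ≤ C * bielecki ρ s) {t : ℝ} (ht : t ∈ S) :
    ‖∫ s in Iic t, k t s (w s)‖ ≤ C * ((bielecki ρ t - 1) / 2) := by
  rw [← hρ.integral_mul_bielecki ht, ← integral_const_mul]
  refine norm_integral_le_of_norm_le ((hρ.integrableOn_mul_bielecki ht).const_mul C) ?_
  filter_upwards [ae_restrict_mem measurableSet_Iic] with s hs
  exact hk.norm_apply_le hρ hw ht hs

/-- Both the domain and the integrand depend on `t`. An indicator moves the integral to the fixed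
half line up to some `u > t₀`, where dominated convergence applies; the integrand can fail to be
continuous in `t` at `t₀` only for `s = t₀`, a null set. -/
theorem VolterraKernel.continuousOn_integral (hρ : VolterraWeight S ρ)
    (hk : VolterraKernel S ρ k) {w : ℝ → X} (hwc : ContinuousOn w S) {C : ℝ}
    (hw : ∀ s ∈ S, ‖w s‖ ≤ C * bielecki ρ s) :
    ContinuousOn (fun t => ∫ s in Iic t, k t s (w s)) S := by
  intro t₀ ht₀
  obtain ⟨u, hu, htu⟩ := hρ.exists_gt ht₀
  have hC : 0 ≤ C := by
    have := (norm_nonneg _).trans (hw t₀ ht₀)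
    exact nonneg_of_mul_nonneg_left this (bielecki_pos _ _)
  have heq : (fun t => ∫ s in Iic t, k t s (w s)) =ᶠ[𝓝 t₀]
      fun t => ∫ s in Iic u, (Iic t).indicator (fun s => k t s (w s)) s := by
    filter_upwards [Iio_mem_nhds htu] with t ht
    rw [setIntegral_indicator measurableSet_Iic, inter_eq_right.2 (Iic_subset_Iic.2 (le_of_lt ht))]
  refine (ContinuousAt.congr ?_ heq.symm).continuousWithinAt
  refine continuousAt_of_dominated (bound := fun s => C * (ρ s * bielecki ρ s)) ?_ ?_
    ((hρ.integrableOn_mul_bielecki hu).const_mul C) ?_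
  · filter_upwards [Iio_mem_nhds htu] with t ht
    refine AEStronglyMeasurable.indicator ?_ measurableSet_Iic
    exact ((hk.continuousOn_apply hwc (hρ.lower (le_of_lt ht) hu)).mono
      (hρ.Iic_subset hu)).aestronglyMeasurable measurableSet_Iic
  · filter_upwards [Iio_mem_nhds htu] with t ht
    filter_upwards [ae_restrict_mem measurableSet_Iic] with s hs
    by_cases hst : s ≤ t
    · rw [indicator_of_mem (by exact hst)]
      exact hk.norm_apply_le hρ hw (hρ.lower (le_of_lt ht) hu) hst
    · rw [indicator_of_notMem (by exact hst), norm_zero]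
      exact mul_nonneg hC (mul_nonneg (hρ.nonneg s (hρ.lower hs hu)) (bielecki_pos _ _).le)
  · have hne : ∀ᵐ s ∂(volume.restrict (Iic u)), s ≠ t₀ :=
      ae_restrict_of_ae (Measure.ae_ne volume t₀)
    filter_upwards [hne, ae_restrict_mem measurableSet_Iic] with s hs hsu
    rcases lt_or_gt_of_ne hs with hlt | hgt
    · have : (fun t => (Iic t).indicator (fun s => k t s (w s)) s) =ᶠ[𝓝 t₀]
          fun t => k t s (w s) := by
        filter_upwards [Ioi_mem_nhds hlt] with t ht
        exact indicator_of_mem (mem_Iic.2 (le_of_lt (mem_Ioi.1 ht))) _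
      refine ContinuousAt.congr ?_ this.symm
      have h1 : ContinuousAt (fun t => k t s) t₀ := by
        have : ContinuousOn (fun t => k t s) S :=
          hk.cont.comp (f := fun t => (t, s)) (by fun_prop) fun t ht => ⟨ht, hρ.lower hsu hu⟩
        exact this.continuousAt (hρ.isOpen.mem_nhds ht₀)
      exact h1.clm_apply continuousAt_const
    · have : (fun t => (Iic t).indicator (fun s => k t s (w s)) s) =ᶠ[𝓝 t₀] fun _ => 0 := by
        filter_upwards [Iio_mem_nhds hgt] with t ht
        exact indicator_of_notMem (by simpa using ht) _
      exact continuousAt_const.congr this.symm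

/-- Each integration gains a factor `1/2` against the exponential weight, so the Picard series is
dominated by a geometric one. -/
theorem volterraTerm_spec (hρ : VolterraWeight S ρ) (hk : VolterraKernel S ρ k) (w₀ : X) (n : ℕ) :
    ContinuousOn (volterraTerm k w₀ n) S ∧
      ∀ t ∈ S, ‖volterraTerm k w₀ n t‖ ≤ (‖w₀‖ * (1 / 2) ^ n) * bielecki ρ t := by
  induction n with
  | zero =>
    refine ⟨continuousOn_const, fun t ht => ?_⟩
    simp only [volterraTerm, pow_zero, mul_one]
    exact le_mul_of_one_le_right (norm_nonneg _) (hρ.one_le_bielecki ht)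
  | succ n ih =>
    refine ⟨hk.continuousOn_integral hρ ih.1 ih.2, fun t ht => ?_⟩
    refine (hk.norm_integral_le hρ ih.2 ht).trans ?_
    rw [pow_succ]
    have : 0 ≤ ‖w₀‖ * (1 / 2) ^ n := by positivity
    nlinarith

theorem summable_volterra_bound (w₀ : X) (E : ℝ) :
    HasSum (fun n : ℕ => (‖w₀‖ * (1 / 2) ^ n) * E) (2 * ‖w₀‖ * E) := by
  have := ((hasSum_geometric_of_lt_one (r := (1 / 2 : ℝ)) (by norm_num) (by norm_num)).mul_left
    ‖w₀‖).mul_right E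
  rwa [show ‖w₀‖ * (1 - 1 / 2 : ℝ)⁻¹ * E = 2 * ‖w₀‖ * E by
    rw [show (1 - 1 / 2 : ℝ)⁻¹ = 2 by norm_num, mul_comm ‖w₀‖ 2]] at this

theorem norm_volterraSol_le (hρ : VolterraWeight S ρ) (hk : VolterraKernel S ρ k) (w₀ : X) {t : ℝ}
    (ht : t ∈ S) : ‖volterraSol k w₀ t‖ ≤ 2 * ‖w₀‖ * bielecki ρ t :=
  tsum_of_norm_bounded (summable_volterra_bound w₀ (bielecki ρ t))
    fun n => (volterraTerm_spec hρ hk w₀ n).2 t ht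

variable [CompleteSpace X]

theorem hasSum_volterraSol (hρ : VolterraWeight S ρ) (hk : VolterraKernel S ρ k) (w₀ : X) {t : ℝ}
    (ht : t ∈ S) : HasSum (fun n => volterraTerm k w₀ n t) (volterraSol k w₀ t) :=
  (Summable.of_norm_bounded (summable_volterra_bound w₀ (bielecki ρ t)).summable
    fun n => (volterraTerm_spec hρ hk w₀ n).2 t ht).hasSum

theorem continuousOn_volterraSol (hρ : VolterraWeight S ρ) (hk : VolterraKernel S ρ k) (w₀ : X) :
    ContinuousOn (volterraSol k w₀) S := by
  intro t₀ ht₀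
  obtain ⟨u, hu, htu⟩ := hρ.exists_gt ht₀
  have : ContinuousOn (volterraSol k w₀) (Iic u) :=
    continuousOn_tsum (fun n => (volterraTerm_spec hρ hk w₀ n).1.mono (hρ.Iic_subset hu))
      (summable_volterra_bound w₀ (bielecki ρ u)).summable fun n t ht =>
        ((volterraTerm_spec hρ hk w₀ n).2 t (hρ.lower ht hu)).trans
          (mul_le_mul_of_nonneg_left (hρ.bielecki_mono hu ht) (by positivity))
  exact (this.continuousAt (Iic_mem_nhds htu)).continuousWithinAt

theorem volterraSol_eq (hρ : VolterraWeight S ρ) (hk : VolterraKernel S ρ k) (w₀ : X) {t : ℝ}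
    (ht : t ∈ S) : volterraSol k w₀ t = w₀ + ∫ s in Iic t, k t s (volterraSol k w₀ s) := by
  have h1 : HasSum (fun n => ∫ s in Iic t, k t s (volterraTerm k w₀ n s))
      (∫ s in Iic t, k t s (volterraSol k w₀ s)) := by
    refine hasSum_integral_of_dominated_convergence
      (bound := fun n s => (‖w₀‖ * (1 / 2) ^ n) * (ρ s * bielecki ρ s)) ?_ ?_ ?_ ?_ ?_
    · intro n
      exact (hk.integrableOn_apply hρ (volterraTerm_spec hρ hk w₀ n).1
        (volterraTerm_spec hρ hk w₀ n).2 ht).aestronglyMeasurable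
    · intro n
      filter_upwards [ae_restrict_mem measurableSet_Iic] with s hs
      exact hk.norm_apply_le hρ (volterraTerm_spec hρ hk w₀ n).2 ht hs
    · exact .of_forall fun s => (summable_volterra_bound w₀ _).summable
    · refine ((hρ.integrableOn_mul_bielecki ht).const_mul (2 * ‖w₀‖)).congr (.of_forall fun s => ?_)
      exact (summable_volterra_bound w₀ _).tsum_eq.symm
    · filter_upwards [ae_restrict_mem measurableSet_Iic] with s hs
      exact (k t s).hasSum (hasSum_volterraSol hρ hk w₀ (hρ.lower hs ht))
  have h2 := hasSum_volterraSol hρ hk w₀ ht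
  -- Without its zeroth term `w₀`, the Picard series is the series of integrals summed in `h1`.
  have h3 := (hasSum_nat_add_iff' (f := fun n => volterraTerm k w₀ n t) 1).2 h2
  simp only [Finset.range_one, Finset.sum_singleton] at h3
  have := h3.unique h1
  rw [← this]
  simp [volterraTerm]

/-- The integral term is at most a constant times `bielecki ρ t - 1`, and the exponential weight
tends to `1`. -/
theorem tendsto_volterraSol (hρ : VolterraWeight S ρ) (hk : VolterraKernel S ρ k) (w₀ : X) {u : ℝ}
    (hu : u ∈ S) : Tendsto (volterraSol k w₀) atBot (𝓝 w₀) := by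
  rw [tendsto_iff_norm_sub_tendsto_zero]
  have hlim : Tendsto (fun t => 2 * ‖w₀‖ * ((bielecki ρ t - 1) / 2)) atBot (𝓝 0) := by
    have := (((hρ.tendsto_bielecki hu).sub_const 1).div_const 2).const_mul (2 * ‖w₀‖)
    simpa using this
  refine squeeze_zero' (.of_forall fun _ => norm_nonneg _) ?_ hlim
  filter_upwards [eventually_le_atBot u] with t ht
  have htS := hρ.lower ht hu
  rw [volterraSol_eq hρ hk w₀ htS, add_sub_cancel_left]
  exact hk.norm_integral_le hρ (fun s hs => norm_volterraSol_le hρ hk w₀ hs) htS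

/-- Differentiation under the integral sign for dominated holomorphic integrands. -/
theorem differentiableOn_integral_of_dominated {α E : Type*} [MeasurableSpace α] {μ : Measure α}
    [NormedAddCommGroup E] [NormedSpace ℂ E] [CompleteSpace E] {Ω : Set ℂ} (hΩ : IsOpen Ω)
    {f : ℂ → α → E} {G : α → ℝ} (hG : Integrable G μ)
    (hmeas : ∀ z ∈ Ω, AEStronglyMeasurable (f z) μ)
    (hbound : ∀ᵐ x ∂μ, ∀ z ∈ Ω, ‖f z x‖ ≤ G x)
    (hdiff : ∀ᵐ x ∂μ, DifferentiableOn ℂ (fun z => f z x) Ω) :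
    DifferentiableOn ℂ (fun z => ∫ x, f z x ∂μ) Ω := by
  intro z₀ hz₀
  obtain ⟨r, hr, hball⟩ := Metric.isOpen_iff.1 hΩ z₀ hz₀
  -- Since `r/2 + r/3 < r`, every `z` near `z₀` has a disc of the fixed radius `r/3` inside `Ω`;
  -- Cauchy's estimate on it bounds the derivative by `G / (r/3)`.
  have hsub : ∀ z ∈ Metric.ball z₀ (r / 2), Metric.closedBall z (r / 3) ⊆ Ω := by
    intro z hz y hy
    apply hball
    rw [Metric.mem_ball] at *
    rw [Metric.mem_closedBall] at hy
    linarith [dist_triangle y z z₀]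
  have hz₀r : z₀ ∈ Metric.ball z₀ (r / 2) := Metric.mem_ball_self (by linarith)
  have hderiv : ∀ᵐ x ∂μ, ∀ z ∈ Metric.ball z₀ (r / 2),
      HasDerivAt (fun z => f z x) (deriv (fun z => f z x) z) z := by
    filter_upwards [hdiff] with x hx z hz
    exact (hx.differentiableAt (hΩ.mem_nhds
      (hsub z hz (Metric.mem_closedBall_self (by linarith))))).hasDerivAt
  -- The derivative is an almost everywhere limit of difference quotients along a sequence, which
  -- gives its measurability.
  have hmeas' : AEStronglyMeasurable (fun x => deriv (fun z => f z x) z₀) μ := by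
    obtain ⟨u, hu⟩ : ∃ u : ℕ → ℂ, Tendsto u atTop (𝓝[≠] (0 : ℂ)) :=
      exists_seq_tendsto _
    have hev : ∀ᶠ n in atTop, z₀ + u n ∈ Ω := by
      have h0 : Tendsto (fun n => z₀ + u n) atTop (𝓝 z₀) := by
        simpa using (hu.mono_right nhdsWithin_le_nhds).const_add z₀
      exact h0.eventually (hΩ.mem_nhds hz₀)
    obtain ⟨N, hN⟩ := eventually_atTop.1 hev
    refine aestronglyMeasurable_of_tendsto_ae (u := atTop)
      (f := fun n x => (u (n + N))⁻¹ • (f (z₀ + u (n + N)) x - f z₀ x)) ?_ ?_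
    · intro n
      exact ((hmeas _ (hN _ (by lia))).sub (hmeas _ hz₀)).const_smul _
    · filter_upwards [hderiv] with x hx
      have := (hasDerivAt_iff_tendsto_slope_zero.1 (hx z₀ hz₀r))
      exact (this.comp hu).comp (tendsto_add_atTop_nat N)
  have key := hasDerivAt_integral_of_dominated_loc_of_deriv_le (𝕜 := ℂ) (μ := μ)
    (F := f) (F' := fun z x => deriv (fun z => f z x) z) (x₀ := z₀)
    (s := Metric.ball z₀ (r / 2)) (bound := fun x => G x / (r / 3))
    (Metric.ball_mem_nhds _ (by linarith))
    (by filter_upwards [hΩ.mem_nhds hz₀] with z hz using hmeas z hz)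
    (hG.mono' (hmeas z₀ hz₀) (by filter_upwards [hbound] with x hx using hx z₀ hz₀))
    hmeas' ?_ (hG.div_const _) ?_
  · exact key.2.differentiableAt.differentiableWithinAt
  · filter_upwards [hbound, hdiff] with x hx hd z hz
    refine Complex.norm_deriv_le_of_forall_mem_sphere_norm_le (by linarith) ?_ ?_
    · exact (hd.mono (hsub z hz)).diffContOnCl_ball subset_rfl
    · intro y hy
      exact hx y (hsub z hz (Metric.sphere_subset_closedBall hy))
  · filter_upwards [hderiv] with x hx z hz using hx z hz

/-- The solution of a Volterra equation is holomorphic in a parameter. -/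
theorem differentiableOn_volterraSol (hρ : VolterraWeight S ρ) {Ω : Set ℂ} (hΩ : IsOpen Ω)
    {k : ℂ → ℝ → ℝ → X →L[ℂ] X} (hk : ∀ z ∈ Ω, VolterraKernel S ρ (k z))
    (hd : ∀ t ∈ S, ∀ s ≤ t, DifferentiableOn ℂ (fun z => k z t s) Ω) (w₀ : X) {t : ℝ}
    (ht : t ∈ S) : DifferentiableOn ℂ (fun z => volterraSol (k z) w₀ t) Ω := by
  have hterm : ∀ n, ∀ t ∈ S, DifferentiableOn ℂ (fun z => volterraTerm (k z) w₀ n t) Ω := by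
    intro n
    induction n with
    | zero => exact fun t _ => differentiableOn_const _
    | succ n ih =>
      intro t ht
      refine differentiableOn_integral_of_dominated hΩ
        ((hρ.integrableOn_mul_bielecki ht).const_mul (‖w₀‖ * (1 / 2) ^ n)) ?_ ?_ ?_
      · intro z hz
        have := volterraTerm_spec hρ (hk z hz) w₀ n
        exact ((hk z hz).integrableOn_apply hρ this.1 this.2 ht).aestronglyMeasurable
      · filter_upwards [ae_restrict_mem measurableSet_Iic] with s hs z hz
        exact (hk z hz).norm_apply_le hρ (volterraTerm_spec hρ (hk z hz) w₀ n).2 ht hs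
      · filter_upwards [ae_restrict_mem measurableSet_Iic] with s hs
        exact (hd t ht s hs).clm_apply (ih s (hρ.lower hs ht))
  exact Complex.differentiableOn_tsum_of_summable_norm
    (summable_volterra_bound w₀ (bielecki ρ t)).summable (fun n => hterm n t ht) hΩ
    fun n z hz => (volterraTerm_spec hρ (hk z hz) w₀ n).2 t ht

end Volterra

end

end SAdS

open MeasureTheory Set Filter Topology Asymptotics

namespace SAdS

noncomputable section

/-! ### First order systems of two equations with decaying coefficients -/

/-- The Volterra kernel of the system `W₁' = δ W₁ + c₁₁ W₁ + c₁₂ W₂`, `W₂' = c₂₁ W₁ + c₂₂ W₂`. -/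
def pairKernel (δ : ℂ) (c₁₁ c₁₂ c₂₁ c₂₂ : ℝ → ℂ) (t s : ℝ) : (ℂ × ℂ) →L[ℂ] (ℂ × ℂ) :=
  (Complex.exp (δ * ((t - s : ℝ) : ℂ)) • (c₁₁ s • ContinuousLinearMap.fst ℂ ℂ ℂ +
    c₁₂ s • ContinuousLinearMap.snd ℂ ℂ ℂ)).prod
  (c₂₁ s • ContinuousLinearMap.fst ℂ ℂ ℂ + c₂₂ s • ContinuousLinearMap.snd ℂ ℂ ℂ)

theorem pairKernel_apply (δ : ℂ) (c₁₁ c₁₂ c₂₁ c₂₂ : ℝ → ℂ) (t s : ℝ) (w : ℂ × ℂ) :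
    pairKernel δ c₁₁ c₁₂ c₂₁ c₂₂ t s w =
      (Complex.exp (δ * ((t - s : ℝ) : ℂ)) * (c₁₁ s * w.1 + c₁₂ s * w.2),
        c₂₁ s * w.1 + c₂₂ s * w.2) := by
  simp [pairKernel, mul_add]

/-- Coefficients dominated by the weight `ρ`. -/
structure PairCoeff (S : Set ℝ) (ρ : ℝ → ℝ) (δ : ℂ) (c₁₁ c₁₂ c₂₁ c₂₂ : ℝ → ℂ) : Prop where
  re_nonpos : δ.re ≤ 0
  cont₁₁ : ContinuousOn c₁₁ S
  cont₁₂ : ContinuousOn c₁₂ S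
  cont₂₁ : ContinuousOn c₂₁ S
  cont₂₂ : ContinuousOn c₂₂ S
  bound₁ : ∀ t ∈ S, ‖c₁₁ t‖ + ‖c₁₂ t‖ ≤ ρ t
  bound₂ : ∀ t ∈ S, ‖c₂₁ t‖ + ‖c₂₂ t‖ ≤ ρ t

/-- The solution of the system with limit `(0, 1)` at `-∞`. -/
def pairSol (δ : ℂ) (c₁₁ c₁₂ c₂₁ c₂₂ : ℝ → ℂ) : ℝ → ℂ × ℂ :=
  volterraSol (pairKernel δ c₁₁ c₁₂ c₂₁ c₂₂) (0, 1)

variable {S : Set ℝ} {ρ : ℝ → ℝ} {δ : ℂ} {c₁₁ c₁₂ c₂₁ c₂₂ : ℝ → ℂ}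

/-- For `s ≤ t` and `Re δ ≤ 0` the propagator `exp (δ (t - s))` has modulus at most `1`; the rest is
the row-sum bound for the max norm of `ℂ × ℂ`. -/
theorem PairCoeff.kernel (h : PairCoeff S ρ δ c₁₁ c₁₂ c₂₁ c₂₂) (hρ : VolterraWeight S ρ) :
    VolterraKernel S ρ (pairKernel δ c₁₁ c₁₂ c₂₁ c₂₂) where
  cont := by
    have hs : ∀ {c : ℝ → ℂ}, ContinuousOn c S → ContinuousOn (fun p : ℝ × ℝ => c p.2) (S ×ˢ S) :=
      fun hc => hc.comp (by fun_prop) fun p hp => hp.2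
    have h11 := hs h.cont₁₁
    have h12 := hs h.cont₁₂
    have h21 := hs h.cont₂₁
    have h22 := hs h.cont₂₂
    have e1 : ContinuousOn (fun p : ℝ × ℝ => (Complex.exp (δ * ((p.1 - p.2 : ℝ) : ℂ)) •
        (c₁₁ p.2 • ContinuousLinearMap.fst ℂ ℂ ℂ + c₁₂ p.2 • ContinuousLinearMap.snd ℂ ℂ ℂ)))
        (S ×ˢ S) := by
      have he : Continuous fun p : ℝ × ℝ => Complex.exp (δ * ((p.1 - p.2 : ℝ) : ℂ)) := by fun_prop
      refine he.continuousOn.smul ?_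
      exact (h11.smul continuousOn_const).add (h12.smul continuousOn_const)
    have e2 : ContinuousOn (fun p : ℝ × ℝ =>
        (c₂₁ p.2 • ContinuousLinearMap.fst ℂ ℂ ℂ + c₂₂ p.2 • ContinuousLinearMap.snd ℂ ℂ ℂ))
        (S ×ˢ S) :=
      (h21.smul continuousOn_const).add (h22.smul continuousOn_const)
    exact (ContinuousLinearMap.prodₗᵢ (𝕜 := ℂ) ℂ).continuous.comp_continuousOn (e1.prodMk e2)
  bound := by
    intro t ht s hst
    have hsS := hρ.lower hst ht
    have hlin : ∀ (a b : ℂ) (w : ℂ × ℂ), ‖a * w.1 + b * w.2‖ ≤ (‖a‖ + ‖b‖) * ‖w‖ := by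
      intro a b w
      calc ‖a * w.1 + b * w.2‖ ≤ ‖a‖ * ‖w.1‖ + ‖b‖ * ‖w.2‖ := by
            simpa using norm_add_le (a * w.1) (b * w.2)
        _ ≤ ‖a‖ * ‖w‖ + ‖b‖ * ‖w‖ := by
            gcongr
            · exact norm_fst_le w
            · exact norm_snd_le w
        _ = _ := by ring
    refine ContinuousLinearMap.opNorm_le_bound _ (hρ.nonneg s hsS) fun w => ?_
    rw [pairKernel_apply, Prod.norm_def]
    refine max_le ?_ ?_
    · have he : ‖Complex.exp (δ * ((t - s : ℝ) : ℂ))‖ ≤ 1 := by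
        rw [Complex.norm_exp, Real.exp_le_one_iff, Complex.re_mul_ofReal]
        exact mul_nonpos_of_nonpos_of_nonneg h.re_nonpos (by linarith)
      rw [norm_mul]
      calc _ ≤ 1 * ((‖c₁₁ s‖ + ‖c₁₂ s‖) * ‖w‖) :=
            mul_le_mul he (hlin _ _ _) (norm_nonneg _) zero_le_one
        _ ≤ _ := by
            rw [one_mul]
            exact mul_le_mul_of_nonneg_right (h.bound₁ s hsS) (norm_nonneg _)
    · exact (hlin _ _ _).trans (mul_le_mul_of_nonneg_right (h.bound₂ s hsS) (norm_nonneg _))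

theorem PairCoeff.continuousOn (h : PairCoeff S ρ δ c₁₁ c₁₂ c₂₁ c₂₂) (hρ : VolterraWeight S ρ) :
    ContinuousOn (pairSol δ c₁₁ c₁₂ c₂₁ c₂₂) S :=
  continuousOn_volterraSol hρ (h.kernel hρ) _

theorem PairCoeff.norm_le (h : PairCoeff S ρ δ c₁₁ c₁₂ c₂₁ c₂₂) (hρ : VolterraWeight S ρ) {t : ℝ}
    (ht : t ∈ S) : ‖pairSol δ c₁₁ c₁₂ c₂₁ c₂₂ t‖ ≤ 2 * bielecki ρ t := by
  have := norm_volterraSol_le hρ (h.kernel hρ) (0, 1) ht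
  simpa [Prod.norm_def, pairSol] using this

theorem PairCoeff.tendsto (h : PairCoeff S ρ δ c₁₁ c₁₂ c₂₁ c₂₂) (hρ : VolterraWeight S ρ) {u : ℝ}
    (hu : u ∈ S) : Tendsto (pairSol δ c₁₁ c₁₂ c₂₁ c₂₂) atBot (𝓝 (0, 1)) :=
  tendsto_volterraSol hρ (h.kernel hρ) _ hu

/-- Writing `exp (δ (t - s)) = exp (δ t) exp (-δ s)` pulls `t` out of the kernel, so that only the
upper limit of the integral is left to differentiate. -/
theorem PairCoeff.hasDerivAt (h : PairCoeff S ρ δ c₁₁ c₁₂ c₂₁ c₂₂) (hρ : VolterraWeight S ρ)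
    {t : ℝ} (ht : t ∈ S) :
    HasDerivAt (fun t => (pairSol δ c₁₁ c₁₂ c₂₁ c₂₂ t).1)
        (δ * (pairSol δ c₁₁ c₁₂ c₂₁ c₂₂ t).1 + c₁₁ t * (pairSol δ c₁₁ c₁₂ c₂₁ c₂₂ t).1 +
          c₁₂ t * (pairSol δ c₁₁ c₁₂ c₂₁ c₂₂ t).2) t ∧
      HasDerivAt (fun t => (pairSol δ c₁₁ c₁₂ c₂₁ c₂₂ t).2)
        (c₂₁ t * (pairSol δ c₁₁ c₁₂ c₂₁ c₂₂ t).1 +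
          c₂₂ t * (pairSol δ c₁₁ c₁₂ c₂₁ c₂₂ t).2) t := by
  have hk := h.kernel hρ
  set W := pairSol δ c₁₁ c₁₂ c₂₁ c₂₂ with hW
  have hWc : ContinuousOn W S := h.continuousOn hρ
  have hW1 : ContinuousOn (fun t => (W t).1) S := continuous_fst.comp_continuousOn hWc
  have hW2 : ContinuousOn (fun t => (W t).2) S := continuous_snd.comp_continuousOn hWc
  have h_int : ∀ u ∈ S, IntegrableOn
      (fun s => pairKernel δ c₁₁ c₁₂ c₂₁ c₂₂ u s (W s)) (Iic u) := fun u hu =>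
    hk.integrableOn_apply hρ hWc (C := 2 * ‖((0, 1) : ℂ × ℂ)‖)
      (fun s hs => norm_volterraSol_le hρ hk (0, 1) hs) hu
  have heq : ∀ u ∈ S, W u = (0, 1) + ∫ s in Iic u, pairKernel δ c₁₁ c₁₂ c₂₁ c₂₂ u s (W s) :=
    fun u hu => volterraSol_eq hρ hk (0, 1) hu
  set g₁ : ℝ → ℂ := fun s => c₁₁ s * (W s).1 + c₁₂ s * (W s).2 with hg₁
  set g₂ : ℝ → ℂ := fun s => c₂₁ s * (W s).1 + c₂₂ s * (W s).2 with hg₂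
  have hexp : ∀ u s : ℝ, Complex.exp (δ * ((u - s : ℝ) : ℂ)) =
      Complex.exp (δ * u) * Complex.exp (-(δ * s)) := by
    intro u s
    rw [← Complex.exp_add]
    congr 1
    push_cast
    ring
  have hi1 : ∀ u ∈ S, IntegrableOn (fun s : ℝ => Complex.exp (-(δ * s)) * g₁ s) (Iic u) := by
    intro u hu
    have := ((h_int u hu).fst).const_mul (Complex.exp (-(δ * u)))
    refine this.congr (.of_forall fun s => ?_)
    simp only [pairKernel_apply, hexp]
    rw [← mul_assoc, ← mul_assoc, ← Complex.exp_add, neg_add_cancel, Complex.exp_zero, one_mul]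
  have hi2 : ∀ u ∈ S, IntegrableOn g₂ (Iic u) := by
    intro u hu
    refine ((h_int u hu).snd).congr (.of_forall fun s => ?_)
    simp only [pairKernel_apply, hg₂]
  have e1 : ∀ u ∈ S, (W u).1 =
      Complex.exp (δ * u) * ∫ s in Iic u, Complex.exp (-(δ * s)) * g₁ s := by
    intro u hu
    have := congrArg Prod.fst (heq u hu)
    rw [this, Prod.fst_add, fst_integral (h_int u hu), ← integral_const_mul]
    simp only [pairKernel_apply, hexp, zero_add, hg₁, mul_assoc]
  have e2 : ∀ u ∈ S, (W u).2 = 1 + ∫ s in Iic u, g₂ s := by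
    intro u hu
    have := congrArg Prod.snd (heq u hu)
    rw [this, Prod.snd_add, snd_integral (h_int u hu)]
    simp only [pairKernel_apply, hg₂]
  have hg1c : ContinuousOn (fun s : ℝ => Complex.exp (-(δ * s)) * g₁ s) S :=
    (Continuous.continuousOn (by fun_prop)).mul ((h.cont₁₁.mul hW1).add (h.cont₁₂.mul hW2))
  have hg2c : ContinuousOn g₂ S := (h.cont₂₁.mul hW1).add (h.cont₂₂.mul hW2)
  have hnhds : ∀ᶠ u in 𝓝 t, u ∈ S := hρ.isOpen.mem_nhds ht
  constructor
  · have d0 : HasDerivAt (fun u : ℝ => Complex.exp (δ * u)) (Complex.exp (δ * t) * δ) t := by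
      have := ((hasDerivAt_id t).ofReal_comp.const_mul δ).cexp
      simpa using this
    have d1 := d0.mul (hasDerivAt_integral_Iic hρ.isOpen hg1c hi1 ht)
    refine (d1.congr_of_eventuallyEq (hnhds.mono fun u hu => e1 u hu)).congr_deriv ?_
    have hc : Complex.exp (δ * t) * (Complex.exp (-(δ * t)) * g₁ t) = g₁ t := by
      rw [← mul_assoc, ← Complex.exp_add, add_neg_cancel, Complex.exp_zero, one_mul]
    rw [hc, mul_right_comm, ← e1 t ht, hg₁]
    ring
  · have d2 := (hasDerivAt_integral_Iic hρ.isOpen hg2c hi2 ht).const_add 1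
    exact d2.congr_of_eventuallyEq (hnhds.mono fun u hu => e2 u hu)

theorem differentiableOn_pairSol {Ω : Set ℂ} (hΩ : IsOpen Ω) (hρ : VolterraWeight S ρ)
    {δ : ℂ → ℂ} {c₁₁ c₁₂ c₂₁ c₂₂ : ℂ → ℝ → ℂ}
    (h : ∀ z ∈ Ω, PairCoeff S ρ (δ z) (c₁₁ z) (c₁₂ z) (c₂₁ z) (c₂₂ z))
    (hδ : Differentiable ℂ δ) (h₁₁ : ∀ s, Differentiable ℂ fun z => c₁₁ z s)
    (h₁₂ : ∀ s, Differentiable ℂ fun z => c₁₂ z s) (h₂₁ : ∀ s, Differentiable ℂ fun z => c₂₁ z s)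
    (h₂₂ : ∀ s, Differentiable ℂ fun z => c₂₂ z s) {t : ℝ} (ht : t ∈ S) :
    DifferentiableOn ℂ (fun z => pairSol (δ z) (c₁₁ z) (c₁₂ z) (c₂₁ z) (c₂₂ z) t) Ω := by
  refine differentiableOn_volterraSol hρ hΩ (fun z hz => (h z hz).kernel hρ) ?_ _ ht
  intro t _ s _
  have a11 := h₁₁ s
  have a12 := h₁₂ s
  have a21 := h₂₁ s
  have a22 := h₂₂ s
  refine Differentiable.differentiableOn ?_
  have e1 : Differentiable ℂ fun z => (Complex.exp (δ z * ((t - s : ℝ) : ℂ)) •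
        (c₁₁ z s • ContinuousLinearMap.fst ℂ ℂ ℂ + c₁₂ z s • ContinuousLinearMap.snd ℂ ℂ ℂ)) := by
    fun_prop
  have e2 : Differentiable ℂ fun z =>
        (c₂₁ z s • ContinuousLinearMap.fst ℂ ℂ ℂ + c₂₂ z s • ContinuousLinearMap.snd ℂ ℂ ℂ) := by
    fun_prop
  exact (ContinuousLinearMap.prodₗᵢ (𝕜 := ℂ) ℂ).toContinuousLinearEquiv.differentiable.comp
    (e1.prodMk e2)

/-- A continuous function on an open lower set with exponential decay at `-∞` is integrable
at `-∞`. -/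
theorem integrableOn_Iic_of_exp_bound {S : Set ℝ} (hS : IsLowerSet S) {f : ℝ → ℝ}
    (hf : ContinuousOn f S) {C c x₀ : ℝ} (hc : 0 < c)
    (hb : ∀ x ∈ S, x ≤ x₀ → |f x| ≤ C * Real.exp (c * x)) {t : ℝ} (ht : t ∈ S) :
    IntegrableOn f (Iic t) := by
  set y := min x₀ t with hy
  have hyt : y ≤ t := min_le_right _ _
  have hyS : y ∈ S := hS hyt ht
  have h1 : IntegrableOn f (Iic y) := by
    refine Integrable.mono' ((integrableOn_exp_mul_Iic hc y).const_mul C) ?_ ?_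
    · exact (hf.mono fun s hs => hS hs hyS).aestronglyMeasurable measurableSet_Iic
    · filter_upwards [ae_restrict_mem measurableSet_Iic] with s hs
      exact hb s (hS hs hyS) (le_trans hs (min_le_left _ _))
  have h2 : IntegrableOn f (Icc y t) :=
    (hf.mono fun s hs => hS hs.2 ht).integrableOn_Icc
  rw [← Iic_union_Icc_eq_Iic hyt]
  exact h1.union h2

end

end SAdS

open MeasureTheory Set Filter Topology Asymptotics

namespace SAdS

noncomputable section

/-! ### The reduced system -/

/-- Real potentials on `]-∞, 0[`: `a` is bounded, `b(x) = ν / (-x) + O(1)` at `0`, and both decay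
at `-∞` like `e^{kx}` for every `k < κ`. -/
structure Admissible (a b : ℝ → ℝ) (ν κ : ℝ) : Prop where
  ν_pos : 0 < ν
  κ_pos : 0 < κ
  cont_a : ContinuousOn a (Iio 0)
  cont_b : ContinuousOn b (Iio 0)
  a_bdd : ∃ C, ∀ x < 0, |a x| ≤ C
  b_zero : ∃ C, ∀ x ∈ Ico (-1 : ℝ) 0, |b x - ν / (-x)| ≤ C
  decay : ∀ k < κ, ∃ C, ∀ x ≤ -1, |a x| ≤ C * Real.exp (k * x) ∧ |b x| ≤ C * Real.exp (k * x)

/-- `p' = i z p + (i a - b) q`, `q' = -i z q + (-i a - b) p` on `]-∞, 0[`. -/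
def IsPairSol (a b : ℝ → ℝ) (z : ℂ) (p q : ℝ → ℂ) : Prop :=
  ∀ x < 0, HasDerivAt p (Complex.I * z * p x + (Complex.I * a x - b x) * q x) x ∧
    HasDerivAt q (-Complex.I * z * q x + (-Complex.I * a x - b x) * p x) x

variable {a b : ℝ → ℝ} {ν κ : ℝ}

theorem norm_exp_jost (z : ℂ) (x : ℝ) :
    ‖Complex.exp (-Complex.I * z * x)‖ = Real.exp (z.im * x) := by
  rw [Complex.norm_exp]
  congr 1
  simp

theorem isOpen_halfPlane (ε : ℝ) : IsOpen (halfPlane ε) :=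
  isOpen_lt continuous_const Complex.continuous_im

/-- With `p = e^{-izx} e^{2εx} W₁` and `q = e^{-izx} W₂` the pair `W` solves a system with `δ = 2iz
- 2ε`, and `Re δ = -2 (Im z + ε)` is negative on the half plane. The price is a factor `e^{-2εx}` in
the coupling `c₁₂`, which the decay of the potentials absorbs exactly because `2ε < κ`. The weight
`ρ` does not involve `z`, so the bounds are uniform on the half plane. -/
theorem exists_jost_pair (h : Admissible a b ν κ) {ε : ℝ} (hε : 0 < ε) (hεκ : 2 * ε < κ) :
    ∃ p q : ℂ → ℝ → ℂ,
      (∀ z ∈ halfPlane ε, IsPairSol a b z (p z) (q z) ∧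
        (p z =o[atBot] fun x => Real.exp (z.im * x)) ∧
        (fun x => q z x - Complex.exp (-Complex.I * z * x)) =o[atBot]
          fun x => Real.exp (z.im * x)) ∧
      (∀ x < 0, DifferentiableOn ℂ (fun z => p z x) (halfPlane ε) ∧
        DifferentiableOn ℂ (fun z => q z x) (halfPlane ε)) ∧
      ∃ C, ∀ z ∈ halfPlane ε, ∀ x ≤ -1,
        ‖p z x‖ ≤ C * Real.exp (z.im * x) ∧ ‖q z x‖ ≤ C * Real.exp (z.im * x) := by
  set ρ : ℝ → ℝ := fun x => (|a x| + |b x|) * Real.exp (-(2 * ε * x)) with hρdef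
  have hρ : VolterraWeight (Iio 0) ρ := by
    have hcont : ContinuousOn ρ (Iio 0) :=
      (h.cont_a.abs.add h.cont_b.abs).mul (Continuous.continuousOn (by fun_prop))
    refine ⟨isOpen_Iio, isLowerSet_Iio 0, hcont, fun t _ => by positivity, ?_⟩
    obtain ⟨k, hk1, hk2⟩ := exists_between hεκ
    obtain ⟨C, hC⟩ := h.decay k hk2
    refine fun t ht => integrableOn_Iic_of_exp_bound (isLowerSet_Iio 0) hcont
      (C := 2 * C) (c := k - 2 * ε) (x₀ := -1) (by linarith) (fun x _ hx => ?_) ht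
    have h1 := hC x hx
    rw [abs_of_nonneg (by positivity), show (k - 2 * ε) * x = k * x + -(2 * ε * x) by ring,
      Real.exp_add, ← mul_assoc]
    refine mul_le_mul_of_nonneg_right ?_ (Real.exp_pos _).le
    linarith
  set δ : ℂ → ℂ := fun z => 2 * Complex.I * z - (2 * ε : ℝ) with hδdef
  set c₁₂ : ℝ → ℂ := fun x => (Complex.I * a x - b x) * (Real.exp (-(2 * ε * x)) : ℝ) with hc₁₂
  set c₂₁ : ℝ → ℂ := fun x => (-Complex.I * a x - b x) * (Real.exp (2 * ε * x) : ℝ) with hc₂₁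
  have hnorm : ∀ x, ‖Complex.I * (a x : ℂ) - b x‖ ≤ |a x| + |b x| := fun x =>
    (norm_sub_le _ _).trans (by simp)
  have hnorm' : ∀ x, ‖-Complex.I * (a x : ℂ) - b x‖ ≤ |a x| + |b x| := fun x =>
    (norm_sub_le _ _).trans (by simp)
  have hca : ContinuousOn (fun x => (a x : ℂ)) (Iio 0) :=
    Complex.continuous_ofReal.comp_continuousOn h.cont_a
  have hcb : ContinuousOn (fun x => (b x : ℂ)) (Iio 0) :=
    Complex.continuous_ofReal.comp_continuousOn h.cont_b
  have hcoef : ∀ z ∈ halfPlane ε, PairCoeff (Iio 0) ρ (δ z) (fun _ => 0) c₁₂ c₂₁ (fun _ => 0) := by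
    intro z hz
    have hz' : -ε < z.im := hz
    refine ⟨?_, continuousOn_const, ?_, ?_, continuousOn_const, ?_, ?_⟩
    · simp [hδdef]
      linarith
    · exact ((continuousOn_const.mul hca).sub hcb).mul (Continuous.continuousOn (by fun_prop))
    · exact ((continuousOn_const.mul hca).sub hcb).mul (Continuous.continuousOn (by fun_prop))
    · intro t _
      rw [norm_zero, zero_add, norm_mul, Complex.norm_real, Real.norm_of_nonneg (Real.exp_pos _).le]
      exact mul_le_mul_of_nonneg_right (hnorm t) (Real.exp_pos _).le
    · intro t ht
      have ht' : t < 0 := ht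
      rw [norm_zero, add_zero, norm_mul, Complex.norm_real, Real.norm_of_nonneg (Real.exp_pos _).le]
      -- The other coupling carries `e^{2εt}`, which for `t < 0` is smaller than `e^{-2εt}`: one
      -- weight dominates both.
      refine mul_le_mul (hnorm' t) (Real.exp_le_exp.2 ?_) (Real.exp_pos _).le (by positivity)
      nlinarith
  set W : ℂ → ℝ → ℂ × ℂ := fun z => pairSol (δ z) (fun _ => 0) c₁₂ c₂₁ (fun _ => 0) with hW
  have hmem : (-1 : ℝ) ∈ Iio (0 : ℝ) := by norm_num
  refine ⟨fun z x => Complex.exp (-Complex.I * z * x) * (Real.exp (2 * ε * x) : ℝ) * (W z x).1,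
    fun z x => Complex.exp (-Complex.I * z * x) * (W z x).2, ?_, ?_, ?_⟩
  · intro z hz
    have hcz := hcoef z hz
    refine ⟨fun x hx => ?_, ?_, ?_⟩
    · have d1 : HasDerivAt (fun t => (W z t).1)
          (δ z * (W z x).1 + 0 * (W z x).1 + c₁₂ x * (W z x).2) x := (hcz.hasDerivAt hρ hx).1
      have d2 : HasDerivAt (fun t => (W z t).2) (c₂₁ x * (W z x).1 + 0 * (W z x).2) x :=
        (hcz.hasDerivAt hρ hx).2
      have de : HasDerivAt (fun x : ℝ => Complex.exp (-Complex.I * z * x))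
          (Complex.exp (-Complex.I * z * x) * (-Complex.I * z)) x := by
        have := ((hasDerivAt_id x).ofReal_comp.const_mul (-Complex.I * z)).cexp
        simpa using this
      have dr : HasDerivAt (fun x : ℝ => ((Real.exp (2 * ε * x) : ℝ) : ℂ))
          ((Real.exp (2 * ε * x) * (2 * ε) : ℝ) : ℂ) x := by
        have := (((hasDerivAt_id x).const_mul (2 * ε)).exp).ofReal_comp
        simpa using this
      have hee : ((Real.exp (2 * ε * x) : ℝ) : ℂ) * ((Real.exp (-(2 * ε * x)) : ℝ) : ℂ) = 1 := by
        rw [← Complex.ofReal_mul, ← Real.exp_add, add_neg_cancel, Real.exp_zero, Complex.ofReal_one]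
      constructor
      · refine ((de.fun_mul dr).fun_mul d1).congr_deriv ?_
        have e1 : δ z = 2 * Complex.I * z - 2 * ε := by simp [hδdef]
        have e2 : c₁₂ x = (Complex.I * a x - b x) * (Real.exp (-(2 * ε * x)) : ℝ) := rfl
        rw [e1, e2, Complex.ofReal_mul (Real.exp _) (2 * ε), Complex.ofReal_mul 2 ε,
          Complex.ofReal_ofNat]
        linear_combination Complex.exp (-Complex.I * z * x) * (Complex.I * a x - b x) *
          (W z x).2 * hee
      · refine (de.fun_mul d2).congr_deriv ?_
        have e2 : c₂₁ x = (-Complex.I * a x - b x) * (Real.exp (2 * ε * x) : ℝ) := rfl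
        rw [e2]
        ring
    · have h1 : (fun x : ℝ =>
          Complex.exp (-Complex.I * z * x) * (Real.exp (2 * ε * x) : ℝ)) =O[atBot]
          fun x => Real.exp (z.im * x) := by
        refine IsBigO.of_bound 1 ?_
        filter_upwards [eventually_le_atBot 0] with x hx
        rw [norm_mul, norm_exp_jost, Complex.norm_real, Real.norm_of_nonneg (Real.exp_pos _).le,
          Real.norm_of_nonneg (Real.exp_pos _).le, one_mul]
        exact mul_le_of_le_one_right (Real.exp_pos _).le
          (Real.exp_le_one_iff.2 (mul_nonpos_of_nonneg_of_nonpos (by linarith) hx))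
      have h2 : (fun x => (W z x).1) =o[atBot] fun _ => (1 : ℝ) := by
        rw [isLittleO_one_iff]
        exact (continuous_fst.tendsto _).comp (hcz.tendsto hρ hmem)
      simpa using h1.mul_isLittleO h2
    · have h1 : (fun x : ℝ => Complex.exp (-Complex.I * z * x)) =O[atBot]
          fun x => Real.exp (z.im * x) := by
        refine IsBigO.of_bound 1 (.of_forall fun x => ?_)
        rw [norm_exp_jost, Real.norm_of_nonneg (Real.exp_pos _).le, one_mul]
      have h2 : (fun x => (W z x).2 - 1) =o[atBot] fun _ => (1 : ℝ) := by
        rw [isLittleO_one_iff]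
        have := ((continuous_snd.tendsto _).comp (hcz.tendsto hρ hmem)).sub_const (1 : ℂ)
        simpa using this
      have h3 := h1.mul_isLittleO h2
      simp only [mul_one] at h3
      refine h3.congr_left fun x => ?_
      ring
  · intro x hx
    have hd := differentiableOn_pairSol (isOpen_halfPlane ε) hρ (δ := δ)
      (c₁₁ := fun _ _ => 0) (c₁₂ := fun _ => c₁₂) (c₂₁ := fun _ => c₂₁) (c₂₂ := fun _ _ => 0)
      hcoef (by fun_prop) (by fun_prop) (by fun_prop) (by fun_prop) (by fun_prop) (t := x) hx
    have he : DifferentiableOn ℂ (fun z : ℂ => Complex.exp (-Complex.I * z * x)) (halfPlane ε) := by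
      fun_prop
    exact ⟨(he.mul_const _).mul hd.fst, he.mul hd.snd⟩
  · refine ⟨2 * bielecki ρ (-1), fun z hz x hx => ?_⟩
    have hx0 : x ∈ Iio (0 : ℝ) := by
      rw [mem_Iio]
      linarith
    have hn := ((hcoef z hz).norm_le hρ hx0).trans
      (mul_le_mul_of_nonneg_left (hρ.bielecki_mono hmem hx) zero_le_two)
    have hn1 := (norm_fst_le (W z x)).trans hn
    have hn2 := (norm_snd_le (W z x)).trans hn
    constructor
    · rw [norm_mul, norm_mul, norm_exp_jost, Complex.norm_real,
        Real.norm_of_nonneg (Real.exp_pos _).le, mul_comm (2 * bielecki ρ (-1))]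
      refine mul_le_mul ?_ hn1 (norm_nonneg _) (Real.exp_pos _).le
      exact mul_le_of_le_one_right (Real.exp_pos _).le
          (Real.exp_le_one_iff.2 (mul_nonpos_of_nonneg_of_nonpos (by linarith) (by linarith)))
    · rw [norm_mul, norm_exp_jost, mul_comm (2 * bielecki ρ (-1))]
      exact mul_le_mul_of_nonneg_left hn2 (Real.exp_pos _).le

end

end SAdS

/-! ### Solutions near the singular endpoint `x = 0`. -/

open MeasureTheory Set Filter Topology Asymptotics

namespace SAdS

noncomputable section

variable {a b : ℝ → ℝ} {ν κ : ℝ}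

/-- In the variable `ξ = log (-x)` the singular point `x = 0` becomes `ξ = -∞`. -/
theorem exists_log_pair (h : Admissible a b ν κ) {τ μ : ℝ} (hτ : |τ| = 1) (hμ : τ * ν ≤ μ)
    (hμτ : |μ + τ * ν| < 1) :
    ∃ Y₁ Y₂ : ℂ → ℝ → ℂ,
      (∀ z ξ, HasDerivAt (Y₁ z) (τ * (Real.exp ξ * b (-Real.exp ξ) : ℝ) * Y₁ z ξ -
          Real.exp ξ * (Complex.I * (z - τ * a (-Real.exp ξ)) * Y₂ z ξ)) ξ ∧
        HasDerivAt (Y₂ z) (-(τ * (Real.exp ξ * b (-Real.exp ξ) : ℝ)) * Y₂ z ξ -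
          Real.exp ξ * (Complex.I * (z + τ * a (-Real.exp ξ)) * Y₁ z ξ)) ξ) ∧
      (∀ z, Tendsto (fun ξ => (Real.exp (-(μ * ξ)) : ℂ) * Y₁ z ξ) atBot (𝓝 0)) ∧
      (∀ z, Tendsto (fun ξ => (Real.exp (τ * ν * ξ) : ℂ) * Y₂ z ξ) atBot (𝓝 1)) ∧
      (∀ ξ, Differentiable ℂ (fun z => Y₁ z ξ) ∧ Differentiable ℂ (fun z => Y₂ z ξ)) ∧
      ∀ r, ∃ C, ∀ z : ℂ, ‖z‖ < r → ∀ ξ ≤ 0, ‖Y₁ z ξ‖ ≤ C * Real.exp (μ * ξ) ∧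
        ‖Y₂ z ξ‖ ≤ C * Real.exp (-(τ * ν * ξ)) := by
  obtain ⟨Ca, hCa⟩ := h.a_bdd
  obtain ⟨Cb, hCb⟩ := h.b_zero
  have hCa0 : 0 ≤ Ca := (abs_nonneg _).trans (hCa (-1) (by norm_num))
  obtain ⟨hμ1, hμ2⟩ := abs_lt.1 hμτ
  set A : ℝ → ℝ := fun ξ => a (-Real.exp ξ) with hA
  -- In the variable `ξ` the singular potential becomes the constant `ν` plus a remainder `β =
  -- O(e^ξ)`, integrable at `-∞`. The constant is removed by the exponential factors in front of
  -- `W`.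
  set β : ℝ → ℝ := fun ξ => Real.exp ξ * b (-Real.exp ξ) - ν with hβ
  have hneg : ∀ ξ : ℝ, -Real.exp ξ < 0 := fun ξ => neg_neg_of_pos (Real.exp_pos ξ)
  have hAc : Continuous A := by
    rw [← continuousOn_univ]
    exact h.cont_a.comp (Continuous.continuousOn (by fun_prop)) fun ξ _ => hneg ξ
  have hβc : Continuous β := by
    have : Continuous fun ξ => b (-Real.exp ξ) := by
      rw [← continuousOn_univ]
      exact h.cont_b.comp (Continuous.continuousOn (by fun_prop)) fun ξ _ => hneg ξ
    exact (Real.continuous_exp.mul this).sub continuous_const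
  have hAb : ∀ ξ, |A ξ| ≤ Ca := fun ξ => hCa _ (hneg ξ)
  have hβb : ∀ ξ ≤ 0, |β ξ| ≤ Cb * Real.exp ξ := by
    intro ξ hξ
    have h1 := hCb (-Real.exp ξ) ⟨by linarith [Real.exp_le_one_iff.2 hξ], hneg ξ⟩
    have h2 : β ξ = Real.exp ξ * (b (-Real.exp ξ) - ν / - -Real.exp ξ) := by
      rw [hβ, neg_neg]
      field_simp
    rw [h2, abs_mul, abs_of_pos (Real.exp_pos ξ), mul_comm]
    exact mul_le_mul_of_nonneg_right h1 (Real.exp_pos ξ).le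
  -- For `Y₁ = e^{μξ} W₁` and `Y₂ = e^{-τνξ} W₂` the couplings acquire the factors `e^{(1 ∓ (μ +
  -- τν)) ξ}`; both are integrable at `-∞` because `|μ + τν| < 1`. Here `r` bounds `‖z‖`.
  set ρ : ℝ → ℝ → ℝ := fun r ξ => |β ξ| + (|r| + Ca) *
    (Real.exp ((1 - (μ + τ * ν)) * ξ) + Real.exp ((1 + (μ + τ * ν)) * ξ)) with hρdef
  have hρ : ∀ r, VolterraWeight univ (ρ r) := by
    intro r
    have hc : Continuous (ρ r) := by fun_prop
    refine ⟨isOpen_univ, isLowerSet_univ, hc.continuousOn, fun t _ => by positivity,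
      fun t ht => ?_⟩
    have hi1 : IntegrableOn (fun ξ => |β ξ|) (Iic t) :=
      integrableOn_Iic_of_exp_bound (S := univ) isLowerSet_univ hβc.abs.continuousOn
        (C := Cb) (c := 1) (x₀ := 0) one_pos
        (fun x _ hx => by rw [abs_abs, one_mul]; exact hβb x hx) ht
    exact hi1.add (((integrableOn_exp_mul_Iic (by linarith) t).add
      (integrableOn_exp_mul_Iic (by linarith) t)).const_mul _)
  set δ : ℂ := ((τ * ν - μ : ℝ) : ℂ) with hδ
  set c₁₁ : ℝ → ℂ := fun ξ => ((τ * β ξ : ℝ) : ℂ) with hc₁₁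
  set c₂₂ : ℝ → ℂ := fun ξ => ((-(τ * β ξ) : ℝ) : ℂ) with hc₂₂
  set c₁₂ : ℂ → ℝ → ℂ := fun z ξ => -(Complex.I * (z - ((τ * A ξ : ℝ) : ℂ))) *
    (Real.exp ((1 - (μ + τ * ν)) * ξ) : ℝ) with hc₁₂
  set c₂₁ : ℂ → ℝ → ℂ := fun z ξ => -(Complex.I * (z + ((τ * A ξ : ℝ) : ℂ))) *
    (Real.exp ((1 + (μ + τ * ν)) * ξ) : ℝ) with hc₂₁
  have hcoef : ∀ (r : ℝ) (z : ℂ), ‖z‖ ≤ r →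
      PairCoeff univ (ρ r) δ c₁₁ (c₁₂ z) (c₂₁ z) c₂₂ := by
    intro r z hz
    have hzr : ‖z‖ ≤ |r| := hz.trans (le_abs_self r)
    have hτA : ∀ ξ, ‖((τ * A ξ : ℝ) : ℂ)‖ ≤ Ca := fun ξ => by
      rw [Complex.norm_real, Real.norm_eq_abs, abs_mul, hτ, one_mul]
      exact hAb ξ
    have e1 : ∀ ξ, ‖c₁₂ z ξ‖ ≤ (|r| + Ca) * Real.exp ((1 - (μ + τ * ν)) * ξ) := fun ξ => by
      rw [hc₁₂, norm_mul, norm_neg, norm_mul, Complex.norm_I, one_mul, Complex.norm_real,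
        Real.norm_of_nonneg (Real.exp_pos _).le]
      refine mul_le_mul_of_nonneg_right ?_ (Real.exp_pos _).le
      exact (norm_sub_le _ _).trans (add_le_add hzr (hτA ξ))
    have e2 : ∀ ξ, ‖c₂₁ z ξ‖ ≤ (|r| + Ca) * Real.exp ((1 + (μ + τ * ν)) * ξ) := fun ξ => by
      rw [hc₂₁, norm_mul, norm_neg, norm_mul, Complex.norm_I, one_mul, Complex.norm_real,
        Real.norm_of_nonneg (Real.exp_pos _).le]
      refine mul_le_mul_of_nonneg_right ?_ (Real.exp_pos _).le
      exact (norm_add_le _ _).trans (add_le_add hzr (hτA ξ))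
    have e0 : ∀ ξ, ‖c₁₁ ξ‖ = |β ξ| := fun ξ => by
      rw [hc₁₁, Complex.norm_real, Real.norm_eq_abs, abs_mul, hτ, one_mul]
    have e3 : ∀ ξ, ‖c₂₂ ξ‖ = |β ξ| := fun ξ => by
      rw [hc₂₂, Complex.norm_real, Real.norm_eq_abs, abs_neg, abs_mul, hτ, one_mul]
    have hr : 0 ≤ |r| + Ca := by positivity
    refine ⟨by rw [hδ, Complex.ofReal_re]; linarith, ?_, ?_, ?_, ?_, ?_, ?_⟩
    · exact Continuous.continuousOn (by fun_prop)
    · exact Continuous.continuousOn (by fun_prop)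
    · exact Continuous.continuousOn (by fun_prop)
    · exact Continuous.continuousOn (by fun_prop)
    · intro ξ _
      simp only [e0, hρdef, mul_add]
      have := e1 ξ
      have h2 := mul_nonneg hr (Real.exp_pos ((1 + (μ + τ * ν)) * ξ)).le
      linarith
    · intro ξ _
      simp only [e3, hρdef, mul_add]
      have := e2 ξ
      have h2 := mul_nonneg hr (Real.exp_pos ((1 - (μ + τ * ν)) * ξ)).le
      linarith
  set W : ℂ → ℝ → ℂ × ℂ := fun z => pairSol δ c₁₁ (c₁₂ z) (c₂₁ z) c₂₂ with hW
  have hee : ∀ y : ℝ, ((Real.exp (-y) : ℝ) : ℂ) * ((Real.exp y : ℝ) : ℂ) = 1 := fun y => by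
    rw [← Complex.ofReal_mul, ← Real.exp_add, neg_add_cancel, Real.exp_zero, Complex.ofReal_one]
  have hexpd : ∀ c ξ : ℝ, HasDerivAt (fun ξ : ℝ => ((Real.exp (c * ξ) : ℝ) : ℂ))
      ((Real.exp (c * ξ) : ℝ) * (c : ℂ)) ξ := fun c ξ => by
    have := (((hasDerivAt_id ξ).const_mul c).exp).ofReal_comp
    simpa using this
  refine ⟨fun z ξ => (Real.exp (μ * ξ) : ℝ) * (W z ξ).1,
    fun z ξ => (Real.exp (-(τ * ν) * ξ) : ℝ) * (W z ξ).2, ?_, ?_, ?_, ?_, ?_⟩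
  · intro z ξ
    have hcz := hcoef ‖z‖ z le_rfl
    have d1 : HasDerivAt (fun t => (W z t).1)
        (δ * (W z ξ).1 + c₁₁ ξ * (W z ξ).1 + c₁₂ z ξ * (W z ξ).2) ξ :=
      (hcz.hasDerivAt (hρ _) (mem_univ ξ)).1
    have d2 : HasDerivAt (fun t => (W z t).2) (c₂₁ z ξ * (W z ξ).1 + c₂₂ ξ * (W z ξ).2) ξ :=
      (hcz.hasDerivAt (hρ _) (mem_univ ξ)).2
    have k1 : ((Real.exp (μ * ξ) : ℝ) : ℂ) * (Real.exp ((1 - (μ + τ * ν)) * ξ) : ℝ) =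
        (Real.exp ξ : ℝ) * (Real.exp (-(τ * ν) * ξ) : ℝ) := by
      rw [← Complex.ofReal_mul, ← Complex.ofReal_mul, ← Real.exp_add, ← Real.exp_add]
      ring_nf
    have k2 : ((Real.exp (-(τ * ν) * ξ) : ℝ) : ℂ) * (Real.exp ((1 + (μ + τ * ν)) * ξ) : ℝ) =
        (Real.exp ξ : ℝ) * (Real.exp (μ * ξ) : ℝ) := by
      rw [← Complex.ofReal_mul, ← Complex.ofReal_mul, ← Real.exp_add, ← Real.exp_add]
      ring_nf
    have v1 : c₁₁ ξ = τ * ((Real.exp ξ * b (-Real.exp ξ) : ℝ) : ℂ) - τ * ν := by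
      simp only [hc₁₁, hβ, Complex.ofReal_mul, Complex.ofReal_sub]
      ring
    have v2 : c₂₂ ξ = -(τ * ((Real.exp ξ * b (-Real.exp ξ) : ℝ) : ℂ)) + τ * ν := by
      simp only [hc₂₂, hβ, Complex.ofReal_mul, Complex.ofReal_sub, Complex.ofReal_neg]
      ring
    have v3 : c₁₂ z ξ = -(Complex.I * (z - τ * a (-Real.exp ξ))) *
      (Real.exp ((1 - (μ + τ * ν)) * ξ) : ℝ) := by
      simp only [hc₁₂, hA, Complex.ofReal_mul]
    have v4 : c₂₁ z ξ = -(Complex.I * (z + τ * a (-Real.exp ξ))) *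
      (Real.exp ((1 + (μ + τ * ν)) * ξ) : ℝ) := by
      simp only [hc₂₁, hA, Complex.ofReal_mul]
    have v5 : δ = τ * ν - μ := by
      rw [hδ, Complex.ofReal_sub, Complex.ofReal_mul]
    rw [v1, v3, v5] at d1
    rw [v2, v4] at d2
    constructor
    · refine ((hexpd μ ξ).fun_mul d1).congr_deriv ?_
      linear_combination (-(Complex.I * (z - τ * a (-Real.exp ξ))) * (W z ξ).2) * k1
    · refine ((hexpd (-(τ * ν)) ξ).fun_mul d2).congr_deriv ?_
      rw [Complex.ofReal_neg, Complex.ofReal_mul τ ν]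
      linear_combination (-(Complex.I * (z + τ * a (-Real.exp ξ))) * (W z ξ).1) * k2
  · intro z
    have := (continuous_fst.tendsto _).comp ((hcoef ‖z‖ z le_rfl).tendsto (hρ _) (mem_univ 0))
    refine this.congr fun ξ => ?_
    rw [← mul_assoc, hee, one_mul]
    rfl
  · intro z
    have := (continuous_snd.tendsto _).comp ((hcoef ‖z‖ z le_rfl).tendsto (hρ _) (mem_univ 0))
    refine this.congr fun ξ => ?_
    rw [← mul_assoc, neg_mul, mul_comm ((Real.exp (τ * ν * ξ) : ℝ) : ℂ), hee, one_mul]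
    rfl
  · intro ξ
    have hd : Differentiable ℂ fun z => W z ξ := by
      intro z
      -- The weight depends on a bound for `‖z‖`, so holomorphy is proved on balls; they cover the
      -- plane.
      have hΩ : IsOpen (Metric.ball (0 : ℂ) (‖z‖ + 1)) := Metric.isOpen_ball
      have := differentiableOn_pairSol hΩ (hρ (‖z‖ + 1)) (δ := fun _ => δ) (c₁₁ := fun _ => c₁₁)
        (c₁₂ := c₁₂) (c₂₁ := c₂₁) (c₂₂ := fun _ => c₂₂)
        (fun w hw => hcoef _ w (by simpa using (mem_ball_zero_iff.1 hw).le))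
        (by fun_prop) (by fun_prop) (by fun_prop) (by fun_prop) (by fun_prop) (mem_univ ξ)
      exact this.differentiableAt (hΩ.mem_nhds (by simp))
    exact ⟨hd.fst.const_mul _, hd.snd.const_mul _⟩
  · intro r
    refine ⟨2 * bielecki (ρ r) 0, fun z hz ξ hξ => ?_⟩
    have hn := ((hcoef r z hz.le).norm_le (hρ r) (mem_univ ξ)).trans
      (mul_le_mul_of_nonneg_left ((hρ r).bielecki_mono (mem_univ 0) hξ) zero_le_two)
    rw [norm_mul, norm_mul, Complex.norm_real, Complex.norm_real,
      Real.norm_of_nonneg (Real.exp_pos _).le, Real.norm_of_nonneg (Real.exp_pos _).le, neg_mul,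
      mul_comm (2 * bielecki (ρ r) 0), mul_comm (2 * bielecki (ρ r) 0)]
    exact ⟨mul_le_mul_of_nonneg_left ((norm_fst_le (W z ξ)).trans hn) (Real.exp_pos _).le,
      mul_le_mul_of_nonneg_left ((norm_snd_le (W z ξ)).trans hn) (Real.exp_pos _).le⟩

/-- The combinations `U = p + q` and `V = p - q` diagonalise the singular part: `U' = -b U + …` and
`V' = b V + …` in the variable `x`. -/
theorem isPairSol_of_log {z : ℂ} {U V : ℝ → ℂ}
    (hU : ∀ ξ, HasDerivAt U ((Real.exp ξ * b (-Real.exp ξ) : ℝ) * U ξ -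
          Real.exp ξ * (Complex.I * (z - a (-Real.exp ξ)) * V ξ)) ξ)
    (hV : ∀ ξ, HasDerivAt V (-(Real.exp ξ * b (-Real.exp ξ) : ℝ) * V ξ -
          Real.exp ξ * (Complex.I * (z + a (-Real.exp ξ)) * U ξ)) ξ) :
    IsPairSol a b z (fun x => (U (Real.log (-x)) + V (Real.log (-x))) / 2)
      (fun x => (U (Real.log (-x)) - V (Real.log (-x))) / 2) := by
  intro x hx
  have hexp : Real.exp (Real.log (-x)) = -x := Real.exp_log (by linarith)
  have hlog : HasDerivAt (fun x : ℝ => Real.log (-x)) (x⁻¹) x := by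
    have := (hasDerivAt_neg x).log (by linarith : -x ≠ 0)
    simpa using this
  have hxC : (x : ℂ) ≠ 0 := by exact_mod_cast hx.ne
  have dU := (hU (Real.log (-x))).scomp x hlog
  have dV := (hV (Real.log (-x))).scomp x hlog
  rw [hexp, neg_neg] at dU dV
  have dU' : HasDerivAt (fun x => U (Real.log (-x))) (-(b x : ℂ) * U (Real.log (-x)) +
      Complex.I * (z - a x) * V (Real.log (-x))) x := by
    refine dU.congr_deriv ?_
    rw [Complex.real_smul]
    push_cast
    field_simp
    ring
  have dV' : HasDerivAt (fun x => V (Real.log (-x))) ((b x : ℂ) * V (Real.log (-x)) +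
      Complex.I * (z + a x) * U (Real.log (-x))) x := by
    refine dV.congr_deriv ?_
    rw [Complex.real_smul]
    push_cast
    field_simp
    ring
  constructor
  · refine ((dU'.fun_add dV').div_const 2).congr_deriv ?_
    ring
  · refine ((dU'.fun_sub dV').div_const 2).congr_deriv ?_
    ring

theorem tendsto_log_neg : Tendsto (fun x : ℝ => Real.log (-x)) (𝓝[<] 0) atBot := by
  have : Tendsto (fun x : ℝ => -x) (𝓝[<] 0) (𝓝[>] 0) := by
    have := tendsto_neg_nhdsLT (a := (0 : ℝ))
    simpa using this
  exact Real.tendsto_log_nhdsGT_zero.comp this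

theorem exp_mul_log_neg {x : ℝ} (hx : x < 0) (c : ℝ) :
    Real.exp (c * Real.log (-x)) = (-x) ^ c := by
  rw [Real.rpow_def_of_pos (by linarith), mul_comm]

/-- The characteristic behaviours at `0` are `(-x)^ν` for `p + q` and `(-x)^{-ν}` for `p - q`. If
`2ν < 1`, both are square integrable and the boundary condition suppresses `p + q`: the solution
chosen is led by `p - q`. If `2ν ≥ 1`, the solution chosen is the small one, led by `p + q`. -/
theorem exists_boundary_pair (h : Admissible a b ν κ) :
    ∃ p q : ℂ → ℝ → ℂ,
      (∀ z, IsPairSol a b z (p z) (q z) ∧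
        (2 * ν < 1 → (fun x => p z x + q z x) =o[𝓝[<] 0] fun x => √(-x)) ∧
        (1 ≤ 2 * ν → Tendsto (p z) (𝓝[<] 0) (𝓝 0) ∧ Tendsto (q z) (𝓝[<] 0) (𝓝 0)) ∧
        ∃ x < 0, p z x ≠ 0 ∨ q z x ≠ 0) ∧
      (∀ x, Differentiable ℂ (fun z => p z x) ∧ Differentiable ℂ (fun z => q z x)) ∧
      (1 ≤ 2 * ν → ∀ r, ∃ C, ∀ z : ℂ, ‖z‖ < r → ∀ x ∈ Ico (-1 : ℝ) 0,
        ‖p z x‖ ≤ C * (-x) ^ ν ∧ ‖q z x‖ ≤ C * (-x) ^ ν) := by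
  have hν := h.ν_pos
  have hnt : ∀ {Y : ℝ → ℂ} {c : ℝ}, Tendsto (fun ξ => (Real.exp (c * ξ) : ℂ) * Y ξ) atBot (𝓝 1) →
      ∃ x < 0, Y (Real.log (-x)) ≠ 0 := by
    intro Y c hY
    have hev := (hY.comp tendsto_log_neg).eventually_ne one_ne_zero
    have := hev.and (self_mem_nhdsWithin : Iio (0 : ℝ) ∈ 𝓝[<] 0)
    obtain ⟨x, hx1, hx2⟩ := this.exists
    exact ⟨x, hx2, right_ne_zero_of_mul hx1⟩
  rcases lt_or_ge (2 * ν) 1 with hlt | hge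
  -- The choice `μ = 1/2` yields exactly `U = o(√(-x))`; it is allowed because `ν ≤ 1/2` and `1/2 +
  -- ν < 1`.
  · obtain ⟨U, V, hsol, hU, hV, hd, -⟩ := exists_log_pair h (τ := 1) (μ := 1 / 2) (by simp)
      (by linarith) (by rw [abs_lt]; constructor <;> linarith)
    refine ⟨fun z x => (U z (Real.log (-x)) + V z (Real.log (-x))) / 2,
      fun z x => (U z (Real.log (-x)) - V z (Real.log (-x))) / 2, fun z => ⟨?_, ?_, ?_, ?_⟩, ?_, ?_⟩
    · refine isPairSol_of_log (fun ξ => (hsol z ξ).1.congr_deriv ?_)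
        fun ξ => (hsol z ξ).2.congr_deriv ?_
      · simp
      · simp
    · intro _
      have h1 : (fun x : ℝ => (Real.exp (1 / 2 * Real.log (-x)) : ℂ)) =O[𝓝[<] 0]
          fun x => √(-x) := by
        refine IsBigO.of_bound 1 ?_
        filter_upwards [self_mem_nhdsWithin] with x hx
        rw [exp_mul_log_neg hx, Real.sqrt_eq_rpow, Complex.norm_real, one_mul]
      have h2 : (fun x : ℝ => (Real.exp (-(1 / 2 * Real.log (-x))) : ℂ) * U z (Real.log (-x)))
          =o[𝓝[<] 0] fun _ => (1 : ℝ) := by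
        rw [isLittleO_one_iff]
        exact (hU z).comp tendsto_log_neg
      have h3 := h1.mul_isLittleO h2
      simp only [mul_one] at h3
      refine h3.congr_left fun x => ?_
      rw [← mul_assoc, ← Complex.ofReal_mul, ← Real.exp_add, add_neg_cancel, Real.exp_zero]
      push_cast
      ring
    · intro hge
      linarith
    · obtain ⟨x, hx, hne⟩ := hnt (c := 1 * ν) (hV z)
      refine ⟨x, hx, ?_⟩
      by_contra! hcon
      apply hne
      linear_combination hcon.1 - hcon.2
    · intro x
      obtain ⟨h1, h2⟩ := hd (Real.log (-x))
      exact ⟨(h1.add h2).div_const 2, (h1.sub h2).div_const 2⟩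
    · intro hge
      linarith
  -- With `τ = -1` the roles of `U` and `V` are exchanged, the normalised component is of size
  -- `(-x)^ν`, and `μ + τν = 0`.
  · obtain ⟨V, U, hsol, -, hU, hd, hb⟩ := exists_log_pair h (τ := -1) (μ := ν) (by simp)
      (by linarith) (by simp)
    have hbound : ∀ r, ∃ C, ∀ z : ℂ, ‖z‖ < r → ∀ x ∈ Ico (-1 : ℝ) 0,
        ‖(U z (Real.log (-x)) + V z (Real.log (-x))) / 2‖ ≤ C * (-x) ^ ν ∧
        ‖(U z (Real.log (-x)) - V z (Real.log (-x))) / 2‖ ≤ C * (-x) ^ ν := by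
      intro r
      obtain ⟨C, hC⟩ := hb r
      refine ⟨C, fun z hz x hx => ?_⟩
      obtain ⟨h1, h2⟩ := hC z hz (Real.log (-x))
        (Real.log_nonpos (by linarith [hx.2]) (by linarith [hx.1]))
      rw [exp_mul_log_neg hx.2] at h1
      rw [show -(-1 * ν * Real.log (-x)) = ν * Real.log (-x) by ring, exp_mul_log_neg hx.2] at h2
      rw [norm_div, norm_div, Complex.norm_ofNat]
      constructor
      · linarith [norm_add_le (U z (Real.log (-x))) (V z (Real.log (-x)))]
      · linarith [norm_sub_le (U z (Real.log (-x))) (V z (Real.log (-x)))]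
    refine ⟨fun z x => (U z (Real.log (-x)) + V z (Real.log (-x))) / 2,
      fun z x => (U z (Real.log (-x)) - V z (Real.log (-x))) / 2, fun z => ⟨?_, ?_, ?_, ?_⟩, ?_,
      fun _ => hbound⟩
    · refine isPairSol_of_log (fun ξ => (hsol z ξ).2.congr_deriv ?_)
        fun ξ => (hsol z ξ).1.congr_deriv ?_
      · push_cast
        ring
      · push_cast
        ring
    · intro hlt
      linarith
    · intro _
      obtain ⟨C, hC⟩ := hbound (‖z‖ + 1)
      have hlim : Tendsto (fun x : ℝ => C * (-x) ^ ν) (𝓝[<] 0) (𝓝 0) := by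
        have : ContinuousAt (fun x : ℝ => C * (-x) ^ ν) 0 :=
          continuousAt_const.mul (ContinuousAt.rpow_const (by fun_prop) (Or.inr hν.le))
        have h2 := this.tendsto.mono_left (nhdsWithin_le_nhds (s := Iio 0))
        simpa [Real.zero_rpow hν.ne'] using h2
      have hmem : Ico (-1 : ℝ) 0 ∈ 𝓝[<] (0 : ℝ) := Ico_mem_nhdsLT (by norm_num)
      constructor
      · refine squeeze_zero_norm' ?_ hlim
        filter_upwards [hmem] with x hx using (hC z (by linarith) x hx).1
      · refine squeeze_zero_norm' ?_ hlim
        filter_upwards [hmem] with x hx using (hC z (by linarith) x hx).2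
    · obtain ⟨x, hx, hne⟩ := hnt (c := -1 * ν) (hU z)
      refine ⟨x, hx, ?_⟩
      by_contra! hcon
      apply hne
      linear_combination hcon.1 + hcon.2
    · intro x
      obtain ⟨h1, h2⟩ := hd (Real.log (-x))
      exact ⟨(h2.add h1).div_const 2, (h2.sub h1).div_const 2⟩

end

end SAdS

open MeasureTheory Set Filter Topology Asymptotics

namespace SAdS

noncomputable section

/-! ### The radial coordinate -/

variable {M l : ℝ}

/-- Cardano's formula: if `p³ = u`, `q³ = v` and `p q = l²/3`, then `(p - q)³ = u - v - 3 p q (p -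
q)`, and `u - v = 2 M l²`. The value of `p q` comes from `u v = (l²/3)³`. -/
theorem horizon_spec (hM : 0 < M) (hl : 0 < l) :
    0 < horizon M l ∧ horizon M l ^ 3 + l ^ 2 * horizon M l = 2 * M * l ^ 2 := by
  set D := √(M ^ 2 * l ^ 4 + l ^ 6 / 27) with hD
  have hD2 : D ^ 2 = M ^ 2 * l ^ 4 + l ^ 6 / 27 := Real.sq_sqrt (by positivity)
  have hMl : 0 < M * l ^ 2 := by positivity
  have hlt : M * l ^ 2 < D := by
    rw [hD]
    refine Real.lt_sqrt_of_sq_lt ?_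
    have : 0 < l ^ 6 / 27 := by positivity
    nlinarith
  set u := M * l ^ 2 + D with hu
  set v := D - M * l ^ 2 with hv
  have hu0 : 0 < u := by positivity
  have hv0 : 0 < v := by linarith
  have huv : u * v = (l ^ 2 / 3) ^ 3 := by
    rw [hu, hv]
    linear_combination hD2
  have hcube : ∀ y : ℝ, 0 ≤ y → (y ^ (1 / 3 : ℝ)) ^ 3 = y := fun y hy => by
    rw [← Real.rpow_natCast, ← Real.rpow_mul hy]
    norm_num
  have h1 := hcube u hu0.le
  have h2 := hcube v hv0.le
  have h3 : u ^ (1 / 3 : ℝ) * v ^ (1 / 3 : ℝ) = l ^ 2 / 3 := by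
    rw [← Real.mul_rpow hu0.le hv0.le, huv, ← Real.rpow_natCast, ← Real.rpow_mul (by positivity)]
    norm_num
  have h4 : horizon M l = u ^ (1 / 3 : ℝ) - v ^ (1 / 3 : ℝ) := rfl
  have h5 : v ^ (1 / 3 : ℝ) < u ^ (1 / 3 : ℝ) :=
    Real.rpow_lt_rpow hv0.le (by linarith) (by norm_num)
  refine ⟨by linarith, ?_⟩
  rw [h4]
  set p := u ^ (1 / 3 : ℝ)
  set q := v ^ (1 / 3 : ℝ)
  linear_combination h1 - h2 - 3 * (p - q) * h3

theorem horizon_pos (hM : 0 < M) (hl : 0 < l) : 0 < horizon M l := (horizon_spec hM hl).1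

theorem lapse_factor (hM : 0 < M) (hl : 0 < l) {r : ℝ} (hr : 0 < r) :
    lapse M l r = (r - horizon M l) * (r ^ 2 + horizon M l * r + horizon M l ^ 2 + l ^ 2) /
      (l ^ 2 * r) := by
  have h := (horizon_spec hM hl).2
  rw [lapse]
  field_simp
  linear_combination h

theorem hasDerivAt_lapse (M l : ℝ) {r : ℝ} (hr : r ≠ 0) :
    HasDerivAt (lapse M l) (2 * M / r ^ 2 + 2 * r / l ^ 2) r := by
  have h1 := ((hasDerivAt_inv hr).const_mul (2 * M))
  have h2 := (hasDerivAt_pow 2 r).div_const (l ^ 2)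
  have h3 := (h1.const_sub 1).fun_add h2
  refine (h3.congr_deriv ?_)
  field_simp
  ring

theorem surfaceGravity_eq (hM : 0 < M) (hl : 0 < l) :
    2 * surfaceGravity M l = 2 * M / horizon M l ^ 2 + 2 * horizon M l / l ^ 2 := by
  rw [surfaceGravity, (hasDerivAt_lapse M l (horizon_pos hM hl).ne').deriv]
  ring

theorem surfaceGravity_pos (hM : 0 < M) (hl : 0 < l) : 0 < surfaceGravity M l := by
  have h0 := horizon_pos hM hl
  have h1 := surfaceGravity_eq hM hl
  have : 0 < 2 * M / horizon M l ^ 2 + 2 * horizon M l / l ^ 2 := by positivity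
  linarith

theorem le_lapse (hM : 0 < M) (hl : 0 < l) {r : ℝ} (hr : horizon M l < r) :
    (r - horizon M l) * r / l ^ 2 ≤ lapse M l r := by
  have h0 := horizon_pos hM hl
  have hr0 : 0 < r := h0.trans hr
  rw [lapse_factor hM hl hr0, div_le_div_iff₀ (by positivity) (by positivity)]
  have h1 : 0 < r - horizon M l := by linarith
  have h2 : r ^ 2 ≤ r ^ 2 + horizon M l * r + horizon M l ^ 2 + l ^ 2 := by
    have : 0 < horizon M l * r := by positivity
    nlinarith [sq_nonneg (horizon M l), sq_nonneg l]
  have h3 : 0 ≤ (r - horizon M l) * l ^ 2 := by positivity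
  nlinarith [mul_le_mul_of_nonneg_left h2 h3]

theorem lapse_pos (hM : 0 < M) (hl : 0 < l) {r : ℝ} (hr : horizon M l < r) :
    0 < lapse M l r := by
  have h0 := horizon_pos hM hl
  have h1 : 0 < r - horizon M l := by linarith
  have h2 : 0 < r := by linarith
  exact lt_of_lt_of_le (by positivity) (le_lapse hM hl hr)

theorem lapse_ge_sq (hM : 0 < M) (hl : 0 < l) {r₀ r : ℝ} (hr₀ : horizon M l < r₀) (hr : r₀ ≤ r) :
    (1 - horizon M l / r₀) / l ^ 2 * r ^ 2 ≤ lapse M l r := by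
  have h0 := horizon_pos hM hl
  have hr0 : 0 < r₀ := h0.trans hr₀
  refine le_trans ?_ (le_lapse hM hl (hr₀.trans_le hr))
  rw [div_mul_eq_mul_div]
  refine div_le_div_of_nonneg_right ?_ (by positivity)
  have h1 : horizon M l ≤ horizon M l / r₀ * r := by
    rw [div_mul_eq_mul_div, le_div_iff₀ hr0]
    exact mul_le_mul_of_nonneg_left hr h0.le
  have h2 : 0 ≤ r := hr0.le.trans hr
  nlinarith

theorem lapse_le_sq (hM : 0 < M) {r₀ r : ℝ} (hr₀ : 0 < r₀) (hr : r₀ ≤ r) :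
    lapse M l r ≤ (1 / r₀ ^ 2 + 1 / l ^ 2) * r ^ 2 := by
  have hr0 : 0 < r := hr₀.trans_le hr
  have h1 : 1 ≤ 1 / r₀ ^ 2 * r ^ 2 := by
    rw [one_div_mul_eq_div, one_le_div (by positivity)]
    exact pow_le_pow_left₀ hr₀.le hr 2
  have h2 : 0 < 2 * M / r := by positivity
  rw [lapse, add_mul, one_div_mul_eq_div (l ^ 2)]
  linarith

theorem continuousOn_lapse (M l : ℝ) : ContinuousOn (lapse M l) (Ioi 0) := fun _ hr =>
  (hasDerivAt_lapse M l (ne_of_gt hr)).continuousAt.continuousWithinAt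

theorem continuousOn_inv_lapse (hM : 0 < M) (hl : 0 < l) :
    ContinuousOn (fun r => (lapse M l r)⁻¹) (Ioi (horizon M l)) :=
  ((continuousOn_lapse M l).mono (Ioi_subset_Ioi (horizon_pos hM hl).le)).inv₀
    fun _ hr => (lapse_pos hM hl hr).ne'

theorem integrableOn_sq_inv {r : ℝ} (hr : 0 < r) (c : ℝ) :
    IntegrableOn (fun ρ : ℝ => c / ρ ^ 2) (Ioi r) ∧ ∫ ρ in Ioi r, c / ρ ^ 2 = c / r := by
  have h1 := (integrableOn_Ioi_rpow_of_lt (a := -2) (by norm_num) hr).const_mul c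
  have h2 := integral_Ioi_rpow_of_lt (a := -2) (by norm_num) hr
  have he : ∀ ρ ∈ Ioi r, c * ρ ^ (-2 : ℝ) = c / ρ ^ 2 := fun ρ hρ => by
    have : (0 : ℝ) < ρ := hr.trans hρ
    rw [Real.rpow_neg this.le, div_eq_mul_inv]
    norm_num
  refine ⟨IntegrableOn.congr_fun h1 he measurableSet_Ioi, ?_⟩
  rw [← setIntegral_congr_fun measurableSet_Ioi he, integral_const_mul, h2]
  norm_num
  rw [Real.rpow_neg_one, div_eq_mul_inv]

theorem integrableOn_inv_lapse (hM : 0 < M) (hl : 0 < l) {r : ℝ} (hr : horizon M l < r) :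
    IntegrableOn (fun ρ => (lapse M l ρ)⁻¹) (Ioi r) := by
  have h0 := horizon_pos hM hl
  have hr0 : 0 < r := h0.trans hr
  set c := (1 - horizon M l / r) / l ^ 2 with hc
  have hc0 : 0 < c := by
    have : horizon M l / r < 1 := (div_lt_one hr0).2 hr
    have : 0 < 1 - horizon M l / r := by linarith
    positivity
  refine Integrable.mono' (integrableOn_sq_inv hr0 c⁻¹).1 ?_ ?_
  · exact ((continuousOn_inv_lapse hM hl).mono (Ioi_subset_Ioi hr.le)).aestronglyMeasurable
      measurableSet_Ioi
  · filter_upwards [ae_restrict_mem measurableSet_Ioi] with ρ hρ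
    have hρ' : r < ρ := hρ
    have hρ0 : 0 < ρ := hr0.trans hρ'
    rw [Real.norm_of_nonneg (inv_nonneg.2 (lapse_pos hM hl (hr.trans hρ')).le), div_eq_mul_inv,
      ← mul_inv]
    exact inv_anti₀ (by positivity) (lapse_ge_sq hM hl hr hρ'.le)

theorem hasDerivAt_tortoise (hM : 0 < M) (hl : 0 < l) {r : ℝ} (hr : horizon M l < r) :
    HasDerivAt (tortoise M l) (lapse M l r)⁻¹ r := by
  obtain ⟨r₁, h1, h2⟩ := exists_between hr
  have hev : tortoise M l =ᶠ[𝓝 r] fun y =>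
      (-∫ ρ in Ioi r₁, (lapse M l ρ)⁻¹) + ∫ ρ in r₁..y, (lapse M l ρ)⁻¹ := by
    filter_upwards [Ioi_mem_nhds h2] with y hy
    have := intervalIntegral.integral_interval_add_Ioi (integrableOn_inv_lapse hM hl h1)
      (integrableOn_inv_lapse hM hl (h1.trans hy))
    rw [tortoise, ← this]
    ring
  refine HasDerivAt.congr_of_eventuallyEq ?_ hev
  refine HasDerivAt.const_add _ (intervalIntegral.integral_hasDerivAt_right ?_ ?_ ?_)
  · refine ContinuousOn.intervalIntegrable ((continuousOn_inv_lapse hM hl).mono ?_)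
    rw [uIcc_of_le h2.le]
    exact fun y hy => h1.trans_le hy.1
  · exact (continuousOn_inv_lapse hM hl).stronglyMeasurableAtFilter isOpen_Ioi r hr
  · exact (continuousOn_inv_lapse hM hl).continuousAt (Ioi_mem_nhds hr)

theorem strictMonoOn_tortoise (hM : 0 < M) (hl : 0 < l) :
    StrictMonoOn (tortoise M l) (Ioi (horizon M l)) := by
  refine strictMonoOn_of_deriv_pos (convex_Ioi _)
    (fun r hr => (hasDerivAt_tortoise hM hl hr).continuousAt.continuousWithinAt) ?_
  intro r hr
  rw [interior_Ioi] at hr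
  rw [(hasDerivAt_tortoise hM hl hr).deriv]
  exact inv_pos.2 (lapse_pos hM hl hr)

theorem neg_tortoise_ge (hM : 0 < M) (hl : 0 < l) {r₀ r : ℝ} (hr₀ : horizon M l < r₀)
    (hr : r₀ ≤ r) : (1 / r₀ ^ 2 + 1 / l ^ 2)⁻¹ / r ≤ -tortoise M l r := by
  have h0 := horizon_pos hM hl
  have hr₀0 : 0 < r₀ := h0.trans hr₀
  have hr0 : 0 < r := hr₀0.trans_le hr
  rw [tortoise, neg_neg, ← (integrableOn_sq_inv hr0 _).2]
  refine setIntegral_mono_on (integrableOn_sq_inv hr0 _).1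
    (integrableOn_inv_lapse hM hl (hr₀.trans_le hr)) measurableSet_Ioi fun ρ hρ => ?_
  have hρ' : r < ρ := hρ
  rw [div_eq_mul_inv, ← mul_inv]
  exact inv_anti₀ (lapse_pos hM hl (by linarith)) (lapse_le_sq hM hr₀0 (by linarith))

theorem tortoise_neg (hM : 0 < M) (hl : 0 < l) {r : ℝ} (hr : horizon M l < r) :
    tortoise M l r < 0 := by
  have h0 := horizon_pos hM hl
  have hr0 : 0 < r := h0.trans hr
  have h1 : 0 < (1 / r ^ 2 + 1 / l ^ 2)⁻¹ / r := by positivity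
  linarith [neg_tortoise_ge hM hl hr le_rfl]

/-- Since `F = r²/l² + O(1)`, the difference `1/F - l²/r²` is `O(r⁻⁴)`; integrating from `r` to `∞`
gains the bound `r⁻³`. -/
theorem abs_neg_tortoise_sub_le (hM : 0 < M) (hl : 0 < l) {r₀ : ℝ} (hr₀ : horizon M l < r₀) :
    ∃ C, ∀ r, r₀ ≤ r → |-tortoise M l r - l ^ 2 / r| ≤ C / r ^ 3 := by
  have h0 := horizon_pos hM hl
  have hr₀0 : 0 < r₀ := h0.trans hr₀
  set c := (1 - horizon M l / r₀) / l ^ 2 with hc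
  have hc0 : 0 < c := by
    have : horizon M l / r₀ < 1 := (div_lt_one hr₀0).2 hr₀
    have : 0 < 1 - horizon M l / r₀ := by linarith
    positivity
  set K := (1 + 2 * M / r₀) * l ^ 2 / c with hK
  refine ⟨K / 3, fun r hr => ?_⟩
  have hr0 : 0 < r := hr₀0.trans_le hr
  have hI1 := integrableOn_inv_lapse hM hl (hr₀.trans_le hr)
  obtain ⟨hI2, hI3⟩ := integrableOn_sq_inv hr0 (l ^ 2)
  have hI4 : IntegrableOn (fun ρ : ℝ => K * ρ ^ (-4 : ℝ)) (Ioi r) :=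
    (integrableOn_Ioi_rpow_of_lt (by norm_num) hr0).const_mul K
  have hI5 : ∫ ρ in Ioi r, K * ρ ^ (-4 : ℝ) = K / 3 / r ^ 3 := by
    rw [integral_const_mul, integral_Ioi_rpow_of_lt (by norm_num) hr0]
    rw [show (-4 : ℝ) + 1 = -(3 : ℕ) by norm_num, Real.rpow_neg hr0.le, Real.rpow_natCast]
    field_simp
    norm_num
  rw [tortoise, neg_neg, ← hI3, ← integral_sub hI1 hI2, ← hI5, ← Real.norm_eq_abs]
  refine norm_integral_le_of_norm_le hI4 ?_
  filter_upwards [ae_restrict_mem measurableSet_Ioi] with ρ hρ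
  have hρ' : r < ρ := hρ
  have hρ0 : 0 < ρ := hr0.trans hρ'
  have hFge := lapse_ge_sq hM hl hr₀ (hr.trans hρ'.le)
  have hF := lapse_pos hM hl (hr₀.trans_le (hr.trans hρ'.le))
  have e1 : (lapse M l ρ)⁻¹ - l ^ 2 / ρ ^ 2 = -((1 - 2 * M / ρ) * l ^ 2 / (ρ ^ 2 * lapse M l ρ)) := by
    have : lapse M l ρ = 1 - 2 * M / ρ + ρ ^ 2 / l ^ 2 := rfl
    rw [inv_eq_one_div, div_sub_div _ _ hF.ne' (by positivity), ← neg_div,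
      div_eq_div_iff (by positivity) (by positivity)]
    have h2 : l ^ 2 * lapse M l ρ = (1 - 2 * M / ρ) * l ^ 2 + ρ ^ 2 := by
      rw [this]
      field_simp
    linear_combination (-(ρ ^ 2 * lapse M l ρ)) * h2
  rw [e1, norm_neg, Real.norm_eq_abs, abs_div, abs_mul, abs_of_pos (by positivity : 0 < l ^ 2),
    abs_of_pos (by positivity : 0 < ρ ^ 2 * lapse M l ρ)]
  have e2 : |1 - 2 * M / ρ| ≤ 1 + 2 * M / r₀ := by
    have h3 : 2 * M / ρ ≤ 2 * M / r₀ :=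
      div_le_div_of_nonneg_left (by positivity) hr₀0 (by linarith)
    have h4 : 0 < 2 * M / ρ := by positivity
    rw [abs_le]
    constructor <;> linarith
  have e3 : ρ ^ (-4 : ℝ) = (ρ ^ 4)⁻¹ := by
    rw [show (-4 : ℝ) = -(4 : ℕ) by norm_num, Real.rpow_neg hρ0.le, Real.rpow_natCast]
  calc |1 - 2 * M / ρ| * l ^ 2 / (ρ ^ 2 * lapse M l ρ)
      ≤ (1 + 2 * M / r₀) * l ^ 2 / (ρ ^ 2 * (c * ρ ^ 2)) := by
        gcongr
    _ = K * ρ ^ (-4 : ℝ) := by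
        rw [e3, hK]
        field_simp

/-- Near the horizon `F ≤ K' (r - r₊)`, so `1/F` dominates `1 / (K' (r - r₊))` and the coordinate
diverges at least logarithmically to `-∞`. -/
theorem exists_tortoise_lt (hM : 0 < M) (hl : 0 < l) (x : ℝ) :
    ∃ r, horizon M l < r ∧ tortoise M l r < x := by
  have h0 := horizon_pos hM hl
  set R := horizon M l with hR
  obtain ⟨K, hK⟩ := (isCompact_Icc (a := R) (b := R + 1)).exists_bound_of_continuousOn
    (f := fun r => (r ^ 2 + R * r + R ^ 2 + l ^ 2) / (l ^ 2 * r))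
    (by
      refine ContinuousOn.div (by fun_prop) (by fun_prop) fun r hr => ?_
      have : 0 < r := h0.trans_le hr.1
      positivity)
  set K' := max K 1 with hK'
  have hK'0 : 0 < K' := lt_max_of_lt_right one_pos
  have hmono : MonotoneOn (fun r => tortoise M l r - K'⁻¹ * Real.log (r - R)) (Ioc R (R + 1)) := by
    have hd : ∀ r ∈ Ioc R (R + 1), HasDerivAt
        (fun r => tortoise M l r - K'⁻¹ * Real.log (r - R))
        ((lapse M l r)⁻¹ - K'⁻¹ * (1 / (r - R))) r := fun r hr =>
      (hasDerivAt_tortoise hM hl hr.1).fun_sub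
        ((((hasDerivAt_id r).sub_const R).log (by simpa using (sub_pos.2 hr.1).ne')).const_mul _)
    refine monotoneOn_of_deriv_nonneg (convex_Ioc _ _)
      (fun r hr => (hd r hr).continuousAt.continuousWithinAt)
      (fun r hr => (hd r (interior_subset hr)).differentiableAt.differentiableWithinAt) ?_
    intro r hr
    have hr' := interior_subset hr
    rw [(hd r hr').deriv, sub_nonneg, one_div, ← mul_inv]
    have hrR : 0 < r - R := sub_pos.2 hr'.1
    refine inv_anti₀ (lapse_pos hM hl hr'.1) ?_
    rw [lapse_factor hM hl (h0.trans hr'.1), mul_comm K', mul_div_assoc]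
    refine mul_le_mul_of_nonneg_left ?_ hrR.le
    exact (le_abs_self _).trans ((hK r ⟨hr'.1.le, hr'.2⟩).trans (le_max_left _ _))
  -- At `r = R + e^L` the logarithmic comparison with `R + 1` gives a coordinate at most `x - 1`;
  -- the minimum with `0` keeps `r` in the interval where the comparison is valid.
  set L := K' * (x - 1 - tortoise M l (R + 1)) with hL
  set r := R + Real.exp (min L 0) with hr
  have he1 : Real.exp (min L 0) ≤ 1 := Real.exp_le_one_iff.2 (min_le_right _ _)
  have hrm : r ∈ Ioc R (R + 1) := ⟨by linarith [Real.exp_pos (min L 0)], by linarith⟩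
  refine ⟨r, hrm.1, ?_⟩
  have := hmono hrm ⟨by linarith, le_rfl⟩ hrm.2
  simp only [hr, add_sub_cancel_left, Real.log_one, Real.log_exp, mul_zero, sub_zero] at this
  have h2 : K'⁻¹ * min L 0 ≤ K'⁻¹ * L :=
    mul_le_mul_of_nonneg_left (min_le_left _ _) (inv_pos.2 hK'0).le
  have h3 : K'⁻¹ * L = x - 1 - tortoise M l (R + 1) := by
    rw [hL, inv_mul_cancel_left₀ hK'0.ne']
  linarith

theorem exists_lt_tortoise (hM : 0 < M) (hl : 0 < l) {x : ℝ} (hx : x < 0) (r₁ : ℝ) :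
    ∃ r, r₁ < r ∧ horizon M l < r ∧ x < tortoise M l r := by
  have h0 := horizon_pos hM hl
  obtain ⟨C, hC⟩ := abs_neg_tortoise_sub_le hM hl (lt_add_one (horizon M l))
  have hlim : Tendsto (fun r : ℝ => l ^ 2 / r + C / r ^ 3) atTop (𝓝 0) := by
    have h1 : Tendsto (fun r : ℝ => l ^ 2 / r) atTop (𝓝 0) := tendsto_const_nhds.div_atTop tendsto_id
    have h2 : Tendsto (fun r : ℝ => C / r ^ 3) atTop (𝓝 0) :=
      tendsto_const_nhds.div_atTop (tendsto_pow_atTop (by norm_num))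
    simpa using h1.add h2
  have hev := (hlim.eventually (gt_mem_nhds (neg_pos.2 hx))).and
    ((eventually_ge_atTop (horizon M l + 1)).and (eventually_gt_atTop r₁))
  obtain ⟨r, h1, h2, h3⟩ := hev.exists
  refine ⟨r, h3, by linarith, ?_⟩
  have := (abs_le.1 (hC r h2)).2
  linarith

theorem surjOn_tortoise (hM : 0 < M) (hl : 0 < l) :
    SurjOn (tortoise M l) (Ioi (horizon M l)) (Iio 0) := by
  intro x hx
  obtain ⟨r₁, h1, h2⟩ := exists_tortoise_lt hM hl x
  obtain ⟨r₂, h3, -, h4⟩ := exists_lt_tortoise hM hl hx r₁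
  obtain ⟨r, hr, hrx⟩ := intermediate_value_Icc h3.le
    (fun r hr => (hasDerivAt_tortoise hM hl (h1.trans_le hr.1)).continuousAt.continuousWithinAt)
    ⟨h2.le, h4.le⟩
  exact ⟨r, h1.trans_le hr.1, hrx⟩

theorem horizon_lt_radius (hM : 0 < M) (hl : 0 < l) {x : ℝ} (hx : x < 0) :
    horizon M l < radius M l x :=
  Function.invFunOn_mem (surjOn_tortoise hM hl hx)

theorem tortoise_radius (hM : 0 < M) (hl : 0 < l) {x : ℝ} (hx : x < 0) :
    tortoise M l (radius M l x) = x :=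
  Function.invFunOn_eq (surjOn_tortoise hM hl hx)

theorem radius_tortoise (hM : 0 < M) (hl : 0 < l) {r : ℝ} (hr : horizon M l < r) :
    radius M l (tortoise M l r) = r :=
  (strictMonoOn_tortoise hM hl).injOn (horizon_lt_radius hM hl (tortoise_neg hM hl hr)) hr
    (tortoise_radius hM hl (tortoise_neg hM hl hr))

theorem strictMonoOn_radius (hM : 0 < M) (hl : 0 < l) :
    StrictMonoOn (radius M l) (Iio 0) := by
  intro x hx y hy hxy
  rw [← (strictMonoOn_tortoise hM hl).lt_iff_lt (horizon_lt_radius hM hl hx)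
    (horizon_lt_radius hM hl hy), tortoise_radius hM hl hx, tortoise_radius hM hl hy]
  exact hxy

/-- Continuity must precede the rule for the derivative of an inverse; it holds because a monotone
map whose image contains a neighbourhood of the value cannot jump. -/
theorem hasDerivAt_radius (hM : 0 < M) (hl : 0 < l) {x : ℝ} (hx : x < 0) :
    HasDerivAt (radius M l) (lapse M l (radius M l x)) x := by
  have hr := horizon_lt_radius hM hl hx
  have hcont : ContinuousAt (radius M l) x := by
    refine continuousAt_of_monotoneOn_of_image_mem_nhds (strictMonoOn_radius hM hl).monotoneOn
      (Iio_mem_nhds hx) (mem_of_superset (Ioi_mem_nhds hr) ?_)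
    exact fun r hr => ⟨tortoise M l r, tortoise_neg hM hl hr, radius_tortoise hM hl hr⟩
  have := HasDerivAt.of_local_left_inverse hcont (hasDerivAt_tortoise hM hl hr)
    (inv_ne_zero (lapse_pos hM hl hr).ne')
    (by filter_upwards [Iio_mem_nhds hx] with y hy using tortoise_radius hM hl hy)
  rwa [inv_inv] at this

theorem continuousOn_lapse_radius (hM : 0 < M) (hl : 0 < l) :
    ContinuousOn (fun x => lapse M l (radius M l x)) (Iio 0) := fun x hx =>
  ((hasDerivAt_lapse M l ((horizon_pos hM hl).trans (horizon_lt_radius hM hl hx)).ne').comp x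
    (hasDerivAt_radius hM hl hx)).continuousAt.continuousWithinAt

theorem continuousOn_radius (hM : 0 < M) (hl : 0 < l) :
    ContinuousOn (radius M l) (Iio 0) := fun _ hx =>
  (hasDerivAt_radius hM hl hx).continuousAt.continuousWithinAt

theorem continuousOn_potB (hM : 0 < M) (hl : 0 < l) : ContinuousOn (potB M l) (Iio 0) :=
  Real.continuous_sqrt.comp_continuousOn (continuousOn_lapse_radius hM hl)

theorem continuousOn_potA (hM : 0 < M) (hl : 0 < l) : ContinuousOn (potA M l) (Iio 0) :=
  (continuousOn_potB hM hl).div (continuousOn_radius hM hl) fun _ hx =>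
    ((horizon_pos hM hl).trans (horizon_lt_radius hM hl hx)).ne'

theorem potB_nonneg (M l x : ℝ) : 0 ≤ potB M l x := Real.sqrt_nonneg _

theorem abs_potA_le (hM : 0 < M) (hl : 0 < l) {x : ℝ} (hx : x < 0) :
    |potA M l x| ≤ √(1 / horizon M l ^ 2 + 1 / l ^ 2) ∧
      |potA M l x| ≤ (horizon M l)⁻¹ * potB M l x := by
  have h0 := horizon_pos hM hl
  have hr := horizon_lt_radius hM hl hx
  have hr0 := h0.trans hr
  have hA : 0 ≤ potA M l x := div_nonneg (Real.sqrt_nonneg _) hr0.le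
  rw [abs_of_nonneg hA]
  constructor
  · rw [potA, div_le_iff₀ hr0]
    calc √(lapse M l (radius M l x))
        ≤ √((1 / horizon M l ^ 2 + 1 / l ^ 2) * radius M l x ^ 2) :=
          Real.sqrt_le_sqrt (lapse_le_sq hM h0 hr.le)
      _ = _ := by rw [Real.sqrt_mul (by positivity), Real.sqrt_sq hr0.le]
  · rw [potA, potB, div_eq_inv_mul]
    exact mul_le_mul_of_nonneg_right (inv_anti₀ h0 hr.le) (Real.sqrt_nonneg _)

/-- Along `dr/dx = F` the function `G = F e^{-2kx}` satisfies `G' = (F'(r) - 2k) G`. Near the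
horizon `F'(r)` is close to `2κ > 2k`, so `G` increases there and is bounded at `-∞`; the square
root of `F ≤ K e^{2kx}` is the claim. -/
theorem exists_potB_le_exp (hM : 0 < M) (hl : 0 < l) {k : ℝ} (hk : k < surfaceGravity M l) :
    ∃ C, ∀ x ≤ -1, potB M l x ≤ C * Real.exp (k * x) := by
  have h0 := horizon_pos hM hl
  set G : ℝ → ℝ := fun x => lapse M l (radius M l x) * Real.exp (-(2 * k * x)) with hG
  have hGd : ∀ x < 0, HasDerivAt G ((2 * M / radius M l x ^ 2 + 2 * radius M l x / l ^ 2 - 2 * k) *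
      G x) x := by
    intro x hx
    have hr0 := h0.trans (horizon_lt_radius hM hl hx)
    have d1 := (hasDerivAt_lapse M l hr0.ne').comp x (hasDerivAt_radius hM hl hx)
    have d2 : HasDerivAt (fun x => Real.exp (-(2 * k * x))) (Real.exp (-(2 * k * x)) * -(2 * k)) x := by
      have := (((hasDerivAt_id x).const_mul (2 * k)).neg).exp
      simpa using this
    refine (d1.mul d2).congr_deriv ?_
    simp only [hG, Function.comp_apply]
    ring
  obtain ⟨r₁, hr₁, hF⟩ : ∃ r₁, horizon M l < r₁ ∧ ∀ r, horizon M l < r → r < r₁ →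
      2 * k < 2 * M / r ^ 2 + 2 * r / l ^ 2 := by
    have hc : ContinuousAt (fun r : ℝ => 2 * M / r ^ 2 + 2 * r / l ^ 2) (horizon M l) := by
      have : horizon M l ^ 2 ≠ 0 := by positivity
      refine ContinuousAt.add (ContinuousAt.div continuousAt_const ?_ this) ?_
      · exact continuousAt_id.pow 2
      · exact (continuousAt_const.mul continuousAt_id).div_const _
    have hlt : 2 * k < 2 * M / horizon M l ^ 2 + 2 * horizon M l / l ^ 2 := by
      rw [← surfaceGravity_eq hM hl]
      linarith
    have hev := hc.eventually (lt_mem_nhds hlt)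
    obtain ⟨u, hu, hsub⟩ := (mem_nhdsGT_iff_exists_Ioo_subset).1
      (nhdsWithin_le_nhds (s := Ioi (horizon M l)) hev)
    exact ⟨u, hu, fun r h1 h2 => hsub ⟨h1, h2⟩⟩
  set y := min (tortoise M l r₁) (-1) with hy
  have hy1 : y ≤ -1 := min_le_right _ _
  have hmono : MonotoneOn G (Iic y) := by
    refine monotoneOn_of_deriv_nonneg (convex_Iic y) ?_ ?_ ?_
    · exact fun x hx => (hGd x (by linarith [mem_Iic.1 hx])).continuousAt.continuousWithinAt
    · exact fun x hx => (hGd x (by linarith [mem_Iic.1 (interior_subset hx)])).differentiableAt.differentiableWithinAt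
    · intro x hx
      rw [interior_Iic, mem_Iio] at hx
      have hx0 : x < 0 := by linarith
      rw [(hGd x hx0).deriv]
      have hrx := horizon_lt_radius hM hl hx0
      have hlt : radius M l x < r₁ := by
        rw [← (strictMonoOn_tortoise hM hl).lt_iff_lt hrx hr₁, tortoise_radius hM hl hx0]
        exact hx.trans_le (min_le_left _ _)
      have := hF _ hrx hlt
      exact mul_nonneg (by linarith) (mul_nonneg (lapse_pos hM hl hrx).le (Real.exp_pos _).le)
  obtain ⟨K, hK⟩ := (isCompact_Icc (a := y) (b := -1)).exists_bound_of_continuousOn (f := G)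
    fun x hx => (hGd x (by linarith [hx.2])).continuousAt.continuousWithinAt
  have hGK : ∀ x ≤ -1, G x ≤ K := by
    intro x hx
    rcases le_total x y with hxy | hxy
    · exact (hmono hxy (mem_Iic.2 le_rfl) hxy).trans
        ((le_abs_self _).trans (hK y ⟨le_rfl, hy1⟩))
    · exact (le_abs_self _).trans (hK x ⟨hxy, hx⟩)
  refine ⟨√K, fun x hx => ?_⟩
  have h1 : lapse M l (radius M l x) ≤ K * Real.exp (k * x) ^ 2 := by
    have h2 := hGK x hx
    have h3 : Real.exp (-(2 * k * x)) * Real.exp (k * x) ^ 2 = 1 := by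
      rw [← Real.exp_nat_mul, ← Real.exp_add, Real.exp_eq_one_iff]
      push_cast
      ring
    have h4 := mul_le_mul_of_nonneg_right h2 (sq_nonneg (Real.exp (k * x)))
    rwa [hG, mul_assoc, h3, mul_one] at h4
  calc potB M l x ≤ √(K * Real.exp (k * x) ^ 2) := Real.sqrt_le_sqrt h1
    _ = √K * Real.exp (k * x) := by
      rw [Real.sqrt_mul' _ (sq_nonneg _), Real.sqrt_sq (Real.exp_pos _).le]

/-- Two comparisons: `B - r/l` is bounded because `B² - r²/l²` is, and `r/l - l/(-x)` is bounded
because `-x = l²/r + O(r⁻³)` while `-x` is at least of order `1/r`. -/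
theorem exists_abs_potB_sub_le (hM : 0 < M) (hl : 0 < l) :
    ∃ C, ∀ x ∈ Ico (-1 : ℝ) 0, |potB M l x - l / (-x)| ≤ C := by
  have h0 := horizon_pos hM hl
  set r₀ := radius M l (-1) with hr₀
  have hr₀h : horizon M l < r₀ := horizon_lt_radius hM hl (by norm_num)
  have hr₀0 : 0 < r₀ := h0.trans hr₀h
  obtain ⟨C, hC⟩ := abs_neg_tortoise_sub_le hM hl hr₀h
  have hCnn : 0 ≤ C := by
    have h1 := (abs_nonneg _).trans (hC r₀ le_rfl)
    by_contra hneg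
    have : C / r₀ ^ 3 < 0 := div_neg_of_neg_of_pos (not_le.1 hneg) (by positivity)
    linarith
  set c := (1 / r₀ ^ 2 + 1 / l ^ 2)⁻¹ with hc
  have hc0 : 0 < c := by positivity
  refine ⟨(1 + 2 * M / r₀) / (r₀ / l) + C / (l * c * r₀), fun x hx => ?_⟩
  have hx0 : x < 0 := hx.2
  set r := radius M l x with hr
  have hrr : r₀ ≤ r := (strictMonoOn_radius hM hl).monotoneOn (by norm_num) hx0 hx.1
  have hr0 : 0 < r := hr₀0.trans_le hrr
  have ht := tortoise_radius hM hl hx0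
  have h1 := hC r hrr
  have h2 := neg_tortoise_ge hM hl hr₀h hrr
  rw [ht] at h1 h2
  have hxp : 0 < -x := by linarith
  have hF := lapse_pos hM hl (horizon_lt_radius hM hl hx0)
  have hB2 : potB M l x ^ 2 = lapse M l r := Real.sq_sqrt hF.le
  have hB := potB_nonneg M l x
  have e1 : |potB M l x - r / l| ≤ (1 + 2 * M / r₀) / (r₀ / l) := by
    have hsum : 0 < potB M l x + r / l := by positivity
    have hmul : (potB M l x - r / l) * (potB M l x + r / l) = 1 - 2 * M / r := by
      have : lapse M l r = 1 - 2 * M / r + r ^ 2 / l ^ 2 := rfl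
      rw [this] at hB2
      linear_combination hB2
    have e3 : |1 - 2 * M / r| ≤ 1 + 2 * M / r₀ := by
      have h3 : 2 * M / r ≤ 2 * M / r₀ := div_le_div_of_nonneg_left (by positivity) hr₀0 hrr
      have h4 : 0 < 2 * M / r := by positivity
      rw [abs_le]
      constructor <;> linarith
    rw [← eq_div_iff hsum.ne'] at hmul
    rw [hmul, abs_div, abs_of_pos hsum]
    refine div_le_div₀ (by positivity) e3 (by positivity) ?_
    have : r₀ / l ≤ r / l := div_le_div_of_nonneg_right hrr hl.le
    linarith
  have e2 : |r / l - l / (-x)| ≤ C / (l * c * r₀) := by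
    have e3 : r / l - l / (-x) = (-x - l ^ 2 / r) * (r / (l * -x)) := by
      have hx1 : -x ≠ 0 := hxp.ne'
      generalize -x = t at hx1
      field_simp
    rw [e3, abs_mul, abs_of_pos (by positivity : 0 < r / (l * -x))]
    calc |-x - l ^ 2 / r| * (r / (l * -x)) ≤ C / r ^ 3 * (r / (l * (c / r))) := by
          gcongr
      _ = C / (l * c * r) := by field_simp
      _ ≤ C / (l * c * r₀) := by gcongr
  calc |potB M l x - l / (-x)| = |(potB M l x - r / l) + (r / l - l / (-x))| := by ring_nf
    _ ≤ _ := (abs_add_le _ _).trans (add_le_add e1 e2)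

theorem admissible_potential (hM : 0 < M) (hl : 0 < l) {m : ℝ} (hm : 0 < m) (c : ℝ) :
    Admissible (fun x => c * potA M l x) (fun x => m * potB M l x) (m * l)
      (surfaceGravity M l) where
  ν_pos := by positivity
  κ_pos := surfaceGravity_pos hM hl
  cont_a := continuousOn_const.mul (continuousOn_potA hM hl)
  cont_b := continuousOn_const.mul (continuousOn_potB hM hl)
  a_bdd := ⟨|c| * √(1 / horizon M l ^ 2 + 1 / l ^ 2), fun x hx => by
    rw [abs_mul]
    exact mul_le_mul_of_nonneg_left (abs_potA_le hM hl hx).1 (abs_nonneg c)⟩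
  b_zero := by
    obtain ⟨C, hC⟩ := exists_abs_potB_sub_le hM hl
    refine ⟨m * C, fun x hx => ?_⟩
    rw [mul_div_assoc, ← mul_sub, abs_mul, abs_of_pos hm]
    exact mul_le_mul_of_nonneg_left (hC x hx) hm.le
  decay := by
    intro k hk
    obtain ⟨C, hC⟩ := exists_potB_le_exp hM hl hk
    have h0 := horizon_pos hM hl
    refine ⟨max (|c| * ((horizon M l)⁻¹ * C)) (m * C), fun x hx => ⟨?_, ?_⟩⟩
    · rw [abs_mul]
      calc |c| * |potA M l x| ≤ |c| * ((horizon M l)⁻¹ * (C * Real.exp (k * x))) := by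
            gcongr
            exact (abs_potA_le hM hl (by linarith)).2.trans
              (mul_le_mul_of_nonneg_left (hC x hx) (inv_pos.2 h0).le)
        _ = |c| * ((horizon M l)⁻¹ * C) * Real.exp (k * x) := by ring
        _ ≤ _ := mul_le_mul_of_nonneg_right (le_max_left _ _) (Real.exp_pos _).le
    · rw [abs_mul, abs_of_pos hm, abs_of_nonneg (potB_nonneg M l x)]
      calc m * potB M l x ≤ m * (C * Real.exp (k * x)) := by
            gcongr
            exact hC x hx
        _ = m * C * Real.exp (k * x) := by ring
        _ ≤ _ := mul_le_mul_of_nonneg_right (le_max_right _ _) (Real.exp_pos _).le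

end

end SAdS

open MeasureTheory Set Filter Topology Asymptotics

namespace SAdS

noncomputable section

/-! ### Spinor form of the equation -/

theorem act_apply (T : Mat4) (v : Spinor) (i : Fin 4) : act T v i = ∑ j, T i j * v j := by
  simp only [act]
  rw [Matrix.ofLp_toEuclideanCLM]
  rfl

theorem spinor_ext {v w : Spinor} (h0 : v 0 = w 0) (h1 : v 1 = w 1) (h2 : v 2 = w 2)
    (h3 : v 3 = w 3) : v = w := by
  ext i
  fin_cases i <;> assumption

theorem tilde_apply (v : Spinor) :
    tilde v 0 = -v 3 ∧ tilde v 1 = v 2 ∧ tilde v 2 = v 1 ∧ tilde v 3 = -v 0 := by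
  refine ⟨?_, ?_, ?_, ?_⟩ <;>
  · rw [tilde, act_apply]
    simp [Fin.sum_univ_four, γ0, γ1, γ2]

theorem norm_spinor_sq (v : Spinor) : ‖v‖ ^ 2 = ‖v 0‖ ^ 2 + ‖v 1‖ ^ 2 + ‖v 2‖ ^ 2 + ‖v 3‖ ^ 2 := by
  rw [EuclideanSpace.norm_sq_eq, Fin.sum_univ_four]

theorem norm_tilde (v : Spinor) : ‖tilde v‖ = ‖v‖ := by
  obtain ⟨h0, h1, h2, h3⟩ := tilde_apply v
  have : ‖tilde v‖ ^ 2 = ‖v‖ ^ 2 := by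
    rw [norm_spinor_sq, norm_spinor_sq, h0, h1, h2, h3, norm_neg, norm_neg]
    ring
  exact (sq_eq_sq₀ (norm_nonneg _) (norm_nonneg _)).1 this

theorem hasDerivAt_spinor_iff {w : ℝ → Spinor} {d : Spinor} {x : ℝ} :
    HasDerivAt w d x ↔ ∀ i, HasDerivAt (fun y => w y i) (d i) x := by
  constructor
  · intro h i
    exact ((PiLp.proj (𝕜 := ℝ) 2 (fun _ : Fin 4 => ℂ) i).hasFDerivAt (x := w x)).comp_hasDerivAt x h
  · intro h
    have h1 : HasDerivAt (fun y => (fun i => w y i)) (fun i => d i) x := hasDerivAt_pi.2 h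
    exact ((PiLp.continuousLinearEquiv 2 ℝ (fun _ : Fin 4 => ℂ)).symm.hasFDerivAt
      (x := fun i => w x i)).comp_hasDerivAt x h1

theorem forall_fin_four {P : Fin 4 → Prop} : (∀ i, P i) ↔ P 0 ∧ P 1 ∧ P 2 ∧ P 3 := by
  constructor
  · exact fun h => ⟨h 0, h 1, h 2, h 3⟩
  · rintro ⟨h0, h1, h2, h3⟩ i
    fin_cases i <;> assumption

/-- The matrix `N` of the equation `w' = N w`, equivalent to `H w = z w`. -/
def flowMat (a b : ℝ) (z : ℂ) : Mat4 :=
  !![Complex.I * z, Complex.I * a, -b, 0; -(Complex.I * a), -(Complex.I * z), 0, b;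
    -b, 0, -(Complex.I * z), Complex.I * a; 0, b, -(Complex.I * a), Complex.I * z]

theorem act_flowMat (a b : ℝ) (z : ℂ) (v : Spinor) :
    act (flowMat a b z) v 0 = Complex.I * z * v 0 + Complex.I * a * v 1 - b * v 2 ∧
    act (flowMat a b z) v 1 = -(Complex.I * a * v 0) - Complex.I * z * v 1 + b * v 3 ∧
    act (flowMat a b z) v 2 = -(b * v 0) - Complex.I * z * v 2 + Complex.I * a * v 3 ∧
    act (flowMat a b z) v 3 = b * v 1 - Complex.I * a * v 2 + Complex.I * z * v 3 := by
  refine ⟨?_, ?_, ?_, ?_⟩ <;>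
  · rw [act_apply]
    simp [Fin.sum_univ_four, flowMat]
    try ring

theorem act_I_Γ1 (v : Spinor) :
    act (Complex.I • Γ1) v 0 = Complex.I * v 0 ∧ act (Complex.I • Γ1) v 1 = -(Complex.I * v 1) ∧
    act (Complex.I • Γ1) v 2 = -(Complex.I * v 2) ∧ act (Complex.I • Γ1) v 3 = Complex.I * v 3 := by
  refine ⟨?_, ?_, ?_, ?_⟩ <;>
  · rw [act_apply]
    simp [Fin.sum_univ_four, Γ1, γ0, γ1]

theorem diracExpr_apply (M l m s x : ℝ) (v v' : Spinor) :
    diracExpr M l m s x v v' 0 = -(Complex.I * v' 0) - ((s + 1 / 2) * potA M l x : ℝ) * v 1 -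
      Complex.I * (m * potB M l x : ℝ) * v 2 ∧
    diracExpr M l m s x v v' 1 = Complex.I * v' 1 - ((s + 1 / 2) * potA M l x : ℝ) * v 0 -
      Complex.I * (m * potB M l x : ℝ) * v 3 ∧
    diracExpr M l m s x v v' 2 = Complex.I * v' 2 + ((s + 1 / 2) * potA M l x : ℝ) * v 3 +
      Complex.I * (m * potB M l x : ℝ) * v 0 ∧
    diracExpr M l m s x v v' 3 = -(Complex.I * v' 3) + ((s + 1 / 2) * potA M l x : ℝ) * v 2 +
      Complex.I * (m * potB M l x : ℝ) * v 1 := by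
  generalize hA : (s + 1 / 2) * potA M l x = A
  generalize hB : m * potB M l x = B
  refine ⟨?_, ?_, ?_, ?_⟩ <;>
  · rw [diracExpr, PiLp.add_apply, act_apply, act_apply, potV, hA, hB]
    simp [Fin.sum_univ_four, γ0, γ1, γ2]
    try ring

/-- The leading coefficient `iγ⁰γ¹ = -iΓ¹` has inverse `iΓ¹`, since `Γ¹` squares to `1`. This turns
the operator equation into a first order system with source `iΓ¹ f`. -/
theorem diracExpr_eq_iff (M l m s x : ℝ) (z : ℂ) (v v' f : Spinor) :
    diracExpr M l m s x v v' = z • v + f ↔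
      v' = act (flowMat ((s + 1 / 2) * potA M l x) (m * potB M l x) z) v +
        act (Complex.I • Γ1) f := by
  obtain ⟨d0, d1, d2, d3⟩ := diracExpr_apply M l m s x v v'
  obtain ⟨n0, n1, n2, n3⟩ := act_flowMat ((s + 1 / 2) * potA M l x) (m * potB M l x) z v
  obtain ⟨g0, g1, g2, g3⟩ := act_I_Γ1 f
  have hI := Complex.I_mul_I
  constructor
  · intro h
    have e0 := congrArg (fun u : Spinor => u 0) h
    have e1 := congrArg (fun u : Spinor => u 1) h
    have e2 := congrArg (fun u : Spinor => u 2) h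
    have e3 := congrArg (fun u : Spinor => u 3) h
    simp only [PiLp.add_apply, PiLp.smul_apply, smul_eq_mul, d0, d1, d2, d3] at e0 e1 e2 e3
    apply spinor_ext <;> rw [PiLp.add_apply]
    · rw [n0, g0]
      linear_combination Complex.I * e0 + (v' 0 + (m * potB M l x : ℝ) * v 2) * hI
    · rw [n1, g1]
      linear_combination -Complex.I * e1 + (v' 1 - (m * potB M l x : ℝ) * v 3) * hI
    · rw [n2, g2]
      linear_combination -Complex.I * e2 + (v' 2 + (m * potB M l x : ℝ) * v 0) * hI
    · rw [n3, g3]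
      linear_combination Complex.I * e3 + (v' 3 - (m * potB M l x : ℝ) * v 1) * hI
  · intro h
    have e0 := congrArg (fun u : Spinor => u 0) h
    have e1 := congrArg (fun u : Spinor => u 1) h
    have e2 := congrArg (fun u : Spinor => u 2) h
    have e3 := congrArg (fun u : Spinor => u 3) h
    simp only [PiLp.add_apply, n0, n1, n2, n3, g0, g1, g2, g3] at e0 e1 e2 e3
    apply spinor_ext <;> rw [PiLp.add_apply, PiLp.smul_apply, smul_eq_mul]
    · rw [d0, e0]
      linear_combination (-(z * v 0) - ((s + 1 / 2) * potA M l x : ℝ) * v 1 - f 0) * hI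
    · rw [d1, e1]
      linear_combination (-(z * v 1) - ((s + 1 / 2) * potA M l x : ℝ) * v 0 - f 1) * hI
    · rw [d2, e2]
      linear_combination (-(z * v 2) + ((s + 1 / 2) * potA M l x : ℝ) * v 3 - f 2) * hI
    · rw [d3, e3]
      linear_combination (-(z * v 3) + ((s + 1 / 2) * potA M l x : ℝ) * v 2 - f 3) * hI

/-- Solutions of `w' = N w` on `]-∞, 0[`. -/
def IsFlowSol (a b : ℝ → ℝ) (z : ℂ) (w : ℝ → Spinor) : Prop :=
  ∀ x < 0, HasDerivAt w (act (flowMat (a x) (b x) z) (w x)) x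

theorem isSol_iff (M l m s : ℝ) (z : ℂ) (w : ℝ → Spinor) :
    IsSol M l m s z w ↔
      IsFlowSol (fun x => (s + 1 / 2) * potA M l x) (fun x => m * potB M l x) z w := by
  refine forall₂_congr fun x _ => ?_
  have h := diracExpr_eq_iff M l m s x z (w x) (deriv w x) 0
  have h0 : act (Complex.I • Γ1) 0 = 0 := by simp [act]
  rw [add_zero, h0, add_zero] at h
  rw [h]
  constructor
  · rintro ⟨h1, h2⟩
    rw [← h2]
    exact h1.hasDerivAt
  · intro h1
    exact ⟨h1.differentiableAt, h1.deriv⟩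

variable {a b : ℝ → ℝ} {z : ℂ} {w : ℝ → Spinor}

theorem IsFlowSol.apply (h : IsFlowSol a b z w) {x : ℝ} (hx : x < 0) :
    HasDerivAt (fun x => w x 0)
      (Complex.I * z * w x 0 + Complex.I * a x * w x 1 - b x * w x 2) x ∧
    HasDerivAt (fun x => w x 1)
      (-(Complex.I * a x * w x 0) - Complex.I * z * w x 1 + b x * w x 3) x ∧
    HasDerivAt (fun x => w x 2)
      (-(b x * w x 0) - Complex.I * z * w x 2 + Complex.I * a x * w x 3) x ∧
    HasDerivAt (fun x => w x 3)
      (b x * w x 1 - Complex.I * a x * w x 2 + Complex.I * z * w x 3) x := by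
  have h1 := hasDerivAt_spinor_iff.1 (h x hx)
  obtain ⟨n0, n1, n2, n3⟩ := act_flowMat (a x) (b x) z (w x)
  exact ⟨n0 ▸ h1 0, n1 ▸ h1 1, n2 ▸ h1 2, n3 ▸ h1 3⟩

theorem IsFlowSol.add {w' : ℝ → Spinor} (h : IsFlowSol a b z w) (h' : IsFlowSol a b z w') :
    IsFlowSol a b z fun x => w x + w' x := fun x hx => by
  have := (h x hx).fun_add (h' x hx)
  simpa [act] using this

theorem IsFlowSol.smul (h : IsFlowSol a b z w) (c : ℂ) :
    IsFlowSol a b z fun x => c • w x := fun x hx => by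
  have := (h x hx).fun_const_smul c
  simpa [act] using this

/-- This symmetry makes `tilde` of a solution a solution, and is what splits the system into two
pairs. -/
theorem act_flowMat_tilde (a b : ℝ) (z : ℂ) (v : Spinor) :
    act (flowMat a b z) (tilde v) = tilde (act (flowMat a b z) v) := by
  obtain ⟨n0, n1, n2, n3⟩ := act_flowMat a b z v
  obtain ⟨k0, k1, k2, k3⟩ := act_flowMat a b z (tilde v)
  obtain ⟨t0, t1, t2, t3⟩ := tilde_apply v
  obtain ⟨s0, s1, s2, s3⟩ := tilde_apply (act (flowMat a b z) v)
  apply spinor_ext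
  · rw [k0, s0, n3, t0, t1, t2]; ring
  · rw [k1, s1, n2, t0, t1, t3]; ring
  · rw [k2, s2, n1, t0, t2, t3]; ring
  · rw [k3, s3, n0, t1, t2, t3]; ring

theorem IsFlowSol.tilde (h : IsFlowSol a b z w) : IsFlowSol a b z fun x => tilde (w x) := by
  intro x hx
  have h1 : HasDerivAt (fun y => SAdS.tilde (w y))
      (SAdS.tilde (act (flowMat (a x) (b x) z) (w x))) x := by
    rw [hasDerivAt_spinor_iff, forall_fin_four]
    obtain ⟨h0, h1, h2, h3⟩ := forall_fin_four.1 (hasDerivAt_spinor_iff.1 (h x hx))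
    have e := fun v : Spinor => tilde_apply v
    simp only [fun v : Spinor => (e v).1, fun v : Spinor => (e v).2.1,
      fun v : Spinor => (e v).2.2.1, fun v : Spinor => (e v).2.2.2]
    exact ⟨h3.fun_neg, h2, h1, h0.fun_neg⟩
  exact act_flowMat_tilde (a x) (b x) z (w x) ▸ h1

/-- The spinor `(p, σ q, q, -σ p)`; for `σ = ±1` these are the eigenvectors of `tilde`. -/
def pairSpinor (σ : ℝ) (p q : ℂ) : Spinor := !₂[p, σ * q, q, -(σ * p)]

theorem pairSpinor_apply (σ : ℝ) (p q : ℂ) :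
    pairSpinor σ p q 0 = p ∧ pairSpinor σ p q 1 = σ * q ∧ pairSpinor σ p q 2 = q ∧
      pairSpinor σ p q 3 = -(σ * p) := ⟨rfl, rfl, rfl, rfl⟩

/-- The system restricted to the eigenspace of `tilde` for the eigenvalue `σ`; the sign of the
eigenvalue only enters through `a`. -/
theorem IsPairSol.isFlowSol {σ : ℝ} (hσ : σ ^ 2 = 1) {p q : ℝ → ℂ}
    (h : IsPairSol (fun x => σ * a x) b z p q) :
    IsFlowSol a b z fun x => pairSpinor σ (p x) (q x) := by
  intro x hx
  obtain ⟨dp, dq⟩ := h x hx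
  rw [hasDerivAt_spinor_iff, forall_fin_four]
  obtain ⟨n0, n1, n2, n3⟩ := act_flowMat (a x) (b x) z (pairSpinor σ (p x) (q x))
  have hs : (σ : ℂ) ^ 2 = 1 := by exact_mod_cast hσ
  rw [n0, n1, n2, n3]
  simp only [pairSpinor_apply]
  push_cast at dp dq
  refine ⟨dp.congr_deriv ?_, (dq.const_mul (σ : ℂ)).congr_deriv ?_, dq.congr_deriv ?_,
    (dp.const_mul (σ : ℂ)).fun_neg.congr_deriv ?_⟩
  · ring
  · linear_combination (-(Complex.I * a x * p x)) * hs
  · ring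
  · linear_combination (-(Complex.I * a x * q x)) * hs

end

end SAdS

open MeasureTheory Set Filter Topology Asymptotics

namespace SAdS

noncomputable section

/-! ### A priori bounds -/

theorem two_mul_re_im_le (u v : ℂ) :
    |2 * (u.re * v.im - u.im * v.re)| ≤ ‖u‖ ^ 2 + ‖v‖ ^ 2 ∧
      |2 * (u.re * v.re + u.im * v.im)| ≤ ‖u‖ ^ 2 + ‖v‖ ^ 2 := by
  rw [Complex.sq_norm, Complex.sq_norm, Complex.normSq_apply, Complex.normSq_apply]
  constructor <;> rw [abs_le] <;> constructor
  · nlinarith [sq_nonneg (u.re + v.im), sq_nonneg (u.im - v.re)]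
  · nlinarith [sq_nonneg (u.re - v.im), sq_nonneg (u.im + v.re)]
  · nlinarith [sq_nonneg (u.re + v.re), sq_nonneg (u.im + v.im)]
  · nlinarith [sq_nonneg (u.re - v.re), sq_nonneg (u.im - v.im)]

/-- The real part of `z` contributes an anti-Hermitian matrix and drops out, so the growth bounds
derived from this depend on `z` only through `Im z`. -/
theorem abs_re_inner_flowMat_le (a b : ℝ) (z : ℂ) (v : Spinor) :
    |(inner ℂ v (act (flowMat a b z) v)).re| ≤ (|z.im| + |a| + |b|) * ‖v‖ ^ 2 := by
  obtain ⟨n0, n1, n2, n3⟩ := act_flowMat a b z v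
  have h1 := (two_mul_re_im_le (v 0) (v 1)).1
  have h2 := (two_mul_re_im_le (v 2) (v 3)).1
  have h3 := (two_mul_re_im_le (v 0) (v 2)).2
  have h4 := (two_mul_re_im_le (v 1) (v 3)).2
  set X := ‖v 0‖ ^ 2 - ‖v 1‖ ^ 2 - ‖v 2‖ ^ 2 + ‖v 3‖ ^ 2 with hX
  set Y₁ := 2 * ((v 0).re * (v 1).im - (v 0).im * (v 1).re)
  set Y₂ := 2 * ((v 2).re * (v 3).im - (v 2).im * (v 3).re)
  set Z₁ := 2 * ((v 0).re * (v 2).re + (v 0).im * (v 2).im)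
  set Z₂ := 2 * ((v 1).re * (v 3).re + (v 1).im * (v 3).im)
  have key : (inner ℂ v (act (flowMat a b z) v)).re =
      -(z.im * X) - a * (Y₁ + Y₂) - b * (Z₁ - Z₂) := by
    rw [PiLp.inner_apply, Fin.sum_univ_four, n0, n1, n2, n3, hX]
    simp only [RCLike.inner_apply, Complex.sq_norm, Complex.normSq_apply]
    simp [Y₁, Y₂, Z₁, Z₂]
    ring
  have hX' : |X| ≤ ‖v‖ ^ 2 := by
    rw [norm_spinor_sq, abs_le]
    constructor <;> nlinarith [sq_nonneg ‖v 0‖, sq_nonneg ‖v 1‖, sq_nonneg ‖v 2‖, sq_nonneg ‖v 3‖]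
  have hY : |Y₁ + Y₂| ≤ ‖v‖ ^ 2 := by
    rw [norm_spinor_sq]
    linarith [abs_add_le Y₁ Y₂]
  have hZ : |Z₁ - Z₂| ≤ ‖v‖ ^ 2 := by
    rw [norm_spinor_sq]
    linarith [abs_sub Z₁ Z₂]
  rw [key]
  calc |-(z.im * X) - a * (Y₁ + Y₂) - b * (Z₁ - Z₂)|
      ≤ |z.im * X| + |a * (Y₁ + Y₂)| + |b * (Z₁ - Z₂)| := by
        refine (abs_sub _ _).trans (add_le_add_left ((abs_sub _ _).trans ?_) _)
        rw [abs_neg]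
    _ ≤ |z.im| * ‖v‖ ^ 2 + |a| * ‖v‖ ^ 2 + |b| * ‖v‖ ^ 2 := by
        rw [abs_mul, abs_mul, abs_mul]
        gcongr
    _ = _ := by ring

variable {a b : ℝ → ℝ} {z : ℂ} {w : ℝ → Spinor}

theorem IsFlowSol.hasDerivAt_norm_sq (h : IsFlowSol a b z w) {x : ℝ} (hx : x < 0) :
    HasDerivAt (fun x => ‖w x‖ ^ 2) (2 * (inner ℂ (w x) (act (flowMat (a x) (b x) z) (w x))).re)
      x := by
  have h1 := (h x hx).inner ℂ (h x hx)
  have h2 := Complex.reCLM.hasFDerivAt.comp_hasDerivAt x h1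
  have e : (fun x => ‖w x‖ ^ 2) = Complex.reCLM ∘ fun x => inner ℂ (w x) (w x) := by
    ext y
    rw [Function.comp_apply, Complex.reCLM_apply]
    exact (inner_self_eq_norm_sq (𝕜 := ℂ) (w y)).symm
  rw [e]
  refine h2.congr_deriv ?_
  rw [Complex.reCLM_apply, Complex.add_re, ← inner_conj_symm (act _ _) (w x), Complex.conj_re]
  ring

/-- Gronwall's inequality in both directions. -/
theorem IsFlowSol.norm_le_exp (h : IsFlowSol a b z w) {g g' : ℝ → ℝ} {x y : ℝ} (hxy : x ≤ y)
    (hy : y < 0) (hg : ∀ u ∈ Icc x y, HasDerivAt g (g' u) u)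
    (hg' : ∀ u ∈ Icc x y, |z.im| + |a u| + |b u| ≤ g' u) :
    ‖w y‖ ≤ ‖w x‖ * Real.exp (g y - g x) ∧ ‖w x‖ ≤ ‖w y‖ * Real.exp (g y - g x) := by
  set D : ℝ → ℝ := fun u => 2 * (inner ℂ (w u) (act (flowMat (a u) (b u) z) (w u))).re with hD
  have hd : ∀ u ∈ Icc x y, HasDerivAt (fun u => ‖w u‖ ^ 2) (D u) u := fun u hu =>
    h.hasDerivAt_norm_sq (lt_of_le_of_lt hu.2 hy)
  have hb : ∀ u ∈ Icc x y, |D u| ≤ 2 * g' u * ‖w u‖ ^ 2 := by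
    intro u hu
    rw [hD, abs_mul, abs_two, mul_assoc]
    refine mul_le_mul_of_nonneg_left ((abs_re_inner_flowMat_le _ _ _ _).trans ?_) zero_le_two
    exact mul_le_mul_of_nonneg_right (hg' u hu) (sq_nonneg _)
  have hfin : ∀ {s t c : ℝ}, 0 ≤ s → 0 ≤ t → s ^ 2 ≤ t ^ 2 * Real.exp (2 * c) →
      s ≤ t * Real.exp c := by
    intro s t c hs ht hst
    refine abs_le_of_sq_le_sq' ?_ (by positivity) |>.2
    rwa [mul_pow, ← Real.exp_nat_mul]
  constructor
  · have hanti : AntitoneOn (fun u => ‖w u‖ ^ 2 * Real.exp (-(2 * g u))) (Icc x y) := by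
      have hd' : ∀ u ∈ Icc x y, HasDerivAt (fun u => ‖w u‖ ^ 2 * Real.exp (-(2 * g u)))
          (D u * Real.exp (-(2 * g u)) + ‖w u‖ ^ 2 *
            (Real.exp (-(2 * g u)) * -(2 * g' u))) u := fun u hu =>
        (hd u hu).fun_mul (((hg u hu).const_mul 2).fun_neg.exp)
      refine antitoneOn_of_deriv_nonpos (convex_Icc x y)
        (fun u hu => (hd' u hu).continuousAt.continuousWithinAt)
        (fun u hu => (hd' u (interior_subset hu)).differentiableAt.differentiableWithinAt) ?_
      intro u hu
      rw [(hd' u (interior_subset hu)).deriv]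
      have h1 := (abs_le.1 (hb u (interior_subset hu))).2
      have h2 := Real.exp_pos (-(2 * g u))
      nlinarith
    have := hanti ⟨le_rfl, hxy⟩ ⟨hxy, le_rfl⟩ hxy
    refine hfin (norm_nonneg _) (norm_nonneg _) ?_
    have h2 := mul_le_mul_of_nonneg_right this (Real.exp_pos (2 * g y)).le
    simp only [mul_assoc, ← Real.exp_add] at h2
    rw [neg_add_cancel, Real.exp_zero, mul_one] at h2
    rwa [show 2 * (g y - g x) = -(2 * g x) + 2 * g y by ring]
  · have hmono : MonotoneOn (fun u => ‖w u‖ ^ 2 * Real.exp (2 * g u)) (Icc x y) := by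
      have hd' : ∀ u ∈ Icc x y, HasDerivAt (fun u => ‖w u‖ ^ 2 * Real.exp (2 * g u))
          (D u * Real.exp (2 * g u) + ‖w u‖ ^ 2 *
            (Real.exp (2 * g u) * (2 * g' u))) u := fun u hu =>
        (hd u hu).fun_mul (((hg u hu).const_mul 2).exp)
      refine monotoneOn_of_deriv_nonneg (convex_Icc x y)
        (fun u hu => (hd' u hu).continuousAt.continuousWithinAt)
        (fun u hu => (hd' u (interior_subset hu)).differentiableAt.differentiableWithinAt) ?_
      intro u hu
      rw [(hd' u (interior_subset hu)).deriv]
      have h1 := (abs_le.1 (hb u (interior_subset hu))).1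
      have h2 := Real.exp_pos (2 * g u)
      nlinarith
    have := hmono ⟨le_rfl, hxy⟩ ⟨hxy, le_rfl⟩ hxy
    refine hfin (norm_nonneg _) (norm_nonneg _) ?_
    have h2 := mul_le_mul_of_nonneg_right this (Real.exp_pos (-(2 * g x))).le
    simp only [mul_assoc, ← Real.exp_add] at h2
    rw [add_neg_cancel, Real.exp_zero, mul_one] at h2
    rwa [show 2 * (g y - g x) = 2 * g y + -(2 * g x) by ring]

/-- Two-sided Gronwall on compact intervals: a zero propagates to the right and to the left. -/
theorem IsFlowSol.eq_zero_of_eq_zero (ha : ContinuousOn a (Iio 0)) (hb : ContinuousOn b (Iio 0))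
    (h : IsFlowSol a b z w) {x₀ : ℝ} (hx₀ : x₀ < 0) (h0 : w x₀ = 0) : ∀ x < 0, w x = 0 := by
  have key : ∀ x y : ℝ, x ≤ y → y < 0 → (w x = 0 ↔ w y = 0) := by
    intro x y hxy hy
    have hsub : Icc x y ⊆ Iio 0 := fun u hu => lt_of_le_of_lt hu.2 hy
    obtain ⟨Ca, hCa⟩ := isCompact_Icc.exists_bound_of_continuousOn (ha.mono hsub)
    obtain ⟨Cb, hCb⟩ := isCompact_Icc.exists_bound_of_continuousOn (hb.mono hsub)
    have := h.norm_le_exp (g := fun u => (|z.im| + Ca + Cb) * u) (g' := fun _ => |z.im| + Ca + Cb)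
      hxy hy (fun u _ => by simpa using (hasDerivAt_id u).const_mul (|z.im| + Ca + Cb))
      (fun u hu => add_le_add (add_le_add le_rfl (hCa u hu)) (hCb u hu))
    constructor
    · intro h1
      have h2 := this.1
      rw [h1, norm_zero, zero_mul] at h2
      exact norm_le_zero_iff.1 h2
    · intro h1
      have h2 := this.2
      rw [h1, norm_zero, zero_mul] at h2
      exact norm_le_zero_iff.1 h2
  intro x hx
  rcases le_total x x₀ with hle | hle
  · exact (key x x₀ hle hx₀).2 h0
  · exact (key x₀ x hle hx).1 h0

variable {ν κ : ℝ}

/-- Every solution is `O((-x)^{-ν})` at `0`. -/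
theorem Admissible.exists_norm_le_zero (hab : Admissible a b ν κ) :
    ∃ C, ∀ (z : ℂ) (w : ℝ → Spinor), IsFlowSol a b z w → ∀ x ∈ Ico (-1 : ℝ) 0,
      ‖w x‖ ≤ ‖w (-1)‖ * Real.exp (|z.im| + C) * (-x) ^ (-ν) := by
  obtain ⟨Ca, hCa⟩ := hab.a_bdd
  obtain ⟨Cb, hCb⟩ := hab.b_zero
  have hCa0 : 0 ≤ Ca := (abs_nonneg _).trans (hCa (-1) (by norm_num))
  have hCb0 : 0 ≤ Cb := (abs_nonneg _).trans (hCb (-1) (by norm_num))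
  have hν := hab.ν_pos
  refine ⟨Ca + Cb, fun z w h x hx => ?_⟩
  set K := |z.im| + (Ca + Cb) with hK
  have hK0 : 0 ≤ K := by positivity
  -- This `g` is a primitive of `ν / (-u) + K`; its logarithm is what produces the power
  -- `(-x)^{-ν}`.
  have := (h.norm_le_exp (g := fun u => -(ν * Real.log (-u)) + K * u)
    (g' := fun u => ν / (-u) + K) hx.1 hx.2 ?_ ?_).1
  · refine this.trans ?_
    rw [mul_assoc]
    refine mul_le_mul_of_nonneg_left ?_ (norm_nonneg _)
    rw [neg_neg, Real.log_one, ← exp_mul_log_neg hx.2, ← Real.exp_add, Real.exp_le_exp]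
    nlinarith [hx.2]
  · intro u hu
    have hu0 : u < 0 := lt_of_le_of_lt hu.2 hx.2
    have d1 := ((hasDerivAt_neg u).log (by linarith : -u ≠ 0)).const_mul ν
    have d2 := d1.fun_neg.fun_add ((hasDerivAt_id u).const_mul K)
    refine d2.congr_deriv ?_
    rw [neg_div, mul_neg, neg_neg, mul_one, mul_one_div]
  · intro u hu
    have hu0 : u < 0 := lt_of_le_of_lt hu.2 hx.2
    have h1 := hCa u hu0
    have h2 := hCb u ⟨hu.1, hu0⟩
    have h3 : |b u| ≤ ν / (-u) + Cb := by
      have h4 : 0 ≤ ν / (-u) := div_nonneg hν.le (by linarith)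
      rw [abs_le] at h2 ⊢
      constructor <;> linarith [h2.1, h2.2]
    simp only [hK]
    linarith

/-- Every solution is `O(e^{|Im z| |x|})` at `-∞`. -/
theorem Admissible.exists_norm_le_neg (hab : Admissible a b ν κ) :
    ∃ C, ∀ (z : ℂ) (w : ℝ → Spinor), IsFlowSol a b z w → ∀ x ≤ -1,
      ‖w x‖ ≤ C * ‖w (-1)‖ * Real.exp (-(|z.im| * x)) := by
  have hκ := hab.κ_pos
  obtain ⟨C, hC⟩ := hab.decay (κ / 2) (by linarith)
  have hC0 : 0 ≤ C := by
    have := (abs_nonneg _).trans (hC (-1) le_rfl).1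
    exact nonneg_of_mul_nonneg_left this (Real.exp_pos _)
  refine ⟨Real.exp (4 * C / κ), fun z w h x hx => ?_⟩
  -- The potentials contribute a bounded primitive, so they cost only the constant `e^{4C/κ}`.
  have := (h.norm_le_exp (g := fun u => |z.im| * u + 4 * C / κ * Real.exp (κ / 2 * u))
    (g' := fun u => |z.im| + 2 * C * Real.exp (κ / 2 * u)) hx (by norm_num) ?_ ?_).2
  · refine this.trans ?_
    rw [mul_comm (Real.exp (4 * C / κ)), mul_assoc, ← Real.exp_add]
    refine mul_le_mul_of_nonneg_left (Real.exp_le_exp.2 ?_) (norm_nonneg _)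
    have h1 : Real.exp (κ / 2 * -1) ≤ 1 := Real.exp_le_one_iff.2 (by linarith)
    have h2 : 0 ≤ 4 * C / κ := by positivity
    have h3 := mul_le_mul_of_nonneg_left h1 h2
    have h4 := mul_nonneg h2 (Real.exp_pos (κ / 2 * x)).le
    have h5 := abs_nonneg z.im
    linarith
  · intro u _
    have d1 := ((hasDerivAt_id u).const_mul (κ / 2)).exp.const_mul (4 * C / κ)
    refine (((hasDerivAt_id u).const_mul |z.im|).fun_add d1).congr_deriv ?_
    simp only [id]
    field_simp
    ring
  · intro u hu
    obtain ⟨h1, h2⟩ := hC u hu.2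
    linarith

/-! ### Wronskians -/

/-- Both antisymmetric forms are preserved by the flow: differentiating and inserting the equations
cancels every term. -/
theorem alphaW_const {φ ψ : ℝ → Spinor} (hφ : IsFlowSol a b z φ) (hψ : IsFlowSol a b z ψ)
    {x y : ℝ} (hx : x < 0) (hy : y < 0) : alphaW (φ x) (ψ x) = alphaW (φ y) (ψ y) ∧
      betaW (φ x) (ψ x) = betaW (φ y) (ψ y) := by
  have hα : ∀ u < 0, HasDerivAt (fun u => alphaW (φ u) (ψ u)) 0 u := by
    intro u hu
    obtain ⟨p0, p1, p2, p3⟩ := hφ.apply hu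
    obtain ⟨q0, q1, q2, q3⟩ := hψ.apply hu
    refine ((((p0.fun_mul q1).fun_sub (q0.fun_mul p1)).fun_add (p2.fun_mul q3)).fun_sub
      (q2.fun_mul p3)).congr_deriv ?_
    ring
  have hβ : ∀ u < 0, HasDerivAt (fun u => betaW (φ u) (ψ u)) 0 u := by
    intro u hu
    obtain ⟨p0, p1, p2, p3⟩ := hφ.apply hu
    obtain ⟨q0, q1, q2, q3⟩ := hψ.apply hu
    refine ((((p0.fun_mul q2).fun_sub (q0.fun_mul p2)).fun_add (p1.fun_mul q3)).fun_sub
      (q1.fun_mul p3)).congr_deriv ?_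
    ring
  exact ⟨isOpen_Iio.is_const_of_deriv_eq_zero isPreconnected_Iio
      (fun u hu => (hα u hu).differentiableAt.differentiableWithinAt)
      (fun u hu => (hα u hu).deriv) hx hy,
    isOpen_Iio.is_const_of_deriv_eq_zero isPreconnected_Iio
      (fun u hu => (hβ u hu).differentiableAt.differentiableWithinAt)
      (fun u hu => (hβ u hu).deriv) hx hy⟩

/-- Invertibility of `M_{α,β}` is thereby the condition `α² ≠ β²`, and the inverse is a matrix
linear in `α, β` divided by one scalar. The continuation uses this form: the only division is by `α²
- β²`. -/
theorem matM_mul_matM (α β : ℂ) : matM α β * matM (-α) β = (α ^ 2 - β ^ 2) • (1 : Mat4) := by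
  ext i j
  fin_cases i <;> fin_cases j <;>
    simp [matM, Matrix.mul_apply, Fin.sum_univ_four] <;> ring

theorem matM_inv {α β : ℂ} (h : α ^ 2 - β ^ 2 ≠ 0) :
    (matM α β)⁻¹ = (α ^ 2 - β ^ 2)⁻¹ • matM (-α) β := by
  refine Matrix.inv_eq_right_inv ?_
  rw [Matrix.mul_smul, matM_mul_matM, smul_smul, inv_mul_cancel₀ h, one_smul]

theorem isUnit_matM {α β : ℂ} (h : α ^ 2 - β ^ 2 ≠ 0) : IsUnit (matM α β) := by
  refine IsUnit.of_mul_eq_one ((α ^ 2 - β ^ 2)⁻¹ • matM (-α) β) ?_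
  rw [Matrix.mul_smul, matM_mul_matM, smul_smul, inv_mul_cancel₀ h, one_smul]

/-- The jump of the kernel on the diagonal. -/
theorem outer_sub_outer (φ ψ : Spinor) :
    (outer φ ψ + outer (tilde φ) (tilde ψ)) - (outer ψ φ + outer (tilde ψ) (tilde φ)) =
      matM (alphaW φ ψ) (betaW φ ψ) := by
  obtain ⟨p0, p1, p2, p3⟩ := tilde_apply φ
  obtain ⟨q0, q1, q2, q3⟩ := tilde_apply ψ
  ext i j
  fin_cases i <;> fin_cases j <;>
    simp [matM, outer, Matrix.vecMulVec_apply, p0, p1, p2, p3, q0, q1, q2, q3, alphaW, betaW] <;>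
    ring

end

end SAdS

open MeasureTheory Set Filter Topology Asymptotics

namespace SAdS

noncomputable section

/-! ### Locally absolutely continuous functions -/

/-- The increments of the primitive of `f` are bounded by those of the primitive of `‖f‖`, a real
function whose absolute continuity is known. -/
theorem absolutelyContinuousOnInterval_primitive {E : Type*} [NormedAddCommGroup E]
    [NormedSpace ℝ E] {f : ℝ → E} {a b c : ℝ} (h : IntervalIntegrable f volume a b)
    (hc : c ∈ uIcc a b) : AbsolutelyContinuousOnInterval (fun x => ∫ t in c..x, f t) a b := by
  have hG := h.norm.absolutelyContinuousOnInterval_intervalIntegral hc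
  rw [absolutelyContinuousOnInterval_iff] at hG ⊢
  intro ε hε
  obtain ⟨δ, hδ, H⟩ := hG ε hε
  refine ⟨δ, hδ, fun I hI hlt => lt_of_le_of_lt (Finset.sum_le_sum fun i hi => ?_) (H I hI hlt)⟩
  have hmem := hI.1 i hi
  have h_int : ∀ x ∈ uIcc a b, IntervalIntegrable f volume c x := fun x hx =>
    h.mono_set (uIcc_subset_uIcc hc hx)
  rw [dist_comm, dist_eq_norm, dist_comm, dist_eq_norm,
    intervalIntegral.integral_interval_sub_left (h_int _ hmem.2) (h_int _ hmem.1),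
    intervalIntegral.integral_interval_sub_left (h_int _ hmem.2).norm (h_int _ hmem.1).norm,
    Real.norm_eq_abs]
  exact intervalIntegral.norm_integral_le_abs_integral_norm

/-- `w` is locally absolutely continuous on `]-∞, 0[` with almost everywhere derivative `w'`. -/
def LocAC {E : Type*} [NormedAddCommGroup E] [NormedSpace ℝ E] (w w' : ℝ → E) : Prop :=
  ∀ a < 0, ∀ b < 0, IntervalIntegrable w' volume a b ∧ w b - w a = ∫ t in a..b, w' t

namespace LocAC

section

variable {E F : Type*} [NormedAddCommGroup E] [NormedSpace ℝ E] [NormedAddCommGroup F]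
  [NormedSpace ℝ F]

theorem clm_comp [CompleteSpace E] [CompleteSpace F] {w w' : ℝ → E} (h : LocAC w w')
    (L : E →L[ℝ] F) : LocAC (fun x => L (w x)) (fun x => L (w' x)) := by
  intro a ha b hb
  obtain ⟨h1, h2⟩ := h a ha b hb
  refine ⟨⟨L.integrable_comp h1.1, L.integrable_comp h1.2⟩, ?_⟩
  rw [L.intervalIntegral_comp_comm h1, ← h2, map_sub]

theorem add {w w' v v' : ℝ → E} (h : LocAC w w') (k : LocAC v v') :
    LocAC (fun x => w x + v x) (fun x => w' x + v' x) := by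
  intro a ha b hb
  obtain ⟨h1, h2⟩ := h a ha b hb
  obtain ⟨k1, k2⟩ := k a ha b hb
  refine ⟨h1.add k1, ?_⟩
  rw [intervalIntegral.integral_add h1 k1, ← h2, ← k2]
  exact add_sub_add_comm _ _ _ _

theorem sub {w w' v v' : ℝ → E} (h : LocAC w w') (k : LocAC v v') :
    LocAC (fun x => w x - v x) (fun x => w' x - v' x) := by
  intro a ha b hb
  obtain ⟨h1, h2⟩ := h a ha b hb
  obtain ⟨k1, k2⟩ := k a ha b hb
  refine ⟨h1.sub k1, ?_⟩
  rw [intervalIntegral.integral_sub h1 k1, ← h2, ← k2]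
  exact sub_sub_sub_comm _ _ _ _

theorem ae_uIoc_of_ae {P : ℝ → Prop} (h : ∀ᵐ x ∂(volume.restrict (Iio (0 : ℝ))), P x) {a b : ℝ}
    (ha : a < 0) (hb : b < 0) : ∀ᵐ x, x ∈ uIoc a b → P x := by
  rw [ae_restrict_iff' measurableSet_Iio] at h
  filter_upwards [h] with x hx hxab
  exact hx (lt_of_le_of_lt hxab.2 (max_lt ha hb))

theorem congr_ae {w w' v' : ℝ → E} (h : LocAC w w')
    (hv : ∀ᵐ x ∂(volume.restrict (Iio (0 : ℝ))), w' x = v' x) : LocAC w v' := by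
  intro a ha b hb
  obtain ⟨h1, h2⟩ := h a ha b hb
  have hae := ae_uIoc_of_ae hv ha hb
  refine ⟨h1.congr_ae ?_, h2.trans (intervalIntegral.integral_congr_ae hae)⟩
  exact (ae_restrict_iff' measurableSet_uIoc).2 hae

theorem congr_left {w v w' : ℝ → E} (h : LocAC w w') (hv : ∀ x < 0, v x = w x) : LocAC v w' := by
  intro a ha b hb
  rw [hv a ha, hv b hb]
  exact h a ha b hb

theorem of_hasDerivAt [CompleteSpace E] {w w' : ℝ → E} (h : ∀ x < 0, HasDerivAt w (w' x) x)
    (hc : ContinuousOn w' (Iio 0)) : LocAC w w' := by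
  intro a ha b hb
  have hsub : uIcc a b ⊆ Iio 0 := fun x hx => lt_of_le_of_lt hx.2 (max_lt ha hb)
  have hi : IntervalIntegrable w' volume a b := (hc.mono hsub).intervalIntegrable
  exact ⟨hi, (intervalIntegral.integral_eq_sub_of_hasDerivAt (fun x hx => h x (hsub hx)) hi).symm⟩

theorem continuousOn {w w' : ℝ → E} (h : LocAC w w') : ContinuousOn w (Iio 0) := by
  intro x hx
  have hx' : x < 0 := hx
  have hev : w =ᶠ[𝓝 x] fun b => w (x - 1) + ∫ t in (x - 1)..b, w' t := by
    filter_upwards [Iio_mem_nhds hx'] with b hb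
    rw [← (h (x - 1) (by linarith) b hb).2]
    abel
  have hc : ContinuousOn (fun b => ∫ t in (x - 1)..b, w' t) (uIcc (x - 1) (x / 2)) :=
    intervalIntegral.continuousOn_primitive_interval'
      (h (x - 1) (by linarith) (x / 2) (by linarith)).1 left_mem_uIcc
  have hmem : uIcc (x - 1) (x / 2) ∈ 𝓝 x := by
    rw [uIcc_of_le (by linarith)]
    exact Icc_mem_nhds (by linarith) (by linarith)
  exact ((continuousAt_const.add (hc.continuousAt hmem)).congr hev.symm).continuousWithinAt

end

variable {E : Type*} [NormedAddCommGroup E] [NormedSpace ℂ E] [CompleteSpace E]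

/-- The product minus the primitive of its expected derivative is absolutely continuous with
derivative zero almost everywhere, hence constant. -/
theorem smul {f f' : ℝ → ℂ} {w w' : ℝ → E} (hf : LocAC f f') (hw : LocAC w w') :
    LocAC (fun x => f x • w x) (fun x => f' x • w x + f x • w' x) := by
  intro a ha b hb
  obtain ⟨f1, f2⟩ := hf a ha b hb
  obtain ⟨w1, w2⟩ := hw a ha b hb
  have hsub : uIcc a b ⊆ Iio 0 := fun x hx => lt_of_le_of_lt hx.2 (max_lt ha hb)
  have hfc := hf.continuousOn.mono hsub
  have hwc := hw.continuousOn.mono hsub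
  have hi : IntervalIntegrable (fun x => f' x • w x + f x • w' x) volume a b :=
    (f1.smul_continuousOn hwc).add (w1.continuousOn_smul hfc)
  refine ⟨hi, ?_⟩
  set F : ℝ → ℂ := fun x => f a + ∫ t in a..x, f' t with hF
  set W : ℝ → E := fun x => w a + ∫ t in a..x, w' t with hW
  have hFf : ∀ x < 0, F x = f x := fun x hx => by
    simp only [hF, ← (hf a ha x hx).2]
    exact add_sub_cancel _ _
  have hWw : ∀ x < 0, W x = w x := fun x hx => by
    simp only [hW, ← (hw a ha x hx).2]
    exact add_sub_cancel _ _
  have hFa : AbsolutelyContinuousOnInterval F a b :=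
    (LipschitzWith.const (f a)).lipschitzOnWith.absolutelyContinuousOnInterval.fun_add
      (absolutelyContinuousOnInterval_primitive f1 left_mem_uIcc)
  have hWa : AbsolutelyContinuousOnInterval W a b :=
    (LipschitzWith.const (w a)).lipschitzOnWith.absolutelyContinuousOnInterval.fun_add
      (absolutelyContinuousOnInterval_primitive w1 left_mem_uIcc)
  have hD := (hFa.fun_smul hWa).fun_sub (absolutelyContinuousOnInterval_primitive hi left_mem_uIcc)
  obtain ⟨C, hC⟩ := hD.const_of_ae_hasDerivAt_zero (by
    filter_upwards [f1.ae_hasDerivAt_integral, w1.ae_hasDerivAt_integral,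
      hi.ae_hasDerivAt_integral] with x x1 x2 x3 hx
    have d1 := (x1 hx a left_mem_uIcc).const_add (f a)
    have d2 := (x2 hx a left_mem_uIcc).const_add (w a)
    have d3 := x3 hx a left_mem_uIcc
    refine ((d1.fun_smul d2).fun_sub d3).congr_deriv ?_
    have e1 := hFf x (hsub hx)
    have e2 := hWw x (hsub hx)
    simp only [hF, hW] at e1 e2
    rw [e1, e2]
    abel)
  have ea := hC a left_mem_uIcc
  have eb := hC b right_mem_uIcc
  simp only [hFf a ha, hFf b hb, hWw a ha, hWw b hb, intervalIntegral.integral_same, sub_zero]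
    at ea eb
  change f b • w b - f a • w a = _
  rw [ea, ← eb]
  abel

theorem mul {f f' g g' : ℝ → ℂ} (hf : LocAC f f') (hg : LocAC g g') :
    LocAC (fun x => f x * g x) (fun x => f' x * g x + f x * g' x) := hf.smul hg

theorem norm_sq {f f' : ℝ → ℂ} (hf : LocAC f f') :
    LocAC (fun x => ‖f x‖ ^ 2) (fun x => 2 * (starRingEnd ℂ (f x) * f' x).re) := by
  have h1 := ((hf.clm_comp Complex.conjCLE.toContinuousLinearMap).mul hf).clm_comp Complex.reCLM
  refine (h1.congr_left fun x _ => ?_).congr_ae (.of_forall fun x => ?_)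
  · simp only [ContinuousLinearEquiv.coe_coe, Complex.conjCLE_apply, Complex.reCLM_apply]
    rw [mul_comm, Complex.mul_conj, Complex.ofReal_re, Complex.normSq_eq_norm_sq]
  · simp [Complex.mul_re]
    ring

end LocAC

/-! ### Integrability and boundary values -/

/-- A function bounded below by `δ > 0` on a half line is not integrable. Boundary terms at `-∞`
need only vanish along a sequence, and this supplies it. -/
theorem exists_lt_of_integrableOn {g : ℝ → ℝ} (hg : IntegrableOn g (Iio 0)) {δ : ℝ} (hδ : 0 < δ)
    (x₀ : ℝ) : ∃ x < x₀, x < 0 ∧ |g x| < δ := by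
  by_contra! hcon
  set y := min x₀ 0 with hy
  have h1 : IntegrableOn (fun _ => δ) (Iio y) := by
    refine Integrable.mono' (hg.mono_set (Iio_subset_Iio (min_le_right _ _))).norm (by fun_prop) ?_
    filter_upwards [ae_restrict_mem measurableSet_Iio] with x hx
    rw [Real.norm_of_nonneg hδ.le]
    exact hcon x (lt_of_lt_of_le hx (min_le_left _ _)) (lt_of_lt_of_le hx (min_le_right _ _))
  rw [integrableOn_const_iff] at h1
  simp [hδ.ne'] at h1

/-- Otherwise `|g|` would dominate `δ / (-x)` near `0`, which is not integrable. Applied to `‖w‖²`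
it makes `√(-x) ‖w(x)‖` small along a sequence tending to `0`. -/
theorem exists_mul_lt_of_integrableOn {g : ℝ → ℝ} (hg : IntegrableOn g (Iio 0)) {δ : ℝ}
    (hδ : 0 < δ) {x₀ : ℝ} (hx₀ : x₀ < 0) : ∃ x ∈ Ioo x₀ 0, -x * |g x| < δ := by
  by_contra! hcon
  have h1 : IntegrableOn (fun x : ℝ => δ * x⁻¹) (Ioo x₀ 0) := by
    refine Integrable.mono' (hg.mono_set Ioo_subset_Iio_self).norm
      (by fun_prop) ?_
    filter_upwards [ae_restrict_mem measurableSet_Ioo] with x hx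
    have h2 := hcon x hx
    have hx0 : 0 < -x := by linarith [hx.2]
    rw [norm_mul, norm_inv, Real.norm_of_nonneg hδ.le, Real.norm_of_nonpos hx.2.le,
      ← div_eq_mul_inv, div_le_iff₀ hx0, mul_comm]
    exact h2
  have h2 : IntervalIntegrable (fun x : ℝ => x⁻¹) volume x₀ 0 := by
    rw [intervalIntegrable_iff_integrableOn_Ioo_of_le hx₀.le]
    have := h1.const_mul δ⁻¹
    refine this.congr (.of_forall fun x => ?_)
    simp only
    rw [inv_mul_cancel_left₀ hδ.ne']
  rw [intervalIntegrable_inv_iff] at h2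
  rcases h2 with h2 | h2
  · exact hx₀.ne h2
  · exact h2 right_mem_uIcc

end

end SAdS

open MeasureTheory Set Filter Topology Asymptotics

namespace SAdS

noncomputable section

/-! ### The energy estimate -/

variable {a b : ℝ → ℝ} {ν κ : ℝ} {z : ℂ}

theorem norm_spinor_apply_le (v : Spinor) (i : Fin 4) : ‖v i‖ ≤ ‖v‖ := PiLp.norm_apply_le v i

theorem LocAC.apply {w w' : ℝ → Spinor} (h : LocAC w w') (i : Fin 4) :
    LocAC (fun x => w x i) fun x => w' x i :=
  h.clm_comp (PiLp.proj (𝕜 := ℝ) 2 (fun _ : Fin 4 => ℂ) i)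

/-- The dominated component of a square integrable function with `V' = b V + g` is `O(√(-x))`. -/
theorem Admissible.exists_norm_le_sqrt (hab : Admissible a b ν κ) (hν : 1 ≤ 2 * ν)
    {V V' g : ℝ → ℂ} (hV : LocAC V V')
    (he : ∀ᵐ x ∂(volume.restrict (Iio (0 : ℝ))), V' x = b x * V x + g x)
    {h : ℝ → ℝ} (h2 : IntegrableOn (fun x => h x ^ 2) (Iio 0)) (hh : ∀ x, ‖V x‖ + ‖g x‖ ≤ h x) :
    ∃ C, 0 ≤ C ∧ ∀ x ∈ Ico (-1 : ℝ) 0, ‖V x‖ ≤ C * √(-x) := by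
  obtain ⟨Cb, hCb⟩ := hab.b_zero
  set C := max Cb 1
  have hC1 : 1 ≤ C := le_max_right _ _
  set K := ∫ x in Iio (0 : ℝ), h x ^ 2
  have hK : 0 ≤ K := integral_nonneg fun x => sq_nonneg _
  -- The integrating factor `(-x)^ν` cancels the singular part `ν / (-x)` of `b`; what remains of
  -- the derivative of `(-x)^ν V` is bounded by `(-x)^ν C h`.
  have hT : LocAC (fun x : ℝ => (((-x) ^ ν : ℝ) : ℂ)) (fun x => ((-(ν * (-x) ^ (ν - 1)) : ℝ) : ℂ)) := by
    refine LocAC.of_hasDerivAt (fun x hx => ?_) ?_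
    · have h1 := (Real.hasDerivAt_rpow_const (x := -x) (p := ν) (Or.inl (by linarith))).comp x
        (hasDerivAt_neg x)
      refine (h1.ofReal_comp).congr_deriv ?_
      simp
    · refine Complex.continuous_ofReal.comp_continuousOn ?_
      refine ((continuousOn_const.mul ?_)).neg
      exact (continuous_neg.continuousOn).rpow_const fun x hx => Or.inl (by
        have : x < 0 := hx
        linarith)
  have hF := hT.smul hV
  refine ⟨C ^ 2 * (1 + K), by positivity, fun c hc => ?_⟩
  have hc0 : 0 < -c := by linarith [hc.2]
  have key : ∀ δ > 0, ‖V c‖ * (-c) ^ ν ≤ δ + (-c) ^ ν * (C ^ 2 * (1 + K) * √(-c)) := by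
    intro δ hδ
    have hVi : IntegrableOn (fun x => ‖V x‖ ^ 2) (Iio 0) := by
      refine h2.mono' ((hV.continuousOn.norm.pow 2).aestronglyMeasurable measurableSet_Iio) ?_
      filter_upwards with x
      rw [Real.norm_of_nonneg (sq_nonneg _)]
      have := hh x
      gcongr
      linarith [norm_nonneg (g x)]
    obtain ⟨d, hd, hd2⟩ := exists_mul_lt_of_integrableOn hVi (sq_pos_of_pos hδ) hc.2
    have hd0 : 0 < -d := by linarith [hd.2]
    rw [abs_of_nonneg (sq_nonneg _)] at hd2
    -- Here `2ν ≥ 1` is used: `(-d)^ν ≤ √(-d)`, and `√(-d) ‖V d‖` is small at the chosen point. So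
    -- `(-x)^ν V` vanishes along a sequence, and `V` at `c` is controlled by the integral from `c`.
    have hFd : (-d) ^ ν * ‖V d‖ ≤ δ := by
      have h3 : (-d) ^ ν ≤ √(-d) := by
        rw [Real.sqrt_eq_rpow]
        exact Real.rpow_le_rpow_of_exponent_ge hd0 (by linarith [hd.1, hc.1]) (by linarith)
      have h4 : (√(-d) * ‖V d‖) ^ 2 ≤ δ ^ 2 := by
        rw [mul_pow, Real.sq_sqrt hd0.le]
        exact hd2.le
      have h5 := (sq_le_sq₀ (by positivity) hδ.le).1 h4
      exact (mul_le_mul_of_nonneg_right h3 (norm_nonneg _)).trans h5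
    obtain ⟨-, e2⟩ := hF c hc.2 d hd.2
    set r := √(-c)
    have hr : 0 < r := Real.sqrt_pos.2 hc0
    have hrr : r * r = -c := Real.mul_self_sqrt hc0.le
    have hbound : ‖∫ t in c..d, (((-(ν * (-t) ^ (ν - 1)) : ℝ) : ℂ) • V t +
        (((-t) ^ ν : ℝ) : ℂ) • V' t)‖ ≤
        ∫ t in c..d, (-c) ^ ν * (C ^ 2 * (r⁻¹ + r * h t ^ 2)) := by
      refine intervalIntegral.norm_integral_le_of_norm_le hd.1.le ?_ ?_
      · rw [ae_restrict_iff' measurableSet_Iio] at he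
        filter_upwards [he] with t ht htm
        have ht0 : 0 < -t := by linarith [htm.2, hd.2]
        rw [ht (by linarith : t < 0)]
        have e3 : ((-(ν * (-t) ^ (ν - 1)) : ℝ) : ℂ) • V t +
            (((-t) ^ ν : ℝ) : ℂ) • (b t * V t + g t) =
            (((-t) ^ ν : ℝ) : ℂ) * (((b t - ν / (-t) : ℝ) : ℂ) * V t + g t) := by
          have e4 : ν * (-t) ^ (ν - 1) = (-t) ^ ν * (ν / (-t)) := by
            rw [Real.rpow_sub_one ht0.ne']
            field_simp
          rw [e4]
          push_cast
          simp only [smul_eq_mul]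
          ring
        rw [e3, norm_mul, Complex.norm_real, Real.norm_of_nonneg (by positivity)]
        refine mul_le_mul (Real.rpow_le_rpow ht0.le (by linarith [htm.1]) hab.ν_pos.le) ?_
          (norm_nonneg _) (by positivity)
        have h6 : ‖((b t - ν / (-t) : ℝ) : ℂ) * V t + g t‖ ≤ C * h t := by
          refine (norm_add_le _ _).trans ?_
          rw [norm_mul, Complex.norm_real, Real.norm_eq_abs]
          have h7 := hCb t ⟨by linarith [hc.1, htm.1], by linarith⟩
          have h8 : |b t - ν / (-t)| ≤ C := h7.trans (le_max_left _ _)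
          nlinarith [hh t, norm_nonneg (V t), norm_nonneg (g t)]
        refine h6.trans ?_
        -- Young's inequality in place of Cauchy-Schwarz. With `r = √(-c)` the two integrals over
        -- `[c, d]` are at most `r` and `r K`.
        have h10 : h t ≤ r⁻¹ + r * h t ^ 2 := by
          have h11 : 0 ≤ r * (h t - r⁻¹ / 2) ^ 2 := by positivity
          have h12 : r * (h t - r⁻¹ / 2) ^ 2 = r * h t ^ 2 - h t + r⁻¹ / 4 := by
            field_simp
            ring
          have := inv_pos.2 hr
          linarith
        have h13 : 0 ≤ r⁻¹ + r * h t ^ 2 := by positivity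
        calc C * h t ≤ C * (r⁻¹ + r * h t ^ 2) := by gcongr
          _ ≤ C ^ 2 * (r⁻¹ + r * h t ^ 2) := by
              refine mul_le_mul_of_nonneg_right ?_ h13
              nlinarith
      · refine (((intervalIntegrable_const).add (IntervalIntegrable.const_mul ?_ r)).const_mul
          _).const_mul _
        rw [intervalIntegrable_iff_integrableOn_Ioc_of_le hd.1.le]
        exact h2.mono_set fun t ht => lt_of_le_of_lt ht.2 hd.2
    have h_int : ∫ t in c..d, (-c) ^ ν * (C ^ 2 * (r⁻¹ + r * h t ^ 2)) ≤
        (-c) ^ ν * (C ^ 2 * (1 + K) * r) := by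
      rw [intervalIntegral.integral_const_mul, intervalIntegral.integral_const_mul]
      have hii : IntervalIntegrable (fun t => h t ^ 2) volume c d := by
        rw [intervalIntegrable_iff_integrableOn_Ioc_of_le hd.1.le]
        exact h2.mono_set fun t ht => lt_of_le_of_lt ht.2 hd.2
      rw [intervalIntegral.integral_add intervalIntegrable_const (hii.const_mul r),
        intervalIntegral.integral_const_mul, intervalIntegral.integral_const, smul_eq_mul,
        mul_assoc (C ^ 2)]
      refine mul_le_mul_of_nonneg_left (mul_le_mul_of_nonneg_left ?_ (by positivity))
        (by positivity)
      have h14 : ∫ t in c..d, h t ^ 2 ≤ K := by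
        rw [intervalIntegral.integral_of_le hd.1.le]
        exact setIntegral_mono_set h2 (.of_forall fun t => sq_nonneg _)
          (Eventually.of_forall fun t (ht : t ∈ Ioc c d) => lt_of_le_of_lt ht.2 hd.2)
      have h15 : (d - c) * r⁻¹ ≤ r := by
        rw [← div_eq_mul_inv, div_le_iff₀ hr, hrr]
        linarith
      nlinarith
    rw [← e2] at hbound
    have h16 := norm_sub_norm_le ((((-c) ^ ν : ℝ) : ℂ) • V c) ((((-d) ^ ν : ℝ) : ℂ) • V d)
    rw [norm_sub_rev] at h16
    rw [norm_smul, norm_smul, Complex.norm_real, Complex.norm_real,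
      Real.norm_of_nonneg (by positivity), Real.norm_of_nonneg (by positivity)] at h16
    linarith
  have h17 := le_of_forall_pos_le_add fun δ hδ => (key δ hδ).trans (add_comm _ _).le
  rw [mul_comm] at h17
  exact le_of_mul_le_mul_left h17 (by positivity)

/-- The flux `|w₁|² - |w₂|² - |w₃|² + |w₄|²`. -/
def flux (v : Spinor) : ℝ := ‖v 0‖ ^ 2 - ‖v 1‖ ^ 2 - ‖v 2‖ ^ 2 + ‖v 3‖ ^ 2

theorem abs_flux_le (v : Spinor) : |flux v| ≤ ‖v‖ ^ 2 := by
  rw [flux, norm_spinor_sq, abs_le]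
  constructor <;> nlinarith [sq_nonneg ‖v 0‖, sq_nonneg ‖v 1‖, sq_nonneg ‖v 2‖, sq_nonneg ‖v 3‖]

theorem abs_norm_sq_sub_norm_sq_le (u v : ℂ) : |‖u‖ ^ 2 - ‖v‖ ^ 2| ≤ ‖u + v‖ * ‖u - v‖ := by
  rw [sq_sub_sq, abs_mul]
  have h1 := abs_norm_sub_norm_le u v
  have h2 : ‖u‖ ^ 2 - ‖v‖ ^ 2 = ((starRingEnd ℂ (u + v)) * (u - v)).re := by
    rw [Complex.sq_norm, Complex.sq_norm, Complex.normSq_apply, Complex.normSq_apply]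
    simp [Complex.mul_re]
    ring
  rw [← abs_mul, ← sq_sub_sq, h2]
  refine (Complex.abs_re_le_norm _).trans ?_
  rw [norm_mul, Complex.norm_conj]

/-- Each product contains one of the components `v 0 + v 2`, `v 1 - v 3` seen by `γ¹ + i` and one of
the complementary components `v 0 - v 2`, `v 1 + v 3`. Hence smallness of either kind makes the flux
small. -/
theorem abs_flux_le_mul (v : Spinor) :
    |flux v| ≤ ‖v 0 + v 2‖ * ‖v 0 - v 2‖ + ‖v 1 - v 3‖ * ‖v 1 + v 3‖ := by
  have h1 := abs_norm_sq_sub_norm_sq_le (v 0) (v 2)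
  have h2 := abs_norm_sq_sub_norm_sq_le (v 1) (v 3)
  have h3 : flux v = (‖v 0‖ ^ 2 - ‖v 2‖ ^ 2) - (‖v 1‖ ^ 2 - ‖v 3‖ ^ 2) := by
    rw [flux]
    ring
  rw [h3]
  refine (abs_sub _ _).trans ?_
  linarith [mul_comm ‖v 1 - v 3‖ ‖v 1 + v 3‖]

theorem act_boundary_apply (v : Spinor) :
    act (γ1 + Complex.I • (1 : Mat4)) v 0 = Complex.I * (v 0 + v 2) ∧
    act (γ1 + Complex.I • (1 : Mat4)) v 1 = Complex.I * (v 1 - v 3) ∧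
    act (γ1 + Complex.I • (1 : Mat4)) v 2 = Complex.I * (v 0 + v 2) ∧
    act (γ1 + Complex.I • (1 : Mat4)) v 3 = -(Complex.I * (v 1 - v 3)) := by
  refine ⟨?_, ?_, ?_, ?_⟩ <;>
  · rw [act_apply]
    simp [Fin.sum_univ_four, γ1]
    ring

theorem norm_le_norm_act_boundary (v : Spinor) :
    ‖v 0 + v 2‖ ≤ ‖act (γ1 + Complex.I • (1 : Mat4)) v‖ ∧
      ‖v 1 - v 3‖ ≤ ‖act (γ1 + Complex.I • (1 : Mat4)) v‖ := by
  obtain ⟨h0, h1, -, -⟩ := act_boundary_apply v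
  have k0 := norm_spinor_apply_le (act (γ1 + Complex.I • (1 : Mat4)) v) 0
  have k1 := norm_spinor_apply_le (act (γ1 + Complex.I • (1 : Mat4)) v) 1
  rw [h0, norm_mul, Complex.norm_I, one_mul] at k0
  rw [h1, norm_mul, Complex.norm_I, one_mul] at k1
  exact ⟨k0, k1⟩

theorem norm_add_sub_le_two_mul (v : Spinor) :
    ‖v 0 + v 2‖ ≤ 2 * ‖v‖ ∧ ‖v 0 - v 2‖ ≤ 2 * ‖v‖ ∧ ‖v 1 - v 3‖ ≤ 2 * ‖v‖ ∧
      ‖v 1 + v 3‖ ≤ 2 * ‖v‖ := by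
  have h := norm_spinor_apply_le v
  have h0 := h 0
  have h1 := h 1
  have h2 := h 2
  have h3 := h 3
  refine ⟨(norm_add_le _ _).trans ?_, (norm_sub_le _ _).trans ?_, (norm_sub_le _ _).trans ?_,
    (norm_add_le _ _).trans ?_⟩ <;> linarith

/-- `w` is locally absolutely continuous with `(H - z) w = f`. -/
def IsForcedSol (a b : ℝ → ℝ) (z : ℂ) (f w : ℝ → Spinor) : Prop :=
  ∃ w' : ℝ → Spinor, LocAC w w' ∧ ∀ᵐ x ∂(volume.restrict (Iio (0 : ℝ))),
    w' x = act (flowMat (a x) (b x) z) (w x) + act (Complex.I • Γ1) (f x)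

theorem integrableOn_norm_sq {w : ℝ → Spinor}
    (hw : MemLp w 2 (volume.restrict (Iio (0 : ℝ)))) :
    IntegrableOn (fun x => ‖w x‖ ^ 2) (Iio 0) := hw.norm.integrable_sq

/-- Square integrability gives `√(-d) ‖w d‖` arbitrarily small along a sequence. The other factor
`√(-d)` needed in the flux comes from the boundary condition if `2ν < 1`. If `2ν ≥ 1` it comes from
the equation: the components obeying `V' = b V + …` are `O(√(-x))`, so no boundary condition is
needed. -/
theorem IsForcedSol.exists_flux_lt (hab : Admissible a b ν κ) {f w : ℝ → Spinor}
    (h : IsForcedSol a b z f w) (hw2 : MemLp w 2 (volume.restrict (Iio (0 : ℝ))))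
    (hf2 : MemLp f 2 (volume.restrict (Iio (0 : ℝ)))) (hbc : 2 * ν < 1 → BoundaryCond w)
    {δ : ℝ} (hδ : 0 < δ) {x₀ : ℝ} (hx₀ : x₀ < 0) : ∃ d ∈ Ioo x₀ 0, |flux (w d)| < δ := by
  obtain ⟨w', hw, he⟩ := h
  have hwi := integrableOn_norm_sq hw2
  have hsmall : ∀ η > 0, ∀ y < 0, ∃ d ∈ Ioo y 0, √(-d) * ‖w d‖ < η := by
    intro η hη y hy
    obtain ⟨d, hd, hd2⟩ := exists_mul_lt_of_integrableOn hwi (sq_pos_of_pos hη) hy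
    have hd0 : 0 ≤ -d := by linarith [hd.2]
    refine ⟨d, hd, (sq_lt_sq₀ (by positivity) hη.le).1 ?_⟩
    rwa [mul_pow, Real.sq_sqrt hd0, ← abs_of_nonneg (sq_nonneg ‖w d‖)]
  rcases lt_or_ge (2 * ν) 1 with hν | hν
  · have h1 := (hbc hν).def (show 0 < δ / 8 by positivity)
    rw [eventually_nhdsWithin_iff] at h1
    obtain ⟨r, hr, hr2⟩ := Metric.eventually_nhds_iff.1 h1
    obtain ⟨d, hd, hd2⟩ := hsmall 1 one_pos (max x₀ (-r / 2)) (max_lt hx₀ (by linarith))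
    refine ⟨d, ⟨(le_max_left _ _).trans_lt hd.1, hd.2⟩, ?_⟩
    have hdr : -r / 2 < d := (le_max_right _ _).trans_lt hd.1
    have h2 := hr2 (y := d) (by
      rw [Real.dist_eq, sub_zero, abs_of_neg hd.2]
      linarith) hd.2
    rw [Real.norm_of_nonneg (Real.sqrt_nonneg _)] at h2
    obtain ⟨k1, k2⟩ := norm_le_norm_act_boundary (w d)
    obtain ⟨-, k3, -, k4⟩ := norm_add_sub_le_two_mul (w d)
    calc |flux (w d)| ≤ _ := abs_flux_le_mul _
      _ ≤ (δ / 8 * √(-d)) * (2 * ‖w d‖) + (δ / 8 * √(-d)) * (2 * ‖w d‖) := by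
          gcongr
          · exact k1.trans h2
          · exact k2.trans h2
      _ = δ / 2 * (√(-d) * ‖w d‖) := by ring
      _ < δ := by nlinarith
  · obtain ⟨Ca, hCa⟩ := hab.a_bdd
    have hCa0 : 0 ≤ Ca := (abs_nonneg _).trans (hCa (-1) (by norm_num))
    set A := 2 + 2 * ‖z‖ + 2 * Ca
    have hh2 : IntegrableOn (fun x => (A * ‖w x‖ + 2 * ‖f x‖) ^ 2) (Iio 0) :=
      ((hw2.norm.const_mul A).add (hf2.norm.const_mul 2)).integrable_sq
    -- The potential is bounded only on `x < 0`, whereas the pointwise bound required below is over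
    -- all of `ℝ`.
    set a' : ℝ → ℝ := (Iio 0).indicator a
    have ha' : ∀ x, |a' x| ≤ Ca := fun x => by
      by_cases hx : x < 0
      · simp only [a', indicator_of_mem (show x ∈ Iio (0 : ℝ) from hx)]
        exact hCa x hx
      · simp only [a', indicator_of_notMem (show x ∉ Iio (0 : ℝ) from hx)]
        simpa using hCa0
    obtain ⟨C₁, hC₁0, hC₁⟩ := hab.exists_norm_le_sqrt hν (V := fun x => w x 0 - w x 2)
      (g := fun x => Complex.I * z * (w x 0 + w x 2) + Complex.I * a' x * (w x 1 - w x 3) +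
        Complex.I * (f x 0 + f x 2)) ((hw.apply 0).sub (hw.apply 2)) (by
        filter_upwards [he, ae_restrict_mem measurableSet_Iio] with x hx hx0
        obtain ⟨n0, n1, n2, n3⟩ := act_flowMat (a x) (b x) z (w x)
        obtain ⟨g0, g1, g2, g3⟩ := act_I_Γ1 (f x)
        simp only [a', indicator_of_mem hx0]
        rw [hx, PiLp.add_apply, PiLp.add_apply, n0, n2, g0, g2]
        ring) hh2 (fun x => by
        obtain ⟨k1, k2, k3, k4⟩ := norm_add_sub_le_two_mul (w x)
        obtain ⟨j1, -, -, -⟩ := norm_add_sub_le_two_mul (f x)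
        have hn := norm_add₃_le (a := Complex.I * z * (w x 0 + w x 2))
          (b := Complex.I * a' x * (w x 1 - w x 3)) (c := Complex.I * (f x 0 + f x 2))
        simp only [norm_mul, Complex.norm_I, one_mul, Complex.norm_real, Real.norm_eq_abs] at hn
        have m1 := mul_le_mul_of_nonneg_left k1 (norm_nonneg z)
        have m2 := mul_le_mul (ha' x) k3 (norm_nonneg _) hCa0
        simp only [A]
        linarith)
    obtain ⟨C₂, hC₂0, hC₂⟩ := hab.exists_norm_le_sqrt hν (V := fun x => w x 1 + w x 3)
      (g := fun x => -(Complex.I * a' x * (w x 0 + w x 2)) + -(Complex.I * z * (w x 1 - w x 3)) +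
        -(Complex.I * (f x 1 - f x 3))) ((hw.apply 1).add (hw.apply 3)) (by
        filter_upwards [he, ae_restrict_mem measurableSet_Iio] with x hx hx0
        obtain ⟨n0, n1, n2, n3⟩ := act_flowMat (a x) (b x) z (w x)
        obtain ⟨g0, g1, g2, g3⟩ := act_I_Γ1 (f x)
        simp only [a', indicator_of_mem hx0]
        rw [hx, PiLp.add_apply, PiLp.add_apply, n1, n3, g1, g3]
        ring) hh2 (fun x => by
        obtain ⟨k1, k2, k3, k4⟩ := norm_add_sub_le_two_mul (w x)
        obtain ⟨-, -, j1, -⟩ := norm_add_sub_le_two_mul (f x)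
        have hn := norm_add₃_le (a := -(Complex.I * a' x * (w x 0 + w x 2)))
          (b := -(Complex.I * z * (w x 1 - w x 3))) (c := -(Complex.I * (f x 1 - f x 3)))
        simp only [norm_neg, norm_mul, Complex.norm_I, one_mul, Complex.norm_real,
          Real.norm_eq_abs] at hn
        have m1 := mul_le_mul_of_nonneg_left k3 (norm_nonneg z)
        have m2 := mul_le_mul (ha' x) k1 (norm_nonneg _) hCa0
        simp only [A]
        linarith)
    obtain ⟨d, hd, hd2⟩ := hsmall (δ / (2 * (C₁ + C₂ + 1))) (by positivity) (max x₀ (-1))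
      (max_lt hx₀ (by norm_num))
    refine ⟨d, ⟨(le_max_left _ _).trans_lt hd.1, hd.2⟩, ?_⟩
    have hdm : d ∈ Ico (-1 : ℝ) 0 := ⟨((le_max_right _ _).trans_lt hd.1).le, hd.2⟩
    obtain ⟨k1, -, k2, -⟩ := norm_add_sub_le_two_mul (w d)
    rw [lt_div_iff₀ (by positivity)] at hd2
    calc |flux (w d)| ≤ _ := abs_flux_le_mul _
      _ ≤ (2 * ‖w d‖) * (C₁ * √(-d)) + (2 * ‖w d‖) * (C₂ * √(-d)) := by
          gcongr
          · exact hC₁ d hdm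
          · exact hC₂ d hdm
      _ ≤ √(-d) * ‖w d‖ * (2 * (C₁ + C₂ + 1)) := by
          have : 0 ≤ √(-d) * ‖w d‖ := by positivity
          nlinarith
      _ < δ := hd2

/-- The real potentials and `Re z` cancel by symmetry of the operator; there remains `-2 Im z ‖v‖²`
plus the source term, and half of the former absorbs the latter. -/
theorem flux_deriv_le (a b : ℝ) {z : ℂ} (hz : 0 < z.im) (v f v' : Spinor)
    (h : v' = act (flowMat a b z) v + act (Complex.I • Γ1) f) :
    2 * (starRingEnd ℂ (v 0) * v' 0).re - 2 * (starRingEnd ℂ (v 1) * v' 1).re -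
      2 * (starRingEnd ℂ (v 2) * v' 2).re + 2 * (starRingEnd ℂ (v 3) * v' 3).re ≤
      -(z.im * ‖v‖ ^ 2) + z.im⁻¹ * ‖f‖ ^ 2 := by
  obtain ⟨n0, n1, n2, n3⟩ := act_flowMat a b z v
  obtain ⟨g0, g1, g2, g3⟩ := act_I_Γ1 f
  subst h
  have key : ∀ p q : ℂ, 2 * (starRingEnd ℂ p * (Complex.I * q)).re ≤
      z.im * ‖p‖ ^ 2 + z.im⁻¹ * ‖q‖ ^ 2 := by
    intro p q
    have h1 : (starRingEnd ℂ p * (Complex.I * q)).re ≤ ‖p‖ * ‖q‖ := by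
      refine (Complex.re_le_norm _).trans ?_
      simp
    have h2 : 0 ≤ z.im⁻¹ * (z.im * ‖p‖ - ‖q‖) ^ 2 := by positivity
    have h3 : z.im⁻¹ * (z.im * ‖p‖ - ‖q‖) ^ 2 =
        z.im * ‖p‖ ^ 2 - 2 * (‖p‖ * ‖q‖) + z.im⁻¹ * ‖q‖ ^ 2 := by
      field_simp
      ring
    linarith
  have e0 := key (v 0) (f 0)
  have e1 := key (v 1) (f 1)
  have e2 := key (v 2) (f 2)
  have e3 := key (v 3) (f 3)
  simp only [PiLp.add_apply, n0, n1, n2, n3, g0, g1, g2, g3]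
  rw [norm_spinor_sq, norm_spinor_sq f]
  have hn : ∀ u : ℂ, ‖u‖ ^ 2 = u.re * u.re + u.im * u.im := fun u => by
    rw [Complex.sq_norm, Complex.normSq_apply]
  rw [hn (v 0)] at e0 ⊢
  rw [hn (v 1)] at e1 ⊢
  rw [hn (v 2)] at e2 ⊢
  rw [hn (v 3)] at e3 ⊢
  simp only [Complex.mul_re, Complex.mul_im, Complex.add_re, Complex.add_im, Complex.sub_re,
    Complex.sub_im, Complex.neg_re, Complex.neg_im, Complex.conj_re, Complex.conj_im, Complex.I_re,
    Complex.I_im, Complex.ofReal_re, Complex.ofReal_im] at e0 e1 e2 e3 ⊢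
  linarith

/-- `Im z ‖w‖ ≤ ‖(H - z) w‖`. -/
theorem IsForcedSol.energy_le (hab : Admissible a b ν κ) (hz : 0 < z.im) {f w : ℝ → Spinor}
    (h : IsForcedSol a b z f w) (hw2 : MemLp w 2 (volume.restrict (Iio (0 : ℝ))))
    (hf2 : MemLp f 2 (volume.restrict (Iio (0 : ℝ)))) (hbc : 2 * ν < 1 → BoundaryCond w) :
    z.im ^ 2 * ∫ x in Iio (0 : ℝ), ‖w x‖ ^ 2 ≤ ∫ x in Iio (0 : ℝ), ‖f x‖ ^ 2 := by
  have hwi := integrableOn_norm_sq hw2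
  have hfi := integrableOn_norm_sq hf2
  set K := ∫ x in Iio (0 : ℝ), ‖f x‖ ^ 2
  have hflux := fun {δ : ℝ} (hδ : 0 < δ) {x₀ : ℝ} (hx₀ : x₀ < 0) =>
    h.exists_flux_lt hab hw2 hf2 hbc hδ hx₀
  obtain ⟨w', hw, he⟩ := h
  have hq : LocAC (fun x => flux (w x)) (fun x => 2 * (starRingEnd ℂ (w x 0) * w' x 0).re -
      2 * (starRingEnd ℂ (w x 1) * w' x 1).re - 2 * (starRingEnd ℂ (w x 2) * w' x 2).re +
      2 * (starRingEnd ℂ (w x 3) * w' x 3).re) :=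
    (((hw.apply 0).norm_sq.sub (hw.apply 1).norm_sq).sub (hw.apply 2).norm_sq).add
      (hw.apply 3).norm_sq
  have key : ∀ n : ℕ, z.im * ∫ x in Ioc (-(n + 2 : ℝ)) (-(n + 2 : ℝ)⁻¹), ‖w x‖ ^ 2 ≤
      z.im⁻¹ * K := by
    intro n
    refine le_of_forall_pos_le_add fun δ hδ => ?_
    have hd₀ : -(n + 2 : ℝ)⁻¹ < 0 := neg_lt_zero.2 (by positivity)
    -- The interval is enlarged to endpoints `c` and `d` where the flux is below `δ/2`; the flux
    -- identity is integrated over `[c, d]`.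
    obtain ⟨c, hc, hc0, hc1⟩ := exists_lt_of_integrableOn hwi (half_pos hδ) (-(n + 2 : ℝ))
    obtain ⟨d, hd, hd1⟩ := hflux (half_pos hδ) hd₀
    have hcd : c ≤ d := by
      have : (n + 2 : ℝ)⁻¹ ≤ n + 2 :=
        (inv_le_one_of_one_le₀ (by linarith [n.cast_nonneg (α := ℝ)])).trans
          (by linarith [n.cast_nonneg (α := ℝ)])
      linarith [hd.1]
    obtain ⟨i1, i2⟩ := hq c hc0 d hd.2
    have hsub : Ioc c d ⊆ Iio 0 := fun t ht => lt_of_le_of_lt ht.2 hd.2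
    have j1 : IntervalIntegrable (fun x => ‖w x‖ ^ 2) volume c d := by
      rw [intervalIntegrable_iff_integrableOn_Ioc_of_le hcd]
      exact hwi.mono_set hsub
    have j2 : IntervalIntegrable (fun x => ‖f x‖ ^ 2) volume c d := by
      rw [intervalIntegrable_iff_integrableOn_Ioc_of_le hcd]
      exact hfi.mono_set hsub
    have h1 := intervalIntegral.integral_mono_ae_restrict hcd i1
      (((j1.const_mul z.im).neg).add (j2.const_mul z.im⁻¹)) (by
        have he' := ae_restrict_of_ae_restrict_of_subset
          (fun t (ht : t ∈ Icc c d) => lt_of_le_of_lt ht.2 hd.2) he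
        filter_upwards [he'] with x hx
        exact flux_deriv_le (a x) (b x) hz (w x) (f x) (w' x) hx)
    rw [← i2] at h1
    have e1 : ∫ u in c..d, ((-fun x => z.im * ‖w x‖ ^ 2) + fun x => z.im⁻¹ * ‖f x‖ ^ 2) u =
        -(z.im * ∫ u in c..d, ‖w u‖ ^ 2) + z.im⁻¹ * ∫ u in c..d, ‖f u‖ ^ 2 := by
      rw [← intervalIntegral.integral_const_mul, ← intervalIntegral.integral_const_mul,
        ← intervalIntegral.integral_neg]
      exact intervalIntegral.integral_add (j1.const_mul z.im).neg (j2.const_mul z.im⁻¹)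
    have h1' := h1.trans e1.le
    have h2 : ∫ u in c..d, ‖f u‖ ^ 2 ≤ K := by
      rw [intervalIntegral.integral_of_le hcd]
      exact setIntegral_mono_set hfi (.of_forall fun t => sq_nonneg _) (.of_forall hsub)
    have h3 : ∫ x in Ioc (-(n + 2 : ℝ)) (-(n + 2 : ℝ)⁻¹), ‖w x‖ ^ 2 ≤
        ∫ u in c..d, ‖w u‖ ^ 2 := by
      rw [intervalIntegral.integral_of_le hcd]
      exact setIntegral_mono_set (hwi.mono_set hsub) (.of_forall fun t => sq_nonneg _)
        (.of_forall fun t (ht : t ∈ Ioc _ _) => ⟨hc.trans ht.1, ht.2.trans hd.1.le⟩)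
    have h4 := abs_flux_le (w c)
    rw [abs_of_nonneg (sq_nonneg _)] at hc1
    have h5 := abs_lt.1 hd1
    have h6 := abs_le.1 h4
    have h7 : z.im⁻¹ * ∫ u in c..d, ‖f u‖ ^ 2 ≤ z.im⁻¹ * K :=
      mul_le_mul_of_nonneg_left h2 (inv_pos.2 hz).le
    have h8 := mul_le_mul_of_nonneg_left h3 hz.le
    linarith
  have hU : ⋃ n : ℕ, Ioc (-(n + 2 : ℝ)) (-(n + 2 : ℝ)⁻¹) = Iio 0 := by
    ext x
    simp only [mem_iUnion, mem_Iio]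
    constructor
    · rintro ⟨n, hn⟩
      exact lt_of_le_of_lt hn.2 (neg_lt_zero.2 (by positivity))
    · intro hx
      obtain ⟨n, hn⟩ := exists_nat_ge (max (-x) (-x)⁻¹)
      have h1 : -x ≤ n := le_trans (le_max_left _ _) hn
      have h2 : (-x)⁻¹ ≤ n := le_trans (le_max_right _ _) hn
      have h3 : (n + 2 : ℝ)⁻¹ ≤ -x := by
        apply inv_le_of_inv_le₀ (by linarith)
        linarith
      exact ⟨n, by linarith, by linarith⟩
  have hmono : Monotone fun n : ℕ => Ioc (-(n + 2 : ℝ)) (-(n + 2 : ℝ)⁻¹) := by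
    intro n k hnk
    have h1 : (n : ℝ) ≤ k := by exact_mod_cast hnk
    refine Ioc_subset_Ioc (by linarith) (neg_le_neg ?_)
    gcongr
  have hlim := tendsto_setIntegral_of_monotone (fun n => measurableSet_Ioc) hmono
    (by rw [hU]; exact hwi)
  rw [hU] at hlim
  have h9 := le_of_tendsto (hlim.const_mul z.im) (.of_forall key)
  have h10 := mul_le_mul_of_nonneg_left h9 hz.le
  rw [← mul_assoc, ← mul_assoc, mul_inv_cancel₀ hz.ne', one_mul] at h10
  rwa [sq]

theorem IsForcedSol.eq_zero (hab : Admissible a b ν κ) (hz : 0 < z.im) {w : ℝ → Spinor}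
    (h : IsForcedSol a b z (fun _ => 0) w) (hw2 : MemLp w 2 (volume.restrict (Iio (0 : ℝ))))
    (hbc : 2 * ν < 1 → BoundaryCond w) : ∀ x < 0, w x = 0 := by
  have h1 := h.energy_le hab hz hw2 MemLp.zero' hbc
  simp only [norm_zero, ne_eq, OfNat.ofNat_ne_zero, not_false_eq_true, zero_pow,
    integral_zero] at h1
  have h2 : ∫ x in Iio (0 : ℝ), ‖w x‖ ^ 2 = 0 := by
    refine le_antisymm ?_ (integral_nonneg fun x => sq_nonneg _)
    by_contra! h3
    have : 0 < z.im ^ 2 * ∫ x in Iio (0 : ℝ), ‖w x‖ ^ 2 := by positivity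
    linarith
  rw [integral_eq_zero_iff_of_nonneg (fun x => sq_nonneg _) (integrableOn_norm_sq hw2)] at h2
  obtain ⟨w', hw, -⟩ := h
  have h3 : w =ᵐ[volume.restrict (Iio (0 : ℝ))] fun _ => (0 : Spinor) := by
    filter_upwards [h2] with x hx
    simpa using hx
  exact fun x hx => Measure.eqOn_open_of_ae_eq h3 isOpen_Iio hw.continuousOn continuousOn_const hx

end

end SAdS

open MeasureTheory Set Filter Topology Asymptotics

namespace SAdS

noncomputable section

/-! ### Jost solutions and boundary solutions -/

variable {a b : ℝ → ℝ} {ν κ : ℝ} {z : ℂ}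

theorem memLp_Iio_of_isBigO_exp {E : Type*} [NormedAddCommGroup E] {w : ℝ → E}
    (hw : ContinuousOn w (Iio 0)) {c : ℝ} (hc : 0 < c)
    (ho : w =O[atBot] fun x => Real.exp (c * x)) {x : ℝ} (hx : x < 0) :
    MemLp w 2 (volume.restrict (Iio x)) := by
  rw [memLp_two_iff_integrable_sq_norm ((hw.mono (Iio_subset_Iio hx.le)).aestronglyMeasurable
    measurableSet_Iio)]
  have h1 : ContinuousOn (fun x => ‖w x‖ ^ 2) (Iic x) :=
    (hw.mono fun y hy => lt_of_le_of_lt hy hx).norm.pow 2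
  refine IntegrableOn.mono_set (t := Iic x) ?_ Iio_subset_Iic_self
  refine (h1.locallyIntegrableOn measurableSet_Iic).integrableOn_of_isBigO_atBot (ho.norm_left.pow 2)
    ⟨Iic 0, Iic_mem_atBot 0, ?_⟩
  refine (integrableOn_exp_mul_Iic (show 0 < 2 * c by linarith) 0).congr_fun (fun y _ => ?_)
    measurableSet_Iic
  simp only
  rw [← Real.exp_nat_mul]
  push_cast
  ring_nf

theorem integrableOn_neg_rpow {r : ℝ} (hr : -1 < r) (x : ℝ) :
    IntegrableOn (fun y : ℝ => (-y) ^ r) (Ioo x 0) := by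
  have h1 := (intervalIntegral.intervalIntegrable_rpow' (a := -x) (b := 0) hr)
  rw [IntervalIntegrable.iff_comp_neg] at h1
  simp only [neg_neg, neg_zero] at h1
  exact h1.1.mono_set Ioo_subset_Ioc_self

theorem memLp_Ioo_of_isBigO_rpow {E : Type*} [NormedAddCommGroup E] {w : ℝ → E}
    (hw : ContinuousOn w (Iio 0)) {η : ℝ}
    (hη : 2 * η < 1) (ho : w =O[𝓝[<] 0] fun x => (-x) ^ (-η)) (x : ℝ) :
    MemLp w 2 (volume.restrict (Ioo x 0)) := by
  have hmeas : ∀ y, AEStronglyMeasurable w (volume.restrict (Ioo y 0)) := fun y =>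
    (hw.mono Ioo_subset_Iio_self).aestronglyMeasurable measurableSet_Ioo
  rw [memLp_two_iff_integrable_sq_norm (hmeas x)]
  obtain ⟨C, hC⟩ := ho.bound
  rw [eventually_nhdsWithin_iff] at hC
  obtain ⟨r, hr, hr2⟩ := Metric.eventually_nhds_iff.1 hC
  have h1 : IntegrableOn (fun x => ‖w x‖ ^ 2) (Ioo (-r) 0) := by
    refine Integrable.mono' ((integrableOn_neg_rpow (show -1 < -η * 2 by linarith) (-r)).const_mul
      (C ^ 2)) ((hmeas _).norm.pow 2) ?_
    filter_upwards [ae_restrict_mem measurableSet_Ioo] with y hy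
    have h2 := hr2 (y := y) (by
      rw [Real.dist_eq, sub_zero, abs_of_neg hy.2]
      linarith [hy.1]) hy.2
    have hy0 : 0 < -y := by linarith [hy.2]
    rw [Real.norm_of_nonneg (by positivity)] at h2
    rw [Real.norm_of_nonneg (by positivity), Real.rpow_mul hy0.le, Real.rpow_two, ← mul_pow]
    gcongr
  have h2 : IntegrableOn (fun x => ‖w x‖ ^ 2) (Icc x (-(r / 2))) :=
    ContinuousOn.integrableOn_Icc ((hw.mono fun y hy =>
      lt_of_le_of_lt hy.2 (by linarith : -(r / 2) < 0)).norm.pow 2)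
  refine (h1.union h2).mono_set fun y hy => ?_
  rcases le_or_gt y (-(r / 2)) with h3 | h3
  · exact Or.inr ⟨hy.1.le, h3⟩
  · exact Or.inl ⟨by linarith, hy.2⟩

/-- A solution of `w' = N w` with the asymptotics of a Jost solution. -/
structure JostSol (a b : ℝ → ℝ) (z : ℂ) (ψ : ℝ → Spinor) : Prop where
  flow : IsFlowSol a b z ψ
  asymp : (fun x => ψ x - EuclideanSpace.single 1 (Complex.exp (-Complex.I * z * x))) =o[atBot]
    fun x => Real.exp (z.im * x)

/-- A solution of `w' = N w` with the boundary behaviour at `0`. -/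
structure BdrySol (a b : ℝ → ℝ) (ν : ℝ) (z : ℂ) (φ : ℝ → Spinor) : Prop where
  flow : IsFlowSol a b z φ
  bdry : 2 * ν < 1 → BoundaryCond φ
  lim : 1 ≤ 2 * ν → Tendsto φ (𝓝[<] 0) (𝓝 0)

theorem isJost_iff (M l m s : ℝ) (z : ℂ) (ψ : ℝ → Spinor) : IsJost M l m s z ψ ↔
    JostSol (fun x => (s + 1 / 2) * potA M l x) (fun x => m * potB M l x) z ψ := by
  rw [IsJost, isSol_iff]
  exact ⟨fun h => ⟨h.1, h.2⟩, fun h => ⟨h.1, h.2⟩⟩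

theorem isBoundarySol_iff (M l m s : ℝ) (z : ℂ) (φ : ℝ → Spinor) : IsBoundarySol M l m s z φ ↔
    BdrySol (fun x => (s + 1 / 2) * potA M l x) (fun x => m * potB M l x) (m * l) z φ := by
  rw [IsBoundarySol, isSol_iff, mul_assoc]
  exact ⟨fun h => ⟨h.1, h.2.1, h.2.2⟩, fun h => ⟨h.1, h.2, h.3⟩⟩

theorem IsFlowSol.continuousOn {w : ℝ → Spinor} (h : IsFlowSol a b z w) : ContinuousOn w (Iio 0) :=
  fun x hx => (h x hx).continuousAt.continuousWithinAt

theorem JostSol.memLp {ψ : ℝ → Spinor} (h : JostSol a b z ψ) (hz : 0 < z.im) {x : ℝ} (hx : x < 0) :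
    MemLp ψ 2 (volume.restrict (Iio x)) := by
  refine memLp_Iio_of_isBigO_exp h.flow.continuousOn hz ?_ hx
  have h1 : (fun x : ℝ => (EuclideanSpace.single 1 (Complex.exp (-Complex.I * z * x)) : Spinor))
      =O[atBot] fun x => Real.exp (z.im * x) := by
    refine IsBigO.of_bound 1 (.of_forall fun x => ?_)
    rw [PiLp.norm_single, norm_exp_jost, one_mul, Real.norm_of_nonneg (Real.exp_pos _).le]
  simpa using h.asymp.isBigO.add h1

theorem Admissible.isBigO_rpow (hab : Admissible a b ν κ) {w : ℝ → Spinor}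
    (h : IsFlowSol a b z w) : w =O[𝓝[<] 0] fun x => (-x) ^ (-ν) := by
  obtain ⟨C, hC⟩ := hab.exists_norm_le_zero
  refine IsBigO.of_bound (‖w (-1)‖ * Real.exp (|z.im| + C)) ?_
  filter_upwards [Ioo_mem_nhdsLT (show (-1 : ℝ) < 0 by norm_num)] with x hx
  have hx0 : 0 < -x := by linarith [hx.2]
  rw [Real.norm_of_nonneg (by positivity : 0 ≤ (-x) ^ (-ν))]
  exact hC z w h x ⟨hx.1.le, hx.2⟩

/-- If `2ν < 1`, every solution is `O((-x)^{-ν})` and thus square integrable at `0`; otherwise the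
limit `0` makes `φ` bounded there. -/
theorem BdrySol.memLp (hab : Admissible a b ν κ) {φ : ℝ → Spinor} (h : BdrySol a b ν z φ) (x : ℝ) :
    MemLp φ 2 (volume.restrict (Ioo x 0)) := by
  rcases lt_or_ge (2 * ν) 1 with hν | hν
  · exact memLp_Ioo_of_isBigO_rpow h.flow.continuousOn hν (hab.isBigO_rpow h.flow) x
  · refine memLp_Ioo_of_isBigO_rpow h.flow.continuousOn (η := 0) (by norm_num) ?_ x
    simp only [neg_zero, Real.rpow_zero]
    exact (h.lim hν).isBigO_one ℝ

theorem continuous_tilde : Continuous tilde := by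
  unfold tilde act
  fun_prop

theorem tilde_zero : tilde 0 = 0 := by simp [tilde, act]

theorem norm_act_boundary_tilde (v : Spinor) :
    ‖act (γ1 + Complex.I • (1 : Mat4)) (tilde v)‖ = ‖act (γ1 + Complex.I • (1 : Mat4)) v‖ := by
  obtain ⟨h0, h1, h2, h3⟩ := act_boundary_apply v
  obtain ⟨k0, k1, k2, k3⟩ := act_boundary_apply (tilde v)
  obtain ⟨t0, t1, t2, t3⟩ := tilde_apply v
  refine (sq_eq_sq₀ (norm_nonneg _) (norm_nonneg _)).1 ?_
  rw [norm_spinor_sq, norm_spinor_sq, h0, h1, h2, h3, k0, k1, k2, k3, t0, t1, t2, t3]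
  rw [show -v 3 + v 1 = v 1 - v 3 by ring, show v 2 - -v 0 = v 0 + v 2 by ring, norm_neg, norm_neg]
  ring

theorem BoundaryCond.tilde {w : ℝ → Spinor} (h : BoundaryCond w) :
    BoundaryCond fun x => tilde (w x) := by
  refine IsBigO.trans_isLittleO (IsBigO.of_bound 1 (.of_forall fun x => ?_)) h
  rw [norm_act_boundary_tilde, one_mul]

theorem BoundaryCond.add {w v : ℝ → Spinor} (h : BoundaryCond w) (k : BoundaryCond v) :
    BoundaryCond fun x => w x + v x := by
  simpa only [BoundaryCond, act, map_add] using IsLittleO.add h k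

theorem BoundaryCond.const_smul {w : ℝ → Spinor} (h : BoundaryCond w) (c : ℂ) :
    BoundaryCond fun x => c • w x := by
  simp only [BoundaryCond, act, map_smul]
  exact IsLittleO.const_smul_left h c

theorem BoundaryCond.congr {w v : ℝ → Spinor} (h : BoundaryCond w) (hv : v =ᶠ[𝓝[<] 0] w) :
    BoundaryCond v := by
  refine IsLittleO.congr' h ?_ EventuallyEq.rfl
  filter_upwards [hv] with x hx
  rw [hx]

theorem BdrySol.tilde {φ : ℝ → Spinor} (h : BdrySol a b ν z φ) :
    BdrySol a b ν z fun x => tilde (φ x) := by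
  refine ⟨h.flow.tilde, fun hν => (h.bdry hν).tilde, fun hν => ?_⟩
  have := (continuous_tilde.tendsto 0).comp (h.lim hν)
  rwa [tilde_zero] at this

theorem BdrySol.add {φ χ : ℝ → Spinor} (h : BdrySol a b ν z φ) (k : BdrySol a b ν z χ) :
    BdrySol a b ν z fun x => φ x + χ x := by
  refine ⟨h.flow.add k.flow, fun hν => (h.bdry hν).add (k.bdry hν), fun hν => ?_⟩
  simpa using (h.lim hν).add (k.lim hν)

theorem BdrySol.const_smul {φ : ℝ → Spinor} (h : BdrySol a b ν z φ) (c : ℂ) :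
    BdrySol a b ν z fun x => c • φ x := by
  refine ⟨h.flow.smul c, fun hν => (h.bdry hν).const_smul c, fun hν => ?_⟩
  simpa using (h.lim hν).const_smul c

theorem continuousOn_act_flowMat (ha : ContinuousOn a (Iio 0)) (hb : ContinuousOn b (Iio 0))
    {w : ℝ → Spinor} (hw : ContinuousOn w (Iio 0)) :
    ContinuousOn (fun x => act (flowMat (a x) (b x) z) (w x)) (Iio 0) := by
  have hwi : ∀ i, ContinuousOn (fun x => w x i) (Iio 0) := fun i =>
    (PiLp.continuous_apply 2 (fun _ : Fin 4 => ℂ) i).comp_continuousOn hw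
  have h0 := hwi 0
  have h1 := hwi 1
  have h2 := hwi 2
  have h3 := hwi 3
  have ha' : ContinuousOn (fun x => (a x : ℂ)) (Iio 0) := Complex.continuous_ofReal.comp_continuousOn ha
  have hb' : ContinuousOn (fun x => (b x : ℂ)) (Iio 0) := Complex.continuous_ofReal.comp_continuousOn hb
  have h4 : ContinuousOn (fun x => (fun i => act (flowMat (a x) (b x) z) (w x) i)) (Iio 0) := by
    rw [continuousOn_pi, forall_fin_four]
    have e := fun x => act_flowMat (a x) (b x) z (w x)
    simp only [fun x => (e x).1, fun x => (e x).2.1, fun x => (e x).2.2.1, fun x => (e x).2.2.2]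
    refine ⟨?_, ?_, ?_, ?_⟩ <;> fun_prop
  exact (PiLp.continuous_toLp 2 (fun _ : Fin 4 => ℂ)).comp_continuousOn h4

theorem IsFlowSol.locAC (hab : Admissible a b ν κ) {w : ℝ → Spinor} (h : IsFlowSol a b z w) :
    LocAC w fun x => act (flowMat (a x) (b x) z) (w x) :=
  LocAC.of_hasDerivAt h (continuousOn_act_flowMat hab.cont_a hab.cont_b h.continuousOn)

theorem act_zero (T : Mat4) : act T 0 = 0 := by simp [act]

theorem IsFlowSol.isForcedSol (hab : Admissible a b ν κ) {w : ℝ → Spinor}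
    (h : IsFlowSol a b z w) : IsForcedSol a b z (fun _ => 0) w :=
  ⟨_, h.locAC hab, .of_forall fun x => by rw [act_zero, add_zero]⟩

theorem IsFlowSol.eq_of_eq (hab : Admissible a b ν κ) {w v : ℝ → Spinor} (h : IsFlowSol a b z w)
    (k : IsFlowSol a b z v) {x₀ : ℝ} (hx₀ : x₀ < 0) (h0 : w x₀ = v x₀) : ∀ x < 0, w x = v x := by
  have h1 := (h.add (k.smul (-1))).eq_zero_of_eq_zero hab.cont_a hab.cont_b hx₀ (by
    rw [h0]
    simp)
  intro x hx
  have h2 := h1 x hx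
  rwa [neg_one_smul, ← sub_eq_add_neg, sub_eq_zero] at h2

theorem memLp_Iio_zero {E : Type*} [NormedAddCommGroup E] {w : ℝ → E}
    (hw : ContinuousOn w (Iio 0)) {c d : ℝ} (hd : d < 0)
    (h1 : MemLp w 2 (volume.restrict (Iio c))) (h2 : MemLp w 2 (volume.restrict (Ioo d 0))) :
    MemLp w 2 (volume.restrict (Iio (0 : ℝ))) := by
  rw [memLp_two_iff_integrable_sq_norm (hw.aestronglyMeasurable measurableSet_Iio)]
  have h3 : IntegrableOn (fun x => ‖w x‖ ^ 2) (Icc c d) :=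
    ContinuousOn.integrableOn_Icc ((hw.mono fun y hy => lt_of_le_of_lt hy.2 hd).norm.pow 2)
  refine IntegrableOn.mono_set ((IntegrableOn.union
    ((memLp_two_iff_integrable_sq_norm h1.1).1 h1) h3).union
    ((memLp_two_iff_integrable_sq_norm h2.1).1 h2)) fun y hy => ?_
  rcases lt_or_ge y c with h | h
  · exact Or.inl (Or.inl h)
  · rcases le_or_gt y d with h' | h'
    · exact Or.inl (Or.inr ⟨h, h'⟩)
    · exact Or.inr ⟨h', hy⟩

/-- The leading term `e^{-izx}` sits in the second component alone, so it survives in `ψ₂ + σ ψ₃`.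
For `σ = ±1` this says that the Jost solution has a nonzero part in both eigenspaces of `tilde`. -/
theorem JostSol.add_tilde_ne_zero {ψ : ℝ → Spinor} (h : JostSol a b z ψ) (σ : ℝ) :
    ∃ x < 0, ψ x + (σ : ℂ) • tilde (ψ x) ≠ 0 := by
  by_contra! hcon
  set D : ℝ → Spinor := fun x => ψ x - EuclideanSpace.single 1 (Complex.exp (-Complex.I * z * x))
  have h1 := h.asymp.def (show 0 < 1 / (2 * (1 + |σ|)) by positivity)
  obtain ⟨x, hx, hx0⟩ := (h1.and (eventually_lt_atBot 0)).exists
  have e : ψ x 1 + σ * ψ x 2 = 0 := by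
    have := congrArg (fun v : Spinor => v 1) (hcon x hx0)
    simpa [(tilde_apply (ψ x)).2.1] using this
  have e1 : D x 1 + σ * D x 2 = -Complex.exp (-Complex.I * z * x) := by
    simp only [D, PiLp.sub_apply, PiLp.single_apply]
    simp
    linear_combination e
  have e2 := congrArg norm e1
  rw [norm_neg, norm_exp_jost] at e2
  have h2 := norm_spinor_apply_le (D x) 1
  have h3 := norm_spinor_apply_le (D x) 2
  have h4 := norm_add_le (D x 1) (σ * D x 2)
  rw [e2, norm_mul, Complex.norm_real, Real.norm_eq_abs] at h4
  rw [Real.norm_of_nonneg (Real.exp_pos _).le] at hx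
  have h5 : (1 + |σ|) * ‖D x‖ ≤ Real.exp (z.im * x) / 2 := by
    have := mul_le_mul_of_nonneg_left hx (show 0 ≤ 1 + |σ| by positivity)
    refine this.trans (le_of_eq ?_)
    field_simp
  have h6 : |σ| * ‖D x 2‖ ≤ |σ| * ‖D x‖ := by gcongr
  linarith [Real.exp_pos (z.im * x)]

theorem add_smul_tilde_eq_pairSpinor {σ : ℝ} (hσ : σ ^ 2 = 1) (v : Spinor) :
    v + (σ : ℂ) • tilde v = pairSpinor σ (v 0 - σ * v 3) (v 2 + σ * v 1) := by
  obtain ⟨t0, t1, t2, t3⟩ := tilde_apply v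
  have hs : (σ : ℂ) ^ 2 = 1 := by exact_mod_cast hσ
  obtain ⟨p0, p1, p2, p3⟩ := pairSpinor_apply σ (v 0 - σ * v 3) (v 2 + σ * v 1)
  apply spinor_ext
  · rw [p0, PiLp.add_apply, PiLp.smul_apply, smul_eq_mul, t0]
    ring
  · rw [p1, PiLp.add_apply, PiLp.smul_apply, smul_eq_mul, t1]
    linear_combination -(v 1) * hs
  · rw [p2, PiLp.add_apply, PiLp.smul_apply, smul_eq_mul, t2]
  · rw [p3, PiLp.add_apply, PiLp.smul_apply, smul_eq_mul, t3]
    linear_combination -(v 3) * hs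

theorem pairSpinor_ne_zero_of {σ : ℝ} {p q : ℂ} (h : pairSpinor σ p q ≠ 0) : p ≠ 0 ∨ q ≠ 0 := by
  by_contra! hcon
  refine h (spinor_ext ?_ ?_ ?_ ?_) <;> simp [pairSpinor_apply, hcon]

/-- Up to the sign `σ`, this number is the 2×2 Wronskian of the parts `Φ`, `Ψ` of `φ`, `ψ` in the
`σ`-eigenspace of `tilde`. If it vanishes, `Φ` is a multiple of `Ψ`, hence square integrable at
`-∞`, and it satisfies the boundary condition; the energy estimate forces `Φ = 0`, against
nondegeneracy. -/
theorem add_mul_wronskian_ne_zero (hab : Admissible a b ν κ) (hz : 0 < z.im) {φ ψ : ℝ → Spinor}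
    (hφ : BdrySol a b ν z φ) (hψ : JostSol a b z ψ) (hn : IsNondegenerate φ) {σ : ℝ}
    (hσ : σ ^ 2 = 1) {x : ℝ} (hx : x < 0) :
    alphaW (φ x) (ψ x) + σ * betaW (φ x) (ψ x) ≠ 0 := by
  intro h0
  have hs : (σ : ℂ) ^ 2 = 1 := by exact_mod_cast hσ
  set Φ : ℝ → Spinor := fun x => φ x + (σ : ℂ) • tilde (φ x) with hΦ
  set Ψ : ℝ → Spinor := fun x => ψ x + (σ : ℂ) • tilde (ψ x) with hΨ
  have hΦf : BdrySol a b ν z Φ := hφ.add (hφ.tilde.const_smul σ)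
  have hΨf : IsFlowSol a b z Ψ := hψ.flow.add (hψ.flow.tilde.smul σ)
  have hΨx : Ψ x ≠ 0 := by
    intro h1
    obtain ⟨y, hy, hy2⟩ := hψ.add_tilde_ne_zero σ
    exact hy2 (hΨf.eq_zero_of_eq_zero hab.cont_a hab.cont_b hx h1 y hy)
  have ew : (φ x 0 - σ * φ x 3) * (ψ x 2 + σ * ψ x 1) -
      (φ x 2 + σ * φ x 1) * (ψ x 0 - σ * ψ x 3) = 0 := by
    rw [alphaW, betaW] at h0
    linear_combination σ * h0 + (ψ x 0 * φ x 2 - φ x 0 * ψ x 2) * hs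
  have hpΦ := add_smul_tilde_eq_pairSpinor hσ (φ x)
  have hpΨ := add_smul_tilde_eq_pairSpinor hσ (ψ x)
  set P := φ x 0 - σ * φ x 3
  set Q := φ x 2 + σ * φ x 1
  set R := ψ x 0 - σ * ψ x 3
  set S := ψ x 2 + σ * ψ x 1
  have hc : ∃ c : ℂ, P = c * R ∧ Q = c * S := by
    have hne : R ≠ 0 ∨ S ≠ 0 := by
      refine pairSpinor_ne_zero_of (σ := σ) ?_
      rw [← hpΨ]
      exact hΨx
    rcases hne with h | h
    · refine ⟨P / R, by field_simp, ?_⟩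
      field_simp
      linear_combination -ew
    · refine ⟨Q / S, ?_, by field_simp⟩
      field_simp
      linear_combination ew
  obtain ⟨c, hc1, hc2⟩ := hc
  have hΦΨ : ∀ y < 0, Φ y = c • Ψ y := by
    refine hΦf.flow.eq_of_eq hab (hΨf.smul c) hx ?_
    simp only [hΦ, hΨ]
    rw [hpΦ, hpΨ, hc1, hc2]
    apply spinor_ext <;> simp [pairSpinor_apply] <;> ring
  have hΨ2 : MemLp Ψ 2 (volume.restrict (Iio (-1))) := by
    refine (hψ.memLp hz (by norm_num)).add (MemLp.const_smul ?_ (σ : ℂ))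
    have h2 := hψ.memLp hz (show (-1 : ℝ) < 0 by norm_num)
    refine h2.of_le (continuous_tilde.comp_aestronglyMeasurable h2.1) (.of_forall fun y => ?_)
    rw [norm_tilde]
  have hΦ2 : MemLp Φ 2 (volume.restrict (Iio (-1))) := by
    refine (hΨ2.const_smul c).ae_eq ?_
    filter_upwards [ae_restrict_mem measurableSet_Iio] with y hy
    have hy' : y < -1 := hy
    exact (hΦΨ y (by linarith)).symm
  have hzero := (hΦf.flow.isForcedSol hab).eq_zero hab hz
    (memLp_Iio_zero hΦf.flow.continuousOn (d := -1) (by norm_num) hΦ2 (hΦf.memLp hab _)) hΦf.bdry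
  have h3 := (LinearIndependent.pair_iff.1 hn) 1 σ (by
    ext1 y
    change (1 : ℂ) • φ y + (σ : ℂ) • tilde (φ y) = 0
    rw [one_smul]
    exact hzero y y.2)
  exact one_ne_zero h3.1

theorem sq_sub_sq_wronskian_ne_zero (hab : Admissible a b ν κ) (hz : 0 < z.im) {φ ψ : ℝ → Spinor}
    (hφ : BdrySol a b ν z φ) (hψ : JostSol a b z ψ) (hn : IsNondegenerate φ) {x : ℝ} (hx : x < 0) :
    alphaW (φ x) (ψ x) ^ 2 - betaW (φ x) (ψ x) ^ 2 ≠ 0 := by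
  have h1 := add_mul_wronskian_ne_zero hab hz hφ hψ hn (σ := 1) (by norm_num) hx
  have h2 := add_mul_wronskian_ne_zero hab hz hφ hψ hn (σ := -1) (by norm_num) hx
  rw [sq_sub_sq]
  refine mul_ne_zero ?_ ?_
  · simpa using h1
  · simpa [sub_eq_add_neg] using h2

theorem Admissible.const_mul (hab : Admissible a b ν κ) (σ : ℝ) :
    Admissible (fun x => σ * a x) b ν κ := by
  refine ⟨hab.ν_pos, hab.κ_pos, continuousOn_const.mul hab.cont_a, hab.cont_b, ?_, hab.b_zero, ?_⟩
  · obtain ⟨C, hC⟩ := hab.a_bdd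
    refine ⟨|σ| * C, fun x hx => ?_⟩
    rw [abs_mul]
    exact mul_le_mul_of_nonneg_left (hC x hx) (abs_nonneg _)
  · intro k hk
    obtain ⟨C, hC⟩ := hab.decay k hk
    refine ⟨max (|σ| * C) C, fun x hx => ⟨?_, ?_⟩⟩
    · rw [abs_mul]
      calc |σ| * |a x| ≤ |σ| * (C * Real.exp (k * x)) := by
            gcongr
            exact (hC x hx).1
        _ = |σ| * C * Real.exp (k * x) := by ring
        _ ≤ _ := mul_le_mul_of_nonneg_right (le_max_left _ _) (Real.exp_pos _).le
    · exact (hC x hx).2.trans (mul_le_mul_of_nonneg_right (le_max_right _ _) (Real.exp_pos _).le)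

theorem norm_spinor_le (v : Spinor) : ‖v‖ ≤ ‖v 0‖ + ‖v 1‖ + ‖v 2‖ + ‖v 3‖ := by
  refine (sq_le_sq₀ (norm_nonneg _) (by positivity)).1 ?_
  rw [norm_spinor_sq]
  have h0 := norm_nonneg (v 0)
  have h1 := norm_nonneg (v 1)
  have h2 := norm_nonneg (v 2)
  have h3 := norm_nonneg (v 3)
  nlinarith [mul_nonneg h0 h1, mul_nonneg h0 h2, mul_nonneg h0 h3, mul_nonneg h1 h2,
    mul_nonneg h1 h3, mul_nonneg h2 h3]

theorem norm_pairSpinor_le {σ : ℝ} (hσ : |σ| = 1) (p q : ℂ) :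
    ‖pairSpinor σ p q‖ ≤ 2 * (‖p‖ + ‖q‖) := by
  have h := norm_spinor_le (pairSpinor σ p q)
  obtain ⟨p0, p1, p2, p3⟩ := pairSpinor_apply σ p q
  rw [p0, p1, p2, p3, norm_neg, norm_mul, norm_mul, Complex.norm_real, Real.norm_eq_abs, hσ] at h
  linarith

theorem differentiableOn_spinor_iff {w : ℂ → Spinor} {s : Set ℂ} :
    DifferentiableOn ℂ w s ↔ ∀ i, DifferentiableOn ℂ (fun y => w y i) s :=
  differentiableOn_euclidean

theorem isLittleO_spinor {w : ℝ → Spinor} {g : ℝ → ℝ} {F : Filter ℝ}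
    (h : ∀ i, (fun x => w x i) =o[F] g) : w =o[F] g := by
  have h1 := (((h 0).norm_left.add (h 1).norm_left).add (h 2).norm_left).add (h 3).norm_left
  refine IsBigO.trans_isLittleO (IsBigO.of_bound 1 (.of_forall fun x => ?_)) h1
  rw [one_mul]
  exact (norm_spinor_le _).trans (le_abs_self _)

/-- Half the difference of the solutions in the two eigenspaces: their terms `e^{-izx}` add up in
the second component and cancel in the third. -/
theorem exists_jost_family (hab : Admissible a b ν κ) {ε : ℝ} (hε : 0 < ε) (hεκ : 2 * ε < κ) :
    ∃ ψ : ℂ → ℝ → Spinor, (∀ z ∈ halfPlane ε, JostSol a b z (ψ z)) ∧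
      (∀ x < 0, DifferentiableOn ℂ (fun z => ψ z x) (halfPlane ε)) ∧
      ∃ C, ∀ z ∈ halfPlane ε, ∀ x ≤ -1, ‖ψ z x‖ ≤ C * Real.exp (z.im * x) := by
  obtain ⟨p, q, h1, h2, C, h3⟩ := exists_jost_pair (hab.const_mul 1) hε hεκ
  obtain ⟨p', q', h1', h2', C', h3'⟩ := exists_jost_pair (hab.const_mul (-1)) hε hεκ
  refine ⟨fun z x => (1 / 2 : ℂ) • (pairSpinor 1 (p z x) (q z x) +
    (-1 : ℂ) • pairSpinor (-1) (p' z x) (q' z x)), fun z hz => ⟨?_, ?_⟩, fun x hx => ?_,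
    2 * (C + C'), fun z hz x hx => ?_⟩
  · exact (((h1 z hz).1.isFlowSol (by norm_num)).add
      (((h1' z hz).1.isFlowSol (by norm_num)).smul (-1))).smul _
  · obtain ⟨-, kp, kq⟩ := h1 z hz
    obtain ⟨-, kp', kq'⟩ := h1' z hz
    refine isLittleO_spinor (forall_fin_four.2 ⟨?_, ?_, ?_, ?_⟩)
    · refine ((kp.sub kp').const_mul_left (1 / 2 : ℂ)).congr_left fun x => ?_
      simp [pairSpinor_apply]
      ring
    · refine ((kq.add kq').const_mul_left (1 / 2 : ℂ)).congr_left fun x => ?_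
      simp [pairSpinor_apply]
      ring
    · refine ((kq.sub kq').const_mul_left (1 / 2 : ℂ)).congr_left fun x => ?_
      simp [pairSpinor_apply]
      ring
    · refine ((kp.add kp').const_mul_left (-1 / 2 : ℂ)).congr_left fun x => ?_
      simp [pairSpinor_apply]
      ring
  · obtain ⟨dp, dq⟩ := h2 x hx
    obtain ⟨dp', dq'⟩ := h2' x hx
    rw [differentiableOn_spinor_iff, forall_fin_four]
    simp only [PiLp.smul_apply, PiLp.add_apply, pairSpinor_apply, smul_eq_mul]
    refine ⟨?_, ?_, ?_, ?_⟩ <;> fun_prop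
  · have k := h3 z hz x hx
    have k' := h3' z hz x hx
    have n1 := norm_pairSpinor_le (σ := 1) (by norm_num) (p z x) (q z x)
    have n2 := norm_pairSpinor_le (σ := -1) (by norm_num) (p' z x) (q' z x)
    have n3 := norm_add_le (pairSpinor 1 (p z x) (q z x))
      ((-1 : ℂ) • pairSpinor (-1) (p' z x) (q' z x))
    rw [norm_smul] at n3 ⊢
    norm_num at n3 ⊢
    linarith

/-- The sum of one nonzero boundary solution in each eigenspace of `tilde`. A relation `c φ + d φ̃ =
0` multiplies the two parts by `c + d` and `c - d`, so both vanish: this is nondegeneracy. -/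
theorem exists_bdry_family (hab : Admissible a b ν κ) :
    ∃ φ : ℂ → ℝ → Spinor, (∀ z, BdrySol a b ν z (φ z) ∧ IsNondegenerate (φ z)) ∧
      (∀ x, Differentiable ℂ fun z => φ z x) ∧
      (1 ≤ 2 * ν → ∀ r, ∃ C, ∀ z, ‖z‖ < r → ∀ x ∈ Ico (-1 : ℝ) 0, ‖φ z x‖ ≤ C * (-x) ^ ν) := by
  obtain ⟨p, q, h1, h2, h3⟩ := exists_boundary_pair (hab.const_mul 1)
  obtain ⟨p', q', h1', h2', h3'⟩ := exists_boundary_pair (hab.const_mul (-1))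
  have hpair : ∀ {σ : ℝ} (hσ : σ ^ 2 = 1) {z : ℂ} {p q : ℝ → ℂ},
      IsPairSol (fun x => σ * a x) b z p q →
      (2 * ν < 1 → (fun x => p x + q x) =o[𝓝[<] 0] fun x => √(-x)) →
      (1 ≤ 2 * ν → Tendsto p (𝓝[<] 0) (𝓝 0) ∧ Tendsto q (𝓝[<] 0) (𝓝 0)) →
      BdrySol a b ν z fun x => pairSpinor σ (p x) (q x) := by
    intro σ hσ z p q k1 k2 k3
    refine ⟨k1.isFlowSol hσ, fun hν => ?_, fun hν => ?_⟩
    · refine isLittleO_spinor (forall_fin_four.2 ?_)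
      simp only [act_boundary_apply, pairSpinor_apply]
      refine ⟨(k2 hν).const_mul_left _, ?_, (k2 hν).const_mul_left _, ?_⟩
      · refine ((k2 hν).const_mul_left (Complex.I * σ)).congr_left fun x => ?_
        ring
      · refine ((k2 hν).const_mul_left (-(Complex.I * σ))).congr_left fun x => ?_
        ring
    · obtain ⟨kp, kq⟩ := k3 hν
      have h4 : Tendsto (fun x => 2 * (‖p x‖ + ‖q x‖)) (𝓝[<] 0) (𝓝 0) := by
        simpa using (kp.norm.add kq.norm).const_mul 2
      refine squeeze_zero_norm (fun x => norm_pairSpinor_le ?_ _ _) h4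
      rw [← sq_eq_sq₀ (abs_nonneg _) zero_le_one, sq_abs, hσ, one_pow]
  refine ⟨fun z x => pairSpinor 1 (p z x) (q z x) + pairSpinor (-1) (p' z x) (q' z x),
    fun z => ⟨?_, ?_⟩, fun x => ?_, fun hν r => ?_⟩
  · obtain ⟨k1, k2, k3, -⟩ := h1 z
    obtain ⟨k1', k2', k3', -⟩ := h1' z
    exact (hpair (by norm_num) k1 k2 k3).add (hpair (by norm_num) k1' k2' k3')
  · obtain ⟨x, hx, hpq⟩ := (h1 z).2.2.2
    obtain ⟨y, hy, hpq'⟩ := (h1' z).2.2.2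
    refine LinearIndependent.pair_iff.2 fun c d hcd => ?_
    have key : ∀ t < 0, (c + d) * p z t = 0 ∧ (c + d) * q z t = 0 ∧ (c - d) * p' z t = 0 ∧
        (c - d) * q' z t = 0 := by
      intro t ht
      have h4 := congrFun hcd ⟨t, ht⟩
      have h5 := fun i : Fin 4 => congrArg (fun v : Spinor => v i) h4
      have e0 := h5 0
      have e1 := h5 1
      have e2 := h5 2
      have e3 := h5 3
      simp [tilde_apply, pairSpinor_apply] at e0 e1 e2 e3
      refine ⟨?_, ?_, ?_, ?_⟩
      · linear_combination (1 / 2) * e0 - (1 / 2) * e3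
      · linear_combination (1 / 2) * e1 + (1 / 2) * e2
      · linear_combination (1 / 2) * e0 + (1 / 2) * e3
      · linear_combination (1 / 2) * e2 - (1 / 2) * e1
    have hplus : c + d = 0 := by
      obtain ⟨k1, k2, -, -⟩ := key x hx
      rcases hpq with h | h
      · exact (mul_eq_zero.1 k1).resolve_right h
      · exact (mul_eq_zero.1 k2).resolve_right h
    have hminus : c - d = 0 := by
      obtain ⟨-, -, k1, k2⟩ := key y hy
      rcases hpq' with h | h
      · exact (mul_eq_zero.1 k1).resolve_right h
      · exact (mul_eq_zero.1 k2).resolve_right h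
    exact ⟨by linear_combination (1 / 2) * hplus + (1 / 2) * hminus,
      by linear_combination (1 / 2) * hplus - (1 / 2) * hminus⟩
  · obtain ⟨dp, dq⟩ := h2 x
    obtain ⟨dp', dq'⟩ := h2' x
    rw [← differentiableOn_univ, differentiableOn_spinor_iff, forall_fin_four]
    simp only [differentiableOn_univ, PiLp.add_apply, pairSpinor_apply]
    refine ⟨?_, ?_, ?_, ?_⟩ <;> fun_prop
  · obtain ⟨C, hC⟩ := h3 hν r
    obtain ⟨C', hC'⟩ := h3' hν r
    refine ⟨4 * (C + C'), fun z hz x hx => ?_⟩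
    have k := hC z hz x hx
    have k' := hC' z hz x hx
    have n1 := norm_pairSpinor_le (σ := 1) (by norm_num) (p z x) (q z x)
    have n2 := norm_pairSpinor_le (σ := -1) (by norm_num) (p' z x) (q' z x)
    have n3 := norm_add_le (pairSpinor 1 (p z x) (q z x)) (pairSpinor (-1) (p' z x) (q' z x))
    linarith

end

end SAdS

open MeasureTheory Set Filter Topology Asymptotics

namespace SAdS

noncomputable section

/-! ### The Green function -/

variable {a b : ℝ → ℝ} {ν κ : ℝ} {z : ℂ}

theorem norm_sum_mul_le (v w : Spinor) : ‖∑ i, v i * w i‖ ≤ 1 * ‖v‖ * ‖w‖ := by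
  refine (norm_sum_le _ _).trans ?_
  rw [one_mul]
  refine (sq_le_sq₀ (Finset.sum_nonneg fun i _ => norm_nonneg _) (by positivity)).1 ?_
  rw [mul_pow, EuclideanSpace.norm_sq_eq, EuclideanSpace.norm_sq_eq]
  simp only [norm_mul]
  exact Finset.sum_mul_sq_le_sq_mul_sq _ _ _

/-- The bilinear form `vᵗ w`. -/
def dotL : Spinor →L[ℂ] Spinor →L[ℂ] ℂ :=
  LinearMap.mkContinuous₂ (LinearMap.mk₂ ℂ (fun v w : Spinor => ∑ i, v i * w i)
    (fun v v' w => by simp [add_mul, Finset.sum_add_distrib])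
    (fun c v w => by simp [Finset.mul_sum, mul_assoc])
    (fun v w w' => by simp [mul_add, Finset.sum_add_distrib])
    (fun c v w => by simp [Finset.mul_sum, mul_left_comm])) 1 norm_sum_mul_le

theorem dotL_apply (v w : Spinor) : dotL v w = ∑ i, v i * w i := rfl

theorem norm_dotL_le (v w : Spinor) : ‖dotL v w‖ ≤ ‖v‖ * ‖w‖ := by
  have h := norm_sum_mul_le v w
  rwa [one_mul] at h

theorem act_outer (v w g : Spinor) : act (outer v w) g = dotL w g • v := by
  ext i
  rw [act_apply, PiLp.smul_apply, dotL_apply, smul_eq_mul, Finset.sum_mul]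
  refine Finset.sum_congr rfl fun j _ => ?_
  simp only [outer, Matrix.vecMulVec_apply]
  ring

theorem act_add (S T : Mat4) (v : Spinor) : act (S + T) v = act S v + act T v := by
  simp [act]

theorem act_sub (S T : Mat4) (v : Spinor) : act (S - T) v = act S v - act T v := by
  simp [act]

theorem act_mul (S T : Mat4) (v : Spinor) : act (S * T) v = act S (act T v) := by
  simp [act]

theorem act_add_right (T : Mat4) (v w : Spinor) : act T (v + w) = act T v + act T w := by
  simp [act]

theorem act_smul_right (T : Mat4) (c : ℂ) (v : Spinor) : act T (c • v) = c • act T v := by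
  simp [act]

theorem memLp_act {f : ℝ → Spinor} {μ : Measure ℝ} (h : MemLp f 2 μ) (T : Mat4) :
    MemLp (fun x => act T (f x)) 2 μ :=
  (Matrix.toEuclideanCLM (n := Fin 4) (𝕜 := ℂ) T).comp_memLp' h

theorem integrable_dotL {f g : ℝ → Spinor} {μ : Measure ℝ} (hf : MemLp f 2 μ) (hg : MemLp g 2 μ) :
    Integrable (fun x => dotL (f x) (g x)) μ := by
  refine (hf.norm.integrable_mul hg.norm).mono' (dotL.aestronglyMeasurable_comp₂ hf.1 hg.1)
    (.of_forall fun x => norm_dotL_le _ _)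

theorem LocAC.integral_Iio {E : Type*} [NormedAddCommGroup E] [NormedSpace ℝ E] {k : ℝ → E}
    (hk : ∀ x < 0, IntegrableOn k (Iio x)) :
    LocAC (fun x => ∫ y in Iio x, k y) k := by
  intro c hc d hd
  have hi : ∀ x < 0, IntegrableOn k (Iic x) := fun x hx =>
    (hk (x / 2) (by linarith)).mono_set fun y (hy : y ≤ x) => show y < x / 2 by linarith
  refine ⟨?_, ?_⟩
  · rw [intervalIntegrable_iff]
    exact (hi (max c d) (max_lt hc hd)).mono_set fun y hy => hy.2
  · change (∫ y in Iio d, k y) - (∫ y in Iio c, k y) = _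
    rw [← integral_Iic_eq_integral_Iio, ← integral_Iic_eq_integral_Iio]
    exact intervalIntegral.integral_Iic_sub_Iic (hi c hc) (hi d hd)

theorem LocAC.integral_Ioo {E : Type*} [NormedAddCommGroup E] [NormedSpace ℝ E] {k : ℝ → E}
    (hk : ∀ x < 0, IntegrableOn k (Ioo x 0)) :
    LocAC (fun x => ∫ y in Ioo x 0, k y) fun x => -k x := by
  have hi : ∀ x < 0, IntervalIntegrable k volume x 0 := fun x hx => by
    rw [intervalIntegrable_iff_integrableOn_Ioo_of_le hx.le]
    exact hk x hx
  have he : ∀ x < 0, ∫ y in Ioo x 0, k y = ∫ y in x..0, k y := fun x hx => by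
    rw [← integral_Ioc_eq_integral_Ioo, intervalIntegral.integral_of_le hx.le]
  intro c hc d hd
  have hcd := (hi c hc).trans (hi d hd).symm
  refine ⟨hcd.neg, ?_⟩
  change (∫ y in Ioo d 0, k y) - (∫ y in Ioo c 0, k y) = ∫ t in c..d, -k t
  rw [he c hc, he d hd, intervalIntegral.integral_neg,
    ← intervalIntegral.integral_add_adjacent_intervals hcd (hi d hd)]
  abel

/-- A solution with the boundary behaviour at `0` and one that is square integrable at `-∞`. -/
structure GreenPair (a b : ℝ → ℝ) (ν : ℝ) (z : ℂ) (φ ψ : ℝ → Spinor) : Prop where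
  bdry : BdrySol a b ν z φ
  flow : IsFlowSol a b z ψ
  memLp : ∀ x < 0, MemLp ψ 2 (volume.restrict (Iio x))

/-- `φ(x) ∫_{-∞}^x ψᵗ g + ψ(x) ∫_x^0 φᵗ g`. -/
def halfGreen (φ ψ g : ℝ → Spinor) (x : ℝ) : Spinor :=
  (∫ y in Iio x, dotL (ψ y) (g y)) • φ x + (∫ y in Ioo x 0, dotL (φ y) (g y)) • ψ x

namespace GreenPair

variable {φ ψ g : ℝ → Spinor}

theorem tilde (h : GreenPair a b ν z φ ψ) :
    GreenPair a b ν z (fun x => tilde (φ x)) fun x => tilde (ψ x) := by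
  refine ⟨h.bdry.tilde, h.flow.tilde, fun x hx => ?_⟩
  have h2 := h.memLp x hx
  refine h2.of_le (continuous_tilde.comp_aestronglyMeasurable h2.1) (.of_forall fun y => ?_)
  rw [norm_tilde]

theorem integrable_left (h : GreenPair a b ν z φ ψ)
    (hg : MemLp g 2 (volume.restrict (Iio (0 : ℝ)))) {x : ℝ} (hx : x < 0) :
    IntegrableOn (fun y => dotL (ψ y) (g y)) (Iio x) :=
  integrable_dotL (h.memLp x hx) (hg.mono_measure (Measure.restrict_mono_set _
    (Iio_subset_Iio hx.le)))

theorem integrable_right (h : GreenPair a b ν z φ ψ) (hab : Admissible a b ν κ)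
    (hg : MemLp g 2 (volume.restrict (Iio (0 : ℝ)))) (x : ℝ) :
    IntegrableOn (fun y => dotL (φ y) (g y)) (Ioo x 0) :=
  integrable_dotL (h.bdry.memLp hab x) (hg.mono_measure (Measure.restrict_mono_set _
    Ioo_subset_Iio_self))

/-- Variation of constants: differentiating `φ` and `ψ` reproduces the equation, differentiating the
integrals leaves the diagonal jump. -/
theorem locAC (h : GreenPair a b ν z φ ψ) (hab : Admissible a b ν κ)
    (hg : MemLp g 2 (volume.restrict (Iio (0 : ℝ)))) :
    LocAC (halfGreen φ ψ g) fun x => act (flowMat (a x) (b x) z) (halfGreen φ ψ g x) +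
      (dotL (ψ x) (g x) • φ x - dotL (φ x) (g x) • ψ x) := by
  have h1 := (LocAC.integral_Iio fun x hx => h.integrable_left hg hx).smul (h.bdry.flow.locAC hab)
  have h2 := (LocAC.integral_Ioo fun x hx => h.integrable_right hab hg x).smul (h.flow.locAC hab)
  refine (h1.add h2).congr_ae (.of_forall fun x => ?_)
  rw [halfGreen, act_add_right, act_smul_right, act_smul_right, neg_smul]
  abel

theorem halfGreen_eq_of_lt {c : ℝ} (hg0 : ∀ y ≤ c, g y = 0) {x : ℝ} (hx : x < c) :
    halfGreen φ ψ g x = (∫ y in Ioo c 0, dotL (φ y) (g y)) • ψ x := by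
  have h1 : ∫ y in Iio x, dotL (ψ y) (g y) = 0 :=
    setIntegral_eq_zero_of_forall_eq_zero fun y hy => by
      rw [hg0 y ((show y < x from hy).trans hx).le, map_zero]
  have h2 : ∫ y in Ioo x 0, dotL (φ y) (g y) = ∫ y in Ioo c 0, dotL (φ y) (g y) :=
    setIntegral_eq_of_subset_of_forall_sdiff_eq_zero measurableSet_Ioo
      (Ioo_subset_Ioo_left hx.le) fun y hy => by
      rw [hg0 y (not_lt.1 fun hc => hy.2 ⟨hc, hy.1.2⟩), map_zero]
  rw [halfGreen, h1, h2, zero_smul, zero_add]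

theorem halfGreen_eq_of_gt {d : ℝ} (hg0 : ∀ y, d ≤ y → g y = 0) {x : ℝ} (hx : d < x) :
    halfGreen φ ψ g x = (∫ y in Iio d, dotL (ψ y) (g y)) • φ x := by
  have h1 : ∫ y in Ioo x 0, dotL (φ y) (g y) = 0 :=
    setIntegral_eq_zero_of_forall_eq_zero fun y hy => by
      rw [hg0 y (hx.trans hy.1).le, map_zero]
  have h2 : ∫ y in Iio x, dotL (ψ y) (g y) = ∫ y in Iio d, dotL (ψ y) (g y) :=
    setIntegral_eq_of_subset_of_forall_sdiff_eq_zero measurableSet_Iio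
      (Iio_subset_Iio hx.le) fun y hy => by
      rw [hg0 y (not_lt.1 hy.2), map_zero]
  rw [halfGreen, h1, h2, zero_smul, add_zero]

/-- For a source vanishing near both ends, the function is a multiple of `ψ` near `-∞` and of `φ`
near `0`, and each is square integrable on its side. -/
theorem memLp_halfGreen (h : GreenPair a b ν z φ ψ) (hab : Admissible a b ν κ)
    (hg : MemLp g 2 (volume.restrict (Iio (0 : ℝ)))) {c d : ℝ} (hc : c < 0) (hd : d < 0)
    (hgc : ∀ y ≤ c, g y = 0) (hgd : ∀ y, d ≤ y → g y = 0) :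
    MemLp (halfGreen φ ψ g) 2 (volume.restrict (Iio (0 : ℝ))) := by
  refine memLp_Iio_zero (h.locAC hab hg).continuousOn (c := c) hd ?_ ?_
  · refine ((h.memLp c hc).const_smul (∫ y in Ioo c 0, dotL (φ y) (g y))).ae_eq ?_
    filter_upwards [ae_restrict_mem measurableSet_Iio] with x hx
    exact (halfGreen_eq_of_lt hgc hx).symm
  · refine ((h.bdry.memLp hab d).const_smul (∫ y in Iio d, dotL (ψ y) (g y))).ae_eq ?_
    filter_upwards [ae_restrict_mem measurableSet_Ioo] with x hx
    exact (halfGreen_eq_of_gt hgd hx.1).symm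

theorem boundaryCond_halfGreen_of_eq_zero (h : GreenPair a b ν z φ ψ) (hν : 2 * ν < 1) {d : ℝ}
    (hd : d < 0) (hgd : ∀ y, d ≤ y → g y = 0) : BoundaryCond (halfGreen φ ψ g) := by
  refine ((h.bdry.bdry hν).const_smul (∫ y in Iio d, dotL (ψ y) (g y))).congr ?_
  filter_upwards [Ioo_mem_nhdsLT hd] with x hx
  exact halfGreen_eq_of_gt hgd hx.1

theorem tendsto_halfGreen (h : GreenPair a b ν z φ ψ) (hab : Admissible a b ν κ)
    (hg : MemLp g 2 (volume.restrict (Iio (0 : ℝ)))) {s : ℕ → Set ℝ}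
    (hs : ∀ n, MeasurableSet (s n)) (hs' : ∀ y < 0, ∀ᶠ n in atTop, y ∈ s n) {x : ℝ} (hx : x < 0) :
    Tendsto (fun n => halfGreen φ ψ ((s n).indicator g) x) atTop (𝓝 (halfGreen φ ψ g x)) := by
  have key : ∀ (t : Set ℝ) (χ : ℝ → Spinor), MeasurableSet t → t ⊆ Iio 0 →
      IntegrableOn (fun y => dotL (χ y) (g y)) t →
      Tendsto (fun n => ∫ y in t, dotL (χ y) ((s n).indicator g y)) atTop
        (𝓝 (∫ y in t, dotL (χ y) (g y))) := by
    intro t χ ht ht0 hi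
    have e : ∀ n y, dotL (χ y) ((s n).indicator g y) =
        (s n).indicator (fun y => dotL (χ y) (g y)) y := by
      intro n y
      by_cases hy : y ∈ s n
      · rw [indicator_of_mem hy, indicator_of_mem hy]
      · rw [indicator_of_notMem hy, indicator_of_notMem hy, map_zero]
    simp only [e]
    refine tendsto_integral_of_dominated_convergence (fun y => ‖dotL (χ y) (g y)‖)
      (fun n => hi.1.indicator (hs n)) hi.norm (fun n => .of_forall fun y =>
        norm_indicator_le_norm_self _ _) ?_
    filter_upwards [ae_restrict_mem ht] with y hy
    refine tendsto_const_nhds.congr' ?_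
    filter_upwards [hs' y (ht0 hy)] with n hn
    rw [indicator_of_mem hn]
  exact ((key (Iio x) ψ measurableSet_Iio (Iio_subset_Iio hx.le) (h.integrable_left hg hx)).smul_const
    _).add ((key (Ioo x 0) φ measurableSet_Ioo Ioo_subset_Iio_self
      (h.integrable_right hab hg x)).smul_const _)

end GreenPair

/-! ### The boundary condition for Green integrals when `2ν < 1`. -/

/-- The decaying component at `0`: `U' = -b U + g` with `U, g = O((-x)^{-ν})`. -/
theorem Admissible.exists_norm_le_rpow (hab : Admissible a b ν κ) (hν : 2 * ν < 1) {U g : ℝ → ℂ}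
    (hU : ∀ x < 0, HasDerivAt U (-(b x * U x) + g x) x) {C : ℝ} (hC : 0 ≤ C)
    (hUC : ∀ x ∈ Ico (-1 : ℝ) 0, ‖U x‖ + ‖g x‖ ≤ C * (-x) ^ (-ν)) :
    ∃ K, 0 ≤ K ∧ ∀ x ∈ Ico (-1 : ℝ) 0, ‖U x‖ ≤ K * (-x) ^ ν := by
  obtain ⟨Cb, hCb⟩ := hab.b_zero
  set D := max Cb 1 * C
  have hD : 0 ≤ D := by positivity
  have hν1 : 0 < 1 - 2 * ν := by linarith
  set F : ℝ → ℂ := fun x => (((-x) ^ (-ν) : ℝ) : ℂ) * U x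
  set F' : ℝ → ℂ := fun x => (((-x) ^ (-ν) : ℝ) : ℂ) * (((ν / (-x) - b x : ℝ) : ℂ) * U x + g x)
  have hF : ∀ x < 0, HasDerivAt F (F' x) x := by
    intro x hx
    have hx0 : 0 < -x := by linarith
    have h1 := ((Real.hasDerivAt_rpow_const (x := -x) (p := -ν) (Or.inl (by linarith))).comp x
        (hasDerivAt_neg x)).ofReal_comp
    refine (h1.mul (hU x hx)).congr_deriv ?_
    have e4 : -ν * (-x) ^ (-ν - 1) * -1 = (-x) ^ (-ν) * (ν / (-x)) := by
      rw [Real.rpow_sub_one hx0.ne']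
      field_simp
    simp only [F', Function.comp_apply, e4]
    push_cast
    ring
  -- The derivative of `F = (-x)^{-ν} U` is `O((-x)^{-2ν})`, integrable up to `0` since `2ν < 1`;
  -- `B` is the bounded primitive that dominates `F`.
  set B : ℝ → ℝ := fun x => ‖F (-1)‖ + D / (1 - 2 * ν) * (1 - (-x) ^ (1 - 2 * ν))
  have hB : ∀ x < 0, HasDerivAt B (D * (-x) ^ (-2 * ν)) x := by
    intro x hx
    have hx0 : 0 < -x := by linarith
    have h1 := ((Real.hasDerivAt_rpow_const (x := -x) (p := 1 - 2 * ν) (Or.inl (by linarith))).comp x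
        (hasDerivAt_neg x))
    refine (((h1.const_sub 1).const_mul (D / (1 - 2 * ν))).const_add ‖F (-1)‖).congr_deriv ?_
    rw [show 1 - 2 * ν - 1 = -2 * ν by ring]
    field_simp
  have hbound : ∀ x ∈ Ico (-1 : ℝ) 0, ‖F x‖ ≤ B x := by
    intro x hx
    refine image_norm_le_of_norm_deriv_right_le_deriv_boundary' (a := -1) (b := x)
      (f' := F') (B' := fun x => D * (-x) ^ (-2 * ν))
      (fun y hy => (hF y (by linarith [hy.2, hx.2])).continuousAt.continuousWithinAt)
      (fun y hy => (hF y (by linarith [hy.2, hx.2])).hasDerivWithinAt) ?_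
      (fun y hy => (hB y (by linarith [hy.2, hx.2])).continuousAt.continuousWithinAt)
      (fun y hy => (hB y (by linarith [hy.2, hx.2])).hasDerivWithinAt) ?_ ⟨hx.1, le_rfl⟩
    · simp [B]
    · intro y hy
      have hy0 : 0 < -y := by linarith [hy.2, hx.2]
      have hym : y ∈ Ico (-1 : ℝ) 0 := ⟨hy.1, by linarith⟩
      simp only [F']
      rw [norm_mul, Complex.norm_real, Real.norm_of_nonneg (by positivity)]
      have h1 := norm_add_le (((ν / (-y) - b y : ℝ) : ℂ) * U y) (g y)
      rw [norm_mul, Complex.norm_real, Real.norm_eq_abs, abs_sub_comm] at h1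
      have h2 : |b y - ν / (-y)| ≤ max Cb 1 := (hCb y hym).trans (le_max_left _ _)
      have h3 : (1 : ℝ) ≤ max Cb 1 := le_max_right _ _
      have h4 := hUC y hym
      have h5 : ‖((ν / (-y) - b y : ℝ) : ℂ) * U y + g y‖ ≤ max Cb 1 * (C * (-y) ^ (-ν)) := by
        refine le_trans ?_ (mul_le_mul_of_nonneg_left h4 (by positivity))
        nlinarith [norm_nonneg (U y), norm_nonneg (g y)]
      calc _ ≤ (-y) ^ (-ν) * (max Cb 1 * (C * (-y) ^ (-ν))) := by gcongr
        _ = D * ((-y) ^ (-ν) * (-y) ^ (-ν)) := by ring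
        _ = D * (-y) ^ (-2 * ν) := by
            rw [← Real.rpow_add hy0]
            ring_nf
  refine ⟨‖F (-1)‖ + D / (1 - 2 * ν), by positivity, fun x hx => ?_⟩
  have hx0 : 0 < -x := by linarith [hx.2]
  have h1 := hbound x hx
  have h2 : B x ≤ ‖F (-1)‖ + D / (1 - 2 * ν) := by
    have h3 : 0 ≤ D / (1 - 2 * ν) := by positivity
    have h4 : 0 ≤ (-x) ^ (1 - 2 * ν) := by positivity
    simp only [B]
    nlinarith
  simp only [F] at h1
  rw [norm_mul, Complex.norm_real, Real.norm_of_nonneg (by positivity), Real.rpow_neg hx0.le,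
    ← div_eq_inv_mul, div_le_iff₀ (by positivity)] at h1
  exact h1.trans (mul_le_mul_of_nonneg_right h2 (by positivity))

/-- The components seen by `γ¹ + i` are `w₁ + w₃` and `w₂ - w₄`. Both obey `U' = -b U +
O((-x)^{-ν})`, so they gain the power `(-x)^ν` whatever the solution. Since `ν < 1/2`, this is
weaker than the boundary condition. -/
theorem Admissible.isBigO_act_boundary (hab : Admissible a b ν κ) (hν : 2 * ν < 1)
    {w : ℝ → Spinor} (h : IsFlowSol a b z w) :
    (fun x => act (γ1 + Complex.I • (1 : Mat4)) (w x)) =O[𝓝[<] 0] fun x => (-x) ^ ν := by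
  obtain ⟨C, hC⟩ := hab.exists_norm_le_zero
  obtain ⟨Ca, hCa⟩ := hab.a_bdd
  have hCa0 : 0 ≤ Ca := (abs_nonneg _).trans (hCa (-1) (by norm_num))
  set E := ‖w (-1)‖ * Real.exp (|z.im| + C)
  have hE : 0 ≤ E := by positivity
  have hw : ∀ x ∈ Ico (-1 : ℝ) 0, ‖w x‖ ≤ E * (-x) ^ (-ν) := hC z w h
  have hD : 0 ≤ (2 + 2 * ‖z‖ + 2 * Ca) * E := by positivity
  obtain ⟨K₁, hK₁0, hK₁⟩ := hab.exists_norm_le_rpow hν (U := fun x => w x 0 + w x 2)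
    (g := fun x => Complex.I * z * (w x 0 - w x 2) + Complex.I * a x * (w x 1 + w x 3))
    (fun x hx => by
      obtain ⟨h0, h1, h2, h3⟩ := h.apply hx
      refine (h0.fun_add h2).congr_deriv ?_
      ring) hD (fun x hx => by
      obtain ⟨k1, k2, k3, k4⟩ := norm_add_sub_le_two_mul (w x)
      have hn := norm_add_le (Complex.I * z * (w x 0 - w x 2)) (Complex.I * a x * (w x 1 + w x 3))
      simp only [norm_mul, Complex.norm_I, one_mul, Complex.norm_real, Real.norm_eq_abs] at hn
      have m1 := mul_le_mul_of_nonneg_left k2 (norm_nonneg z)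
      have m2 := mul_le_mul (hCa x hx.2) k4 (norm_nonneg _) hCa0
      have m3 := mul_le_mul_of_nonneg_left (hw x hx) (show 0 ≤ 2 + 2 * ‖z‖ + 2 * Ca by positivity)
      linarith)
  obtain ⟨K₂, hK₂0, hK₂⟩ := hab.exists_norm_le_rpow hν (U := fun x => w x 1 - w x 3)
    (g := fun x => -(Complex.I * a x * (w x 0 - w x 2)) + -(Complex.I * z * (w x 1 + w x 3)))
    (fun x hx => by
      obtain ⟨h0, h1, h2, h3⟩ := h.apply hx
      refine (h1.fun_sub h3).congr_deriv ?_
      ring) hD (fun x hx => by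
      obtain ⟨k1, k2, k3, k4⟩ := norm_add_sub_le_two_mul (w x)
      have hn := norm_add_le (-(Complex.I * a x * (w x 0 - w x 2)))
        (-(Complex.I * z * (w x 1 + w x 3)))
      simp only [norm_neg, norm_mul, Complex.norm_I, one_mul, Complex.norm_real,
        Real.norm_eq_abs] at hn
      have m1 := mul_le_mul_of_nonneg_left k4 (norm_nonneg z)
      have m2 := mul_le_mul (hCa x hx.2) k2 (norm_nonneg _) hCa0
      have m3 := mul_le_mul_of_nonneg_left (hw x hx) (show 0 ≤ 2 + 2 * ‖z‖ + 2 * Ca by positivity)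
      linarith)
  refine IsBigO.of_bound (2 * (K₁ + K₂)) ?_
  filter_upwards [Ioo_mem_nhdsLT (show (-1 : ℝ) < 0 by norm_num)] with x hx
  have hx' : x ∈ Ico (-1 : ℝ) 0 := ⟨hx.1.le, hx.2⟩
  have hx0 : 0 < -x := by linarith [hx.2]
  rw [Real.norm_of_nonneg (by positivity : 0 ≤ (-x) ^ ν)]
  obtain ⟨h0, h1, h2, h3⟩ := act_boundary_apply (w x)
  have h4 := norm_spinor_le (act (γ1 + Complex.I • (1 : Mat4)) (w x))
  rw [h0, h1, h2, h3, norm_neg, norm_mul, norm_mul, Complex.norm_I, one_mul, one_mul] at h4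
  linarith [hK₁ x hx', hK₂ x hx']

/-- Cauchy-Schwarz would give `(∫_x^0 (-y)^{-2ν})^{1/2}`, of order `(-x)^{1/2 - ν}`, times the norm
of `g` on `]x, 0[`, which tends to `0`. The proof uses the equivalent weighted Young inequality. -/
theorem isLittleO_integral_dotL (hν : 2 * ν < 1) {φ g : ℝ → Spinor}
    (hφ : φ =O[𝓝[<] 0] fun x => (-x) ^ (-ν))
    (hg : MemLp g 2 (volume.restrict (Iio (0 : ℝ)))) :
    (fun x => ∫ y in Ioo x 0, dotL (φ y) (g y)) =o[𝓝[<] 0] fun x => (-x) ^ (1 / 2 - ν) := by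
  have hν1 : 0 < 1 - 2 * ν := by linarith
  have hgi := integrableOn_norm_sq hg
  obtain ⟨C, hC0, hC⟩ := hφ.exists_pos
  have hCb := hC.bound
  rw [eventually_nhdsWithin_iff] at hCb
  obtain ⟨r, hr, hr2⟩ := Metric.eventually_nhds_iff.1 hCb
  rw [isLittleO_iff]
  intro δ hδ
  -- Chosen so that each of the two terms of Young's inequality is at most `δ / (C + 1)` times `T =
  -- (-x)^{1/2 - ν}`, once the tail of `‖g‖²` is below `η δ / (C + 1)`.
  set η := δ * (1 - 2 * ν) / (C + 1) with hη
  have hη0 : 0 < η := by positivity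
  have hlim : Tendsto (fun x => ∫ y in Ioo x 0, ‖g y‖ ^ 2) (𝓝[<] 0) (𝓝 0) := by
    have h1 := tendsto_setIntegral_of_antitone (μ := volume) (f := fun y => ‖g y‖ ^ 2)
      (s := fun n : ℕ => Ioo (-(1 / (n + 1) : ℝ)) 0) (fun n => measurableSet_Ioo)
      (fun n k hnk => Ioo_subset_Ioo_left (neg_le_neg (by
        have : (n : ℝ) ≤ k := by exact_mod_cast hnk
        gcongr))) ⟨0, hgi.mono_set Ioo_subset_Iio_self⟩
    have h2 : ⋂ n : ℕ, Ioo (-(1 / (n + 1) : ℝ)) 0 = ∅ := by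
      ext y
      simp only [mem_iInter, mem_Ioo, mem_empty_iff_false, iff_false, not_forall]
      by_cases hy : y < 0
      · obtain ⟨n, hn⟩ := exists_nat_one_div_lt (show 0 < -y by linarith)
        exact ⟨n, fun h => by linarith [h.1]⟩
      · exact ⟨0, fun h => hy h.2⟩
    rw [h2, setIntegral_empty] at h1
    rw [Metric.tendsto_nhds]
    intro ρ hρ
    obtain ⟨n, hn⟩ := (h1.eventually (Metric.ball_mem_nhds 0 hρ)).exists
    filter_upwards [Ioo_mem_nhdsLT (show -(1 / (n + 1) : ℝ) < 0 from
      neg_lt_zero.2 (by positivity))] with x hx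
    rw [Real.dist_eq, sub_zero] at hn
    rw [Real.dist_eq, sub_zero, abs_of_nonneg (integral_nonneg fun y => sq_nonneg _)]
    refine lt_of_le_of_lt ?_ ((le_abs_self _).trans_lt hn)
    exact setIntegral_mono_set (hgi.mono_set Ioo_subset_Iio_self) (.of_forall fun y => sq_nonneg _)
      (.of_forall (Ioo_subset_Ioo_left hx.1.le))
  filter_upwards [Ioo_mem_nhdsLT (show -r < 0 by linarith),
    hlim.eventually (gt_mem_nhds (show 0 < η * δ / (C + 1) by positivity))] with x hx hgx
  have hx0 : 0 < -x := by linarith [hx.2]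
  set T := (-x) ^ (1 / 2 - ν) with hT
  have hT0 : 0 < T := by positivity
  have hTT : T * T = (-x) ^ (1 - 2 * ν) := by
    rw [hT, ← Real.rpow_add hx0]
    ring_nf
  have hrp := integrableOn_neg_rpow (show -1 < -2 * ν by linarith) x
  have hgx' := hgi.mono_set (Ioo_subset_Iio_self (a := x))
  have h_int : ∫ y in Ioo x 0, (-y) ^ (-2 * ν) = (-x) ^ (1 - 2 * ν) / (1 - 2 * ν) := by
    rw [← integral_Ioc_eq_integral_Ioo, ← intervalIntegral.integral_of_le hx.2.le,
      intervalIntegral.integral_comp_neg (fun y => y ^ (-2 * ν)), integral_rpow (Or.inl (by linarith))]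
    rw [neg_zero, show -2 * ν + 1 = 1 - 2 * ν by ring, Real.zero_rpow hν1.ne', sub_zero]
  have h1 : ‖∫ y in Ioo x 0, dotL (φ y) (g y)‖ ≤
      ∫ y in Ioo x 0, C / 2 * (η * T⁻¹ * (-y) ^ (-2 * ν) + η⁻¹ * T * ‖g y‖ ^ 2) := by
    refine norm_integral_le_of_norm_le (((hrp.const_mul _).add (hgx'.const_mul _)).const_mul _) ?_
    filter_upwards [ae_restrict_mem measurableSet_Ioo] with y hy
    have hy0 : 0 < -y := by linarith [hy.2]
    have h2 := hr2 (y := y) (by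
      rw [Real.dist_eq, sub_zero, abs_of_neg hy.2]
      linarith [hy.1, hx.1]) hy.2
    rw [Real.norm_of_nonneg (by positivity)] at h2
    refine (norm_dotL_le _ _).trans ((mul_le_mul_of_nonneg_right h2 (norm_nonneg _)).trans ?_)
    have e : (-y) ^ (-2 * ν) = ((-y) ^ (-ν)) ^ 2 := by
      rw [← Real.rpow_natCast, ← Real.rpow_mul hy0.le]
      push_cast
      ring_nf
    rw [e, mul_assoc, div_mul_eq_mul_div, mul_div_assoc]
    refine mul_le_mul_of_nonneg_left ?_ hC0.le
    set p := (-y) ^ (-ν)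
    have h3 : 0 ≤ η⁻¹ * T⁻¹ * (η * p - T * ‖g y‖) ^ 2 := by positivity
    have h4 : η⁻¹ * T⁻¹ * (η * p - T * ‖g y‖) ^ 2 =
        η * T⁻¹ * p ^ 2 + η⁻¹ * T * ‖g y‖ ^ 2 - 2 * (p * ‖g y‖) := by
      field_simp
      ring
    linarith
  rw [integral_const_mul, integral_add (hrp.const_mul _) (hgx'.const_mul _), integral_const_mul,
    integral_const_mul, h_int, ← hTT] at h1
  refine h1.trans ?_
  rw [Real.norm_of_nonneg hT0.le]
  have h5 : η * T⁻¹ * (T * T / (1 - 2 * ν)) = δ / (C + 1) * T := by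
    rw [hη]
    field_simp
  have h6 : η⁻¹ * T * ∫ y in Ioo x 0, ‖g y‖ ^ 2 ≤ δ / (C + 1) * T := by
    have : η⁻¹ * T * ∫ y in Ioo x 0, ‖g y‖ ^ 2 ≤ η⁻¹ * T * (η * δ / (C + 1)) := by gcongr
    refine this.trans (le_of_eq ?_)
    field_simp
  rw [h5]
  calc C / 2 * (δ / (C + 1) * T + η⁻¹ * T * ∫ y in Ioo x 0, ‖g y‖ ^ 2)
      ≤ C / 2 * (δ / (C + 1) * T + δ / (C + 1) * T) := by gcongr
    _ = C / (C + 1) * (δ * T) := by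
        field_simp
        ring
    _ ≤ 1 * (δ * T) := by
        gcongr
        rw [div_le_one (by positivity)]
        linarith
    _ = δ * T := one_mul _

/-- The coefficient of `φ` is bounded, because `ψ` is square integrable up to `0` when `2ν < 1`. The
coefficient of `ψ` is `o((-x)^{1/2 - ν})`, which compensates `(γ¹ + i) ψ = O((-x)^ν)`. -/
theorem GreenPair.boundaryCond_halfGreen {φ ψ g : ℝ → Spinor} (h : GreenPair a b ν z φ ψ)
    (hab : Admissible a b ν κ) (hν : 2 * ν < 1)
    (hg : MemLp g 2 (volume.restrict (Iio (0 : ℝ)))) : BoundaryCond (halfGreen φ ψ g) := by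
  have hψ2 : MemLp ψ 2 (volume.restrict (Iio (0 : ℝ))) :=
    memLp_Iio_zero h.flow.continuousOn (c := -1) (d := -1) (by norm_num) (h.memLp _ (by norm_num))
      (memLp_Ioo_of_isBigO_rpow h.flow.continuousOn hν (hab.isBigO_rpow h.flow) _)
  have hi := integrable_dotL hψ2 hg
  have hA : (fun x => ∫ y in Iio x, dotL (ψ y) (g y)) =O[𝓝[<] 0] fun _ => (1 : ℝ) := by
    refine IsBigO.of_bound (∫ y in Iio (0 : ℝ), ‖dotL (ψ y) (g y)‖) ?_
    filter_upwards [self_mem_nhdsWithin] with x hx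
    rw [norm_one, mul_one]
    refine (norm_integral_le_integral_norm _).trans ?_
    exact setIntegral_mono_set hi.norm (.of_forall fun y => norm_nonneg _)
      (.of_forall (Iio_subset_Iio (le_of_lt hx)))
  have h1 := hA.smul_isLittleO (h.bdry.bdry hν)
  have h2 := (isLittleO_integral_dotL hν
    (hab.isBigO_rpow h.bdry.flow) hg).smul_isBigO (hab.isBigO_act_boundary hν h.flow)
  have h2' : (fun x => (∫ y in Ioo x 0, dotL (φ y) (g y)) •
      act (γ1 + Complex.I • (1 : Mat4)) (ψ x)) =o[𝓝[<] 0] fun x => √(-x) := by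
    refine h2.congr' EventuallyEq.rfl ?_
    filter_upwards [self_mem_nhdsWithin] with x hx
    have hx0 : 0 < -x := by
      have : x < 0 := hx
      linarith
    rw [smul_eq_mul, ← Real.rpow_add hx0, Real.sqrt_eq_rpow]
    ring_nf
  have h1' : (fun x => (∫ y in Iio x, dotL (ψ y) (g y)) •
      act (γ1 + Complex.I • (1 : Mat4)) (φ x)) =o[𝓝[<] 0] fun x => √(-x) := by
    simpa using h1
  refine (h1'.add h2').congr_left fun x => ?_
  rw [halfGreen, act_add_right, act_smul_right, act_smul_right]

end

end SAdS

open MeasureTheory Set Filter Topology Asymptotics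

namespace SAdS

noncomputable section

/-! ### The resolvent -/

variable {a b : ℝ → ℝ} {ν κ : ℝ} {z : ℂ}

theorem eLpNorm_two_eq {μ : Measure ℝ} {w : ℝ → Spinor} (h : MemLp w 2 μ) :
    eLpNorm w 2 μ = ENNReal.ofReal √(∫ x, ‖w x‖ ^ 2 ∂μ) := by
  rw [h.eLpNorm_eq_integral_rpow_norm (by norm_num) (by norm_num)]
  simp [Real.sqrt_eq_rpow]

theorem norm_hil_sq (u : Hil) : ‖u‖ ^ 2 = ∫ x in Iio (0 : ℝ), ‖u x‖ ^ 2 := by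
  rw [Lp.norm_def, eLpNorm_two_eq (Lp.memLp u), ENNReal.toReal_ofReal (Real.sqrt_nonneg _),
    Real.sq_sqrt (integral_nonneg fun x => sq_nonneg _)]

/-- The solution of `(H - z) u = f` built from a Green pair; `g` is a fixed matrix applied to `f`. -/
def greenSol (φ ψ g : ℝ → Spinor) (x : ℝ) : Spinor :=
  halfGreen φ ψ g x + halfGreen (fun x => tilde (φ x)) (fun x => tilde (ψ x)) g x

namespace GreenPair

variable {φ ψ f : ℝ → Spinor} {T : Mat4}

/-- The jumps of the two half kernels add up to `M_{α,β}`, and `T` is chosen so that this matrix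
turns it into `iΓ¹`. -/
theorem isForcedSol (h : GreenPair a b ν z φ ψ) (hab : Admissible a b ν κ)
    (hf : MemLp f 2 (volume.restrict (Iio (0 : ℝ))))
    (hT : ∀ x < 0, matM (alphaW (φ x) (ψ x)) (betaW (φ x) (ψ x)) * T = Complex.I • Γ1) :
    IsForcedSol a b z f (greenSol φ ψ fun y => act T (f y)) := by
  refine ⟨_, (h.locAC hab (memLp_act hf T)).add (h.tilde.locAC hab (memLp_act hf T)), ?_⟩
  filter_upwards [ae_restrict_mem measurableSet_Iio] with x hx
  have h1 := congrArg (fun S => act S (act T (f x))) (outer_sub_outer (φ x) (ψ x))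
  simp only [act_sub, act_add, act_outer] at h1
  rw [← act_mul, hT x hx] at h1
  rw [greenSol, act_add_right, ← h1]
  abel

theorem greenSol_truncated (h : GreenPair a b ν z φ ψ) (hab : Admissible a b ν κ) (hz : 0 < z.im)
    (hf : MemLp f 2 (volume.restrict (Iio (0 : ℝ))))
    (hT : ∀ x < 0, matM (alphaW (φ x) (ψ x)) (betaW (φ x) (ψ x)) * T = Complex.I • Γ1)
    {c d : ℝ} (hc : c < 0) (hd : d < 0) (hfc : ∀ y ≤ c, f y = 0) (hfd : ∀ y, d ≤ y → f y = 0) :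
    MemLp (greenSol φ ψ fun y => act T (f y)) 2 (volume.restrict (Iio (0 : ℝ))) ∧
    z.im ^ 2 * ∫ x in Iio (0 : ℝ), ‖greenSol φ ψ (fun y => act T (f y)) x‖ ^ 2 ≤
      ∫ x in Iio (0 : ℝ), ‖f x‖ ^ 2 := by
  have hg := memLp_act hf T
  have hgc : ∀ y ≤ c, act T (f y) = 0 := fun y hy => by rw [hfc y hy, act_zero]
  have hgd : ∀ y, d ≤ y → act T (f y) = 0 := fun y hy => by rw [hfd y hy, act_zero]
  have hm := (h.memLp_halfGreen hab hg hc hd hgc hgd).add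
    (h.tilde.memLp_halfGreen hab hg hc hd hgc hgd)
  exact ⟨hm, (h.isForcedSol hab hf hT).energy_le hab hz hm hf fun hν =>
    (h.boundaryCond_halfGreen_of_eq_zero hν hd hgd).add
      (h.tilde.boundaryCond_halfGreen_of_eq_zero hν hd hgd)⟩

/-- The source is truncated to compact subintervals. The energy estimate bounds the truncated
solutions uniformly in `L²`, they converge pointwise, and Fatou's lemma passes to the limit; no
estimate of the kernel itself is needed. -/
theorem memLp_greenSol (h : GreenPair a b ν z φ ψ) (hab : Admissible a b ν κ) (hz : 0 < z.im)
    (hf : MemLp f 2 (volume.restrict (Iio (0 : ℝ))))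
    (hT : ∀ x < 0, matM (alphaW (φ x) (ψ x)) (betaW (φ x) (ψ x)) * T = Complex.I • Γ1) :
    MemLp (greenSol φ ψ fun y => act T (f y)) 2 (volume.restrict (Iio (0 : ℝ))) := by
  set s : ℕ → Set ℝ := fun n => Ioo (-(n + 2 : ℝ)) (-(n + 2 : ℝ)⁻¹)
  have hs : ∀ n, MeasurableSet (s n) := fun n => measurableSet_Ioo
  have hs' : ∀ y < 0, ∀ᶠ n in atTop, y ∈ s n := by
    intro y hy
    obtain ⟨n₀, hn₀⟩ := exists_nat_ge (max (-y) (-y)⁻¹)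
    filter_upwards [eventually_ge_atTop n₀] with n hn
    have hn' : (n₀ : ℝ) ≤ n := by exact_mod_cast hn
    have h1 : -y ≤ n₀ := le_trans (le_max_left _ _) hn₀
    have h2 : (-y)⁻¹ ≤ n₀ := le_trans (le_max_right _ _) hn₀
    have h3 : (n + 2 : ℝ)⁻¹ < -y := by
      apply inv_lt_of_inv_lt₀ (by linarith)
      linarith
    exact ⟨by linarith, by linarith⟩
  have hfn : ∀ n, MemLp ((s n).indicator f) 2 (volume.restrict (Iio (0 : ℝ))) := fun n =>
    hf.indicator (hs n)
  have hfi := integrableOn_norm_sq hf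
  set K := ∫ x in Iio (0 : ℝ), ‖f x‖ ^ 2
  set u : ℕ → ℝ → Spinor := fun n => greenSol φ ψ fun y => act T ((s n).indicator f y)
  have hu : ∀ n, MemLp (u n) 2 (volume.restrict (Iio (0 : ℝ))) ∧
      ∫ x in Iio (0 : ℝ), ‖u n x‖ ^ 2 ≤ K / z.im ^ 2 := by
    intro n
    obtain ⟨h1, h2⟩ := h.greenSol_truncated hab hz (hfn n) hT (c := -(n + 2 : ℝ))
      (d := -(n + 2 : ℝ)⁻¹) (neg_lt_zero.2 (by positivity)) (neg_lt_zero.2 (by positivity))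
      (fun y hy => indicator_of_notMem (fun hm => by linarith [hm.1]) _)
      (fun y hy => indicator_of_notMem (fun hm => by linarith [hm.2]) _)
    refine ⟨h1, ?_⟩
    rw [le_div_iff₀ (by positivity), mul_comm]
    refine h2.trans (integral_mono (integrableOn_norm_sq (hfn n)) hfi fun y => ?_)
    have := norm_indicator_le_norm_self f y (s := s n)
    simp only
    gcongr
  have hlim : ∀ᵐ x ∂(volume.restrict (Iio (0 : ℝ))), Tendsto (fun n => u n x) atTop
      (𝓝 (greenSol φ ψ (fun y => act T (f y)) x)) := by
    filter_upwards [ae_restrict_mem measurableSet_Iio] with x hx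
    have e : ∀ n, (fun y => act T ((s n).indicator f y)) =
        (s n).indicator fun y => act T (f y) := by
      intro n
      ext1 y
      by_cases hy : y ∈ s n
      · rw [indicator_of_mem hy, indicator_of_mem hy]
      · rw [indicator_of_notMem hy, indicator_of_notMem hy, act_zero]
    simp only [u, e]
    exact (h.tendsto_halfGreen hab (memLp_act hf T) hs hs' hx).add
      (h.tilde.tendsto_halfGreen hab (memLp_act hf T) hs hs' hx)
  obtain ⟨w', hw, -⟩ := h.isForcedSol hab hf hT
  refine ⟨hw.continuousOn.aestronglyMeasurable measurableSet_Iio, ?_⟩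
  refine (Lp.eLpNorm_lim_le_liminf_eLpNorm (fun n => (hu n).1.1) _ hlim).trans_lt ?_
  refine lt_of_le_of_lt (liminf_le_of_le (a := ENNReal.ofReal √(K / z.im ^ 2)) (by isBoundedDefault)
    fun c hc => ?_) ENNReal.ofReal_lt_top
  obtain ⟨n, hn⟩ := hc.exists
  refine hn.trans ?_
  rw [eLpNorm_two_eq (hu n).1]
  exact ENNReal.ofReal_le_ofReal (Real.sqrt_le_sqrt (hu n).2)

theorem boundaryCond_greenSol (h : GreenPair a b ν z φ ψ) (hab : Admissible a b ν κ)
    (hν : 2 * ν < 1) (hf : MemLp f 2 (volume.restrict (Iio (0 : ℝ)))) :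
    BoundaryCond (greenSol φ ψ fun y => act T (f y)) :=
  (h.boundaryCond_halfGreen hab hν (memLp_act hf T)).add
    (h.tilde.boundaryCond_halfGreen hab hν (memLp_act hf T))

end GreenPair

/-- Existence of preimages together with the lower bound: the latter gives uniqueness, hence
linearity of the solution map, and its continuity with norm at most `c⁻¹`. -/
theorem exists_resolvent {E : Type*} [NormedAddCommGroup E] [NormedSpace ℂ E]
    (S : Submodule ℂ (E × E)) (z : ℂ) {c : ℝ} (hc : 0 < c)
    (hex : ∀ f, ∃ u, (u, z • u + f) ∈ S) (hle : ∀ u g, (u, g) ∈ S → c * ‖u‖ ≤ ‖g - z • u‖) :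
    ∃ R : E →L[ℂ] E, ∀ f, (R f, z • R f + f) ∈ S := by
  have huniq : ∀ u v f, (u, z • u + f) ∈ S → (v, z • v + f) ∈ S → u = v := by
    intro u v f hu hv
    have h1 := hle _ _ (S.sub_mem hu hv)
    have h2 : z • u + f - (z • v + f) - z • (u - v) = 0 := by
      rw [smul_sub]
      abel
    simp only [h2, norm_zero] at h1
    have h3 : ‖u - v‖ = 0 := le_antisymm (by
      by_contra! h4
      have := mul_pos hc h4
      linarith) (norm_nonneg _)
    exact sub_eq_zero.1 (norm_eq_zero.1 h3)
  choose R hR using hex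
  refine ⟨LinearMap.mkContinuous ⟨⟨R, fun f g => ?_⟩, fun k f => ?_⟩ c⁻¹ fun f => ?_, hR⟩
  · refine huniq _ _ (f + g) (hR _) ?_
    have h1 := S.add_mem (hR f) (hR g)
    rwa [Prod.mk_add_mk, add_add_add_comm, ← smul_add] at h1
  · refine huniq _ _ (k • f) (hR _) ?_
    have h1 := S.smul_mem k (hR f)
    rwa [Prod.smul_mk, smul_add, smul_comm] at h1
  · have h1 := hle _ _ (hR f)
    rw [add_sub_cancel_left] at h1
    rw [← div_eq_inv_mul, le_div_iff₀ hc, mul_comm]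
    exact h1

theorem isResolventAt_of_mem_graph {E : Type*} [NormedAddCommGroup E] [NormedSpace ℂ E]
    {T : E →ₗ.[ℂ] E} {z : ℂ} {R : E →L[ℂ] E} {c : ℝ} (hc : 0 < c)
    (hR : ∀ f, (R f, z • R f + f) ∈ T.graph)
    (hle : ∀ u g, (u, g) ∈ T.graph → c * ‖u‖ ≤ ‖g - z • u‖) : IsResolventAt T z R := by
  refine ⟨fun f => ?_, fun u => ?_⟩
  · obtain ⟨u, hu1, hu2⟩ := (LinearPMap.mem_graph_iff T).1 (hR f)
    refine ⟨u, hu1, ?_⟩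
    simp only at hu1 hu2
    rw [hu2, hu1, add_sub_cancel_left]
  · have h1 := hR (T u - z • (u : E))
    have h2 := hle _ _ (T.graph.sub_mem h1 (T.mem_graph u))
    set v := R (T u - z • (u : E))
    have h3 : z • v + (T u - z • (u : E)) - T u - z • (v - u) = 0 := by
      rw [smul_sub]
      abel
    simp only [h3, norm_zero] at h2
    have h4 : ‖v - u‖ = 0 := le_antisymm (by
      by_contra! h4
      have := mul_pos hc h4
      linarith) (norm_nonneg _)
    exact sub_eq_zero.1 (norm_eq_zero.1 h4)

/-! ### The resolvent of the Dirac operator in the upper half plane. -/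

variable {M l m s : ℝ}

theorem two_mul_assoc_lt (m l : ℝ) : 2 * m * l < 1 ↔ 2 * (m * l) < 1 := by rw [mul_assoc]

theorem norm_le_of_mem_diracGraph (hM : 0 < M) (hl : 0 < l) (hm : 0 < m) (hz : 0 < z.im) (u v : Hil)
    (h : (u, v) ∈ diracGraph M l m s) : z.im * ‖u‖ ≤ ‖v - z • u‖ := by
  obtain ⟨w, w', hw, hu, hv, hb⟩ := h
  have hab := admissible_potential hM hl hm (s + 1 / 2)
  have hwu : (u : ℝ → Spinor) =ᵐ[volume.restrict (Iio (0 : ℝ))] w := hu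
  have hforced : IsForcedSol (fun x => (s + 1 / 2) * potA M l x) (fun x => m * potB M l x) z
      (v - z • u : Hil) w := by
    refine ⟨w', hw, ?_⟩
    filter_upwards [hu, hv, Lp.coeFn_sub v (z • u), Lp.coeFn_smul z u] with x h1 h2 h3 h4
    rw [← diracExpr_eq_iff, h3, Pi.sub_apply, h4, Pi.smul_apply]
    rw [h1, ← h2]
    abel
  have h1 := hforced.energy_le hab hz ((Lp.memLp u).ae_eq hwu) (Lp.memLp _)
    fun hν => hb ((two_mul_assoc_lt m l).2 hν)
  have h2 : ∫ x in Iio (0 : ℝ), ‖w x‖ ^ 2 = ‖u‖ ^ 2 := by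
    rw [norm_hil_sq]
    refine integral_congr_ae ?_
    filter_upwards [hwu] with x hx
    rw [hx]
  rw [h2, ← norm_hil_sq, ← mul_pow] at h1
  exact (sq_le_sq₀ (by positivity) (norm_nonneg _)).1 h1

theorem mem_diracGraph_of_isForcedSol {f : Hil} {w : ℝ → Spinor}
    (h : IsForcedSol (fun x => (s + 1 / 2) * potA M l x) (fun x => m * potB M l x) z f w)
    (hw2 : MemLp w 2 (volume.restrict (Iio (0 : ℝ)))) (hb : 2 * m * l < 1 → BoundaryCond w) :
    (hw2.toLp w, z • hw2.toLp w + f) ∈ diracGraph M l m s := by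
  obtain ⟨w', hw, he⟩ := h
  refine ⟨w, w', hw, hw2.coeFn_toLp, ?_, hb⟩
  filter_upwards [he, hw2.coeFn_toLp, Lp.coeFn_add (z • hw2.toLp w) f,
    Lp.coeFn_smul z (hw2.toLp w)] with x h1 h2 h3 h4
  rw [(diracExpr_eq_iff M l m s x z (w x) (w' x) (f x)).2 h1]
  rw [h3, Pi.add_apply, h4, Pi.smul_apply, h2]

theorem JostSol.greenPair {φ ψ : ℝ → Spinor} (hψ : JostSol a b z ψ) (hφ : BdrySol a b ν z φ)
    (hz : 0 < z.im) : GreenPair a b ν z φ ψ := ⟨hφ, hψ.flow, fun _ hx => hψ.memLp hz hx⟩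

theorem act_kernelR (φ ψ : ℝ → Spinor) (α β : ℂ) (x y : ℝ) (v : Spinor) :
    act (kernelR φ ψ α β x y) v =
      (Iio x).indicator (fun y => dotL (ψ y) (act ((matM α β)⁻¹ * (Complex.I • Γ1)) v) • φ x +
        dotL (tilde (ψ y)) (act ((matM α β)⁻¹ * (Complex.I • Γ1)) v) • tilde (φ x)) y +
      (Ioo x 0).indicator (fun y => dotL (φ y) (act ((matM α β)⁻¹ * (Complex.I • Γ1)) v) • ψ x +
        dotL (tilde (φ y)) (act ((matM α β)⁻¹ * (Complex.I • Γ1)) v) • tilde (ψ x)) y := by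
  have h0 : act 0 v = 0 := by simp [act]
  rw [kernelR, act_add]
  congr 1
  · by_cases hy : y ∈ Iio x
    · rw [indicator_of_mem hy, indicator_of_mem hy, mul_assoc, act_mul, act_add, act_outer,
        act_outer]
    · rw [indicator_of_notMem hy, indicator_of_notMem hy, h0]
  · by_cases hy : y ∈ Ioo x 0
    · rw [indicator_of_mem hy, indicator_of_mem hy, mul_assoc, act_mul, act_add, act_outer,
        act_outer]
    · rw [indicator_of_notMem hy, indicator_of_notMem hy, h0]

theorem GreenPair.integral_kernelR {φ ψ f : ℝ → Spinor} (h : GreenPair a b ν z φ ψ)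
    (hab : Admissible a b ν κ) (hf : MemLp f 2 (volume.restrict (Iio (0 : ℝ)))) (α β : ℂ) {x : ℝ}
    (hx : x < 0) :
    IntegrableOn (fun y => act (kernelR φ ψ α β x y) (f y)) (Iio 0) ∧
    ∫ y in Iio (0 : ℝ), act (kernelR φ ψ α β x y) (f y) =
      greenSol φ ψ (fun y => act ((matM α β)⁻¹ * (Complex.I • Γ1)) (f y)) x := by
  have hg := memLp_act hf ((matM α β)⁻¹ * (Complex.I • Γ1))
  set g : ℝ → Spinor := fun y => act ((matM α β)⁻¹ * (Complex.I • Γ1)) (f y)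
  have i1 := (h.integrable_left hg hx).smul_const (φ x)
  have i2 := (h.tilde.integrable_left hg hx).smul_const (SAdS.tilde (φ x))
  have i3 := (h.integrable_right hab hg x).smul_const (ψ x)
  have i4 := (h.tilde.integrable_right hab hg x).smul_const (SAdS.tilde (ψ x))
  have e : (fun y => act (kernelR φ ψ α β x y) (f y)) = fun y =>
      (Iio x).indicator (fun y => dotL (ψ y) (g y) • φ x +
        dotL (SAdS.tilde (ψ y)) (g y) • SAdS.tilde (φ x)) y +
      (Ioo x 0).indicator (fun y => dotL (φ y) (g y) • ψ x +
        dotL (SAdS.tilde (φ y)) (g y) • SAdS.tilde (ψ x)) y := by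
    ext1 y
    rw [act_kernelR]
    rfl
  have j1 := (IntegrableOn.integrable_indicator (Integrable.fun_add i1 i2)
    measurableSet_Iio).integrableOn (s := Iio 0)
  have j2 := (IntegrableOn.integrable_indicator (Integrable.fun_add i3 i4)
    measurableSet_Ioo).integrableOn (s := Iio 0)
  rw [e]
  refine ⟨j1.add j2, ?_⟩
  rw [integral_add j1 j2, setIntegral_indicator measurableSet_Iio,
    setIntegral_indicator measurableSet_Ioo, Iio_inter_Iio, min_eq_right hx.le,
    inter_eq_right.2 Ioo_subset_Iio_self, integral_add i1 i2, integral_add i3 i4,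
    integral_smul_const, integral_smul_const, integral_smul_const, integral_smul_const, greenSol,
    halfGreen, halfGreen]
  abel

/-- The Green function inverts `H - z`. -/
theorem greenSol_mem_diracGraph (hM : 0 < M) (hl : 0 < l) (hm : 0 < m) (hz : 0 < z.im)
    {φ ψ : ℝ → Spinor} (hψ : IsJost M l m s z ψ) (hφ : IsBoundarySol M l m s z φ) {α β : ℂ}
    (hαβ : ∀ x < 0, alphaW (φ x) (ψ x) = α ∧ betaW (φ x) (ψ x) = β)
    (hdet : α ^ 2 - β ^ 2 ≠ 0) (f : Hil) :
    ∃ u : Hil, (u, z • u + f) ∈ diracGraph M l m s ∧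
      ∀ᵐ x ∂(volume.restrict (Iio (0 : ℝ))),
        u x = ∫ y in Iio (0 : ℝ), act (kernelR φ ψ α β x y) (f y) := by
  have hab := admissible_potential hM hl hm (s + 1 / 2)
  have hp := ((isJost_iff M l m s z ψ).1 hψ).greenPair ((isBoundarySol_iff M l m s z φ).1 hφ) hz
  have hf := Lp.memLp f
  have hT : ∀ x < 0, matM (alphaW (φ x) (ψ x)) (betaW (φ x) (ψ x)) *
      ((matM α β)⁻¹ * (Complex.I • Γ1)) = Complex.I • Γ1 := by
    intro x hx
    rw [(hαβ x hx).1, (hαβ x hx).2, ← mul_assoc,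
      Matrix.mul_nonsing_inv _ ((Matrix.isUnit_iff_isUnit_det _).1 (isUnit_matM hdet)), one_mul]
  have hm2 := hp.memLp_greenSol hab hz hf hT
  refine ⟨hm2.toLp _, mem_diracGraph_of_isForcedSol (hp.isForcedSol hab hf hT) hm2 fun hν =>
    hp.boundaryCond_greenSol hab ((two_mul_assoc_lt m l).1 hν) hf, ?_⟩
  filter_upwards [hm2.coeFn_toLp, ae_restrict_mem measurableSet_Iio] with x h1 hx
  rw [h1, (hp.integral_kernelR hab hf α β hx).2]

theorem exists_isJost (hM : 0 < M) (hl : 0 < l) (hm : 0 < m) (hz : 0 < z.im) :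
    ∃ ψ, IsJost M l m s z ψ := by
  have hκ := surfaceGravity_pos hM hl
  obtain ⟨ψ, hψ, -⟩ := exists_jost_family (admissible_potential hM hl hm (s + 1 / 2))
    (ε := surfaceGravity M l / 4) (by linarith) (by linarith)
  refine ⟨ψ z, (isJost_iff M l m s z _).2 (hψ z ?_)⟩
  change -(surfaceGravity M l / 4) < z.im
  linarith

theorem exists_isBoundarySol (hM : 0 < M) (hl : 0 < l) (hm : 0 < m) (z : ℂ) :
    ∃ φ, IsBoundarySol M l m s z φ ∧ IsNondegenerate φ := by
  obtain ⟨φ, hφ, -⟩ := exists_bdry_family (admissible_potential hM hl hm (s + 1 / 2))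
  exact ⟨φ z, (isBoundarySol_iff M l m s z _).2 (hφ z).1, (hφ z).2⟩

theorem exists_wronskian (hM : 0 < M) (hl : 0 < l) (hm : 0 < m) (hz : 0 < z.im)
    {φ ψ : ℝ → Spinor} (hψ : IsJost M l m s z ψ) (hφ : IsBoundarySol M l m s z φ)
    (hn : IsNondegenerate φ) :
    ∃ α β : ℂ, (∀ x < 0, alphaW (φ x) (ψ x) = α ∧ betaW (φ x) (ψ x) = β) ∧
      α ^ 2 - β ^ 2 ≠ 0 := by
  have hψ' := (isJost_iff M l m s z ψ).1 hψ
  have hφ' := (isBoundarySol_iff M l m s z φ).1 hφ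
  exact ⟨_, _, fun x hx => alphaW_const hφ'.flow hψ'.flow hx (show (-1 : ℝ) < 0 by norm_num),
    sq_sub_sq_wronskian_ne_zero (admissible_potential hM hl hm (s + 1 / 2)) hz hφ' hψ' hn
      (by norm_num)⟩

theorem exists_resolvent_diracGraph (hM : 0 < M) (hl : 0 < l) (hm : 0 < m) (hz : 0 < z.im) :
    ∃ R : Hil →L[ℂ] Hil, ∀ f, (R f, z • R f + f) ∈ diracGraph M l m s := by
  refine exists_resolvent _ z hz (fun f => ?_) fun u v h => norm_le_of_mem_diracGraph hM hl hm hz u v h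
  obtain ⟨ψ, hψ⟩ := exists_isJost (s := s) hM hl hm hz
  obtain ⟨φ, hφ, hn⟩ := exists_isBoundarySol (s := s) hM hl hm z
  obtain ⟨α, β, hαβ, hdet⟩ := exists_wronskian hM hl hm hz hψ hφ hn
  obtain ⟨u, hu, -⟩ := greenSol_mem_diracGraph hM hl hm hz hψ hφ hαβ hdet f
  exact ⟨u, hu⟩

open Classical in
/-- The resolvent `(H - z)⁻¹` for `Im z > 0`. -/
def resolvent (M l m s : ℝ) (z : ℂ) : Hil →L[ℂ] Hil :=
  if h : ∃ R : Hil →L[ℂ] Hil, ∀ f, (R f, z • R f + f) ∈ diracGraph M l m s then h.choose else 0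

theorem resolvent_mem (hM : 0 < M) (hl : 0 < l) (hm : 0 < m) (hz : 0 < z.im) (f : Hil) :
    (resolvent M l m s z f, z • resolvent M l m s z f + f) ∈ diracGraph M l m s := by
  have h := exists_resolvent_diracGraph (s := s) hM hl hm hz
  rw [resolvent, dif_pos h]
  exact h.choose_spec f

theorem isResolventAt_resolvent (hM : 0 < M) (hl : 0 < l) (hm : 0 < m) (hz : 0 < z.im) :
    IsResolventAt (diracOp M l m s) z (resolvent M l m s z) := by
  refine isResolventAt_of_mem_graph hz (fun f => ?_) fun u v h => ?_
  · rw [diracOp_graph]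
    exact resolvent_mem hM hl hm hz f
  · rw [diracOp_graph] at h
    exact norm_le_of_mem_diracGraph hM hl hm hz u v h

/-- The resolvent was chosen without reference to any solutions. Both sides invert `H - z`, and the
lower bound makes the inverse unique, so the formula holds for every admissible choice of `φ` and
`ψ`. -/
theorem resolvent_eq_integral (hM : 0 < M) (hl : 0 < l) (hm : 0 < m) (hz : 0 < z.im)
    {φ ψ : ℝ → Spinor} (hψ : IsJost M l m s z ψ) (hφ : IsBoundarySol M l m s z φ) {α β : ℂ}
    (hαβ : ∀ x < 0, alphaW (φ x) (ψ x) = α ∧ betaW (φ x) (ψ x) = β)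
    (hdet : α ^ 2 - β ^ 2 ≠ 0) (f : Hil) :
    ∀ᵐ x ∂(volume.restrict (Iio (0 : ℝ))),
      resolvent M l m s z f x = ∫ y in Iio (0 : ℝ), act (kernelR φ ψ α β x y) (f y) := by
  obtain ⟨u, hu, hu2⟩ := greenSol_mem_diracGraph hM hl hm hz hψ hφ hαβ hdet f
  have h1 := norm_le_of_mem_diracGraph hM hl hm hz _ _
    ((diracGraph M l m s).sub_mem hu (resolvent_mem hM hl hm hz f))
  set v := resolvent M l m s z f
  have h3 : z • u + f - (z • v + f) - z • (u - v) = 0 := by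
    rw [smul_sub]
    abel
  simp only [h3, norm_zero] at h1
  have h4 : ‖u - v‖ = 0 := le_antisymm (by
    by_contra! h4
    have := mul_pos hz h4
    linarith) (norm_nonneg _)
  have h5 : u = v := sub_eq_zero.1 (norm_eq_zero.1 h4)
  rw [← h5]
  exact hu2

end

end SAdS

open MeasureTheory Set Filter Topology Asymptotics

namespace SAdS

noncomputable section

/-! ### Holomorphic families of square integrable functions and of integral operators -/

/-- Lebesgue measure on `]-∞, 0[`. -/
abbrev volNeg : Measure ℝ := volume.restrict (Iio (0 : ℝ))

open Classical in
/-- The class of a square integrable function, and `0` for other functions. -/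
def lpOf (w : ℝ → Spinor) : Hil := if h : MemLp w 2 volNeg then h.toLp w else 0

theorem lpOf_eq {w : ℝ → Spinor} (h : MemLp w 2 volNeg) : lpOf w = h.toLp w := dif_pos h

theorem coeFn_lpOf {w : ℝ → Spinor} (h : MemLp w 2 volNeg) : lpOf w =ᵐ[volNeg] w := by
  rw [lpOf_eq h]
  exact h.coeFn_toLp

theorem norm_lpOf {w : ℝ → Spinor} (h : MemLp w 2 volNeg) :
    ‖lpOf w‖ = √(∫ x, ‖w x‖ ^ 2 ∂volNeg) := by
  rw [lpOf_eq h, Lp.norm_toLp, eLpNorm_two_eq h, ENNReal.toReal_ofReal (Real.sqrt_nonneg _)]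

/-- Pointwise holomorphy with a square integrable majorant `D`: Cauchy's estimate and the mean value
inequality bound the difference quotients by `D / r`, so they converge in `L²` by dominated
convergence. -/
theorem differentiableOn_lpOf {U : Set ℂ} (hU : IsOpen U) {G : ℂ → ℝ → Spinor}
    (hm : ∀ z ∈ U, AEStronglyMeasurable (G z) volNeg)
    (hd : ∀ x < 0, DifferentiableOn ℂ (fun z => G z x) U) {D : ℝ → ℝ} (hD : MemLp D 2 volNeg)
    (hGD : ∀ z ∈ U, ∀ x < 0, ‖G z x‖ ≤ D x) : DifferentiableOn ℂ (fun z => lpOf (G z)) U := by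
  intro z₀ hz₀
  obtain ⟨R, hR, hRU⟩ := Metric.nhds_basis_closedBall.mem_iff.1 (hU.mem_nhds hz₀)
  set r := R / 2
  have hr : 0 < r := by positivity
  have hG2 : ∀ z ∈ U, MemLp (G z) 2 volNeg := fun z hz => hD.mono (hm z hz) (by
    filter_upwards [ae_restrict_mem measurableSet_Iio] with x hx
    exact (hGD z hz x hx).trans (le_abs_self _))
  have hDr : MemLp (fun x => D x / r) 2 volNeg := by
    simpa [div_eq_inv_mul] using hD.const_mul r⁻¹
  have hderiv : ∀ x < 0, ∀ c ∈ Metric.ball z₀ r, ‖deriv (fun z => G z x) c‖ ≤ D x / r := by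
    intro x hx c hc
    have hsub : Metric.closedBall c r ⊆ U := by
      refine (Metric.closedBall_subset_closedBall' ?_).trans hRU
      have : dist c z₀ < r := hc
      simp only [r] at this ⊢
      linarith
    refine Complex.norm_deriv_le_of_forall_mem_sphere_norm_le hr ?_ fun z hz =>
      hGD z (hsub (Metric.sphere_subset_closedBall hz)) x hx
    refine DifferentiableOn.diffContOnCl ((hd x hx).mono ?_)
    rwa [closure_ball c hr.ne']
  have hballU : Metric.ball z₀ r ⊆ U := fun c hc => hRU (by
    have : dist c z₀ < r := hc
    rw [Metric.mem_closedBall]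
    simp only [r] at this
    linarith)
  set S : ℂ → ℝ → Spinor := fun z x => (z - z₀)⁻¹ • (G z x - G z₀ x) with hS
  set L : ℝ → Spinor := fun x => deriv (fun z => G z x) z₀
  have hSD : ∀ z ∈ Metric.ball z₀ r, ∀ x < 0, ‖S z x‖ ≤ D x / r := by
    intro z hz x hx
    have h1 := (convex_ball z₀ r).norm_image_sub_le_of_norm_deriv_le (f := fun z => G z x)
      (fun c hc => (hd x hx).differentiableAt (hU.mem_nhds (hballU hc)))
      (fun c hc => hderiv x hx c hc) (Metric.mem_ball_self hr) hz
    rcases eq_or_ne z z₀ with h | h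
    · simp only [hS, h, sub_self, smul_zero, norm_zero]
      exact (norm_nonneg _).trans (hderiv x hx z₀ (Metric.mem_ball_self hr))
    · have h2 : 0 < ‖z - z₀‖ := norm_pos_iff.2 (sub_ne_zero.2 h)
      simp only [hS]
      rw [norm_smul, norm_inv, ← div_eq_inv_mul, div_le_iff₀ h2]
      exact h1
  have hlim : ∀ x < 0, Tendsto (fun z => S z x) (𝓝[≠] z₀) (𝓝 (L x)) := by
    intro x hx
    have h1 := ((hd x hx).differentiableAt (hU.mem_nhds hz₀)).hasDerivAt
    rw [hasDerivAt_iff_tendsto_slope] at h1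
    exact h1
  have hSm : ∀ z ∈ U, AEStronglyMeasurable (S z) volNeg := fun z hz =>
    ((hm z hz).sub (hm z₀ hz₀)).const_smul (z - z₀)⁻¹
  have hUne : ∀ᶠ z in 𝓝[≠] z₀, z ∈ Metric.ball z₀ r :=
    mem_nhdsWithin_of_mem_nhds (Metric.ball_mem_nhds z₀ hr)
  have hLm : AEStronglyMeasurable L volNeg := by
    classical
    refine aestronglyMeasurable_of_tendsto_ae (𝓝[≠] z₀)
      (f := fun z => if z ∈ U then S z else fun _ => 0) (fun z => ?_) ?_
    · split_ifs with h
      · exact hSm z h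
      · exact aestronglyMeasurable_const
    · filter_upwards [ae_restrict_mem measurableSet_Iio] with x hx
      refine (hlim x hx).congr' ?_
      filter_upwards [hUne] with z hz
      rw [if_pos (hballU hz)]
  have hLD : ∀ x < 0, ‖L x‖ ≤ D x / r := fun x hx => hderiv x hx z₀ (Metric.mem_ball_self hr)
  have hL2 : MemLp L 2 volNeg := hDr.mono hLm (by
    filter_upwards [ae_restrict_mem measurableSet_Iio] with x hx
    exact (hLD x hx).trans (le_abs_self _))
  have h_int : Tendsto (fun z => ∫ x, ‖S z x - L x‖ ^ 2 ∂volNeg) (𝓝[≠] z₀) (𝓝 0) := by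
    have h0 : (0 : ℝ) = ∫ _, (0 : ℝ) ∂volNeg := by simp
    rw [h0]
    refine tendsto_integral_filter_of_dominated_convergence (fun x => (2 * (D x / r)) ^ 2) ?_ ?_
      (hDr.const_mul 2).integrable_sq ?_
    · filter_upwards [hUne] with z hz
      exact ((hSm z (hballU hz)).sub hLm).norm.pow 2
    · filter_upwards [hUne] with z hz
      filter_upwards [ae_restrict_mem measurableSet_Iio] with x hx
      rw [Real.norm_of_nonneg (sq_nonneg _)]
      gcongr
      refine (norm_sub_le _ _).trans ?_
      linarith [hSD z hz x hx, hLD x hx]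
    · filter_upwards [ae_restrict_mem measurableSet_Iio] with x hx
      have := (((hlim x hx).sub_const (L x)).norm).pow 2
      simpa using this
  have hder : HasDerivAt (fun z => lpOf (G z)) (lpOf L) z₀ := by
    rw [hasDerivAt_iff_tendsto_slope, tendsto_iff_norm_sub_tendsto_zero]
    have h1 := (Real.continuous_sqrt.tendsto 0).comp h_int
    rw [Real.sqrt_zero] at h1
    refine h1.congr' ?_
    filter_upwards [hUne] with z hz
    have hz2 := hG2 z (hballU hz)
    have hz02 := hG2 z₀ hz₀
    have hSz : MemLp (S z) 2 volNeg := (hz2.sub hz02).const_smul (z - z₀)⁻¹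
    have hS2 : MemLp (fun x => S z x - L x) 2 volNeg := hSz.sub hL2
    have e : slope (fun z => lpOf (G z)) z₀ z - lpOf L = lpOf fun x => S z x - L x := by
      rw [lpOf_eq hS2, slope_def_module, lpOf_eq hz2, lpOf_eq hz02, lpOf_eq hL2,
        ← MemLp.toLp_sub, ← MemLp.toLp_const_smul, ← MemLp.toLp_sub]
      exact MemLp.toLp_congr _ _ (.of_forall fun x => rfl)
    rw [e, norm_lpOf hS2]
    rfl
  exact hder.differentiableAt.differentiableWithinAt

/-- A kernel bounded by `1` maps `L¹` to `L^∞` with norm at most `1`. -/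
theorem exists_integralOp {k : ℝ → ℝ → ℂ} (hk : Measurable (Function.uncurry k))
    (hk1 : ∀ x y, ‖k x y‖ ≤ 1) :
    ∃ J : Lp ℂ 1 volNeg →L[ℂ] Lp ℂ ⊤ volNeg,
      ∀ F, ∀ᵐ x ∂volNeg, J F x = ∫ y, k x y * F y ∂volNeg := by
  have hFi : ∀ F : Lp ℂ 1 volNeg, Integrable F volNeg := fun F =>
    memLp_one_iff_integrable.1 (Lp.memLp F)
  have hi : ∀ (F : Lp ℂ 1 volNeg) x, Integrable (fun y => k x y * F y) volNeg := fun F x =>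
    (hFi F).bdd_mul (c := 1) (hk.of_uncurry_left (x := x)).aestronglyMeasurable
      (.of_forall fun y => hk1 x y)
  have hb : ∀ (F : Lp ℂ 1 volNeg) x, ‖∫ y, k x y * F y ∂volNeg‖ ≤ ‖F‖ := by
    intro F x
    rw [L1.norm_eq_integral_norm]
    refine norm_integral_le_of_norm_le (hFi F).norm (.of_forall fun y => ?_)
    rw [norm_mul]
    exact mul_le_of_le_one_left (norm_nonneg _) (hk1 x y)
  have hmeas : ∀ F : Lp ℂ 1 volNeg,
      AEStronglyMeasurable (fun x => ∫ y, k x y * F y ∂volNeg) volNeg := by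
    intro F
    refine AEStronglyMeasurable.integral_prod_right' (f := fun p : ℝ × ℝ => k p.1 p.2 * F p.2) ?_
    exact hk.aestronglyMeasurable.mul (hFi F).1.comp_snd
  have hT : ∀ F : Lp ℂ 1 volNeg, MemLp (fun x => ∫ y, k x y * F y ∂volNeg) ⊤ volNeg := fun F =>
    memLp_top_of_bound (hmeas F) ‖F‖ (.of_forall (hb F))
  refine ⟨LinearMap.mkContinuous ⟨⟨fun F => (hT F).toLp _, fun F G => ?_⟩, fun c F => ?_⟩ 1
    fun F => ?_, fun F => (hT F).coeFn_toLp⟩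
  · rw [← MemLp.toLp_add]
    refine MemLp.toLp_congr _ _ (.of_forall fun x => ?_)
    simp only [Pi.add_apply]
    rw [← integral_add (hi F x) (hi G x)]
    refine integral_congr_ae ?_
    filter_upwards [Lp.coeFn_add F G] with y hy
    rw [hy, Pi.add_apply, mul_add]
  · simp only [RingHom.id_apply]
    rw [← MemLp.toLp_const_smul]
    refine MemLp.toLp_congr _ _ (.of_forall fun x => ?_)
    simp only [Pi.smul_apply, smul_eq_mul]
    rw [← integral_const_mul]
    refine integral_congr_ae ?_
    filter_upwards [Lp.coeFn_smul c F] with y hy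
    rw [hy, Pi.smul_apply, smul_eq_mul]
    ring
  · rw [one_mul]
    change ‖(hT F).toLp _‖ ≤ _
    rw [Lp.norm_toLp]
    refine ENNReal.toReal_le_of_le_ofReal (norm_nonneg _) ?_
    rw [eLpNorm_exponent_top]
    exact eLpNormEssSup_le_of_ae_bound (.of_forall (hb F))

/-- Integral operators with kernel `g(x) k(x, y) hᵗ(y)`, `|k| ≤ 1`. -/
theorem exists_kernelOp {k : ℝ → ℝ → ℂ} (hk : Measurable (Function.uncurry k))
    (hk1 : ∀ x y, ‖k x y‖ ≤ 1) :
    ∃ B : Hil → Hil → Hil →L[ℂ] Hil,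
      (∀ g h F, ∀ᵐ x ∂volNeg, B g h F x = (∫ y, k x y * dotL (h y) (F y) ∂volNeg) • g x) ∧
      ∀ {U : Set ℂ} {g h : ℂ → Hil}, DifferentiableOn ℂ g U → DifferentiableOn ℂ h U →
        DifferentiableOn ℂ (fun z => B (g z) (h z)) U := by
  obtain ⟨J, hJ⟩ := exists_integralOp hk hk1
  set S := ((ContinuousLinearMap.lsmul ℂ ℂ : ℂ →L[ℂ] Spinor →L[ℂ] Spinor).holderL volNeg ⊤ 2 2).flip
  set P := dotL.holderL volNeg 2 2 1
  -- Pair with `h` (from `L²` to `L¹`), apply the scalar kernel (to `L^∞`), multiply by `g` (back to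
  -- `L²`). This is bounded and bilinear in `g` and `h`, so holomorphy passes from them to the
  -- operator.
  refine ⟨fun g h => S g ∘L J ∘L P h, fun g h F => ?_, fun {U g h} hg hh => ?_⟩
  · have h1 := ContinuousLinearMap.coeFn_holder (r := 2)
      (ContinuousLinearMap.lsmul ℂ ℂ : ℂ →L[ℂ] Spinor →L[ℂ] Spinor) (J (P h F)) g
    have h2 := ContinuousLinearMap.coeFn_holder (r := 1) dotL h F
    filter_upwards [h1, hJ (P h F)] with x hx1 hx2
    change ((ContinuousLinearMap.lsmul ℂ ℂ : ℂ →L[ℂ] Spinor →L[ℂ] Spinor).holder 2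
      (J (P h F)) g : Hil) x = _
    rw [hx1, hx2, ContinuousLinearMap.lsmul_apply]
    congr 1
    refine integral_congr_ae ?_
    filter_upwards [h2] with y hy
    congr 1
  · have h1 : DifferentiableOn ℂ (fun z => S (g z)) U := S.differentiable.comp_differentiableOn hg
    have h2 : DifferentiableOn ℂ (fun z => P (h z)) U := P.differentiable.comp_differentiableOn hh
    exact h1.clm_comp ((differentiableOn_const J).clm_comp h2)

end

end SAdS

open MeasureTheory Set Filter Topology Asymptotics

namespace SAdS

noncomputable section

/-! ### The weighted resolvent -/

variable {a b : ℝ → ℝ} {ν κ : ℝ} {z : ℂ}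

/-- For `y < x` the kernel `e^{εx} φ(x) ψᵗ(y) e^{εy}` is the product of `e^{εx} φ(x) / w(x)`, the
ratio `w(x) / w(y)`, and `e^{εy} w(y) ψᵗ(y)`. Since `w` is antitone the ratio is at most `1`, while
both outer factors are dominated by `D`. For `x < y` the roles of `φ` and `ψ` are exchanged. -/
theorem exists_halfOp {U : Set ℂ} (hU : IsOpen U) {w : ℝ → ℝ} (hw0 : ∀ x, 0 ≤ w x)
    (hwpos : ∀ x < 0, 0 < w x) (hanti : Antitone w) (ε : ℝ) {φ ψ : ℂ → ℝ → Spinor}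
    (hφ : ∀ x < 0, DifferentiableOn ℂ (fun z => φ z x) U)
    (hψ : ∀ x < 0, DifferentiableOn ℂ (fun z => ψ z x) U)
    (cφ : ∀ z ∈ U, ContinuousOn (φ z) (Iio 0)) (cψ : ∀ z ∈ U, ContinuousOn (ψ z) (Iio 0))
    {D : ℝ → ℝ} (hD : MemLp D 2 volNeg)
    (hDφ : ∀ z ∈ U, ∀ x < 0, Real.exp (ε * x) / w x * ‖φ z x‖ ≤ D x)
    (hDψ : ∀ z ∈ U, ∀ x < 0, Real.exp (ε * x) * w x * ‖ψ z x‖ ≤ D x) :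
    ∃ K : ℂ → Hil →L[ℂ] Hil, DifferentiableOn ℂ K U ∧ ∀ z ∈ U, ∀ F : Hil, ∀ᵐ x ∂volNeg,
      K z F x = (Real.exp (ε * x) : ℂ) •
        halfGreen (φ z) (ψ z) (fun y => (Real.exp (ε * y) : ℂ) • F y) x := by
  have hwm : Measurable w := hanti.measurable
  set g : ℂ → ℝ → Spinor := fun z x => ((Real.exp (ε * x) / w x : ℝ) : ℂ) • φ z x with hg
  set h : ℂ → ℝ → Spinor := fun z x => ((Real.exp (ε * x) * w x : ℝ) : ℂ) • ψ z x with hh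
  have hgm : ∀ z ∈ U, AEStronglyMeasurable (g z) volNeg := fun z hz =>
    (Measurable.aestronglyMeasurable (f := fun x => ((Real.exp (ε * x) / w x : ℝ) : ℂ))
      (by fun_prop)).smul ((cφ z hz).aestronglyMeasurable measurableSet_Iio)
  have hhm : ∀ z ∈ U, AEStronglyMeasurable (h z) volNeg := fun z hz =>
    (Measurable.aestronglyMeasurable (f := fun x => ((Real.exp (ε * x) * w x : ℝ) : ℂ))
      (by fun_prop)).smul ((cψ z hz).aestronglyMeasurable measurableSet_Iio)
  have hgD : ∀ z ∈ U, ∀ x < 0, ‖g z x‖ ≤ D x := fun z hz x hx => by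
    have := hwpos x hx
    rw [hg, norm_smul, Complex.norm_real, Real.norm_of_nonneg (by positivity)]
    exact hDφ z hz x hx
  have hhD : ∀ z ∈ U, ∀ x < 0, ‖h z x‖ ≤ D x := fun z hz x hx => by
    have := hwpos x hx
    rw [hh, norm_smul, Complex.norm_real, Real.norm_of_nonneg (by positivity)]
    exact hDψ z hz x hx
  have hmono : ∀ {G : ℝ → Spinor}, AEStronglyMeasurable G volNeg → (∀ x < 0, ‖G x‖ ≤ D x) →
      MemLp G 2 volNeg := fun hm hb => hD.mono hm (by
    filter_upwards [ae_restrict_mem measurableSet_Iio] with x hx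
    exact (hb x hx).trans (le_abs_self _))
  have dg := differentiableOn_lpOf hU hgm (fun x hx => (hφ x hx).fun_const_smul _) hD hgD
  have dh := differentiableOn_lpOf hU hhm (fun x hx => (hψ x hx).fun_const_smul _) hD hhD
  have hle : ∀ x y, y ≤ x → ‖((w x / w y : ℝ) : ℂ)‖ ≤ 1 := fun x y hxy => by
    rw [Complex.norm_real, Real.norm_of_nonneg (div_nonneg (hw0 x) (hw0 y))]
    exact div_le_one_of_le₀ (hanti hxy) (hw0 y)
  obtain ⟨B₁, hB₁, dB₁⟩ := exists_kernelOp
    (k := fun x y => if y < x then ((w x / w y : ℝ) : ℂ) else 0) (by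
      refine Measurable.ite (measurableSet_lt measurable_snd measurable_fst) ?_ measurable_const
      fun_prop) (fun x y => by
      split_ifs with hxy
      · exact hle x y hxy.le
      · simp)
  obtain ⟨B₂, hB₂, dB₂⟩ := exists_kernelOp
    (k := fun x y => if x < y then ((w y / w x : ℝ) : ℂ) else 0) (by
      refine Measurable.ite (measurableSet_lt measurable_fst measurable_snd) ?_ measurable_const
      fun_prop) (fun x y => by
      split_ifs with hxy
      · exact hle y x hxy.le
      · simp)
  refine ⟨fun z => B₁ (lpOf (g z)) (lpOf (h z)) + B₂ (lpOf (h z)) (lpOf (g z)),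
    (dB₁ dg dh).add (dB₂ dh dg), fun z hz F => ?_⟩
  have eg := coeFn_lpOf (hmono (hgm z hz) (hgD z hz))
  have eh := coeFn_lpOf (hmono (hhm z hz) (hhD z hz))
  filter_upwards [hB₁ (lpOf (g z)) (lpOf (h z)) F, hB₂ (lpOf (h z)) (lpOf (g z)) F, eg, eh,
    Lp.coeFn_add (B₁ (lpOf (g z)) (lpOf (h z)) F) (B₂ (lpOf (h z)) (lpOf (g z)) F),
    ae_restrict_mem measurableSet_Iio] with x h1 h2 hgx hhx hadd hx
  have hx' : x < 0 := hx
  have hwx := hwpos x hx'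
  have i1 : ∫ y, (if y < x then ((w x / w y : ℝ) : ℂ) else 0) *
      dotL (lpOf (h z) y) (F y) ∂volNeg =
      w x * ∫ y in Iio x, dotL (ψ z y) ((Real.exp (ε * y) : ℂ) • F y) := by
    rw [← integral_const_mul]
    have e : Iio x = Iio 0 ∩ Iio x := by rw [Iio_inter_Iio, min_eq_right hx'.le]
    rw [e, ← setIntegral_indicator measurableSet_Iio]
    refine integral_congr_ae ?_
    filter_upwards [eh, ae_restrict_mem measurableSet_Iio] with y hy hy0
    have hwy := (hwpos y hy0).ne'
    by_cases hyx : y < x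
    · rw [if_pos hyx, indicator_of_mem (show y ∈ Iio x from hyx), hy]
      simp only [hh, map_smul, smul_apply, smul_eq_mul]
      push_cast
      have : (w y : ℂ) ≠ 0 := by exact_mod_cast hwy
      field_simp
    · rw [if_neg hyx, indicator_of_notMem (show y ∉ Iio x from hyx), zero_mul]
  have i2 : ∫ y, (if x < y then ((w y / w x : ℝ) : ℂ) else 0) *
      dotL (lpOf (g z) y) (F y) ∂volNeg =
      (w x : ℂ)⁻¹ * ∫ y in Ioo x 0, dotL (φ z y) ((Real.exp (ε * y) : ℂ) • F y) := by
    rw [← integral_const_mul]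
    have e : Ioo x 0 = Iio 0 ∩ Ioi x := by rw [inter_comm, Ioi_inter_Iio]
    rw [e, ← setIntegral_indicator measurableSet_Ioi]
    refine integral_congr_ae ?_
    filter_upwards [eg, ae_restrict_mem measurableSet_Iio] with y hy hy0
    have hwy := (hwpos y hy0).ne'
    by_cases hyx : x < y
    · rw [if_pos hyx, indicator_of_mem (show y ∈ Ioi x from hyx), hy]
      simp only [hg, map_smul, smul_apply, smul_eq_mul]
      push_cast
      have : (w y : ℂ) ≠ 0 := by exact_mod_cast hwy
      have : (w x : ℂ) ≠ 0 := by exact_mod_cast hwx.ne'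
      field_simp
    · rw [if_neg hyx, indicator_of_notMem (show y ∉ Ioi x from hyx), zero_mul]
  have hwx' : (w x : ℂ) ≠ 0 := by exact_mod_cast hwx.ne'
  rw [add_apply, hadd, Pi.add_apply, h1, h2, hgx, hhx, i1, i2, halfGreen,
    smul_add]
  simp only [hg, hh, smul_smul]
  push_cast
  congr 2 <;> field_simp

/-- The weight must balance the growth of `φ` against the decay of `ψ`. At `-∞` it is `e^{-cx}` with
`c` the positive part of `Im z₀`; at `0` it is constant if `2ν < 1` and of order `(-x)^ν` if `2ν ≥
1`. It depends on `z₀` but not on the nearby `z`, which is why the construction is local. -/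
theorem exists_local_weight (hab : Admissible a b ν κ) {ε : ℝ} {φ ψ : ℂ → ℝ → Spinor}
    (hφ : ∀ z, IsFlowSol a b z (φ z)) (dφ : ∀ x, Differentiable ℂ fun z => φ z x)
    (hφ0 : 1 ≤ 2 * ν → ∀ r, ∃ C, ∀ z, ‖z‖ < r → ∀ x ∈ Ico (-1 : ℝ) 0, ‖φ z x‖ ≤ C * (-x) ^ ν)
    (hψ : ∀ z ∈ halfPlane ε, IsFlowSol a b z (ψ z))
    (hψC : ∃ C, ∀ z ∈ halfPlane ε, ∀ x ≤ -1, ‖ψ z x‖ ≤ C * Real.exp (z.im * x)) (hε : 0 < ε)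
    {z₀ : ℂ} (hz₀ : z₀ ∈ halfPlane ε) :
    ∃ (U : Set ℂ) (w D : ℝ → ℝ), IsOpen U ∧ z₀ ∈ U ∧ U ⊆ halfPlane ε ∧ (∀ x, 0 ≤ w x) ∧
      (∀ x < 0, 0 < w x) ∧ Antitone w ∧ MemLp D 2 volNeg ∧
      ∀ z ∈ U, ∀ x < 0, Real.exp (ε * x) / w x * ‖φ z x‖ ≤ D x ∧
        Real.exp (ε * x) * w x * ‖ψ z x‖ ≤ D x := by
  have hy₀ : -ε < z₀.im := hz₀
  set c := max z₀.im 0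
  set δ := (ε + min z₀.im 0) / 2 with hδ
  have hc : 0 ≤ c := le_max_right _ _
  have hmin : -ε < min z₀.im 0 := lt_min hy₀ (by linarith)
  have hδ0 : 0 < δ := by
    rw [hδ]
    linarith
  have him : ∀ z ∈ Metric.ball z₀ δ, |z.im - z₀.im| < δ := fun z hz => by
    have h1 : ‖z - z₀‖ < δ := by
      rw [← dist_eq_norm]
      exact hz
    exact lt_of_le_of_lt (by simpa using Complex.abs_im_le_norm (z - z₀)) h1
  -- These are the exponential rates at `-∞` of `e^{εx} φ / w` and `e^{εx} w ψ`. Both stay at least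
  -- `δ` near `z₀`: for `Im z₀ > 0` they are close to `ε`, and for `Im z₀ ≤ 0` close to `ε + Im z₀`.
  have hrate : ∀ z ∈ Metric.ball z₀ δ, δ ≤ ε + c - |z.im| ∧ δ ≤ ε - c + z.im := by
    intro z hz
    have h1 := abs_lt.1 (him z hz)
    rcases le_total z₀.im 0 with h | h
    · have e1 : c = 0 := max_eq_right h
      have e2 : min z₀.im 0 = z₀.im := min_eq_left h
      rw [e2] at hδ
      have h2 : |z.im| ≤ δ - z₀.im := abs_le.2 ⟨by linarith, by linarith⟩
      rw [e1]
      constructor <;> linarith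
    · have e1 : c = z₀.im := max_eq_left h
      have e2 : min z₀.im 0 = 0 := min_eq_right h
      rw [e2] at hδ
      have h2 : |z.im| ≤ δ + z₀.im := abs_le.2 ⟨by linarith, by linarith⟩
      rw [e1]
      constructor <;> linarith
  have hsub : Metric.ball z₀ δ ⊆ halfPlane ε := by
    intro z hz
    have h1 := abs_lt.1 (him z hz)
    change -ε < z.im
    have h2 : min z₀.im 0 ≤ z₀.im := min_le_left _ _
    linarith
  have hY : ∀ z ∈ Metric.ball z₀ δ, |z.im| ≤ |z₀.im| + δ := fun z hz => by
    have h1 := abs_sub_abs_le_abs_sub z.im z₀.im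
    linarith [him z hz]
  obtain ⟨C₁, hC₁⟩ := (isCompact_closedBall z₀ δ).exists_bound_of_continuousOn
    (dφ (-1)).continuous.continuousOn
  have hC₁0 : 0 ≤ C₁ := (norm_nonneg _).trans (hC₁ z₀ (Metric.mem_closedBall_self hδ0.le))
  have hφ1 : ∀ z ∈ Metric.ball z₀ δ, ‖φ z (-1)‖ ≤ C₁ := fun z hz =>
    hC₁ z (Metric.ball_subset_closedBall hz)
  obtain ⟨C₂, hC₂⟩ := hψC
  have hC₂0 : 0 ≤ C₂ := by
    have h1 := (norm_nonneg _).trans (hC₂ z₀ hz₀ (-1) le_rfl)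
    by_contra! h2
    have := mul_neg_of_neg_of_pos h2 (Real.exp_pos (z₀.im * -1))
    linarith
  obtain ⟨C₃, hC₃⟩ := hab.exists_norm_le_neg
  obtain ⟨C₄, hC₄⟩ := hab.exists_norm_le_zero
  set Y := |z₀.im| + δ
  have hnear : ∀ (χ : ℂ → ℝ → Spinor) (C : ℝ), 0 ≤ C →
      (∀ z ∈ Metric.ball z₀ δ, IsFlowSol a b z (χ z) ∧ ‖χ z (-1)‖ ≤ C) →
      ∀ z ∈ Metric.ball z₀ δ, ∀ x ∈ Ico (-1 : ℝ) 0,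
        ‖χ z x‖ ≤ C * Real.exp (Y + C₄) * (-x) ^ (-ν) := by
    intro χ C hC hχ z hz x hx
    have hx0 : 0 < -x := by linarith [hx.2]
    refine (hC₄ z (χ z) (hχ z hz).1 x hx).trans ?_
    have h1 := (hχ z hz).2
    have h2 := hY z hz
    gcongr
  have hψ1 : ∀ z ∈ Metric.ball z₀ δ, ‖ψ z (-1)‖ ≤ C₂ * Real.exp Y := by
    intro z hz
    refine (hC₂ z (hsub hz) (-1) le_rfl).trans ?_
    gcongr
    linarith [neg_abs_le z.im, hY z hz]
  set K₂ := C₂ * Real.exp Y * Real.exp (Y + C₄)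
  have hK₂ : 0 ≤ K₂ := by positivity
  have hψnear := hnear ψ (C₂ * Real.exp Y) (by positivity) fun z hz => ⟨hψ z (hsub hz), hψ1 z hz⟩
  have hφnear := hnear φ C₁ hC₁0 fun z hz => ⟨hφ z, hφ1 z hz⟩
  -- Here `ν'` is the power of `-x` in the weight and `(-x)^{-η}` the common bound left at `0`:
  -- `(ν', η)` is `(0, ν)` if `2ν < 1`, and `(ν, 0)` if `2ν ≥ 1`.
  obtain ⟨ν', η, K₁, hν', hη2, hη0, hK₁, hF1, hF2⟩ : ∃ ν' η K₁ : ℝ, 0 ≤ ν' ∧ 2 * η < 1 ∧ 0 ≤ η ∧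
      0 ≤ K₁ ∧ (∀ z ∈ Metric.ball z₀ δ, ∀ x ∈ Ico (-1 : ℝ) 0,
        ‖φ z x‖ ≤ K₁ * ((-x) ^ ν' * (-x) ^ (-η))) ∧
      ∀ z ∈ Metric.ball z₀ δ, ∀ x ∈ Ico (-1 : ℝ) 0, (-x) ^ ν' * ‖ψ z x‖ ≤ K₂ * (-x) ^ (-η) := by
    rcases lt_or_ge (2 * ν) 1 with hν | hν
    · refine ⟨0, ν, C₁ * Real.exp (Y + C₄), le_rfl, hν, hab.ν_pos.le, by positivity,
        fun z hz x hx => ?_, fun z hz x hx => ?_⟩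
      · rw [Real.rpow_zero, one_mul]
        exact hφnear z hz x hx
      · rw [Real.rpow_zero, one_mul]
        exact hψnear z hz x hx
    · obtain ⟨C₅, hC₅⟩ := hφ0 hν (‖z₀‖ + δ)
      refine ⟨ν, 0, max C₅ 0, hab.ν_pos.le, by norm_num, le_rfl, le_max_right _ _,
        fun z hz x hx => ?_, fun z hz x hx => ?_⟩
      · have hx0 : 0 < -x := by linarith [hx.2]
        have hzn : ‖z‖ < ‖z₀‖ + δ := by
          have h1 : ‖z - z₀‖ < δ := by
            rw [← dist_eq_norm]
            exact hz
          have h2 := norm_le_norm_add_norm_sub' z z₀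
          linarith
        rw [neg_zero, Real.rpow_zero, mul_one]
        refine (hC₅ z hzn x hx).trans ?_
        gcongr
        exact le_max_left _ _
      · have hx0 : 0 < -x := by linarith [hx.2]
        have h1 := mul_le_mul_of_nonneg_left (hψnear z hz x hx)
          (show 0 ≤ (-x) ^ ν by positivity)
        refine h1.trans (le_of_eq ?_)
        rw [mul_left_comm, ← Real.rpow_add hx0, add_neg_cancel, neg_zero]
  set T : ℝ → ℝ := fun x => min 1 (max (-x) 0)
  have hT0 : ∀ x, 0 ≤ T x := fun x => le_min zero_le_one (le_max_right _ _)
  have hTanti : Antitone T := fun x y hxy =>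
    min_le_min le_rfl (max_le_max (neg_le_neg hxy) le_rfl)
  set w : ℝ → ℝ := fun x => Real.exp (-(c * x)) * T x ^ ν'
  set K := (K₁ + K₂ + C₂ + |C₃| * C₁) * Real.exp (c + δ)
  have hK : 0 ≤ K := by positivity
  set D : ℝ → ℝ := fun x => K * (Real.exp (δ * x) + Real.exp (δ * x) * (-x) ^ (-η))
  have hexp1 : ∀ x < 0, Real.exp (δ * x) ≤ 1 := fun x hx => by
    rw [Real.exp_le_one_iff]
    exact mul_nonpos_of_nonneg_of_nonpos hδ0.le hx.le
  have hDc : ContinuousOn D (Iio 0) := by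
    refine continuousOn_const.mul (ContinuousOn.add (by fun_prop) (ContinuousOn.mul (by fun_prop) ?_))
    exact (continuous_neg.continuousOn).rpow_const fun x (hx : x < 0) => Or.inl (by linarith)
  have hD2 : MemLp D 2 volNeg := by
    refine memLp_Iio_zero hDc (c := -1) (d := -1) (by norm_num)
      (memLp_Iio_of_isBigO_exp hDc hδ0 ?_ (by norm_num))
      (memLp_Ioo_of_isBigO_rpow hDc hη2 ?_ _)
    · refine IsBigO.of_bound (K * 2) ?_
      filter_upwards [eventually_le_atBot (-1)] with x hx
      have hx0 : 0 < -x := by linarith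
      have h1 : (-x) ^ (-η) ≤ 1 := Real.rpow_le_one_of_one_le_of_nonpos (by linarith) (by linarith)
      have h2 := Real.exp_pos (δ * x)
      rw [Real.norm_of_nonneg (by positivity), Real.norm_of_nonneg h2.le, mul_assoc]
      refine mul_le_mul_of_nonneg_left ?_ hK
      nlinarith
    · refine IsBigO.of_bound (K * 2) ?_
      filter_upwards [Ioo_mem_nhdsLT (show (-1 : ℝ) < 0 by norm_num)] with x hx
      have hx0 : 0 < -x := by linarith [hx.2]
      have h1 : 1 ≤ (-x) ^ (-η) :=
        Real.one_le_rpow_of_pos_of_le_one_of_nonpos hx0 (by linarith [hx.1]) (by linarith)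
      have h2 := hexp1 x hx.2
      rw [Real.norm_of_nonneg (by positivity), Real.norm_of_nonneg (by positivity), mul_assoc]
      refine mul_le_mul_of_nonneg_left ?_ hK
      nlinarith
  refine ⟨Metric.ball z₀ δ, w, D, Metric.isOpen_ball, Metric.mem_ball_self hδ0, hsub,
    fun x => mul_nonneg (Real.exp_pos _).le (Real.rpow_nonneg (hT0 x) _), fun x hx => ?_,
    fun x y hxy => ?_, hD2, fun z hz x hx => ?_⟩
  · exact mul_pos (Real.exp_pos _) (Real.rpow_pos_of_pos
      (lt_min one_pos (lt_max_of_lt_left (by linarith))) _)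
  · refine mul_le_mul (Real.exp_le_exp.2 ?_) (Real.rpow_le_rpow (hT0 y) (hTanti hxy) hν')
      (Real.rpow_nonneg (hT0 y) _) (Real.exp_pos _).le
    exact neg_le_neg (mul_le_mul_of_nonneg_left hxy hc)
  · have hε1 : Real.exp (ε * x) ≤ 1 := by
      rw [Real.exp_le_one_iff]
      exact mul_nonpos_of_nonneg_of_nonpos hε.le hx.le
    have hec : 1 ≤ Real.exp (c + δ) := Real.one_le_exp (by linarith)
    rcases le_or_gt x (-1) with hx1 | hx1
    · have hT1 : T x = 1 := min_eq_left (le_max_of_le_left (by linarith))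
      have hwx : w x = Real.exp (-(c * x)) := by simp only [w, hT1, Real.one_rpow, mul_one]
      obtain ⟨hr1, hr2⟩ := hrate z hz
      have hDK : (K₁ + K₂ + C₂ + |C₃| * C₁) * Real.exp (δ * x) ≤ D x := by
        have h1 : 0 ≤ K * (Real.exp (δ * x) * (-x) ^ (-η)) := by
          have : 0 < -x := by linarith
          positivity
        have h2 : K₁ + K₂ + C₂ + |C₃| * C₁ ≤ K := le_mul_of_one_le_right (by positivity) hec
        have h3 := mul_le_mul_of_nonneg_right h2 (Real.exp_pos (δ * x)).le
        simp only [D, mul_add]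
        linarith
      constructor
      · refine le_trans ?_ hDK
        have h1 : ‖φ z x‖ ≤ |C₃| * C₁ * Real.exp (-(|z.im| * x)) := by
          refine (hC₃ z (φ z) (hφ z) x hx1).trans ?_
          have h2 := hφ1 z hz
          have h3 := le_abs_self C₃
          gcongr
        have h4 : Real.exp (ε * x) / w x * ‖φ z x‖ ≤
            Real.exp (ε * x) / w x * (|C₃| * C₁ * Real.exp (-(|z.im| * x))) := by
          rw [hwx]
          gcongr
        refine h4.trans ?_
        have h5 : Real.exp (ε * x) / w x * (|C₃| * C₁ * Real.exp (-(|z.im| * x))) =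
            |C₃| * C₁ * Real.exp ((ε + c - |z.im|) * x) := by
          rw [hwx, ← Real.exp_sub, mul_left_comm, ← Real.exp_add]
          ring_nf
        rw [h5]
        have h6 : Real.exp ((ε + c - |z.im|) * x) ≤ Real.exp (δ * x) :=
          Real.exp_le_exp.2 (mul_le_mul_of_nonpos_right hr1 hx.le)
        have h7 : |C₃| * C₁ ≤ K₁ + K₂ + C₂ + |C₃| * C₁ := by linarith
        gcongr
      · refine le_trans ?_ hDK
        have h4 : Real.exp (ε * x) * w x * ‖ψ z x‖ ≤
            Real.exp (ε * x) * w x * (C₂ * Real.exp (z.im * x)) := by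
          rw [hwx]
          have := hC₂ z (hsub hz) x hx1
          gcongr
        refine h4.trans ?_
        have h5 : Real.exp (ε * x) * w x * (C₂ * Real.exp (z.im * x)) =
            C₂ * Real.exp ((ε - c + z.im) * x) := by
          rw [hwx, ← Real.exp_add, mul_left_comm, ← Real.exp_add]
          ring_nf
        rw [h5]
        have h6 : Real.exp ((ε - c + z.im) * x) ≤ Real.exp (δ * x) :=
          Real.exp_le_exp.2 (mul_le_mul_of_nonpos_right hr2 hx.le)
        have h7 : C₂ ≤ K₁ + K₂ + C₂ + |C₃| * C₁ := by
          have : 0 ≤ |C₃| * C₁ := by positivity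
          linarith
        gcongr
    · have hx0 : 0 < -x := by linarith
      have hxm : x ∈ Ico (-1 : ℝ) 0 := ⟨hx1.le, hx⟩
      have hT1 : T x = -x := by
        simp only [T, max_eq_left hx0.le]
        exact min_eq_right (by linarith)
      have hwx : w x = Real.exp (-(c * x)) * (-x) ^ ν' := by simp only [w, hT1]
      have hDK : (K₁ + K₂) * Real.exp c * (-x) ^ (-η) ≤ D x := by
        have h1 : Real.exp c ≤ Real.exp (c + δ) * Real.exp (δ * x) := by
          rw [← Real.exp_add]
          exact Real.exp_le_exp.2 (by nlinarith)
        have h2 : 0 ≤ K * Real.exp (δ * x) := by positivity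
        have h3 : (K₁ + K₂) * Real.exp c ≤ K * Real.exp (δ * x) := by
          simp only [K]
          rw [mul_assoc]
          have : 0 ≤ |C₃| * C₁ := by positivity
          exact mul_le_mul (by linarith) h1 (Real.exp_pos _).le (by positivity)
        have h4 := mul_le_mul_of_nonneg_right h3 (show 0 ≤ (-x) ^ (-η) by positivity)
        simp only [D, mul_add]
        linarith
      have hcx : 1 ≤ Real.exp (-(c * x)) := Real.one_le_exp (by nlinarith)
      have hcx' : Real.exp (-(c * x)) ≤ Real.exp c := Real.exp_le_exp.2 (by nlinarith)
      have hecc : 1 ≤ Real.exp c := Real.one_le_exp hc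
      constructor
      · refine le_trans ?_ hDK
        have hwp : 0 < w x := by
          rw [hwx]
          positivity
        rw [div_mul_eq_mul_div, div_le_iff₀ hwp, hwx]
        calc Real.exp (ε * x) * ‖φ z x‖ ≤ 1 * (K₁ * ((-x) ^ ν' * (-x) ^ (-η))) := by
              have := hF1 z hz x hxm
              gcongr
          _ = K₁ * 1 * (-x) ^ (-η) * (1 * (-x) ^ ν') := by ring
          _ ≤ (K₁ + K₂) * Real.exp c * (-x) ^ (-η) * (Real.exp (-(c * x)) * (-x) ^ ν') := by
              gcongr
              linarith
      · refine le_trans ?_ hDK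
        rw [hwx]
        calc Real.exp (ε * x) * (Real.exp (-(c * x)) * (-x) ^ ν') * ‖ψ z x‖
            = Real.exp (ε * x) * Real.exp (-(c * x)) * ((-x) ^ ν' * ‖ψ z x‖) := by ring
          _ ≤ 1 * Real.exp c * (K₂ * (-x) ^ (-η)) := by
              have := hF2 z hz x hxm
              gcongr
          _ = K₂ * Real.exp c * (-x) ^ (-η) := by ring
          _ ≤ (K₁ + K₂) * Real.exp c * (-x) ^ (-η) := by
              gcongr
              linarith

end

end SAdS

open MeasureTheory Set Filter Topology Asymptotics

namespace SAdS

noncomputable section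

/-! ### Meromorphic extension -/

variable {a b : ℝ → ℝ} {ν κ : ℝ} {z : ℂ}

theorem halfGreen_congr_ae {φ ψ g g' : ℝ → Spinor} (h : ∀ᵐ y ∂volNeg, g y = g' y) {x : ℝ}
    (hx : x < 0) : halfGreen φ ψ g x = halfGreen φ ψ g' x := by
  have key : ∀ (s : Set ℝ) (χ : ℝ → Spinor), s ⊆ Iio 0 →
      ∫ y in s, dotL (χ y) (g y) = ∫ y in s, dotL (χ y) (g' y) := by
    intro s χ hs
    refine integral_congr_ae ?_
    filter_upwards [ae_restrict_of_ae_restrict_of_subset hs h] with y hy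
    rw [hy]
  rw [halfGreen, halfGreen, key _ _ (Iio_subset_Iio hx.le), key _ _ Ioo_subset_Iio_self]

theorem halfGreen_const_smul (φ ψ g : ℝ → Spinor) (c : ℂ) (x : ℝ) :
    halfGreen φ ψ (fun y => c • g y) x = c • halfGreen φ ψ g x := by
  simp only [halfGreen, map_smul, smul_eq_mul, integral_const_mul, smul_add, mul_smul]

theorem greenSol_congr_ae {φ ψ g g' : ℝ → Spinor} (h : ∀ᵐ y ∂volNeg, g y = g' y) {x : ℝ}
    (hx : x < 0) : greenSol φ ψ g x = greenSol φ ψ g' x := by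
  rw [greenSol, greenSol, halfGreen_congr_ae h hx, halfGreen_congr_ae h hx]

theorem greenSol_const_smul (φ ψ g : ℝ → Spinor) (c : ℂ) (x : ℝ) :
    greenSol φ ψ (fun y => c • g y) x = c • greenSol φ ψ g x := by
  rw [greenSol, greenSol, halfGreen_const_smul, halfGreen_const_smul, smul_add]

/-- `T f = e^{εx} G(N (e^{εx} f))`, with `G` the Green operator of the pair `φ, ψ`. -/
def IsWeightedGreenOp (ε : ℝ) (φ ψ : ℝ → Spinor) (N : Mat4) (T : Hil →L[ℂ] Hil) : Prop :=
  ∀ F : Hil, ∀ᵐ x ∂volNeg, T F x = (Real.exp (ε * x) : ℂ) •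
    greenSol φ ψ (fun y => (Real.exp (ε * y) : ℂ) • act N (F y)) x

/-- Uniqueness lets the operators built from different local weights be glued to one holomorphic
family. -/
theorem IsWeightedGreenOp.unique {ε : ℝ} {φ ψ : ℝ → Spinor} {N : Mat4} {T T' : Hil →L[ℂ] Hil}
    (h : IsWeightedGreenOp ε φ ψ N T) (h' : IsWeightedGreenOp ε φ ψ N T') : T = T' := by
  ext1 F
  refine Lp.ext ?_
  filter_upwards [h F, h' F] with x h1 h2
  rw [h1, h2]

/-- Linearity in `α` and `β` transfers their holomorphy to the multiplication operator. -/
theorem matM_eq (α β : ℂ) : matM α β = α • matM 1 0 + β • matM 0 1 := by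
  ext i j
  fin_cases i <;> fin_cases j <;> simp [matM]

/-- A matrix acting pointwise on spinor fields. -/
def matOp (N : Mat4) : Hil →L[ℂ] Hil :=
  (Matrix.toEuclideanCLM (n := Fin 4) (𝕜 := ℂ) N).compLpL 2 volNeg

theorem coeFn_matOp (N : Mat4) (F : Hil) : ∀ᵐ x ∂volNeg, matOp N F x = act N (F x) :=
  ContinuousLinearMap.coeFn_compLpL _ F

theorem matOp_add_smul (α β : ℂ) (S T : Mat4) :
    matOp (α • S + β • T) = α • matOp S + β • matOp T := by
  simp only [matOp, map_add, map_smul, ContinuousLinearMap.add_compLpL,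
    ContinuousLinearMap.smul_compLpL]

theorem matM_mul_eq (α β : ℂ) : matM α β * (Complex.I • Γ1) =
    α • (matM 1 0 * (Complex.I • Γ1)) + β • (matM 0 1 * (Complex.I • Γ1)) := by
  conv_lhs => rw [matM_eq]
  rw [add_mul, Matrix.smul_mul, Matrix.smul_mul]

theorem differentiableOn_tilde {w : ℂ → Spinor} {U : Set ℂ} (h : DifferentiableOn ℂ w U) :
    DifferentiableOn ℂ (fun z => tilde (w z)) U :=
  (Matrix.toEuclideanCLM (n := Fin 4) (𝕜 := ℂ)
    ((-Complex.I) • (γ0 * γ1 * γ2))).differentiable.comp_differentiableOn h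

/-- The Green operators of holomorphic families of solutions form a holomorphic family. -/
theorem exists_weightedGreenOp (hab : Admissible a b ν κ) {ε : ℝ} (hε : 0 < ε)
    {φ ψ : ℂ → ℝ → Spinor}
    (hφ : ∀ z, IsFlowSol a b z (φ z)) (dφ : ∀ x, Differentiable ℂ fun z => φ z x)
    (hφ0 : 1 ≤ 2 * ν → ∀ r, ∃ C, ∀ z, ‖z‖ < r → ∀ x ∈ Ico (-1 : ℝ) 0, ‖φ z x‖ ≤ C * (-x) ^ ν)
    (hψ : ∀ z ∈ halfPlane ε, IsFlowSol a b z (ψ z))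
    (dψ : ∀ x < 0, DifferentiableOn ℂ (fun z => ψ z x) (halfPlane ε))
    (hψC : ∃ C, ∀ z ∈ halfPlane ε, ∀ x ≤ -1, ‖ψ z x‖ ≤ C * Real.exp (z.im * x))
    {α β : ℂ → ℂ} (dα : DifferentiableOn ℂ α (halfPlane ε))
    (dβ : DifferentiableOn ℂ β (halfPlane ε)) :
    ∃ T : ℂ → Hil →L[ℂ] Hil, DifferentiableOn ℂ T (halfPlane ε) ∧
      ∀ z ∈ halfPlane ε, IsWeightedGreenOp ε (φ z) (ψ z)
        (matM (α z) (β z) * (Complex.I • Γ1)) (T z) := by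
  classical
  have hloc : ∀ z₀ ∈ halfPlane ε, ∃ (U : Set ℂ) (T : ℂ → Hil →L[ℂ] Hil), IsOpen U ∧ z₀ ∈ U ∧
      U ⊆ halfPlane ε ∧ DifferentiableOn ℂ T U ∧
      ∀ z ∈ U, IsWeightedGreenOp ε (φ z) (ψ z) (matM (α z) (β z) * (Complex.I • Γ1)) (T z) := by
    intro z₀ hz₀
    obtain ⟨U, w, D, hU, hz₀U, hUs, hw0, hwpos, hanti, hD, hDb⟩ :=
      exists_local_weight hab hφ dφ hφ0 hψ hψC hε hz₀
    have dφ' : ∀ x < 0, DifferentiableOn ℂ (fun z => φ z x) U := fun x _ =>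
      (dφ x).differentiableOn
    have dψ' : ∀ x < 0, DifferentiableOn ℂ (fun z => ψ z x) U := fun x hx => (dψ x hx).mono hUs
    obtain ⟨K₁, dK₁, hK₁⟩ := exists_halfOp hU hw0 hwpos hanti ε dφ' dψ'
      (fun z _ => (hφ z).continuousOn) (fun z hz => (hψ z (hUs hz)).continuousOn) hD
      (fun z hz x hx => (hDb z hz x hx).1) (fun z hz x hx => (hDb z hz x hx).2)
    obtain ⟨K₂, dK₂, hK₂⟩ := exists_halfOp hU hw0 hwpos hanti ε
      (φ := fun z x => tilde (φ z x)) (ψ := fun z x => tilde (ψ z x))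
      (fun x hx => differentiableOn_tilde (dφ' x hx))
      (fun x hx => differentiableOn_tilde (dψ' x hx))
      (fun z _ => (hφ z).tilde.continuousOn) (fun z hz => (hψ z (hUs hz)).tilde.continuousOn) hD
      (fun z hz x hx => by rw [norm_tilde]; exact (hDb z hz x hx).1)
      (fun z hz x hx => by rw [norm_tilde]; exact (hDb z hz x hx).2)
    refine ⟨U, fun z => (K₁ z + K₂ z) ∘L matOp (matM (α z) (β z) * (Complex.I • Γ1)), hU, hz₀U,
      hUs, ?_, fun z hz F => ?_⟩
    · refine (dK₁.add dK₂).clm_comp ?_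
      have e : (fun z => matOp (matM (α z) (β z) * (Complex.I • Γ1))) = fun z =>
          α z • matOp (matM 1 0 * (Complex.I • Γ1)) + β z • matOp (matM 0 1 * (Complex.I • Γ1)) := by
        funext z
        rw [matM_mul_eq, matOp_add_smul]
      rw [e]
      exact ((dα.mono hUs).smul_const _).fun_add ((dβ.mono hUs).smul_const _)
    · set G := matOp (matM (α z) (β z) * (Complex.I • Γ1)) F with hG
      have hGae : ∀ᵐ y ∂volNeg, (Real.exp (ε * y) : ℂ) • G y =
          (Real.exp (ε * y) : ℂ) • act (matM (α z) (β z) * (Complex.I • Γ1)) (F y) := by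
        filter_upwards [coeFn_matOp (matM (α z) (β z) * (Complex.I • Γ1)) F] with y hy
        rw [hG, hy]
      filter_upwards [hK₁ z hz G, hK₂ z hz G, Lp.coeFn_add (K₁ z G) (K₂ z G),
        ae_restrict_mem measurableSet_Iio] with x h1 h2 h3 hx
      change (K₁ z G + K₂ z G : Hil) x = _
      rw [h3, Pi.add_apply, h1, h2, ← smul_add, ← greenSol_congr_ae hGae hx, greenSol]
  -- The global family is chosen pointwise; near each point it coincides with a local holomorphic
  -- one by uniqueness.
  set T : ℂ → Hil →L[ℂ] Hil := fun z =>
    if h : ∃ T, IsWeightedGreenOp ε (φ z) (ψ z) (matM (α z) (β z) * (Complex.I • Γ1)) T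
    then h.choose else 0 with hT
  have hTspec : ∀ z ∈ halfPlane ε, IsWeightedGreenOp ε (φ z) (ψ z)
      (matM (α z) (β z) * (Complex.I • Γ1)) (T z) := by
    intro z hz
    obtain ⟨U, T', -, hzU, -, -, hT'⟩ := hloc z hz
    have hex : ∃ T, IsWeightedGreenOp ε (φ z) (ψ z)
        (matM (α z) (β z) * (Complex.I • Γ1)) T := ⟨T' z, hT' z hzU⟩
    simp only [hT, dif_pos hex]
    exact hex.choose_spec
  refine ⟨T, fun z hz => ?_, hTspec⟩
  obtain ⟨U, T', hU, hzU, hUs, dT', hT'⟩ := hloc z hz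
  have h1 := (dT' z hzU).differentiableAt (hU.mem_nhds hzU)
  refine (h1.congr_of_eventuallyEq ?_).differentiableWithinAt
  filter_upwards [hU.mem_nhds hzU] with y hy
  exact (hTspec y (hUs hy)).unique (hT' y hy)

theorem coeFn_weight (ε : ℝ) (hε : 0 ≤ ε) (F : Hil) :
    ∀ᵐ x ∂volNeg, weight ε hε F x = (Real.exp (ε * x) : ℂ) • F x := by
  have h1 := ContinuousLinearMap.coeFn_holder (r := 2)
    (ContinuousLinearMap.lsmul ℂ ℂ : ℂ →L[ℂ] Spinor →L[ℂ] Spinor)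
    ((memLp_weight ε hε).toLp _) F
  filter_upwards [h1, (memLp_weight ε hε).coeFn_toLp] with x hx1 hx2
  change ((ContinuousLinearMap.lsmul ℂ ℂ : ℂ →L[ℂ] Spinor →L[ℂ] Spinor).holder 2
    ((memLp_weight ε hε).toLp _) F : Hil) x = _
  rw [hx1, hx2, ContinuousLinearMap.lsmul_apply]

theorem act_smul_left (c : ℂ) (T : Mat4) (v : Spinor) : act (c • T) v = c • act T v := by
  simp [act]

/-! ### Continuation of the weighted resolvent of the Dirac operator. -/

variable {M l m s : ℝ}

/-- Replacing `M_{α,β}⁻¹` by `M_{-α,β}` isolates the only possible source of poles in the scalar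
`(α² - β²)⁻¹`; the operator `T` still makes sense where that scalar is singular. -/
theorem weight_resolvent_weight (hM : 0 < M) (hl : 0 < l) (hm : 0 < m) (hz : 0 < z.im) {ε : ℝ}
    (hε : 0 ≤ ε) {φ ψ : ℝ → Spinor} (hψ : IsJost M l m s z ψ) (hφ : IsBoundarySol M l m s z φ)
    {α β : ℂ} (hαβ : ∀ x < 0, alphaW (φ x) (ψ x) = α ∧ betaW (φ x) (ψ x) = β)
    (hdet : α ^ 2 - β ^ 2 ≠ 0) {T : Hil →L[ℂ] Hil}
    (hT : IsWeightedGreenOp ε φ ψ (matM (-α) β * (Complex.I • Γ1)) T) :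
    weight ε hε ∘L resolvent M l m s z ∘L weight ε hε = (α ^ 2 - β ^ 2)⁻¹ • T := by
  have hab := admissible_potential hM hl hm (s + 1 / 2)
  have hp := ((isJost_iff M l m s z ψ).1 hψ).greenPair ((isBoundarySol_iff M l m s z φ).1 hφ) hz
  ext1 F
  refine Lp.ext ?_
  set G := weight ε hε F with hG
  filter_upwards [coeFn_weight ε hε (resolvent M l m s z G),
    resolvent_eq_integral hM hl hm hz hψ hφ hαβ hdet G, hT F,
    Lp.coeFn_smul (α ^ 2 - β ^ 2)⁻¹ (T F), ae_restrict_mem measurableSet_Iio] with x h1 h2 h3 h4 hx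
  change (weight ε hε (resolvent M l m s z G) : Hil) x = ((α ^ 2 - β ^ 2)⁻¹ • T F : Hil) x
  rw [h1, h2, h4, Pi.smul_apply, h3, (hp.integral_kernelR hab (Lp.memLp G) α β hx).2,
    smul_comm (α ^ 2 - β ^ 2)⁻¹, ← greenSol_const_smul _ _ _ (α ^ 2 - β ^ 2)⁻¹]
  congr 1
  refine greenSol_congr_ae ?_ hx
  filter_upwards [coeFn_weight ε hε F] with y hy
  rw [hG, hy, matM_inv hdet, Matrix.smul_mul, act_smul_left, act_smul_right]

theorem differentiableOn_wronskian {φ ψ : ℂ → Spinor} {U : Set ℂ} (hφ : DifferentiableOn ℂ φ U)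
    (hψ : DifferentiableOn ℂ ψ U) : DifferentiableOn ℂ (fun z => alphaW (φ z) (ψ z)) U ∧
      DifferentiableOn ℂ (fun z => betaW (φ z) (ψ z)) U := by
  obtain ⟨p0, p1, p2, p3⟩ := forall_fin_four.1 (differentiableOn_spinor_iff.1 hφ)
  obtain ⟨q0, q1, q2, q3⟩ := forall_fin_four.1 (differentiableOn_spinor_iff.1 hψ)
  simp only [alphaW, betaW]
  constructor <;> fun_prop

/-- A quotient of a holomorphic operator family by the holomorphic function `α² - β²`, which has no
zero in the upper half plane. The Wronskians may be taken at `x = -1` since they are constant. -/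
theorem exists_meromorphic_extension (hM : 0 < M) (hl : 0 < l) (hm : 0 < m) {ε : ℝ} (hε : 0 < ε)
    (hεκ : ε < surfaceGravity M l / 2) :
    ∃ 𝓡 : ℂ → Hil →L[ℂ] Hil, MeromorphicOn 𝓡 (halfPlane ε) ∧
      AnalyticOnNhd ℂ 𝓡 (halfPlane ε \ poles ε 𝓡) ∧
      ∀ z : ℂ, 0 < z.im → 𝓡 z = weight ε hε.le ∘L resolvent M l m s z ∘L weight ε hε.le := by
  have hab := admissible_potential hM hl hm (s + 1 / 2)
  obtain ⟨φ, hφ, dφ, hφ0⟩ := exists_bdry_family hab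
  obtain ⟨ψ, hψ, dψ, hψC⟩ := exists_jost_family hab hε (by linarith)
  obtain ⟨dα, dβ⟩ := differentiableOn_wronskian (dφ (-1)).differentiableOn
    (dψ (-1) (by norm_num))
  set α : ℂ → ℂ := fun z => alphaW (φ z (-1)) (ψ z (-1))
  set β : ℂ → ℂ := fun z => betaW (φ z (-1)) (ψ z (-1))
  obtain ⟨T, dT, hT⟩ := exists_weightedGreenOp hab hε (fun z => (hφ z).1.flow) dφ hφ0
    (fun z hz => (hψ z hz).flow) dψ hψC (α := fun z => -α z) dα.fun_neg dβ
  have hopen := isOpen_halfPlane ε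
  set d : ℂ → ℂ := fun z => α z ^ 2 - β z ^ 2
  have dd : DifferentiableOn ℂ d (halfPlane ε) := (dα.fun_pow 2).fun_sub (dβ.fun_pow 2)
  have hd : ∀ z ∈ halfPlane ε, AnalyticAt ℂ d z := fun z hz =>
    dd.analyticAt (hopen.mem_nhds hz)
  have hTa : ∀ z ∈ halfPlane ε, AnalyticAt ℂ T z := fun z hz =>
    dT.analyticAt (hopen.mem_nhds hz)
  set 𝓢 : ℂ → Hil →L[ℂ] Hil := fun z => (d z)⁻¹ • T z
  have hS : MeromorphicOn 𝓢 (halfPlane ε) := fun z hz =>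
    ((hd z hz).meromorphicAt.inv).smul (hTa z hz).meromorphicAt
  have hNF := meromorphicNFOn_toMeromorphicNFOn 𝓢 (halfPlane ε)
  -- At a zero of `d` the inverse takes the value `0` by convention, even if the singularity is
  -- removable. The normal form corrects these values, so that a point of nonnegative order is a
  -- point of analyticity.
  refine ⟨toMeromorphicNFOn 𝓢 (halfPlane ε), hNF.meromorphicOn, fun z hz => ?_, fun z hz => ?_⟩
  · refine (hNF hz.1).meromorphicOrderAt_nonneg_iff_analyticAt.1 ?_
    by_contra! h
    exact hz.2 ⟨hz.1, h⟩
  · have hzε : z ∈ halfPlane ε := by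
      change -ε < z.im
      linarith
    have hJ := (isJost_iff M l m s z _).2 (hψ z hzε)
    have hB := (isBoundarySol_iff M l m s z _).2 (hφ z).1
    have hαβ : ∀ x < 0, alphaW (φ z x) (ψ z x) = α z ∧ betaW (φ z x) (ψ z x) = β z :=
      fun x hx => alphaW_const (hφ z).1.flow (hψ z hzε).flow hx (by norm_num)
    have hdet : d z ≠ 0 :=
      sq_sub_sq_wronskian_ne_zero hab hz (hφ z).1 (hψ z hzε) (hφ z).2 (by norm_num)
    have hSa : AnalyticAt ℂ 𝓢 z := ((hd z hzε).inv hdet).smul (hTa z hzε)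
    rw [toMeromorphicNFOn_eq_toMeromorphicNFAt hS hzε,
      toMeromorphicNFAt_eq_self.2 hSa.meromorphicNFAt]
    exact (weight_resolvent_weight hM hl hm hz hε.le hJ hB hαβ hdet (hT z hzε)).symm

end

end SAdS

theorem theorem1 (M l m s : ℝ) (hM : 0 < M) (hl : 0 < l) (hm : 0 < m)
    (hs : ∃ k : ℕ, s = k + 1 / 2) :
    ∃ Res : ℂ → SAdS.Hil →L[ℂ] SAdS.Hil,
      (∀ z : ℂ, 0 < z.im → SAdS.IsResolventAt (SAdS.diracOp M l m s) z (Res z)) ∧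
      -- the solutions entering the formula exist
      (∀ z : ℂ, 0 < z.im →
        (∃ ψ, SAdS.IsJost M l m s z ψ) ∧
        ∃ φ, SAdS.IsBoundarySol M l m s z φ ∧ SAdS.IsNondegenerate φ) ∧
      -- formula for the resolvent
      (∀ z : ℂ, 0 < z.im → ∀ φ ψ : ℝ → SAdS.Spinor,
        SAdS.IsJost M l m s z ψ → SAdS.IsBoundarySol M l m s z φ → SAdS.IsNondegenerate φ →
        ∃ α β : ℂ,
          (∀ x < 0, SAdS.alphaW (φ x) (ψ x) = α ∧ SAdS.betaW (φ x) (ψ x) = β) ∧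
          IsUnit (SAdS.matM α β) ∧
          ∀ f : SAdS.Hil,
            (∀ x < 0, MeasureTheory.IntegrableOn
              (fun y => SAdS.act (SAdS.kernelR φ ψ α β x y) (f y)) (Set.Iio 0)) ∧
            ∀ᵐ x ∂(MeasureTheory.volume.restrict (Set.Iio (0 : ℝ))),
              Res z f x = ∫ y in Set.Iio (0 : ℝ), SAdS.act (SAdS.kernelR φ ψ α β x y) (f y)) ∧
      -- meromorphic extension of the weighted resolvent
      (∀ (ε : ℝ) (hε : 0 < ε), ε < SAdS.surfaceGravity M l / 2 →
        ∃ 𝓡 : ℂ → SAdS.Hil →L[ℂ] SAdS.Hil,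
          MeromorphicOn 𝓡 (SAdS.halfPlane ε) ∧
          AnalyticOnNhd ℂ 𝓡 (SAdS.halfPlane ε \ SAdS.poles ε 𝓡) ∧
          ∀ z : ℂ, 0 < z.im →
            𝓡 z = SAdS.weight ε hε.le ∘L Res z ∘L SAdS.weight ε hε.le) := by
  refine ⟨SAdS.resolvent M l m s, fun z hz => SAdS.isResolventAt_resolvent hM hl hm hz,
    fun z hz => ⟨SAdS.exists_isJost hM hl hm hz, SAdS.exists_isBoundarySol hM hl hm z⟩,
    fun z hz φ ψ hψ hφ hn => ?_,
    fun ε hε hεκ => SAdS.exists_meromorphic_extension hM hl hm hε hεκ⟩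
  obtain ⟨α, β, hαβ, hdet⟩ := SAdS.exists_wronskian hM hl hm hz hψ hφ hn
  refine ⟨α, β, hαβ, SAdS.isUnit_matM hdet, fun f => ⟨fun x hx => ?_,
    SAdS.resolvent_eq_integral hM hl hm hz hψ hφ hαβ hdet f⟩⟩
  exact ((((SAdS.isJost_iff M l m s z ψ).1 hψ).greenPair
    ((SAdS.isBoundarySol_iff M l m s z φ).1 hφ) hz).integral_kernelR
    (SAdS.admissible_potential hM hl hm (s + 1 / 2)) (MeasureTheory.Lp.memLp f) α β hx).1
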